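/- For $a\ge 0$ let $p_a(x)=(1+|x|)^a$ on $\mathbb R^2$. For $\alpha<0$ let $\mathcal C^{\alpha}_{p_a}$ be the closure of $C^\infty_c(\mathbb R^2)$ under the norm $$\|f\|_{\mathcal C^\alpha_{p_a}}=\sup_{x\in\mathbb R^2}\ \sup_{\lambda\in(0,1]}\ \sup_{\varphi\in\mathcal B_{\lceil-\alpha\rceil}}\frac{|\langle f,\varphi_x^\lambda\rangle|}{p_a(x)\,\lambda^{\alpha}},\qquad \varphi_x^\lambda(y)=\lambda^{-2}\varphi\big((y-x)/\lambda\big),$$ where $\mathcal B_r$ is the set of smooth functions supported in the unit ball whose $C^r$-norm is at most $1$. For every sufficiently small $\kappa>0$ and every $b\in(0,\kappa/2)$ the following holds. Let $\mathscr M=\mathcal C^{-1-\kappa}_{p_\kappa}\times\mathcal C^{-\kappa}_{p_\kappa}$ and let $\Omega=\mathcal C^{-1-\kappa}_{p_b}$ be endowed with the law $\mathbb P$ of white noise; write $\xi$ for the canonical variable. Let $\varrho$ be an even smooth function on $\mathbb R^2$ supported in the unit ball with $\int\varrho=1$, let $\varrho_\varepsilon=\varepsilon^{-2}\varrho(\cdot/\varepsilon)$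 and $\xi_\varepsilon=\xi*\varrho_\varepsilon$. Let $\chi$ be a smooth radial function equal to $1$ in $B(0,1)$ and supported in $B(0,2)$, and let $G(x)=-\frac{\log|x|}{2\pi}\chi(x)$. For $\varepsilon\in(0,1)$ set $$Q_\varepsilon=\big(\xi_\varepsilon,\ |\nabla G*\xi_\varepsilon|^2-C_\varepsilon\big)\in\mathscr M,\qquad C_\varepsilon=\mathbb E\big[|(\nabla G*\xi_\varepsilon)(0)|^2\big].$$ Then $Q_\varepsilon$ converges in probability in $\mathscr M$, as $\varepsilon\downarrow0$, to a random variable $Q$. Moreover, writing $\mathrm{supp}(\cdot)$ for the topological support in $\mathscr M$ of the law of a random variable (the intersection of all closed sets of full measure), one has $\mathrm{supp}(Q_\varepsilon)\subset\mathrm{supp}(Q)$ for every $\varepsilon\in(0,1)$, and $$\mathrm{supp}(Q)=\overline{\big\{(h,\ |\nabla G*h|^2+c)\ :\ h\in L^\infty_{p_b}(\mathbb R^2),\ c\in\mathbb R\big\}}^{\,\mathscr M},$$ where $L^\infty_{p_b}$ is the space of measurable functions $h$ such that $h/p_b$ is essentially bounded. -/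

import Mathlib

open MeasureTheory ProbabilityTheory Filter Topology Set TopologicalSpace
open scoped Distributions ENNReal NNReal

noncomputable section

namespace Anderson

/-- The Euclidean plane `ℝ²`. -/
abbrev Plane : Type := EuclideanSpace ℝ (Fin 2)

/-- Smooth compactly supported functions `ℝ² → ℝ`. -/
abbrev Test : Type := 𝓓((⊤ : Opens Plane), ℝ)

/-- Real distributions on `ℝ²`. -/
abbrev Distrib : Type := 𝓓'((⊤ : Opens Plane), ℝ)

/-- The distribution `φ ↦ ∫ φ f` attached to a locally integrable function `f`. -/
def ofFun (f : Plane → ℝ) : Distrib :=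
  TestFunction.integralAgainstBilinCLM (ContinuousLinearMap.mul ℝ ℝ) volume f

lemma ofFun_apply {f : Plane → ℝ} (hf : LocallyIntegrable f) (φ : Test) :
    ofFun f φ = ∫ x, φ x * f x := by
  exact TestFunction.integralAgainstBilinCLM_eq_integral (hf.locallyIntegrableOn _)

lemma ofFun_add {f g : Plane → ℝ} (hf : LocallyIntegrable f) (hg : LocallyIntegrable g) :
    ofFun (f + g) = ofFun f + ofFun g := by
  ext φ
  have h1 : Integrable (fun x => φ x * f x) := by
    simpa using φ.integrable_bilin (ContinuousLinearMap.mul ℝ ℝ)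
      (hf.locallyIntegrableOn ((⊤ : Opens Plane) : Set Plane))
  have h2 : Integrable (fun x => φ x * g x) := by
    simpa using φ.integrable_bilin (ContinuousLinearMap.mul ℝ ℝ)
      (hg.locallyIntegrableOn ((⊤ : Opens Plane) : Set Plane))
  change ofFun (f + g) φ = ofFun f φ + ofFun g φ
  rw [ofFun_apply hf, ofFun_apply hg, ofFun_apply (hf.add hg), ← integral_add h1 h2]
  simp [mul_add]

lemma ofFun_neg {f : Plane → ℝ} (hf : LocallyIntegrable f) : ofFun (-f) = -ofFun f := by
  ext φ
  change ofFun (-f) φ = -(ofFun f φ)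
  rw [ofFun_apply hf, ofFun_apply hf.neg, ← integral_neg]
  simp

lemma ofFun_test_add (g h : Test) : ofFun (g + h : Test) = ofFun g + ofFun h :=
  ofFun_add g.continuous.locallyIntegrable h.continuous.locallyIntegrable

lemma ofFun_test_neg (g : Test) : ofFun (-g : Test) = -ofFun g :=
  ofFun_neg g.continuous.locallyIntegrable

/-- The polynomial weight `p_a(x) = (1 + |x|)^a`. -/
def polyWeight (a : ℝ) (x : Plane) : ℝ := (1 + ‖x‖) ^ a

/-- The rescaled test function `φ_x^l(y) = l⁻² φ((y - x) / l)`; it is only used for `l > 0`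
(for `l = 0` the formula gives the zero function). -/
def rescale (φ : Test) (l : ℝ) (x : Plane) : Test where
  toFun y := (l ^ 2)⁻¹ * φ (l⁻¹ • (y - x))
  contDiff' := by
    have := φ.contDiff
    fun_prop
  hasCompactSupport' := by
    rcases eq_or_ne l 0 with rfl | hl
    · have : (fun y : Plane => (((0 : ℝ) ^ 2)⁻¹ * φ ((0 : ℝ)⁻¹ • (y - x)) : ℝ)) = 0 := by
        ext y; simp
      rw [this]
      exact HasCompactSupport.zero
    · apply HasCompactSupport.mul_left
      exact φ.hasCompactSupport.comp_homeomorph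
        ((Homeomorph.subRight x).trans (Homeomorph.smulOfNeZero l⁻¹ (inv_ne_zero hl)))
  tsupport_subset' := fun _ _ => trivial

/-- The set `B_r` of test functions supported in the unit ball whose `C^r` norm is at most `1`. -/
def unitTests (r : ℕ) : Set Test :=
  {φ | tsupport φ ⊆ Metric.closedBall 0 1 ∧
    ∀ k ≤ r, ∀ y : Plane, ‖iteratedFDeriv ℝ k (φ : Plane → ℝ) y‖ ≤ 1}

/-- The `[0, ∞]`-valued weighted Hölder norm of negative regularity `α`,
`sup_x sup_{l ∈ (0,1]} sup_{φ ∈ B_⌈-α⌉} |⟨T, φ_x^l⟩| / (w(x) l^α)`. -/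
def holderNorm (α : ℝ) (w : Plane → ℝ) (T : Distrib) : ℝ≥0∞ :=
  ⨆ (x : Plane) (l ∈ Ioc (0 : ℝ) 1) (φ ∈ unitTests ⌈-α⌉₊),
    ENNReal.ofReal (|T (rescale φ l x)| / (w x * l ^ α))

lemma holderNorm_zero (α : ℝ) (w : Plane → ℝ) : holderNorm α w 0 = 0 := by
  simp [holderNorm]

lemma holderNorm_neg (α : ℝ) (w : Plane → ℝ) (T : Distrib) :
    holderNorm α w (-T) = holderNorm α w T := by
  simp [holderNorm]

lemma holderNorm_add_le (α : ℝ) (w : Plane → ℝ) (S T : Distrib) :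
    holderNorm α w (S + T) ≤ holderNorm α w S + holderNorm α w T := by
  refine iSup_le fun x => iSup₂_le fun l hl => iSup₂_le fun φ hφ => ?_
  have key : ∀ a b c : ℝ, ENNReal.ofReal (|a + b| / c)
      ≤ ENNReal.ofReal (|a| / c) + ENNReal.ofReal (|b| / c) := by
    intro a b c
    rcases le_or_gt c 0 with hc | hc
    · rw [ENNReal.ofReal_of_nonpos (div_nonpos_of_nonneg_of_nonpos (abs_nonneg _) hc)]
      exact zero_le
    · rw [← ENNReal.ofReal_add (by positivity) (by positivity), ← add_div]
      exact ENNReal.ofReal_le_ofReal (by gcongr; exact abs_add_le a b)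
  refine (key (S (rescale φ l x)) (T (rescale φ l x)) (w x * l ^ α)).trans (add_le_add ?_ ?_)
  · exact le_iSup_of_le x (le_iSup₂_of_le l hl (le_iSup₂_of_le φ hφ le_rfl))
  · exact le_iSup_of_le x (le_iSup₂_of_le l hl (le_iSup₂_of_le φ hφ le_rfl))

/-- Distributions in the closure, for the weighted Hölder norm, of the smooth compactly supported
functions. -/
def holderSubgroup (α : ℝ) (w : Plane → ℝ) : AddSubgroup Distrib where
  carrier := {T | holderNorm α w T < ∞ ∧
    ∀ δ : ℝ≥0∞, 0 < δ → ∃ g : Test, holderNorm α w (T - ofFun g) < δ}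
  zero_mem' := by
    refine ⟨by simp [holderNorm_zero], fun δ hδ => ⟨0, ?_⟩⟩
    have : (0 : Distrib) - ofFun (0 : Test) = 0 := by
      have h := ofFun_test_add 0 0
      rw [add_zero, left_eq_add] at h
      rw [h, sub_zero]
    rw [this, holderNorm_zero]
    exact hδ
  add_mem' := by
    rintro S T ⟨hS, hS'⟩ ⟨hT, hT'⟩
    refine ⟨(holderNorm_add_le α w S T).trans_lt (ENNReal.add_lt_top.2 ⟨hS, hT⟩), fun δ hδ => ?_⟩
    obtain ⟨g, hg⟩ := hS' (δ / 2) (ENNReal.half_pos hδ.ne')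
    obtain ⟨h, hh⟩ := hT' (δ / 2) (ENNReal.half_pos hδ.ne')
    refine ⟨g + h, ?_⟩
    have e : S + T - ofFun (g + h : Test) = (S - ofFun g) + (T - ofFun h) := by
      rw [ofFun_test_add]; abel
    rw [e]
    exact (holderNorm_add_le α w _ _).trans_lt (by
      simpa using ENNReal.add_lt_add hg hh)
  neg_mem' := by
    rintro S ⟨hS, hS'⟩
    refine ⟨by rwa [holderNorm_neg], fun δ hδ => ?_⟩
    obtain ⟨g, hg⟩ := hS' δ hδ
    refine ⟨-g, ?_⟩
    have e : -S - ofFun (-g : Test) = -(S - ofFun g) := by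
      rw [ofFun_test_neg]; abel
    rwa [e, holderNorm_neg]

/-- The space `C^α_w`: the closure of the smooth compactly supported functions under the weighted
Hölder norm of regularity `α < 0`. -/
structure HolderSpace (α : ℝ) (w : Plane → ℝ) : Type where
  /-- The underlying distribution. -/
  toDistrib : Distrib
  mem : toDistrib ∈ holderSubgroup α w

namespace HolderSpace

variable {α : ℝ} {w : Plane → ℝ}

/-- The identification of `C^α_w` with a set of distributions. -/
def equivSubgroup (α : ℝ) (w : Plane → ℝ) : HolderSpace α w ≃ holderSubgroup α w where
  toFun T := ⟨T.toDistrib, T.mem⟩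
  invFun T := ⟨T.1, T.2⟩
  left_inv _ := rfl
  right_inv _ := rfl

instance : AddCommGroup (HolderSpace α w) := (equivSubgroup α w).addCommGroup

lemma toDistrib_zero : (0 : HolderSpace α w).toDistrib = 0 := rfl

lemma toDistrib_add (S T : HolderSpace α w) :
    (S + T).toDistrib = S.toDistrib + T.toDistrib := rfl

lemma toDistrib_neg (T : HolderSpace α w) : (-T).toDistrib = -T.toDistrib := rfl

instance : SeminormedAddCommGroup (HolderSpace α w) :=
  AddGroupSeminorm.toSeminormedAddCommGroup
    { toFun := fun T => (holderNorm α w T.toDistrib).toReal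
      map_zero' := by
        rw [toDistrib_zero, holderNorm_zero, ENNReal.toReal_zero]
      add_le' := fun S T => by
        have hS : holderNorm α w S.toDistrib ≠ ∞ := S.mem.1.ne
        have hT : holderNorm α w T.toDistrib ≠ ∞ := T.mem.1.ne
        rw [toDistrib_add, ← ENNReal.toReal_add hS hT]
        exact ENNReal.toReal_mono (ENNReal.add_ne_top.2 ⟨hS, hT⟩) (holderNorm_add_le α w _ _)
      neg' := fun T => by
        rw [toDistrib_neg, holderNorm_neg] }

lemma norm_def (T : HolderSpace α w) : ‖T‖ = (holderNorm α w T.toDistrib).toReal := rfl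

instance : MeasurableSpace (HolderSpace α w) := borel _

instance : BorelSpace (HolderSpace α w) := ⟨rfl⟩

open Classical in
/-- A distribution in `C^α_w` seen as an element of this space (and `0` for other distributions). -/
def ofDistrib (α : ℝ) (w : Plane → ℝ) (T : Distrib) : HolderSpace α w :=
  if h : T ∈ holderSubgroup α w then ⟨T, h⟩ else 0

lemma toDistrib_ofDistrib {T : Distrib} (h : T ∈ holderSubgroup α w) :
    (ofDistrib α w T).toDistrib = T := by
  rw [ofDistrib, dif_pos h]

end HolderSpace

/-- The probability space `Ω = C^{-1-κ}_{p_b}` carrying the noise. -/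
abbrev Noise (κ b : ℝ) : Type := HolderSpace (-1 - κ) (polyWeight b)

/-- The space of enhanced noises `C^{-1-κ}_{p_κ} × C^{-κ}_{p_κ}`. -/
abbrev EnhancedSpace (κ : ℝ) : Type :=
  HolderSpace (-1 - κ) (polyWeight κ) × HolderSpace (-κ) (polyWeight κ)

/-- `P` is the law of white noise: `⟨ξ, φ⟩` is a centred Gaussian variable of variance `∫ φ²`
for every test function `φ`. -/
structure IsWhiteNoise {κ b : ℝ} (P : Measure (Noise κ b)) : Prop where
  isProbabilityMeasure : IsProbabilityMeasure P
  hasLaw : ∀ φ : Test, HasLaw (fun ξ : Noise κ b => ξ.toDistrib φ)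
    (gaussianReal 0 (∫ x, φ x ^ 2).toNNReal) P

/-- Even smooth functions supported in the unit ball with integral one. -/
structure IsMollifier (ρ : Test) : Prop where
  even : ∀ x, ρ (-x) = ρ x
  tsupport_subset : tsupport ρ ⊆ Metric.closedBall 0 1
  integral_eq_one : ∫ x, ρ x = 1

/-- Smooth radial functions equal to one in the unit ball and supported in the ball of radius
two. -/
structure IsCutoff (χ : Test) : Prop where
  radial : ∀ x y : Plane, ‖x‖ = ‖y‖ → χ x = χ y
  eq_one : ∀ x ∈ Metric.ball (0 : Plane) 1, χ x = 1
  tsupport_subset : tsupport χ ⊆ Metric.closedBall 0 2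

/-- The truncated Green's function `G(x) = -(2π)⁻¹ log|x| χ(x)`. -/
def green (χ : Test) (x : Plane) : ℝ := -(Real.log ‖x‖ / (2 * Real.pi)) * χ x

/-- The convolution `∇G * f`. -/
def gradGreenConv (χ : Test) (f : Plane → ℝ) (x : Plane) : Plane :=
  ∫ y, f (x - y) • gradient (green χ) y

/-- The function `(T * ρ_ε)(x) = ⟨T, ρ_ε(x - ·)⟩` where `ρ_ε = ε⁻² ρ(· / ε)`; as `ρ` is even,
`ρ_ε(x - ·)` is the test function `ρ` rescaled by `ε` around `x`. -/
def mollify (ρ : Test) (ε : ℝ) (T : Distrib) (x : Plane) : ℝ := T (rescale ρ ε x)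

/-- The renormalisation constant `C_ε = E[|∇Y_ε(0)|²]`, `Y_ε = G * ξ_ε`. -/
def renormConst {κ b : ℝ} (ρ χ : Test) (P : Measure (Noise κ b)) (ε : ℝ) : ℝ :=
  ∫ ξ, ‖gradGreenConv χ (mollify ρ ε ξ.toDistrib) 0‖ ^ 2 ∂P

/-- The renormalised enhanced noise `Q_ε(ξ) = (ξ_ε, |∇G * ξ_ε|² - C_ε)`. -/
def enhancedNoise {κ b : ℝ} (ρ χ : Test) (P : Measure (Noise κ b)) (ε : ℝ) (ξ : Noise κ b) :
    EnhancedSpace κ :=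
  (HolderSpace.ofDistrib _ _ (ofFun (mollify ρ ε ξ.toDistrib)),
    HolderSpace.ofDistrib _ _ (ofFun fun x =>
      ‖gradGreenConv χ (mollify ρ ε ξ.toDistrib) x‖ ^ 2 - renormConst ρ χ P ε))

/-- `Q` is the limit in probability of `Q_ε` as `ε ↓ 0`. -/
structure IsLimitNoise {κ b : ℝ} (ρ χ : Test) (P : Measure (Noise κ b))
    (Q : Noise κ b → EnhancedSpace κ) : Prop where
  aemeasurable : AEMeasurable Q P
  tendsto : TendstoInMeasure P (enhancedNoise ρ χ P) (𝓝[>] 0) Q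

/-- The space `L^∞_{p_b}`: measurable functions `h` such that `h / p_b` is essentially bounded. -/
def weightedLInfty (b : ℝ) : Set (Plane → ℝ) :=
  {h | AEStronglyMeasurable h volume ∧ ∃ C : ℝ, ∀ᵐ x, |h x| ≤ C * polyWeight b x}

/-- The pairs `(h, |∇G * h|² + c)`, `h ∈ L^∞_{p_b}`, `c ∈ ℝ`, as elements of the space of enhanced
noises. -/
def shiftedPairs (κ b : ℝ) (χ : Test) : Set (EnhancedSpace κ) :=
  {q | ∃ h ∈ weightedLInfty b, ∃ c : ℝ, q.1.toDistrib = ofFun h ∧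
    q.2.toDistrib = ofFun fun x => ‖gradGreenConv χ h x‖ ^ 2 + c}

/-! The rest of this section checks that, for every noise `ξ` and every `ε ∈ (0, 1]`, the two
components of `Q_ε(ξ)` belong to the spaces in which they are considered, so that `ofDistrib` never
takes its default value there. -/

lemma polyWeight_pos (a : ℝ) (x : Plane) : 0 < polyWeight a x := by
  unfold polyWeight; positivity

lemma continuous_polyWeight (a : ℝ) : Continuous (polyWeight a) := by
  unfold polyWeight
  exact Continuous.rpow_const (by fun_prop) fun x => Or.inl (by positivity)

lemma one_le_polyWeight {a : ℝ} (ha : 0 ≤ a) (x : Plane) : 1 ≤ polyWeight a x :=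
  Real.one_le_rpow (by linarith [norm_nonneg x]) ha

lemma polyWeight_mono {a b : ℝ} (hab : a ≤ b) (x : Plane) : polyWeight a x ≤ polyWeight b x :=
  Real.rpow_le_rpow_of_exponent_le (by linarith [norm_nonneg x]) hab

lemma polyWeight_le {a : ℝ} (ha : 0 ≤ a) {R : ℝ} (hR : 0 ≤ R) {x y : Plane}
    (h : ‖y‖ ≤ ‖x‖ + R) : polyWeight a y ≤ (1 + R) ^ a * polyWeight a x := by
  unfold polyWeight
  rw [← Real.mul_rpow (by positivity) (by positivity)]
  refine Real.rpow_le_rpow (by positivity) ?_ ha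
  nlinarith [norm_nonneg x]

/-- The function `f` belongs to the closure of the test functions for the norm
`sup |f| / p_a`. -/
def SupClosure (a : ℝ) (f : Plane → ℝ) : Prop :=
  ∀ δ : ℝ, 0 < δ → ∃ g : Test, ∀ y, |f y - g y| ≤ δ * polyWeight a y

lemma SupClosure.continuous {a : ℝ} {f : Plane → ℝ} (hf : SupClosure a f) : Continuous f := by
  have h : Continuous fun y => f y / polyWeight a y := by
    refine continuous_of_uniform_approx_of_continuous fun u hu => ?_
    obtain ⟨δ, hδ, hδu⟩ := Metric.mem_uniformity_dist.1 hu
    obtain ⟨g, hg⟩ := hf (δ / 2) (by positivity)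
    refine ⟨fun y => g y / polyWeight a y,
      g.continuous.div (continuous_polyWeight a) fun y => (polyWeight_pos a y).ne', fun y => ?_⟩
    apply hδu
    rw [Real.dist_eq, ← sub_div, abs_div, abs_of_pos (polyWeight_pos a y),
      div_lt_iff₀ (polyWeight_pos a y)]
    have := polyWeight_pos a y
    exact (hg y).trans_lt (by nlinarith)
  have e : f = fun y => (f y / polyWeight a y) * polyWeight a y := by
    ext y
    rw [div_mul_cancel₀ _ (polyWeight_pos a y).ne']
  rw [e]
  exact h.mul (continuous_polyWeight a)

lemma Test.exists_bound (g : Test) : ∃ C : ℝ, 0 ≤ C ∧ ∀ y, |g y| ≤ C := by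
  obtain ⟨C, hC⟩ := g.continuous.bounded_above_of_compact_support g.hasCompactSupport
  exact ⟨C, (norm_nonneg _).trans (hC 0), hC⟩

lemma SupClosure.exists_bound {a : ℝ} (ha : 0 ≤ a) {f : Plane → ℝ} (hf : SupClosure a f) :
    ∃ C : ℝ, 0 ≤ C ∧ ∀ y, |f y| ≤ C * polyWeight a y := by
  obtain ⟨g, hg⟩ := hf 1 one_pos
  obtain ⟨C, hC0, hC⟩ := g.exists_bound
  refine ⟨1 + C, by positivity, fun y => ?_⟩
  have h1 := one_le_polyWeight ha y
  have : |f y| ≤ |f y - g y| + |g y| := by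
    have := abs_add_le (f y - g y) (g y); simpa using this
  nlinarith [hg y, hC y]

lemma SupClosure.mono {a b : ℝ} (hab : a ≤ b) {f : Plane → ℝ} (hf : SupClosure a f) :
    SupClosure b f := by
  intro δ hδ
  obtain ⟨g, hg⟩ := hf δ hδ
  exact ⟨g, fun y => (hg y).trans (by gcongr; exact polyWeight_mono hab y)⟩

lemma SupClosure.add {a : ℝ} {f g : Plane → ℝ} (hf : SupClosure a f) (hg : SupClosure a g) :
    SupClosure a (fun x => f x + g x) := by
  intro δ hδ
  obtain ⟨u, hu⟩ := hf (δ / 2) (by positivity)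
  obtain ⟨v, hv⟩ := hg (δ / 2) (by positivity)
  refine ⟨u + v, fun y => ?_⟩
  have e : f y + g y - (u + v : Test) y = (f y - u y) + (g y - v y) := by
    simp; ring
  rw [e]
  exact (abs_add_le _ _).trans (by linarith [hu y, hv y])

lemma supClosure_const {a : ℝ} (ha : 0 < a) (c : ℝ) : SupClosure a (fun _ => c) := by
  intro δ hδ
  obtain ⟨R, hR, hR1⟩ : ∃ R : ℝ, |c| ≤ δ * R ^ a ∧ 1 ≤ R := by
    have h := ((tendsto_rpow_atTop ha).eventually_ge_atTop (|c| / δ)).and (eventually_ge_atTop 1)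
    obtain ⟨R, h1, h2⟩ := h.exists
    exact ⟨R, by rw [div_le_iff₀ hδ] at h1; linarith, h2⟩
  let B : ContDiffBump (0 : Plane) := ⟨R, R + 1, by linarith, by linarith⟩
  refine ⟨⟨fun y => c * B y, contDiff_const.mul B.contDiff, B.hasCompactSupport.mul_left,
    fun _ _ => trivial⟩, fun y => ?_⟩
  change |c - c * B y| ≤ _
  by_cases hy : y ∈ Metric.closedBall (0 : Plane) R
  · rw [B.one_of_mem_closedBall hy]
    simpa using mul_nonneg hδ.le (polyWeight_pos a y).le
  · have hy' : R < ‖y‖ := by simpa using hy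
    have h1 : |c - c * B y| ≤ |c| := by
      have : c - c * B y = c * (1 - B y) := by ring
      rw [this, abs_mul]
      refine mul_le_of_le_one_right (abs_nonneg c) ?_
      rw [abs_le]
      constructor <;> linarith [B.nonneg (x := y), B.le_one (x := y)]
    refine h1.trans (hR.trans ?_)
    unfold polyWeight
    gcongr
    linarith

lemma rescale_apply (φ : Test) (l : ℝ) (x y : Plane) :
    rescale φ l x y = (l ^ 2)⁻¹ * φ (l⁻¹ • (y - x)) := rfl

lemma holderNorm_ofFun_le {α κ C : ℝ} (hα : α ≤ 0) (hκ : 0 ≤ κ) (hC : 0 ≤ C) {f : Plane → ℝ}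
    (hf : LocallyIntegrable f) (hb : ∀ y, |f y| ≤ C * polyWeight κ y) :
    holderNorm α (polyWeight κ) (ofFun f)
      ≤ ENNReal.ofReal (C * (2 ^ κ * volume.real (Metric.closedBall (0 : Plane) 1))) := by
  refine iSup_le fun x => iSup₂_le fun l hl => iSup₂_le fun φ hφ => ENNReal.ofReal_le_ofReal ?_
  obtain ⟨hl0, hl1⟩ := hl
  have hw := polyWeight_pos κ x
  have hlα : 1 ≤ l ^ α := Real.one_le_rpow_of_pos_of_le_one_of_nonpos hl0 hl1 hα
  rw [div_le_iff₀ (by positivity), ofFun_apply hf]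
  have hsupp : ∀ y, y ∉ Metric.closedBall x l → rescale φ l x y * f y = 0 := by
    intro y hy
    rw [rescale_apply]
    have : l⁻¹ • (y - x) ∉ tsupport φ := by
      intro h
      have := hφ.1 h
      rw [mem_closedBall_zero_iff, norm_smul, norm_inv, Real.norm_of_nonneg hl0.le,
        inv_mul_le_iff₀ hl0, mul_one] at this
      exact hy (by rwa [mem_closedBall_iff_norm])
    rw [image_eq_zero_of_notMem_tsupport this]
    simp
  rw [← setIntegral_eq_integral_of_forall_compl_eq_zero hsupp]
  have hbd : ∀ y ∈ Metric.closedBall x l,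
      ‖rescale φ l x y * f y‖ ≤ (l ^ 2)⁻¹ * (C * (2 ^ κ * polyWeight κ x)) := by
    intro y hy
    rw [norm_mul, rescale_apply, norm_mul, Real.norm_of_nonneg (by positivity : 0 ≤ (l ^ 2)⁻¹)]
    have h1 : ‖φ (l⁻¹ • (y - x))‖ ≤ 1 := by
      simpa using hφ.2 0 (Nat.zero_le _) (l⁻¹ • (y - x))
    have h2 : |f y| ≤ C * (2 ^ κ * polyWeight κ x) := by
      refine (hb y).trans ?_
      gcongr
      have := polyWeight_le hκ zero_le_one (x := x) (y := y) (by
        have h := mem_closedBall_iff_norm.1 hy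
        have := norm_le_norm_add_norm_sub x y
        rw [norm_sub_rev] at this
        linarith)
      norm_num at this
      exact this
    calc (l ^ 2)⁻¹ * ‖φ (l⁻¹ • (y - x))‖ * ‖f y‖
        ≤ (l ^ 2)⁻¹ * 1 * (C * (2 ^ κ * polyWeight κ x)) := by
          gcongr
          exact h2
      _ = _ := by ring
  have hfin : volume (Metric.closedBall x l) < ∞ := measure_closedBall_lt_top
  have := norm_setIntegral_le_of_norm_le_const hfin hbd
  rw [Real.norm_eq_abs] at this
  refine this.trans ?_
  rw [Measure.addHaar_real_closedBall' _ _ hl0.le]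
  simp only [finrank_euclideanSpace, Fintype.card_fin]
  have e : (l ^ 2)⁻¹ * (C * (2 ^ κ * polyWeight κ x)) *
      (l ^ 2 * volume.real (Metric.closedBall (0 : Plane) 1))
      = C * (2 ^ κ * volume.real (Metric.closedBall (0 : Plane) 1)) * (polyWeight κ x * 1) := by
    field_simp
  rw [e]
  gcongr

lemma SupClosure.mem_holderSubgroup {α κ : ℝ} (hα : α ≤ 0) (hκ : 0 ≤ κ) {f : Plane → ℝ}
    (hf : SupClosure κ f) : ofFun f ∈ holderSubgroup α (polyWeight κ) := by
  have hfi : LocallyIntegrable f := hf.continuous.locallyIntegrable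
  obtain ⟨C, hC0, hC⟩ := hf.exists_bound hκ
  refine ⟨(holderNorm_ofFun_le hα hκ hC0 hfi hC).trans_lt ENNReal.ofReal_lt_top, fun δ hδ => ?_⟩
  set K : ℝ := 2 ^ κ * volume.real (Metric.closedBall (0 : Plane) 1) with hK
  have hK0 : 0 ≤ K := by positivity
  obtain ⟨δ', hδ', hlt⟩ : ∃ δ' : ℝ, 0 < δ' ∧ ENNReal.ofReal (δ' * K) < δ := by
    rcases eq_or_ne δ ∞ with rfl | hδt
    · exact ⟨1, one_pos, ENNReal.ofReal_lt_top⟩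
    · have hr : 0 < δ.toReal := ENNReal.toReal_pos hδ.ne' hδt
      refine ⟨δ.toReal / (K + 1), by positivity, ?_⟩
      rw [ENNReal.ofReal_lt_iff_lt_toReal (by positivity) hδt, div_mul_eq_mul_div,
        div_lt_iff₀ (by positivity)]
      nlinarith
  obtain ⟨g, hg⟩ := hf δ' hδ'
  refine ⟨g, lt_of_le_of_lt ?_ hlt⟩
  have hgi : LocallyIntegrable (g : Plane → ℝ) := g.continuous.locallyIntegrable
  have e : ofFun f - ofFun g = ofFun (f + -(g : Plane → ℝ)) := by
    rw [ofFun_add hfi hgi.neg, ofFun_neg hgi, sub_eq_add_neg]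
  rw [e]
  exact holderNorm_ofFun_le hα hκ hδ'.le (hfi.add hgi.neg) (fun y => by
    simpa [sub_eq_add_neg] using hg y)

/-- Up to a multiplicative constant, a test function supported in the unit ball belongs to `B_r`. -/
lemma exists_smul_mem_unitTests (r : ℕ) {φ : Test} (hφ : tsupport φ ⊆ Metric.closedBall 0 1) :
    ∃ M : ℝ, 0 < M ∧ M⁻¹ • φ ∈ unitTests r := by
  have hk : ∀ k : ℕ, ∃ C : ℝ, ∀ y, ‖iteratedFDeriv ℝ k (φ : Plane → ℝ) y‖ ≤ C := fun k =>
    (φ.contDiff.continuous_iteratedFDeriv (m := k)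
      (by exact_mod_cast le_top)).bounded_above_of_compact_support
      (φ.hasCompactSupport.iteratedFDeriv k)
  choose C hC using hk
  have hC0 : ∀ k, 0 ≤ C k := fun k => (norm_nonneg _).trans (hC k 0)
  refine ⟨1 + ∑ k ∈ Finset.range (r + 1), C k,
    by have := Finset.sum_nonneg (s := Finset.range (r + 1)) fun k _ => hC0 k; linarith, ?_, ?_⟩
  · exact (tsupport_smul_subset_right (fun _ : Plane => (_ : ℝ)) (φ : Plane → ℝ)).trans hφ
  · intro k hkr y
    set M := 1 + ∑ k ∈ Finset.range (r + 1), C k with hM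
    have hsum : C k ≤ ∑ k ∈ Finset.range (r + 1), C k :=
      Finset.single_le_sum (f := C) (fun i _ => hC0 i) (Finset.mem_range.2 (by omega))
    have hM0 : 0 < M := by linarith [hC0 k]
    have e : ((M⁻¹ • φ : Test) : Plane → ℝ) = M⁻¹ • (φ : Plane → ℝ) := rfl
    rw [e, iteratedFDeriv_const_smul_apply
      ((φ.contDiff.of_le (by exact_mod_cast le_top)).contDiffAt), norm_smul, norm_inv,
      Real.norm_of_nonneg hM0.le, inv_mul_le_iff₀ hM0, mul_one]
    linarith [hC k y]

lemma le_holderNorm {α : ℝ} {w : Plane → ℝ} (T : Distrib) {φ : Test} (hφ : φ ∈ unitTests ⌈-α⌉₊)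
    {l : ℝ} (hl : l ∈ Ioc (0 : ℝ) 1) (x : Plane) :
    ENNReal.ofReal (|T (rescale φ l x)| / (w x * l ^ α)) ≤ holderNorm α w T :=
  le_iSup_of_le x (le_iSup₂_of_le l hl (le_iSup₂_of_le φ hφ le_rfl))

/-- The mollification of a test function is a test function. -/
lemma exists_test_mollify (ρ g : Test) (ε : ℝ) :
    ∃ u : Test, ∀ x, u x = mollify ρ ε (ofFun g) x := by
  have hneg : ContDiff ℝ (⊤ : ℕ∞) (fun z : Plane => rescale ρ ε 0 (-z)) :=
    (rescale ρ ε 0).contDiff.comp contDiff_neg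
  have hnegs : HasCompactSupport (fun z : Plane => rescale ρ ε 0 (-z)) :=
    (rescale ρ ε 0).hasCompactSupport.comp_homeomorph (Homeomorph.neg Plane)
  have h1 : ContDiff ℝ (⊤ : ℕ∞) (convolution g (fun z => rescale ρ ε 0 (-z))
      (ContinuousLinearMap.mul ℝ ℝ) volume) :=
    HasCompactSupport.contDiff_convolution_right (n := ⊤) (ContinuousLinearMap.mul ℝ ℝ) hnegs
      g.continuous.locallyIntegrable hneg
  have h2 : HasCompactSupport (convolution g (fun z => rescale ρ ε 0 (-z))
      (ContinuousLinearMap.mul ℝ ℝ) volume) :=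
    HasCompactSupport.convolution (ContinuousLinearMap.mul ℝ ℝ) g.hasCompactSupport hnegs
  refine ⟨⟨_, h1, h2, fun _ _ => trivial⟩, fun x => ?_⟩
  change convolution g (fun z => rescale ρ ε 0 (-z)) (ContinuousLinearMap.mul ℝ ℝ) volume x = _
  rw [mollify, ofFun_apply g.continuous.locallyIntegrable, convolution_def]
  refine integral_congr_ae (Eventually.of_forall fun t => ?_)
  simp only [ContinuousLinearMap.mul_apply', rescale_apply, neg_sub, sub_zero]
  ring

lemma supClosure_mollify {α b : ℝ} {ρ : Test} (hρ : tsupport ρ ⊆ Metric.closedBall 0 1)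
    {ε : ℝ} (hε : ε ∈ Ioc (0 : ℝ) 1) {T : Distrib} (hT : T ∈ holderSubgroup α (polyWeight b)) :
    SupClosure b (mollify ρ ε T) := by
  intro δ hδ
  obtain ⟨M, hM, hρM⟩ := exists_smul_mem_unitTests ⌈-α⌉₊ hρ
  have hεα : 0 < ε ^ α := Real.rpow_pos_of_pos hε.1 α
  obtain ⟨g, hg⟩ := hT.2 (ENNReal.ofReal (δ / (M * ε ^ α)))
    (ENNReal.ofReal_pos.2 (by positivity))
  obtain ⟨u, hu⟩ := exists_test_mollify ρ g ε
  refine ⟨u, fun y => ?_⟩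
  have h := (le_holderNorm (T - ofFun g) hρM hε y).trans hg.le
  rw [ENNReal.ofReal_le_ofReal_iff (by positivity),
    div_le_iff₀ (mul_pos (polyWeight_pos b y) hεα)] at h
  have e : (T - ofFun g) (rescale (M⁻¹ • ρ) ε y)
      = M⁻¹ * (mollify ρ ε T y - u y) := by
    have e1 : rescale (M⁻¹ • ρ) ε y = M⁻¹ • rescale ρ ε y := by
      ext z
      change (ε ^ 2)⁻¹ * (M⁻¹ * ρ (ε⁻¹ • (z - y))) = M⁻¹ * ((ε ^ 2)⁻¹ * ρ (ε⁻¹ • (z - y)))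
      ring
    rw [e1, map_smul, hu]
    rfl
  rw [e, abs_mul, abs_of_pos (inv_pos.2 hM), inv_mul_le_iff₀ hM] at h
  refine h.trans (le_of_eq ?_)
  field_simp

lemma measurable_gradient_green (χ : Test) : Measurable (gradient (green χ)) := by
  unfold gradient
  exact (InnerProductSpace.toDual ℝ Plane).symm.continuous.measurable.comp
    (measurable_fderiv ℝ (green χ))

lemma gradient_green_eq_zero {χ : Test} (hχ : IsCutoff χ) {x : Plane}
    (hx : x ∉ Metric.closedBall (0 : Plane) 2) : gradient (green χ) x = 0 := by
  have h : green χ =ᶠ[𝓝 x] fun _ => 0 := by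
    filter_upwards [Metric.isClosed_closedBall.isOpen_compl.mem_nhds hx] with y hy
    rw [green, image_eq_zero_of_notMem_tsupport fun h => hy (hχ.tsupport_subset h), mul_zero]
  rw [gradient, h.fderiv_eq]
  simp

lemma exists_norm_gradient_green_le {χ : Test} (hχ : IsCutoff χ) :
    ∃ C : ℝ, ∀ x : Plane, x ≠ 0 → ‖gradient (green χ) x‖ ≤ C * ‖x‖ ^ (-1 : ℝ) := by
  obtain ⟨A, hA0, hA⟩ := χ.exists_bound
  obtain ⟨D, hD⟩ := (χ.contDiff.continuous_fderiv (by simp)).bounded_above_of_compact_support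
    (χ.hasCompactSupport.fderiv ℝ)
  have hD0 : 0 ≤ D := (norm_nonneg _).trans (hD 0)
  refine ⟨5 * D + A, fun x hx => ?_⟩
  have hx0 : 0 < ‖x‖ := norm_pos_iff.2 hx
  rw [Real.rpow_neg_one]
  by_cases hx2 : x ∈ Metric.closedBall (0 : Plane) 2
  swap
  · rw [gradient_green_eq_zero hχ hx2, norm_zero]
    positivity
  have hx2' : ‖x‖ ≤ 2 := by simpa using hx2
  have hn : HasFDerivAt (fun y : Plane => ‖y‖) (fderiv ℝ (fun y : Plane => ‖y‖) x) x :=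
    ((contDiffAt_norm ℝ hx (n := 1)).differentiableAt (by simp)).hasFDerivAt
  have hn1 : ‖fderiv ℝ (fun y : Plane => ‖y‖) x‖ ≤ 1 := by
    simpa using norm_fderiv_le_of_lipschitz ℝ (lipschitzWith_one_norm (E := Plane)) (x₀ := x)
  have hlog := ((hn.log hx0.ne').mul_const ((2 * Real.pi)⁻¹)).neg
  have hχd : HasFDerivAt (χ : Plane → ℝ) (fderiv ℝ χ x) x :=
    (χ.contDiff.differentiable (by simp) x).hasFDerivAt
  have hG := hlog.mul hχd
  have hG' : HasFDerivAt (green χ) _ x := hG.congr_of_eventuallyEq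
    (Eventually.of_forall fun y => by simp [green, div_eq_mul_inv])
  rw [gradient, LinearIsometryEquiv.norm_map, hG'.fderiv]
  have hpi : (2 * Real.pi)⁻¹ ≤ 1 := inv_le_one_of_one_le₀ (by linarith [Real.pi_gt_three])
  have hpi0 : 0 ≤ (2 * Real.pi)⁻¹ := by positivity
  have hl : |Real.log ‖x‖| ≤ 5 * ‖x‖⁻¹ := by
    have h1 : Real.log ‖x‖ ≤ ‖x‖ := Real.log_le_self hx0.le
    have h2 : -Real.log ‖x‖ ≤ ‖x‖⁻¹ := by
      rw [← Real.log_inv]; exact Real.log_le_self (by positivity)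
    have h3 : ‖x‖ ≤ 5 * ‖x‖⁻¹ := by
      rw [← div_eq_mul_inv, le_div_iff₀ hx0]; nlinarith
    rw [abs_le]
    have : 0 < ‖x‖⁻¹ := by positivity
    constructor <;> linarith
  refine (norm_add_le _ _).trans ?_
  rw [norm_smul, norm_smul, norm_neg, norm_smul, norm_smul]
  rw [Pi.neg_apply, Real.norm_eq_abs, Real.norm_eq_abs, abs_neg, abs_mul, abs_of_nonneg hpi0,
    Real.norm_of_nonneg hpi0, norm_inv, norm_norm]
  have h1 : |Real.log ‖x‖| * (2 * Real.pi)⁻¹ * ‖fderiv ℝ χ x‖ ≤ 5 * ‖x‖⁻¹ * 1 * D := by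
    gcongr
    exact hD x
  have h2 : |χ x| * ((2 * Real.pi)⁻¹ * (‖x‖⁻¹ * ‖fderiv ℝ (fun y : Plane => ‖y‖) x‖))
      ≤ A * (1 * (‖x‖⁻¹ * 1)) := by
    gcongr
    exact hA x
  calc _ ≤ 5 * ‖x‖⁻¹ * 1 * D + A * (1 * (‖x‖⁻¹ * 1)) := add_le_add h1 h2
    _ = _ := by ring

lemma integrable_gradient_green {χ : Test} (hχ : IsCutoff χ) :
    Integrable (gradient (green χ)) := by
  obtain ⟨C, hC⟩ := exists_norm_gradient_green_le hχ
  have h : LocallyIntegrable (gradient (green χ)) := by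
    refine locallyIntegrable_of_norm_le_rpow (C := C) (α := 1) (by simp) (by simp) ?_
      (measurable_gradient_green χ).aestronglyMeasurable
    have h0 : ∀ᵐ x : Plane, x ≠ 0 := by simp [ae_iff]
    filter_upwards [h0] with x hx using hC x hx
  rw [← integrableOn_iff_integrable_of_support_subset
    (s := Metric.closedBall (0 : Plane) 2) (fun x hx => by
      by_contra h'
      exact hx (gradient_green_eq_zero hχ h'))]
  exact h.integrableOn_isCompact (isCompact_closedBall _ _)

lemma integrable_smul_gradient_green {χ : Test} (hχ : IsCutoff χ) {f : Plane → ℝ}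
    (hf : Continuous f) (x : Plane) :
    Integrable (fun y => f (x - y) • gradient (green χ) y) := by
  rw [← integrableOn_iff_integrable_of_support_subset
    (s := Metric.closedBall (0 : Plane) 2) (fun y hy => by
      by_contra h'
      exact hy (by simp [gradient_green_eq_zero hχ h']))]
  exact (integrable_gradient_green hχ).integrableOn.continuousOn_smul
    (hf.comp (continuous_const.sub continuous_id)).continuousOn (isCompact_closedBall _ _)

lemma norm_gradGreenConv_le {χ : Test} (hχ : IsCutoff χ) {b C : ℝ} (hb : 0 ≤ b) (hC : 0 ≤ C)
    {f : Plane → ℝ} (hfb : ∀ y, |f y| ≤ C * polyWeight b y) (x : Plane) :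
    ‖gradGreenConv χ f x‖ ≤ C * (3 ^ b * ∫ y, ‖gradient (green χ) y‖) * polyWeight b x := by
  have hI := (integrable_gradient_green hχ).norm
  have h : ∀ y, ‖f (x - y) • gradient (green χ) y‖
      ≤ C * (3 ^ b * polyWeight b x) * ‖gradient (green χ) y‖ := by
    intro y
    by_cases hy : y ∈ Metric.closedBall (0 : Plane) 2
    · have hy' : ‖y‖ ≤ 2 := by simpa using hy
      rw [norm_smul]
      gcongr
      refine (hfb (x - y)).trans ?_
      gcongr
      have := polyWeight_le hb zero_le_two (x := x) (y := x - y)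
        ((norm_sub_le x y).trans (by linarith))
      norm_num at this
      exact this
    · simp [gradient_green_eq_zero hχ hy]
  have := norm_integral_le_of_norm_le (hI.const_mul (C * (3 ^ b * polyWeight b x)))
    (Eventually.of_forall h)
  rw [integral_const_mul] at this
  refine this.trans (le_of_eq ?_)
  ring

lemma exists_test_sq_norm_gradGreenConv {χ : Test} (hχ : IsCutoff χ) (g : Test) :
    ∃ u : Test, ∀ x, u x = ‖gradGreenConv χ g x‖ ^ 2 := by
  have hGs : HasCompactSupport (gradient (green χ)) :=
    HasCompactSupport.intro (isCompact_closedBall (0 : Plane) 2) fun x hx =>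
      gradient_green_eq_zero hχ hx
  have hconv : gradGreenConv χ g = convolution (gradient (green χ)) g
      (ContinuousLinearMap.lsmul ℝ ℝ).flip volume := by
    ext1 x
    rfl
  have hsm : ContDiff ℝ (⊤ : ℕ∞) (gradGreenConv χ g) := by
    rw [hconv]
    exact HasCompactSupport.contDiff_convolution_right (n := ⊤) _ g.hasCompactSupport
      (integrable_gradient_green hχ).locallyIntegrable g.contDiff
  have hcs : HasCompactSupport (gradGreenConv χ g) := by
    rw [hconv]
    exact HasCompactSupport.convolution _ hGs g.hasCompactSupport
  refine ⟨⟨fun x => ‖gradGreenConv χ g x‖ ^ 2, hsm.norm_sq ℝ,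
    hcs.comp_left (g := fun v : Plane => ‖v‖ ^ 2) (by simp), fun _ _ => trivial⟩, fun x => rfl⟩

lemma abs_sq_sub_sq_le {A c d η K C p δ : ℝ} (hη : 0 ≤ η) (hη1 : η ≤ 1)
    (hK : 0 ≤ K) (hp : 0 ≤ p) (hA : 0 ≤ A) (hc : 0 ≤ c) (h1 : d ≤ η * K * p)
    (h2 : A ≤ C * K * p) (h3 : c ≤ A + d) (h4 : |A - c| ≤ d)
    (hδ : η * (K * (2 * C * K + K)) ≤ δ) : |A ^ 2 - c ^ 2| ≤ δ * p ^ 2 := by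
  have e : A ^ 2 - c ^ 2 = (A - c) * (A + c) := by ring
  rw [e, abs_mul, abs_of_nonneg (add_nonneg hA hc)]
  have h5 : η * K * p ≤ 1 * K * p := by gcongr
  calc |A - c| * (A + c) ≤ (η * K * p) * (2 * (C * K * p) + 1 * K * p) :=
        mul_le_mul (h4.trans h1) (by linarith) (by positivity) (by positivity)
    _ = η * (K * (2 * C * K + K)) * p ^ 2 := by ring
    _ ≤ δ * p ^ 2 := by gcongr

lemma supClosure_sq_norm_gradGreenConv {χ : Test} (hχ : IsCutoff χ) {b : ℝ} (hb : 0 ≤ b)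
    {f : Plane → ℝ} (hf : SupClosure b f) :
    SupClosure (2 * b) (fun x => ‖gradGreenConv χ f x‖ ^ 2) := by
  intro δ hδ
  obtain ⟨C, hC0, hC⟩ := hf.exists_bound hb
  set K : ℝ := 3 ^ b * ∫ y, ‖gradient (green χ) y‖ with hK
  have hK0 : 0 ≤ K := mul_nonneg (by positivity) (integral_nonneg fun _ => norm_nonneg _)
  obtain ⟨η, hη, hη1, hηδ⟩ : ∃ η : ℝ, 0 < η ∧ η ≤ 1 ∧ η * (K * (2 * C * K + K)) ≤ δ := by
    refine ⟨min 1 (δ / (K * (2 * C * K + K) + 1)), by positivity, min_le_left _ _, ?_⟩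
    have hN : 0 ≤ K * (2 * C * K + K) := by positivity
    calc _ ≤ δ / (K * (2 * C * K + K) + 1) * (K * (2 * C * K + K)) := by
          gcongr; exact min_le_right _ _
      _ ≤ δ := by
          rw [div_mul_eq_mul_div, div_le_iff₀ (by positivity)]; nlinarith
  obtain ⟨g, hg⟩ := hf η hη
  obtain ⟨u, hu⟩ := exists_test_sq_norm_gradGreenConv hχ g
  refine ⟨u, fun x => ?_⟩
  rw [hu]
  beta_reduce
  have hdiff : gradGreenConv χ f x - gradGreenConv χ g x
      = gradGreenConv χ (fun y => f y - g y) x := by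
    simp only [gradGreenConv, sub_smul]
    rw [integral_sub (integrable_smul_gradient_green hχ hf.continuous x)
      (integrable_smul_gradient_green hχ g.continuous x)]
  have h1 := norm_gradGreenConv_le hχ hb hη.le hg x
  rw [← hdiff, ← hK] at h1
  have h2 := norm_gradGreenConv_le hχ hb hC0 hC x
  rw [← hK] at h2
  clear hdiff
  generalize gradGreenConv χ f x = a at *
  generalize gradGreenConv χ g x = c at *
  set p := polyWeight b x with hp
  have hp0 : 0 < p := polyWeight_pos b x
  have hpp : polyWeight (2 * b) x = p ^ 2 := by
    rw [hp, polyWeight, polyWeight, mul_comm, Real.rpow_mul (by positivity)]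
    norm_cast
  have h3 : ‖c‖ ≤ ‖a‖ + ‖a - c‖ := norm_le_norm_add_norm_sub a c
  have h4 : |‖a‖ - ‖c‖| ≤ ‖a - c‖ := abs_norm_sub_norm_le a c
  rw [hpp]
  exact abs_sq_sub_sq_le hη.le hη1 hK0 hp0.le (norm_nonneg a) (norm_nonneg c) h1 h2 h3 h4 hηδ

/-- For every noise, both components of the enhanced noise do belong to the spaces in which they
are considered. -/
theorem toDistrib_enhancedNoise {κ b : ℝ} (hκ : 0 < κ) (hb : 0 < b) (hbκ : b < κ / 2) {ρ χ : Test}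
    (hρ : IsMollifier ρ) (hχ : IsCutoff χ) (P : Measure (Noise κ b)) {ε : ℝ}
    (hε : ε ∈ Ioc (0 : ℝ) 1) (ξ : Noise κ b) :
    (enhancedNoise ρ χ P ε ξ).1.toDistrib = ofFun (mollify ρ ε ξ.toDistrib) ∧
    (enhancedNoise ρ χ P ε ξ).2.toDistrib = ofFun fun x =>
      ‖gradGreenConv χ (mollify ρ ε ξ.toDistrib) x‖ ^ 2 - renormConst ρ χ P ε := by
  have h := supClosure_mollify hρ.tsupport_subset hε ξ.mem
  refine ⟨HolderSpace.toDistrib_ofDistrib ?_, HolderSpace.toDistrib_ofDistrib ?_⟩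
  · exact (h.mono (by linarith)).mem_holderSubgroup (by linarith) hκ.le
  · have h2 := (supClosure_sq_norm_gradGreenConv hχ hb.le h).mono (b := κ) (by linarith)
    exact (h2.add (supClosure_const hκ (-renormConst ρ χ P ε))).mem_holderSubgroup
      (by linarith) hκ.le

end Anderson

end

noncomputable section
namespace Anderson

/-! ### Partition of unity and evaluation bounds -/

/-! Convergence. Associativity of convolution moves the mollifier onto the kernel, so the second
component of `Q_ε` is the sum over `i` of the Wick squares `(ξ * wᵢ)² - ‖wᵢ‖²` with `wᵢ = ∂ᵢG *
ρ_ε`. A difference of two such squares is a Wick product of `ξ * (wᵢ - wᵢ')` and `ξ * (wᵢ + wᵢ')`.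
In the weighted space of regularity `-κ`, a Wick product with kernels `u`, `v` is controlled in
probability by `‖u‖_s ‖v‖_s` for some `s < 2` (`exists_chaos_bounds`). In the plane `|∇G| ≲ 1/|x|`
near the origin, hence `∇G` lies in all these `L^s`, its mollifications converge there, and `Q_ε` is
Cauchy in probability. The first component converges for every realisation of the noise.

Chaos bounds. Decoupling plays the role of hypercontractivity. Subtracting an independent copy and
rotating the pair of noises by `π/4` turns a centred quadratic form into a bilinear form in two
independent noises. That form is Gaussian in each noise when the other is frozen, and a Minkowski
argument then bounds its moments by its variance (`lintegral_rpow_wick_le`). Young's inequality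
bounds the variance by `L^s` norms of the kernels, and a weighted Besov embedding
(`exists_holderNorm_le_besovSum`) converts moments at all dyadic scales into tail bounds on the
Hölder norm.

Upper bound on the support. Every `Q_ε(ξ)` is a pair of the required form, with `h = ξ_ε` and `c =
-C_ε`, and `Q` is an almost sure limit of such pairs along a sequence. The same remark gives the
inclusion of supports once the support of `Q` is identified.

Lower bound. Mollification and truncation reduce to a test function `h` (`exists_test_pair`). The
law of white noise shifted by a test function is absolutely continuous with respect to white noise,
so almost sure facts survive such shifts. Shift `ξ` by `h - g * k`, where `k` is an approximate
identity and `g` a test function close to `ξ`: the result is `h + (ξ - ξ * k)` up to a small error.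
The rough part `ξ - ξ * k` is small as a distribution, and so is its Wick square, because `wᵢ - wᵢ *
k` is small in `L^s`. However `Q_ε` subtracts `‖wᵢ‖²` instead of `‖wᵢ - wᵢ * k‖²`, which leaves the
constant `∑ᵢ (‖wᵢ - wᵢ * k‖² - ‖wᵢ‖²)`. Since `∇G` is not square integrable, `k` can be chosen, by
the intermediate value theorem, so that this constant tends to any prescribed `c` (`exists_kernel`).
Finally `g` depends on `ξ`; it is picked in a countable dense family, for which all the shifts can
be handled outside one null set (`test_mem_support`). -/

open scoped Manifold in
lemma exists_partition (R : ℝ) : ∃ (n : ℕ) (c : Fin n → Plane) (θ : Fin n → Test),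
    (∀ i, tsupport (θ i) ⊆ Metric.closedBall (c i) 1) ∧
    ∀ y ∈ Metric.closedBall (0 : Plane) R, ∑ i, θ i y = 1 := by
  obtain ⟨t, -, ht⟩ := (isCompact_closedBall (0 : Plane) R).elim_nhds_subcover
    (fun x => Metric.ball x 1) fun x _ => Metric.ball_mem_nhds x one_pos
  obtain ⟨f, hf⟩ := SmoothPartitionOfUnity.exists_isSubordinate 𝓘(ℝ, Plane)
    (Metric.isClosed_closedBall (x := (0 : Plane)) (ε := R))
    (fun i : t => Metric.ball (i : Plane) 1) (fun i => Metric.isOpen_ball)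
    (by simpa [iUnion_subtype] using ht)
  have hts : ∀ i, tsupport (f i) ⊆ Metric.closedBall (i : Plane) 1 := fun i =>
    (hf i).trans Metric.ball_subset_closedBall
  let e := (Fintype.equivFin t).symm
  refine ⟨Fintype.card t, fun i => (e i : Plane), fun i => ⟨f (e i), ?_, ?_, fun _ _ => trivial⟩,
    fun i => hts (e i), fun y hy => ?_⟩
  · exact (f (e i)).contMDiff.contDiff
  · exact (isCompact_closedBall _ _).of_isClosed_subset (isClosed_tsupport _) (hts _)
  · have := f.sum_eq_one hy
    rw [finsum_eq_sum_of_fintype] at this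
    exact (e.sum_comp (fun j => f j y)).trans this

lemma Test.exists_iteratedFDeriv_bound (φ : Test) (r : ℕ) :
    ∃ C : ℝ, 0 ≤ C ∧ ∀ k ≤ r, ∀ y, ‖iteratedFDeriv ℝ k (φ : Plane → ℝ) y‖ ≤ C := by
  have hk : ∀ k : ℕ, ∃ C : ℝ, ∀ y, ‖iteratedFDeriv ℝ k (φ : Plane → ℝ) y‖ ≤ C := fun k =>
    (φ.contDiff.continuous_iteratedFDeriv (m := k)
      (by exact_mod_cast le_top)).bounded_above_of_compact_support
      (φ.hasCompactSupport.iteratedFDeriv k)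
  choose C hC using hk
  have hC0 : ∀ k, 0 ≤ C k := fun k => (norm_nonneg _).trans (hC k 0)
  refine ⟨∑ k ∈ Finset.range (r + 1), C k, Finset.sum_nonneg fun k _ => hC0 k, fun k hk y => ?_⟩
  exact (hC k y).trans
    (Finset.single_le_sum (f := C) (fun i _ => hC0 i) (Finset.mem_range.2 (by omega)))

/-- The product of two test functions, the second one translated. -/
def mulShift (φ θ : Test) (x z : Plane) : Test where
  toFun y := φ (y + x) * θ (y + z)
  contDiff' := by
    have := φ.contDiff
    have := θ.contDiff
    fun_prop
  hasCompactSupport' := by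
    apply HasCompactSupport.mul_left
    exact θ.hasCompactSupport.comp_homeomorph (Homeomorph.addRight z)
  tsupport_subset' := fun _ _ => trivial

/-- By homogeneity: `φ / M` belongs to `unitTests`. As `M = 0` is allowed, the normalisation uses
`M' > M` and then lets `M'` decrease to `M`. -/
lemma abs_apply_le_of_mem_unitTests {α b : ℝ} {T : Distrib}
    (hT : holderNorm α (polyWeight b) T < ∞) {φ : Test} {l : ℝ} (hl : l ∈ Ioc (0 : ℝ) 1)
    (x : Plane) {M : ℝ} (hM : 0 ≤ M) (hs : tsupport φ ⊆ Metric.closedBall 0 1)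
    (hφ : ∀ k ≤ ⌈-α⌉₊, ∀ y : Plane, ‖iteratedFDeriv ℝ k (φ : Plane → ℝ) y‖ ≤ M) :
    |T (rescale φ l x)| ≤ M * (holderNorm α (polyWeight b) T).toReal * (polyWeight b x * l ^ α) := by
  have hlα : 0 < l ^ α := Real.rpow_pos_of_pos hl.1 α
  have hw := polyWeight_pos b x
  have key : ∀ M' : ℝ, 0 < M' → M ≤ M' →
      |T (rescale φ l x)| ≤ M' * (holderNorm α (polyWeight b) T).toReal * (polyWeight b x * l ^ α) := by
    intro M' hM' hMM
    have hmem : M'⁻¹ • φ ∈ unitTests ⌈-α⌉₊ := by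
      refine ⟨(tsupport_smul_subset_right (fun _ : Plane => (_ : ℝ)) (φ : Plane → ℝ)).trans hs,
        fun k hk y => ?_⟩
      have e : ((M'⁻¹ • φ : Test) : Plane → ℝ) = M'⁻¹ • (φ : Plane → ℝ) := rfl
      rw [e, iteratedFDeriv_const_smul_apply
        ((φ.contDiff.of_le (by exact_mod_cast le_top)).contDiffAt), norm_smul, norm_inv,
        Real.norm_of_nonneg hM'.le, inv_mul_le_iff₀ hM', mul_one]
      exact (hφ k hk y).trans hMM
    have h := le_holderNorm (w := polyWeight b) T hmem hl x
    have e1 : rescale (M'⁻¹ • φ) l x = M'⁻¹ • rescale φ l x := by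
      ext z
      change (l ^ 2)⁻¹ * (M'⁻¹ * φ (l⁻¹ • (z - x))) = M'⁻¹ * ((l ^ 2)⁻¹ * φ (l⁻¹ • (z - x)))
      ring
    rw [e1, map_smul, ENNReal.ofReal_le_iff_le_toReal hT.ne, div_le_iff₀ (by positivity),
      smul_eq_mul, abs_mul, abs_of_pos (inv_pos.2 hM'), inv_mul_le_iff₀ hM'] at h
    linarith
  set H := (holderNorm α (polyWeight b) T).toReal
  have hlim : Tendsto (fun M' => M' * H * (polyWeight b x * l ^ α)) (𝓝[>] M)
      (𝓝 (M * H * (polyWeight b x * l ^ α))) := by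
    refine Tendsto.mono_left (Continuous.tendsto ?_ M) nhdsWithin_le_nhds
    fun_prop
  refine ge_of_tendsto hlim ?_
  filter_upwards [self_mem_nhdsWithin] with M' hM'
  exact key M' (hM.trans_lt hM') (le_of_lt hM')

/-- A distribution of finite weighted Hölder norm is bounded, on test functions supported in a ball
of given radius, by their `C^r` norm. -/
theorem exists_abs_apply_le (α : ℝ) {b : ℝ} (hb : 0 ≤ b) (R : ℝ) :
    ∃ C : ℝ, 0 ≤ C ∧ ∀ (T : Distrib), holderNorm α (polyWeight b) T < ∞ → ∀ (φ : Test) (x : Plane)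
      (M : ℝ), 0 ≤ M → tsupport φ ⊆ Metric.closedBall x R →
      (∀ k ≤ ⌈-α⌉₊, ∀ y : Plane, ‖iteratedFDeriv ℝ k (φ : Plane → ℝ) y‖ ≤ M) →
      |T φ| ≤ C * M * (holderNorm α (polyWeight b) T).toReal * polyWeight b x := by
  obtain ⟨n, c, θ, hθ, hsum⟩ := exists_partition R
  set r := ⌈-α⌉₊
  choose D hD0 hD using fun i => (θ i).exists_iteratedFDeriv_bound r
  refine ⟨∑ i, 2 ^ r * D i * (1 + ‖c i‖) ^ b,
    Finset.sum_nonneg fun i _ => by have := hD0 i; positivity, ?_⟩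
  intro T hT φ x M hM hs hφ
  set H := (holderNorm α (polyWeight b) T).toReal
  have hH : 0 ≤ H := ENNReal.toReal_nonneg
  -- Each localised piece `φ · θᵢ(· - x)` is recentred at `x + cᵢ`, so that it is supported in the
  -- unit ball and is seen by the norm at scale `l = 1`. The Leibniz rule then produces the factor
  -- `2 ^ r`.
  have hdec : φ = ∑ i, rescale (mulShift φ (θ i) (x + c i) (c i)) 1 (x + c i) := by
    ext y
    have e : (∑ i, rescale (mulShift φ (θ i) (x + c i) (c i)) 1 (x + c i)) y
        = ∑ i, rescale (mulShift φ (θ i) (x + c i) (c i)) 1 (x + c i) y := by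
      simp
    rw [e]
    have e2 : ∀ i, rescale (mulShift φ (θ i) (x + c i) (c i)) 1 (x + c i) y
        = φ y * θ i (y - x) := by
      intro i
      rw [rescale_apply]
      change ((1 : ℝ) ^ 2)⁻¹ * (φ _ * θ i _) = _
      simp only [one_pow, inv_one, one_smul, one_mul]
      congr 2 <;> abel
    simp_rw [e2, ← Finset.mul_sum]
    by_cases hy : y ∈ tsupport φ
    · rw [hsum _ (by have := hs hy; rw [mem_closedBall_iff_norm] at this; simpa using this), mul_one]
    · rw [image_eq_zero_of_notMem_tsupport hy, zero_mul]
  have hterm : ∀ i, |T (rescale (mulShift φ (θ i) (x + c i) (c i)) 1 (x + c i))|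
      ≤ (2 ^ r * D i * (1 + ‖c i‖) ^ b) * (M * H * polyWeight b x) := by
    intro i
    have h1 := abs_apply_le_of_mem_unitTests hT (φ := mulShift φ (θ i) (x + c i) (c i))
      (l := 1) (by simp) (x + c i) (M := 2 ^ r * (M * D i)) (by have := hD0 i; positivity) ?_ ?_
    · have hw : polyWeight b (x + c i) ≤ (1 + ‖c i‖) ^ b * polyWeight b x :=
        polyWeight_le hb (norm_nonneg _) (norm_add_le _ _)
      rw [Real.one_rpow, mul_one] at h1
      refine h1.trans ?_
      have := hD0 i
      calc 2 ^ r * (M * D i) * H * polyWeight b (x + c i)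
          ≤ 2 ^ r * (M * D i) * H * ((1 + ‖c i‖) ^ b * polyWeight b x) := by gcongr
        _ = _ := by ring
    · refine closure_minimal ?_ Metric.isClosed_closedBall
      intro y hy
      have hy' : θ i (y + c i) ≠ 0 := right_ne_zero_of_mul (hy : φ _ * θ i _ ≠ 0)
      have := hθ i (subset_tsupport _ hy')
      rw [mem_closedBall_iff_norm] at this
      simpa using this
    · intro k hk y
      have h2 := norm_iteratedFDeriv_mul_le (N := k) (f := fun y => φ (y + (x + c i)))
        (g := fun y => θ i (y + c i)) (𝕜 := ℝ)
        ((φ.contDiff.comp (contDiff_id.add contDiff_const)).of_le (by exact_mod_cast le_top))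
        (((θ i).contDiff.comp (contDiff_id.add contDiff_const)).of_le (by exact_mod_cast le_top))
        y le_rfl
      refine h2.trans ?_
      have h3 : ∀ j ∈ Finset.range (k + 1),
          (k.choose j : ℝ) * ‖iteratedFDeriv ℝ j (fun y => φ (y + (x + c i))) y‖ *
            ‖iteratedFDeriv ℝ (k - j) (fun y => θ i (y + c i)) y‖ ≤ k.choose j * (M * D i) := by
        intro j hj
        rw [mul_assoc]
        gcongr
        · rw [iteratedFDeriv_comp_add_right]
          exact hφ j (by have := Finset.mem_range.1 hj; omega) _
        · rw [iteratedFDeriv_comp_add_right]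
          exact hD i _ (by omega) _
      refine (Finset.sum_le_sum h3).trans ?_
      rw [← Finset.sum_mul]
      have h4 : (∑ j ∈ Finset.range (k + 1), (k.choose j : ℝ)) = 2 ^ k := by
        exact_mod_cast Nat.sum_range_choose k
      rw [h4]
      have := hD0 i
      gcongr
      norm_num
  conv_lhs => rw [hdec, map_sum]
  refine (Finset.abs_sum_le_sum_abs _ _).trans ((Finset.sum_le_sum fun i _ => hterm i).trans ?_)
  rw [← Finset.sum_mul]
  apply le_of_eq
  ring

end Anderson
end

noncomputable section
namespace Anderson

/-! ### Convolution of a distribution with a test function -/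

/-- The reflected and translated test function `y ↦ w (x - y)`. -/
def reflect (w : Test) (x : Plane) : Test where
  toFun y := w (x - y)
  contDiff' := by
    have := w.contDiff
    fun_prop
  hasCompactSupport' := w.hasCompactSupport.comp_homeomorph (Homeomorph.subLeft x)
  tsupport_subset' := fun _ _ => trivial

lemma reflect_apply (w : Test) (x y : Plane) : reflect w x y = w (x - y) := rfl

/-- The convolution `(T * w)(x) = ⟨T, w(x - ·)⟩`. -/
def conv (T : Distrib) (w : Test) (x : Plane) : ℝ := T (reflect w x)

lemma reflect_add (w v : Test) (x : Plane) : reflect (w + v) x = reflect w x + reflect v x := rfl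

lemma reflect_sub (w v : Test) (x : Plane) : reflect (w - v) x = reflect w x - reflect v x := rfl

lemma reflect_smul (c : ℝ) (w : Test) (x : Plane) : reflect (c • w) x = c • reflect w x := rfl

lemma conv_add_right (T : Distrib) (w v : Test) (x : Plane) :
    conv T (w + v) x = conv T w x + conv T v x := by
  rw [conv, reflect_add, map_add]; rfl

lemma conv_sub_right (T : Distrib) (w v : Test) (x : Plane) :
    conv T (w - v) x = conv T w x - conv T v x := by
  rw [conv, reflect_sub, map_sub]; rfl

lemma conv_smul_right (T : Distrib) (c : ℝ) (w : Test) (x : Plane) :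
    conv T (c • w) x = c * conv T w x := by
  rw [conv, reflect_smul, map_smul]; rfl

lemma conv_add_left (S T : Distrib) (w : Test) (x : Plane) :
    conv (S + T) w x = conv S w x + conv T w x := rfl

lemma conv_sub_left (S T : Distrib) (w : Test) (x : Plane) :
    conv (S - T) w x = conv S w x - conv T w x := rfl

lemma Test.exists_radius (w : Test) : ∃ R : ℝ, 0 ≤ R ∧ tsupport w ⊆ Metric.closedBall 0 R := by
  obtain ⟨R, hR⟩ := w.hasCompactSupport.isCompact.isBounded.subset_closedBall (0 : Plane)
  exact ⟨max R 0, le_max_right _ _, hR.trans (Metric.closedBall_subset_closedBall (le_max_left _ _))⟩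

lemma tsupport_reflect {w : Test} {R : ℝ} (h : tsupport w ⊆ Metric.closedBall 0 R) (x : Plane) :
    tsupport (reflect w x) ⊆ Metric.closedBall x R := by
  refine closure_minimal (fun y hy => ?_) Metric.isClosed_closedBall
  have := h (subset_tsupport _ (show x - y ∈ Function.support w from hy))
  rw [mem_closedBall_zero_iff, norm_sub_rev] at this
  rwa [mem_closedBall_iff_norm]

lemma norm_iteratedFDeriv_reflect (w : Test) (x : Plane) (k : ℕ) (y : Plane) :
    ‖iteratedFDeriv ℝ k (reflect w x : Plane → ℝ) y‖
      = ‖iteratedFDeriv ℝ k (w : Plane → ℝ) (x - y)‖ := by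
  have e : (reflect w x : Plane → ℝ)
      = fun z => ((w : Plane → ℝ) ∘ (LinearIsometryEquiv.neg ℝ : Plane ≃ₗᵢ[ℝ] Plane)) (z - x) := by
    ext z
    simp [reflect_apply]
  rw [e, iteratedFDeriv_comp_sub, LinearIsometryEquiv.norm_iteratedFDeriv_comp_right]
  simp

/-- The constant depends on `w` but not on `T`: this uniformity is what allows identities and
closures to be extended from test functions to `C^α_w` by density. -/
lemma exists_abs_conv_le (α : ℝ) {b : ℝ} (hb : 0 ≤ b) (w : Test) :
    ∃ C : ℝ, 0 ≤ C ∧ ∀ T : Distrib, holderNorm α (polyWeight b) T < ∞ → ∀ x : Plane,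
      |conv T w x| ≤ C * (holderNorm α (polyWeight b) T).toReal * polyWeight b x := by
  obtain ⟨R, -, hR⟩ := w.exists_radius
  obtain ⟨M, hM0, hM⟩ := w.exists_iteratedFDeriv_bound ⌈-α⌉₊
  obtain ⟨C, hC0, hC⟩ := exists_abs_apply_le α hb R
  refine ⟨C * M, by positivity, fun T hT x => hC T hT _ x M hM0 (tsupport_reflect hR x) ?_⟩
  intro k hk y
  rw [norm_iteratedFDeriv_reflect]
  exact hM k hk _

/-- Evaluation at `φ` is the value at the origin of the convolution with the reflection of `φ`, and
the weight equals one there. -/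
lemma exists_abs_apply_le_holderNorm (α : ℝ) {b : ℝ} (hb : 0 ≤ b) (φ : Test) :
    ∃ C : ℝ, 0 ≤ C ∧ ∀ T : Distrib, holderNorm α (polyWeight b) T < ∞ →
      |T φ| ≤ C * (holderNorm α (polyWeight b) T).toReal := by
  obtain ⟨C, hC0, hC⟩ := exists_abs_conv_le α hb (reflect φ 0)
  refine ⟨C, hC0, fun T hT => ?_⟩
  have h := hC T hT 0
  have e : reflect (reflect φ 0) 0 = φ := by ext y; simp [reflect_apply]
  rw [conv, e] at h
  simpa [polyWeight] using h

open Classical in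
/-- The convolution of a test function with a compactly supported locally integrable function. -/
def testConv (w : Test) (f : Plane → ℝ) : Test :=
  if h : LocallyIntegrable f ∧ HasCompactSupport f then
    ⟨convolution f w (ContinuousLinearMap.mul ℝ ℝ) volume,
      HasCompactSupport.contDiff_convolution_right (n := ⊤) (ContinuousLinearMap.mul ℝ ℝ)
        w.hasCompactSupport h.1 w.contDiff,
      HasCompactSupport.convolution (ContinuousLinearMap.mul ℝ ℝ) h.2 w.hasCompactSupport,
      fun _ _ => trivial⟩
  else 0

lemma testConv_apply (w : Test) {f : Plane → ℝ} (hf : LocallyIntegrable f)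
    (hc : HasCompactSupport f) (x : Plane) : testConv w f x = ∫ t, f t * w (x - t) := by
  rw [testConv, dif_pos ⟨hf, hc⟩]
  rfl

lemma Test.testConv_apply (w f : Test) (x : Plane) : testConv w f x = ∫ t, f t * w (x - t) :=
  Anderson.testConv_apply w f.continuous.locallyIntegrable f.hasCompactSupport x

lemma conv_ofFun {f : Plane → ℝ} (hf : LocallyIntegrable f) (w : Test) (x : Plane) :
    conv (ofFun f) w x = ∫ y, f y * w (x - y) := by
  rw [conv, ofFun_apply hf]
  simp_rw [reflect_apply, mul_comm]

lemma conv_ofFun_test (g w : Test) : conv (ofFun g) w = testConv w g := by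
  ext x
  rw [conv_ofFun g.continuous.locallyIntegrable, Test.testConv_apply]

lemma HolderSubgroup.sub_ofFun_mem {α : ℝ} {w : Plane → ℝ} {T : Distrib}
    (hT : T ∈ holderSubgroup α w) {g : Test} (hg : holderNorm α w (T - ofFun g) < ∞) :
    T - ofFun g ∈ holderSubgroup α w := by
  refine ⟨hg, fun δ hδ => ?_⟩
  obtain ⟨u, hu⟩ := hT.2 δ hδ
  refine ⟨u - g, ?_⟩
  have e : ofFun (u - g : Test) = ofFun u - ofFun g := by
    have := ofFun_test_add u (-g)
    rw [ofFun_test_neg] at this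
    rwa [sub_eq_add_neg, sub_eq_add_neg]
  rw [e, sub_sub_sub_cancel_right]
  exact hu

lemma exists_test_toReal_lt {α : ℝ} {w : Plane → ℝ} {T : Distrib}
    (hT : T ∈ holderSubgroup α w) {δ : ℝ} (hδ : 0 < δ) :
    ∃ g : Test, T - ofFun g ∈ holderSubgroup α w ∧ (holderNorm α w (T - ofFun g)).toReal < δ := by
  obtain ⟨g, hg⟩ := hT.2 (ENNReal.ofReal δ) (ENNReal.ofReal_pos.2 hδ)
  refine ⟨g, HolderSubgroup.sub_ofFun_mem hT (hg.trans ENNReal.ofReal_lt_top), ?_⟩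
  rwa [← ENNReal.lt_ofReal_iff_toReal_lt (hg.trans ENNReal.ofReal_lt_top).ne]

/-- The map `T ↦ T * w` is bounded from the Hölder norm to the weighted uniform norm and sends test
functions to test functions, so it maps one closure into the other. -/
lemma supClosure_conv {α b : ℝ} (hb : 0 ≤ b) {T : Distrib}
    (hT : T ∈ holderSubgroup α (polyWeight b)) (w : Test) : SupClosure b (conv T w) := by
  intro δ hδ
  obtain ⟨C, hC0, hC⟩ := exists_abs_conv_le α hb w
  obtain ⟨g, hg, hgδ⟩ := exists_test_toReal_lt hT (show 0 < δ / (C + 1) by positivity)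
  refine ⟨testConv w g, fun y => ?_⟩
  rw [← conv_ofFun_test, ← conv_sub_left]
  refine (hC _ hg.1 y).trans ?_
  have := polyWeight_pos b y
  gcongr
  rw [lt_div_iff₀ (by positivity)] at hgδ
  nlinarith [ENNReal.toReal_nonneg (a := holderNorm α (polyWeight b) (T - ofFun g))]

lemma continuous_conv {α b : ℝ} (hb : 0 ≤ b) {T : Distrib}
    (hT : T ∈ holderSubgroup α (polyWeight b)) (w : Test) : Continuous (conv T w) :=
  (supClosure_conv hb hT w).continuous

lemma integrable_mul_comp_sub {f F : Plane → ℝ} (hf : LocallyIntegrable f)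
    (hc : HasCompactSupport f) (hF : Continuous F) (x : Plane) :
    Integrable fun y => f y * F (x - y) := by
  have h1 : IntegrableOn (fun y => f y * F (x - y)) (tsupport f) :=
    (hf.integrableOn_isCompact hc).mul_continuousOn
      (hF.comp (continuous_const.sub continuous_id)).continuousOn hc
  rw [← integrableOn_iff_integrable_of_support_subset (s := tsupport f)]
  · exact h1
  · intro y hy
    exact subset_tsupport _ (left_ne_zero_of_mul hy)

lemma integral_mul_conv_ofFun (g w : Test) {f : Plane → ℝ} (hf : LocallyIntegrable f)
    (hc : HasCompactSupport f) (x : Plane) :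
    ∫ y, f y * conv (ofFun g) w (x - y) = conv (ofFun g) (testConv w f) x := by
  have hfi : Integrable f := by
    rw [← integrableOn_iff_integrable_of_support_subset (subset_tsupport f)]
    exact hf.integrableOn_isCompact hc
  have hgi : Integrable (g : Plane → ℝ) := g.continuous.integrable_of_hasCompactSupport g.hasCompactSupport
  obtain ⟨B, hB0, hB⟩ := w.exists_bound
  rw [conv_ofFun g.continuous.locallyIntegrable]
  simp_rw [conv_ofFun g.continuous.locallyIntegrable, testConv_apply w hf hc, ← integral_const_mul]
  rw [integral_integral_swap]
  · congr 1 with z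
    congr 1 with y
    rw [show x - y - z = x - z - y by abel]
    ring
  · have h1 := (hfi.mul_prod hgi)
    have h2 : Integrable (fun p : Plane × Plane => w (x - p.1 - p.2) * (f p.1 * g p.2))
        (volume.prod volume) := by
      refine h1.bdd_mul (c := B) ?_ (Eventually.of_forall fun p => hB _)
      exact (w.continuous.comp (by fun_prop)).aestronglyMeasurable
    refine h2.congr (Eventually.of_forall fun p => ?_)
    simp only [Function.uncurry]
    ring

/-- Associativity of convolution: `f * (T * w) = T * (f * w)`. -/
theorem integral_mul_conv {α b : ℝ} (hb : 0 ≤ b) {T : Distrib}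
    (hT : T ∈ holderSubgroup α (polyWeight b)) (w : Test) {f : Plane → ℝ}
    (hf : LocallyIntegrable f) (hc : HasCompactSupport f) (x : Plane) :
    ∫ y, f y * conv T w (x - y) = conv T (testConv w f) x := by
  obtain ⟨C, hC0, hC⟩ := exists_abs_conv_le α hb w
  obtain ⟨C', hC'0, hC'⟩ := exists_abs_conv_le α hb (testConv w f)
  have hI := integrable_mul_comp_sub
    (show LocallyIntegrable fun y => ‖f y‖ from fun y => (hf y).norm) hc.norm (continuous_polyWeight b) x
  set I := ∫ y, ‖f y‖ * polyWeight b (x - y)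
  have hI0 : 0 ≤ I := integral_nonneg fun y =>
    mul_nonneg (norm_nonneg _) (polyWeight_pos _ _).le
  -- Both sides depend continuously on `T` in the Hölder norm, and by Fubini they agree when `T` is
  -- a test function. The constant `K` below collects the two operator bounds.
  rw [← sub_eq_zero]
  refine eq_of_abs_sub_le_all fun δ hδ => ?_
  obtain ⟨K, hK⟩ : ∃ K, K = C * I + C' * polyWeight b x := ⟨_, rfl⟩
  have hK0 : 0 ≤ K := by
    rw [hK]
    exact add_nonneg (mul_nonneg hC0 hI0) (mul_nonneg hC'0 (polyWeight_pos b x).le)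
  obtain ⟨g, hg, hgδ⟩ := exists_test_toReal_lt hT (show 0 < δ / (K + 1) by positivity)
  obtain ⟨H, hHdef⟩ : ∃ H, H = (holderNorm α (polyWeight b) (T - ofFun g)).toReal := ⟨_, rfl⟩
  have hH : 0 ≤ H := hHdef ▸ ENNReal.toReal_nonneg
  rw [← hHdef] at hgδ
  have e : (∫ y, f y * conv T w (x - y)) - conv T (testConv w f) x
      = (∫ y, f y * conv (T - ofFun g) w (x - y)) - conv (T - ofFun g) (testConv w f) x := by
    simp_rw [conv_sub_left, mul_sub]
    rw [integral_sub, integral_mul_conv_ofFun g w hf hc]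
    · ring
    · exact integrable_mul_comp_sub hf hc (continuous_conv hb hT w) x
    · refine integrable_mul_comp_sub hf hc ?_ x
      rw [conv_ofFun_test]
      exact (testConv w g).continuous
  rw [sub_zero, e]
  have h1 : |∫ y, f y * conv (T - ofFun g) w (x - y)| ≤ C * H * I := by
    rw [← integral_const_mul, ← Real.norm_eq_abs]
    refine norm_integral_le_of_norm_le (hI.const_mul _) (Eventually.of_forall fun y => ?_)
    rw [norm_mul]
    calc ‖f y‖ * ‖conv (T - ofFun g) w (x - y)‖ ≤ ‖f y‖ * (C * H * polyWeight b (x - y)) := by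
          gcongr
          rw [hHdef]
          exact hC _ hg.1 _
      _ = _ := by ring
  have h2 := hC' _ hg.1 x
  rw [← hHdef] at h2
  refine (abs_sub _ _).trans ((add_le_add h1 h2).trans ?_)
  rw [lt_div_iff₀ (by positivity)] at hgδ
  calc C * H * I + C' * H * polyWeight b x = H * K := by rw [hK]; ring
    _ ≤ δ := by nlinarith

end Anderson
end

noncomputable section
namespace Anderson

/-! ### The spaces `C^α_w`: scalar multiplication, separability, measurability, completeness -/

lemma ofFun_test_smul (c : ℝ) (g : Test) : ofFun (c • g : Test) = c • ofFun g := by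
  ext φ
  change ofFun (c • g : Test) φ = c * ofFun g φ
  rw [ofFun_apply (c • g : Test).continuous.locallyIntegrable,
    ofFun_apply g.continuous.locallyIntegrable, ← integral_const_mul]
  congr 1 with x
  change φ x * (c * g x) = _
  ring

lemma ofFun_test_sub (g h : Test) : ofFun (g - h : Test) = ofFun g - ofFun h := by
  rw [sub_eq_add_neg, ofFun_test_add, ofFun_test_neg, sub_eq_add_neg]

lemma holderNorm_smul_le (α : ℝ) (w : Plane → ℝ) (c : ℝ) (T : Distrib) :
    holderNorm α w (c • T) ≤ ENNReal.ofReal |c| * holderNorm α w T := by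
  refine iSup_le fun x => iSup₂_le fun l hl => iSup₂_le fun φ hφ => ?_
  have e : |(c • T) (rescale φ l x)| / (w x * l ^ α) = |c| * (|T (rescale φ l x)| / (w x * l ^ α)) := by
    change |c * T (rescale φ l x)| / _ = _
    rw [abs_mul, mul_div_assoc]
  rw [e, ENNReal.ofReal_mul (abs_nonneg c)]
  gcongr
  exact le_holderNorm T hφ hl x

lemma smul_mem_holderSubgroup {α : ℝ} {w : Plane → ℝ} (c : ℝ) {T : Distrib}
    (hT : T ∈ holderSubgroup α w) : c • T ∈ holderSubgroup α w := by
  refine ⟨(holderNorm_smul_le α w c T).trans_lt (ENNReal.mul_lt_top ENNReal.ofReal_lt_top hT.1),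
    fun δ hδ => ?_⟩
  obtain ⟨g, hg⟩ := hT.2 (δ / (ENNReal.ofReal |c| + 1)) (ENNReal.div_pos hδ.ne' (by simp))
  refine ⟨c • g, ?_⟩
  have e : c • T - ofFun (c • g : Test) = c • (T - ofFun g) := by rw [ofFun_test_smul, smul_sub]
  rw [e]
  have hne : ENNReal.ofReal |c| + 1 ≠ 0 := by simp
  have hlt : holderNorm α w (T - ofFun g) * (ENNReal.ofReal |c| + 1) < δ :=
    ENNReal.mul_lt_of_lt_div hg
  refine lt_of_le_of_lt ?_ hlt
  refine (holderNorm_smul_le α w c _).trans ?_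
  rw [mul_comm]
  gcongr
  exact le_self_add

namespace HolderSpace

variable {α : ℝ} {w : Plane → ℝ}

/-- Scalar multiplication on `C^α_w`. -/
def scale (c : ℝ) (T : HolderSpace α w) : HolderSpace α w :=
  ⟨c • T.toDistrib, smul_mem_holderSubgroup c T.mem⟩

lemma toDistrib_scale (c : ℝ) (T : HolderSpace α w) :
    (scale c T).toDistrib = c • T.toDistrib := rfl

lemma toDistrib_sub (S T : HolderSpace α w) :
    (S - T).toDistrib = S.toDistrib - T.toDistrib := by
  rw [sub_eq_add_neg, toDistrib_add, toDistrib_neg, sub_eq_add_neg]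
end HolderSpace

lemma Test.supClosure (g : Test) (a : ℝ) : SupClosure a g := fun δ hδ =>
  ⟨g, fun y => by simpa using mul_nonneg hδ.le (polyWeight_pos a y).le⟩

lemma ofFun_test_mem {α κ : ℝ} (hα : α ≤ 0) (hκ : 0 ≤ κ) (g : Test) :
    ofFun g ∈ holderSubgroup α (polyWeight κ) := (g.supClosure κ).mem_holderSubgroup hα hκ

/-- There is a sequence of test functions which is dense for the uniform norm. -/
theorem exists_dense_tests : ∃ D : ℕ → Test, ∀ (g : Test) (δ : ℝ), 0 < δ →
    ∃ j, ∀ y, |g y - D j y| ≤ δ := by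
  let F : Test → C(Plane, ℝ) := fun g => ⟨g, g.continuous⟩
  -- Separability of the compact-open topology only gives locally uniform approximation. Confining
  -- the supports to a fixed ball makes it uniform, because both functions vanish outside.
  let S : ℕ → Set Test := fun n => {g | tsupport g ⊆ Metric.closedBall 0 (n : ℝ)}
  have h : ∀ n, ∃ u : ℕ → Test, (∀ k, u k ∈ S n) ∧ ∀ g ∈ S n, F g ∈ closure (range (F ∘ u)) := by
    intro n
    have : Nonempty (F '' S n) := ⟨⟨F 0, 0, by
      intro x hx
      have : tsupport ((0 : Test) : Plane → ℝ) = ∅ := by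
        rw [tsupport_eq_empty_iff]; rfl
      rw [this] at hx
      exact hx.elim, rfl⟩⟩
    obtain ⟨v, hv⟩ := TopologicalSpace.exists_dense_seq (F '' S n)
    choose u hu huv using fun k => (v k).2
    refine ⟨u, hu, fun g hg => ?_⟩
    have h1 : (⟨F g, g, hg, rfl⟩ : F '' S n) ∈ closure (range v) := hv _
    have h2 := image_closure_subset_closure_image (f := ((↑) : F '' S n → C(Plane, ℝ)))
      continuous_subtype_val (mem_image_of_mem _ h1)
    convert h2 using 2
    ext f
    simp [huv]
  choose u hu hd using h
  obtain ⟨e⟩ : Nonempty (ℕ ≃ ℕ × ℕ) := ⟨Nat.pairEquiv.symm⟩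
  refine ⟨fun j => u (e j).1 (e j).2, fun g δ hδ => ?_⟩
  obtain ⟨R, hR0, hR⟩ := g.exists_radius
  obtain ⟨n, hn⟩ := exists_nat_ge R
  have hgS : g ∈ S n := hR.trans (Metric.closedBall_subset_closedBall hn)
  have hunif := (ContinuousMap.tendsto_iff_forall_isCompact_tendstoUniformlyOn.1
    (tendsto_id : Tendsto id (𝓝 (F g)) (𝓝 (F g)))) _ (isCompact_closedBall (0 : Plane) n)
  rw [Metric.tendstoUniformlyOn_iff] at hunif
  obtain ⟨f, ⟨k, rfl⟩, hf⟩ := ((mem_closure_iff_frequently.1 (hd n g hgS)).and_eventually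
    (hunif δ hδ)).exists
  refine ⟨e.symm (n, k), fun y => ?_⟩
  simp only [Equiv.apply_symm_apply]
  by_cases hy : y ∈ Metric.closedBall (0 : Plane) n
  · exact (hf y hy).le
  · rw [image_eq_zero_of_notMem_tsupport fun h => hy (hgS h),
      image_eq_zero_of_notMem_tsupport fun h => hy (hu n k h)]
    simpa using hδ.le

lemma ofFun_sub {f g : Plane → ℝ} (hf : LocallyIntegrable f) (hg : LocallyIntegrable g) :
    ofFun (fun x => f x - g x) = ofFun f - ofFun g := by
  have e : (fun x => f x - g x) = f + -g := by ext x; simp [sub_eq_add_neg]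
  rw [e, ofFun_add hf hg.neg, ofFun_neg hg, sub_eq_add_neg]

lemma exists_holderNorm_test_sub_le {α κ : ℝ} (hα : α ≤ 0) (hκ : 0 ≤ κ) : ∃ K : ℝ, 0 < K ∧
    ∀ (g h : Test) (δ : ℝ), 0 ≤ δ → (∀ y, |g y - h y| ≤ δ) →
      holderNorm α (polyWeight κ) (ofFun g - ofFun h) ≤ ENNReal.ofReal (δ * K) := by
  refine ⟨2 ^ κ * volume.real (Metric.closedBall (0 : Plane) 1), ?_, fun g h δ hδ hgh => ?_⟩
  · have : 0 < volume.real (Metric.closedBall (0 : Plane) 1) :=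
      ENNReal.toReal_pos (Metric.measure_closedBall_pos volume _ one_pos).ne'
        measure_closedBall_lt_top.ne
    positivity
  · rw [← ofFun_test_sub]
    refine holderNorm_ofFun_le hα hκ hδ (g - h : Test).continuous.locallyIntegrable fun y => ?_
    have := one_le_polyWeight hκ y
    exact (hgh y).trans (by nlinarith)

/-- Countability is the point: besides separability, it allows a noise-dependent approximation to be
chosen among countably many shifts, for which almost sure statements can be intersected. -/
theorem exists_dense_tests_holderNorm {α κ : ℝ} (hα : α ≤ 0) (hκ : 0 ≤ κ) : ∃ D : ℕ → Test,
    ∀ T ∈ holderSubgroup α (polyWeight κ), ∀ δ : ℝ, 0 < δ →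
      ∃ j, holderNorm α (polyWeight κ) (T - ofFun (D j)) < ENNReal.ofReal δ := by
  obtain ⟨D, hD⟩ := exists_dense_tests
  obtain ⟨K, hK, hKle⟩ := exists_holderNorm_test_sub_le hα hκ
  refine ⟨D, fun T hT δ hδ => ?_⟩
  obtain ⟨g, hg⟩ := hT.2 (ENNReal.ofReal (δ / 2)) (ENNReal.ofReal_pos.2 (by positivity))
  obtain ⟨j, hj⟩ := hD g (δ / (2 * K)) (by positivity)
  refine ⟨j, ?_⟩
  have e : T - ofFun (D j) = (T - ofFun g) + (ofFun g - ofFun (D j)) := by abel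
  rw [e]
  refine (holderNorm_add_le _ _ _ _).trans_lt ?_
  have h2 := hKle g (D j) _ (by positivity) hj
  have e2 : δ / (2 * K) * K = δ / 2 := by field_simp
  rw [e2] at h2
  calc _ < ENNReal.ofReal (δ / 2) + ENNReal.ofReal (δ / 2) :=
        ENNReal.add_lt_add_of_lt_of_le (h2.trans_lt ENNReal.ofReal_lt_top).ne hg h2
    _ = _ := by rw [← ENNReal.ofReal_add (by positivity) (by positivity), add_halves]

lemma norm_mk_lt {α : ℝ} {w : Plane → ℝ} {T : HolderSpace α w} {δ : ℝ}
    (h : holderNorm α w T.toDistrib < ENNReal.ofReal δ) : ‖T‖ < δ := by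
  rw [HolderSpace.norm_def]
  exact (ENNReal.lt_ofReal_iff_toReal_lt T.mem.1.ne).1 h

lemma separableSpace_holderSpace {α κ : ℝ} (hα : α ≤ 0) (hκ : 0 ≤ κ) :
    SeparableSpace (HolderSpace α (polyWeight κ)) := by
  obtain ⟨D, hD⟩ := exists_dense_tests_holderNorm hα hκ
  refine ⟨range fun j => (⟨ofFun (D j), ofFun_test_mem hα hκ _⟩ : HolderSpace α (polyWeight κ)),
    countable_range _, fun T => Metric.mem_closure_iff.2 fun δ hδ => ?_⟩
  obtain ⟨j, hj⟩ := hD T.toDistrib T.mem δ hδ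
  refine ⟨_, ⟨j, rfl⟩, ?_⟩
  rw [dist_eq_norm]
  exact norm_mk_lt (by rwa [HolderSpace.toDistrib_sub])

lemma secondCountable_holderSpace {α κ : ℝ} (hα : α ≤ 0) (hκ : 0 ≤ κ) :
    SecondCountableTopology (HolderSpace α (polyWeight κ)) :=
  have := separableSpace_holderSpace hα hκ
  UniformSpace.secondCountable_of_separable _

lemma HolderSpace.exists_abs_eval_le (α : ℝ) {κ : ℝ} (hκ : 0 ≤ κ) (φ : Test) : ∃ C : ℝ, 0 ≤ C ∧
    ∀ T : HolderSpace α (polyWeight κ), |T.toDistrib φ| ≤ C * ‖T‖ := by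
  obtain ⟨C, hC0, hC⟩ := exists_abs_apply_le_holderNorm α hκ φ
  exact ⟨C, hC0, fun T => hC _ T.mem.1⟩

lemma HolderSpace.continuous_eval (α : ℝ) {κ : ℝ} (hκ : 0 ≤ κ) (φ : Test) :
    Continuous fun T : HolderSpace α (polyWeight κ) => T.toDistrib φ := by
  obtain ⟨C, hC0, hC⟩ := HolderSpace.exists_abs_eval_le α hκ φ
  refine LipschitzWith.continuous (K := ⟨C, hC0⟩) (LipschitzWith.of_dist_le_mul fun S T => ?_)
  rw [Real.dist_eq, dist_eq_norm]
  have := hC (S - T)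
  rw [HolderSpace.toDistrib_sub] at this
  exact this

/-- Measurability of a map into `C^α_w` can be tested on evaluations. -/
theorem HolderSpace.measurable_of_eval {α κ : ℝ} (hα : α ≤ 0) (hκ : 0 ≤ κ) {β : Type*}
    [MeasurableSpace β] {f : β → HolderSpace α (polyWeight κ)}
    (hf : ∀ φ : Test, Measurable fun x => (f x).toDistrib φ) : Measurable f := by
  have := secondCountable_holderSpace hα hκ
  have := separableSpace_holderSpace hα hκ
  have hball : ∀ (S : HolderSpace α (polyWeight κ)) (r : ℝ), 0 ≤ r →
      MeasurableSet (f ⁻¹' Metric.closedBall S r) := by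
    intro S r hr
    -- The norm is a supremum over an uncountable family. The complement of a closed ball is
    -- therefore an uncountable union of open sets, each defined by one evaluation, and second
    -- countability extracts a countable subunion.
    let ι := {p : Plane × ℝ × Test // p.2.1 ∈ Ioc (0 : ℝ) 1 ∧ p.2.2 ∈ unitTests ⌈-α⌉₊}
    let U : ι → Set (HolderSpace α (polyWeight κ)) := fun p =>
      {T | r * (polyWeight κ p.1.1 * p.1.2.1 ^ α)
        < |T.toDistrib (rescale p.1.2.2 p.1.2.1 p.1.1)
            - S.toDistrib (rescale p.1.2.2 p.1.2.1 p.1.1)|}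
    have hU : ∀ p, IsOpen (U p) := fun p => isOpen_lt continuous_const
      ((HolderSpace.continuous_eval α hκ _).sub continuous_const).abs
    have hcompl : (Metric.closedBall S r)ᶜ = ⋃ p, U p := by
      ext T
      rw [mem_compl_iff, Metric.mem_closedBall, dist_eq_norm, HolderSpace.norm_def,
        ← ENNReal.le_ofReal_iff_toReal_le (T - S).mem.1.ne hr, HolderSpace.toDistrib_sub]
      simp only [holderNorm, iSup_le_iff, not_forall, mem_iUnion]
      constructor
      · rintro ⟨x, l, hl, φ, hφ, h⟩
        refine ⟨⟨(x, l, φ), hl, hφ⟩, ?_⟩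
        rw [ENNReal.ofReal_le_ofReal_iff hr, not_le, lt_div_iff₀ (mul_pos (polyWeight_pos _ _)
          (Real.rpow_pos_of_pos hl.1 _))] at h
        exact h
      · rintro ⟨⟨⟨x, l, φ⟩, hl, hφ⟩, h⟩
        refine ⟨x, l, hl, φ, hφ, ?_⟩
        rw [ENNReal.ofReal_le_ofReal_iff hr, not_le, lt_div_iff₀ (mul_pos (polyWeight_pos _ _)
          (Real.rpow_pos_of_pos hl.1 _))]
        exact h
    obtain ⟨s, hs, hsU⟩ := TopologicalSpace.isOpen_iUnion_countable U hU
    rw [← MeasurableSet.compl_iff, ← preimage_compl, hcompl, ← hsU, preimage_iUnion₂]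
    refine MeasurableSet.biUnion hs fun p _ => ?_
    exact measurableSet_lt measurable_const ((hf _).sub measurable_const).abs
  refine measurable_of_isOpen fun O hO => ?_
  obtain ⟨u, hu⟩ := TopologicalSpace.exists_dense_seq (HolderSpace α (polyWeight κ))
  have hO' : O = ⋃ p : {p : ℕ × ℕ // Metric.closedBall (u p.1) (1 / (p.2 + 1 : ℝ)) ⊆ O},
      Metric.closedBall (u p.1.1) (1 / (p.1.2 + 1 : ℝ)) := by
    refine Subset.antisymm (fun T hT => ?_) (iUnion_subset fun p => p.2)
    obtain ⟨ε, hε, hεO⟩ := Metric.isOpen_iff.1 hO T hT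
    obtain ⟨k, hk⟩ := exists_nat_one_div_lt (half_pos hε)
    obtain ⟨j, hj⟩ := hu.exists_dist_lt T (show (0 : ℝ) < 1 / (k + 1) by positivity)
    refine mem_iUnion.2 ⟨⟨(j, k), fun S hS => hεO ?_⟩, Metric.mem_closedBall.2 hj.le⟩
    rw [Metric.mem_ball]
    have := dist_triangle S (u j) T
    rw [dist_comm (u j) T] at this
    have h3 := Metric.mem_closedBall.1 hS
    simp only at h3
    linarith
  rw [hO', preimage_iUnion]
  exact MeasurableSet.iUnion fun p => hball _ _ (by positivity)

lemma HolderSpace.measurable_eval (α : ℝ) {κ : ℝ} (hκ : 0 ≤ κ) (φ : Test) :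
    Measurable fun T : HolderSpace α (polyWeight κ) => T.toDistrib φ :=
  (HolderSpace.continuous_eval α hκ φ).measurable

/-- Finite measures on a space whose σ-algebra is generated by a family of real functions are
determined by the characteristic functions of the linear combinations of these functions. -/
theorem measure_ext_of_charFun {E ι : Type*} [mE : MeasurableSpace E] {X : ι → E → ℝ}
    (hX : ∀ i, Measurable (X i))
    (hgen : mE ≤ MeasurableSpace.comap (fun e i => X i e) MeasurableSpace.pi)
    {μ ν : Measure E} [IsFiniteMeasure μ] [IsFiniteMeasure ν]
    (h : ∀ (I : Finset ι) (c : I → ℝ), ∫ e, Complex.exp ((∑ j, c j * X j e : ℝ) * Complex.I) ∂μ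
      = ∫ e, Complex.exp ((∑ j, c j * X j e : ℝ) * Complex.I) ∂ν) : μ = ν := by
  classical
  let F : E → ι → ℝ := fun e i => X i e
  have hF : Measurable F := measurable_pi_lambda _ hX
  have hmap : μ.map F = ν.map F := by
    refine IsProjectiveLimit.unique (P := fun I : Finset ι => (μ.map F).map I.restrict)
      (fun I => rfl) fun I => ?_
    refine Measure.ext_of_charFunDual ?_
    ext L
    have hL : ∀ x : I → ℝ, L x = ∑ j, L (Pi.single j 1) * x j := by
      intro x
      conv_lhs => rw [← Finset.univ_sum_single x]
      rw [map_sum]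
      refine Finset.sum_congr rfl fun j _ => ?_
      have : Pi.single j (x j) = x j • (Pi.single j (1 : ℝ) : I → ℝ) := by
        rw [← Pi.single_smul, smul_eq_mul, mul_one]
      rw [this, map_smul, smul_eq_mul, mul_comm]
    have hmr : Measurable (I.restrict : (ι → ℝ) → (I → ℝ)) := Finset.measurable_restrict I
    have key : ∀ m : Measure E, charFunDual ((m.map F).map I.restrict) L
        = ∫ e, Complex.exp ((∑ j, L (Pi.single j 1) * X j e : ℝ) * Complex.I) ∂m := by
      intro m
      rw [charFunDual_apply, Measure.map_map hmr hF, integral_map (hmr.comp hF).aemeasurable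
        (by fun_prop)]
      congr 1 with e
      rw [hL]
      rfl
    rw [key, key]
    exact (h I fun j => L (Pi.single j 1)).symm
  ext s hs
  obtain ⟨t, ht, rfl⟩ := hgen s hs
  rw [← Measure.map_apply hF ht, ← Measure.map_apply hF ht, hmap]

/-- The identity map, with the σ-algebra generated by the evaluations on its source, is measurable
by `HolderSpace.measurable_of_eval`. -/
lemma HolderSpace.measurableSpace_le {α κ : ℝ} (hα : α ≤ 0) (hκ : 0 ≤ κ) :
    (inferInstance : MeasurableSpace (HolderSpace α (polyWeight κ)))
      ≤ MeasurableSpace.comap (fun T (φ : Test) => T.toDistrib φ) MeasurableSpace.pi := by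
  have h := @HolderSpace.measurable_of_eval α κ hα hκ (HolderSpace α (polyWeight κ))
    (MeasurableSpace.comap (fun T (φ : Test) => T.toDistrib φ) MeasurableSpace.pi) id
    (fun φ => @Measurable.comp _ _ _ (_) _ _ _ _ (measurable_pi_apply φ) (comap_measurable _))
  intro s hs
  exact h hs

/-- A linear combination of evaluations is the evaluation at the corresponding combination of test
functions, so a single test function suffices in the characteristic function. -/
theorem HolderSpace.measure_ext {α κ : ℝ} (hα : α ≤ 0) (hκ : 0 ≤ κ)
    {μ ν : Measure (HolderSpace α (polyWeight κ))} [IsFiniteMeasure μ] [IsFiniteMeasure ν]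
    (h : ∀ φ : Test, ∫ T, Complex.exp ((T.toDistrib φ : ℝ) * Complex.I) ∂μ
      = ∫ T, Complex.exp ((T.toDistrib φ : ℝ) * Complex.I) ∂ν) : μ = ν := by
  refine measure_ext_of_charFun (fun φ => HolderSpace.measurable_eval α hκ φ)
    (HolderSpace.measurableSpace_le hα hκ) fun I c => ?_
  convert h (∑ j, c j • (j : Test)) using 6 <;> simp

theorem HolderSpace.measure_prod_ext {α κ : ℝ} (hα : α ≤ 0) (hκ : 0 ≤ κ)
    {μ ν : Measure (HolderSpace α (polyWeight κ) × HolderSpace α (polyWeight κ))}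
    [IsFiniteMeasure μ] [IsFiniteMeasure ν]
    (h : ∀ φ ψ : Test,
      ∫ T, Complex.exp ((T.1.toDistrib φ + T.2.toDistrib ψ : ℝ) * Complex.I) ∂μ
      = ∫ T, Complex.exp ((T.1.toDistrib φ + T.2.toDistrib ψ : ℝ) * Complex.I) ∂ν) : μ = ν := by
  let E := HolderSpace α (polyWeight κ)
  let X : Test ⊕ Test → E × E → ℝ := Sum.elim (fun φ T => T.1.toDistrib φ) fun φ T => T.2.toDistrib φ
  have hm := HolderSpace.measurable_eval α hκ
  refine measure_ext_of_charFun (X := X) ?_ ?_ fun I c => ?_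
  · rintro (φ | φ)
    · exact (hm φ).comp measurable_fst
    · exact (hm φ).comp measurable_snd
  · let m := MeasurableSpace.comap (fun (e : E × E) i => X i e) MeasurableSpace.pi
    have hX : ∀ i, @Measurable _ _ m _ (X i) := fun i =>
      @Measurable.comp _ _ _ m _ _ (fun f : Test ⊕ Test → ℝ => f i) (fun (e : E × E) i => X i e)
        (measurable_pi_apply i) (comap_measurable _)
    have h1 : @Measurable _ _ m _ (Prod.fst : E × E → E) :=
      @HolderSpace.measurable_of_eval α κ hα hκ (E × E) m Prod.fst fun φ => hX (Sum.inl φ)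
    have h2 : @Measurable _ _ m _ (Prod.snd : E × E → E) :=
      @HolderSpace.measurable_of_eval α κ hα hκ (E × E) m Prod.snd fun φ => hX (Sum.inr φ)
    exact sup_le h1.comap_le h2.comap_le
  · have key : ∀ T : E × E, (∑ j, c j * X j T : ℝ)
        = T.1.toDistrib (∑ j, c j • (Sum.elim id 0 (j : Test ⊕ Test) : Test))
          + T.2.toDistrib (∑ j, c j • (Sum.elim 0 id (j : Test ⊕ Test) : Test)) := by
      intro T
      rw [map_sum, map_sum, ← Finset.sum_add_distrib]
      refine Finset.sum_congr rfl fun j _ => ?_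
      rcases j with ⟨φ | φ, hj⟩ <;> simp [X]
    simp_rw [key]
    exact h _ _

/-- The limit of a sequence of distributions which is bounded for a weighted Hölder norm and
converges pointwise. -/
def limitDistrib {α κ : ℝ} (hκ : 0 ≤ κ) (u : ℕ → HolderSpace α (polyWeight κ)) {B : ℝ}
    (hB : ∀ n, ‖u n‖ ≤ B) (L : Test → ℝ)
    (hL : ∀ φ, Tendsto (fun n => (u n).toDistrib φ) atTop (𝓝 (L φ))) : Distrib :=
  TestFunction.limitCLM ℝ L
    (fun K _ => ContDiffMapSupportedIn.mkCLMtoNormedSpace ℝ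
      (fun f => L (TestFunction.ofSupportedIn (fun _ _ => trivial) f))
      (fun f g => tendsto_nhds_unique (hL _) (((hL _).add (hL _)).congr fun n => by
        rw [← map_add]; rfl))
      (fun c f => tendsto_nhds_unique (hL _) (((hL _).const_smul c).congr fun n => by
        rw [← map_smul]; rfl))
      (by
        obtain ⟨R, hR⟩ := K.isCompact.isBounded.subset_closedBall (0 : Plane)
        obtain ⟨C, hC0, hC⟩ := exists_abs_apply_le α hκ R
        have hB0 : 0 ≤ B := (norm_nonneg _).trans (hB 0)
        -- Continuity of the limit: all the `u n` are of order at most `⌈-α⌉` on `K`, with a common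
        -- constant, and the bound passes to the pointwise limit.
        refine ⟨Finset.range (⌈-α⌉₊ + 1), C * B, by positivity, fun f => ?_⟩
        refine le_of_tendsto (hL _).norm (Eventually.of_forall fun n => ?_)
        have h := hC (u n).toDistrib (u n).mem.1
          (TestFunction.ofSupportedIn (fun _ _ => trivial) f) 0
          (((Finset.range (⌈-α⌉₊ + 1)).sup
            fun i => ContDiffMapSupportedIn.seminorm ℝ Plane ℝ ⊤ K i) f) (apply_nonneg _ _)
          (f.tsupport_subset.trans hR) (fun k hk y =>
            (ContDiffMapSupportedIn.norm_iteratedFDeriv_apply_le_seminorm_top ℝ).trans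
              (Seminorm.le_finset_sup_apply (Finset.mem_range.2 (by omega))))
        have hw : polyWeight κ (0 : Plane) = 1 := by simp [polyWeight]
        rw [hw, mul_one] at h
        refine h.trans ?_
        have h2 := hB n
        rw [HolderSpace.norm_def] at h2
        calc _ ≤ C * ((Finset.range (⌈-α⌉₊ + 1)).sup
              fun i => ContDiffMapSupportedIn.seminorm ℝ Plane ℝ ⊤ K i) f * B :=
              mul_le_mul_of_nonneg_left h2 (mul_nonneg hC0 (apply_nonneg _ _))
          _ = _ := by ring))
    (fun _ _ _ => rfl)
theorem completeSpace_holderSpace (α : ℝ) {κ : ℝ} (hκ : 0 ≤ κ) :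
    CompleteSpace (HolderSpace α (polyWeight κ)) := by
  refine UniformSpace.complete_of_cauchySeq_tendsto fun u hu => ?_
  have hlim : ∀ φ : Test, ∃ x, Tendsto (fun n => (u n).toDistrib φ) atTop (𝓝 x) := by
    intro φ
    refine cauchySeq_tendsto_of_complete ?_
    obtain ⟨C, hC0, hC⟩ := HolderSpace.exists_abs_eval_le α hκ φ
    rw [Metric.cauchySeq_iff'] at hu ⊢
    intro ε hε
    obtain ⟨N, hN⟩ := hu (ε / (C + 1)) (by positivity)
    refine ⟨N, fun n hn => ?_⟩
    have h1 := hC (u n - u N)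
    rw [HolderSpace.toDistrib_sub] at h1
    have h2 := hN n hn
    rw [dist_eq_norm, lt_div_iff₀ (by positivity)] at h2
    rw [Real.dist_eq]
    refine lt_of_le_of_lt h1 ?_
    nlinarith [norm_nonneg (u n - u N)]
  choose L hL using hlim
  obtain ⟨B, hB⟩ := hu.isBounded_range.exists_norm_le
  have hB' : ∀ n, ‖u n‖ ≤ B := fun n => hB _ ⟨n, rfl⟩
  set T := limitDistrib hκ u hB' L hL with hT
  -- As a supremum of evaluations, the norm is lower semicontinuous under pointwise convergence, so
  -- the Cauchy estimate survives when the first index tends to infinity.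
  have hconv : ∀ ε : ℝ, 0 < ε → ∃ N, ∀ n ≥ N,
      holderNorm α (polyWeight κ) (T - (u n).toDistrib) ≤ ENNReal.ofReal ε := by
    intro ε hε
    obtain ⟨N, hN⟩ := Metric.cauchySeq_iff.1 hu ε hε
    refine ⟨N, fun n hn => ?_⟩
    refine iSup_le fun x => iSup₂_le fun l hl => iSup₂_le fun φ hφ => ?_
    refine ENNReal.ofReal_le_ofReal ?_
    have ht : Tendsto (fun m => |((u m).toDistrib - (u n).toDistrib) (rescale φ l x)| /
        (polyWeight κ x * l ^ α)) atTop
        (𝓝 (|(T - (u n).toDistrib) (rescale φ l x)| / (polyWeight κ x * l ^ α))) :=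
      (((hL (rescale φ l x)).sub_const _).abs).div_const _
    refine le_of_tendsto ht ?_
    filter_upwards [eventually_ge_atTop N] with m hm
    have h1 := le_holderNorm (w := polyWeight κ) ((u m - u n).toDistrib) hφ hl x
    rw [ENNReal.ofReal_le_iff_le_toReal (u m - u n).mem.1.ne, HolderSpace.toDistrib_sub] at h1
    refine h1.trans ?_
    have h2 := hN m hm n hn
    rw [dist_eq_norm, HolderSpace.norm_def, HolderSpace.toDistrib_sub] at h2
    exact h2.le
  have hmem : T ∈ holderSubgroup α (polyWeight κ) := by
    constructor
    · obtain ⟨N, hN⟩ := hconv 1 one_pos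
      have e : T = (T - (u N).toDistrib) + (u N).toDistrib := by abel
      rw [e]
      exact (holderNorm_add_le _ _ _ _).trans_lt (ENNReal.add_lt_top.2
        ⟨(hN N le_rfl).trans_lt ENNReal.ofReal_lt_top, (u N).mem.1⟩)
    · intro δ hδ
      obtain ⟨ε, hε, hεδ⟩ : ∃ ε : ℝ, 0 < ε ∧ ENNReal.ofReal ε ≤ δ / 2 := by
        have h2 : δ / 2 ≠ 0 := (ENNReal.half_pos hδ.ne').ne'
        rcases eq_or_ne (δ / 2) ∞ with h | h
        · exact ⟨1, one_pos, h ▸ le_top⟩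
        · exact ⟨(δ / 2).toReal, ENNReal.toReal_pos h2 h, (ENNReal.ofReal_toReal h).le⟩
      obtain ⟨N, hN⟩ := hconv ε hε
      obtain ⟨g, hg⟩ := (u N).mem.2 (δ / 2) (ENNReal.half_pos hδ.ne')
      refine ⟨g, ?_⟩
      have e : T - ofFun g = (T - (u N).toDistrib) + ((u N).toDistrib - ofFun g) := by abel
      rw [e]
      refine (holderNorm_add_le _ _ _ _).trans_lt ?_
      calc _ < δ / 2 + δ / 2 := ENNReal.add_lt_add_of_le_of_lt
            ((hN N le_rfl).trans_lt ENNReal.ofReal_lt_top).ne ((hN N le_rfl).trans hεδ) hg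
        _ = δ := ENNReal.add_halves δ
  refine ⟨⟨T, hmem⟩, Metric.tendsto_atTop.2 fun ε hε => ?_⟩
  obtain ⟨N, hN⟩ := hconv (ε / 2) (by positivity)
  refine ⟨N, fun n hn => ?_⟩
  rw [dist_comm, dist_eq_norm]
  refine norm_mk_lt ?_
  rw [HolderSpace.toDistrib_sub]
  exact (hN n hn).trans_lt ((ENNReal.ofReal_lt_ofReal_iff hε).2 (by linarith))

end Anderson
end

noncomputable section
namespace Anderson

/-! ### White noise: moments, rotation invariance and quasi-invariance under shifts -/

lemma Test.integrable_mul (φ ψ : Test) : Integrable fun x => φ x * ψ x :=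
  (φ.continuous.mul ψ.continuous).integrable_of_hasCompactSupport (φ.hasCompactSupport.mul_right)

/-- The `L²` scalar product of two test functions. -/
def l2inner (φ ψ : Test) : ℝ := ∫ x, φ x * ψ x

lemma l2inner_comm (φ ψ : Test) : l2inner φ ψ = l2inner ψ φ := by
  simp only [l2inner, mul_comm]

lemma l2inner_add_left (φ φ' ψ : Test) : l2inner (φ + φ') ψ = l2inner φ ψ + l2inner φ' ψ := by
  rw [l2inner, l2inner, l2inner, ← integral_add (φ.integrable_mul ψ) (φ'.integrable_mul ψ)]
  congr 1 with x
  exact add_mul (φ x) (φ' x) (ψ x)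

lemma l2inner_smul_left (c : ℝ) (φ ψ : Test) : l2inner (c • φ) ψ = c * l2inner φ ψ := by
  rw [l2inner, l2inner, ← integral_const_mul]
  congr 1 with x
  exact mul_assoc c (φ x) (ψ x)

lemma l2inner_sub_left (φ φ' ψ : Test) : l2inner (φ - φ') ψ = l2inner φ ψ - l2inner φ' ψ := by
  have e : φ - φ' = φ + (-1 : ℝ) • φ' := by module
  rw [e, l2inner_add_left, l2inner_smul_left]
  ring

lemma l2inner_add_right (φ ψ ψ' : Test) : l2inner φ (ψ + ψ') = l2inner φ ψ + l2inner φ ψ' := by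
  rw [l2inner_comm, l2inner_add_left, l2inner_comm ψ, l2inner_comm ψ']

lemma l2inner_sub_right (φ ψ ψ' : Test) : l2inner φ (ψ - ψ') = l2inner φ ψ - l2inner φ ψ' := by
  rw [l2inner_comm, l2inner_sub_left, l2inner_comm ψ, l2inner_comm ψ']

lemma l2inner_smul_right (c : ℝ) (φ ψ : Test) : l2inner φ (c • ψ) = c * l2inner φ ψ := by
  rw [l2inner_comm, l2inner_smul_left, l2inner_comm]

lemma l2inner_self_nonneg (φ : Test) : 0 ≤ l2inner φ φ :=
  integral_nonneg fun x => mul_self_nonneg (φ x)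

lemma eq_zero_of_l2inner_self {φ : Test} (h : l2inner φ φ = 0) : φ = 0 := by
  have h1 := (integral_eq_zero_iff_of_nonneg (fun x => mul_self_nonneg (φ x))
    (φ.integrable_mul φ)).1 h
  have h2 := (Continuous.ae_eq_iff_eq volume (φ.continuous.mul φ.continuous)
    continuous_zero).1 h1
  ext x
  exact mul_self_eq_zero.1 (congrFun h2 x)

namespace IsWhiteNoise

variable {κ b : ℝ} {P : Measure (Noise κ b)}

lemma hasLaw' (hP : IsWhiteNoise P) (φ : Test) : HasLaw (fun ξ : Noise κ b => ξ.toDistrib φ)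
    (gaussianReal 0 (l2inner φ φ).toNNReal) P := by
  have := hP.hasLaw φ
  simp_rw [sq] at this
  exact this

lemma integral_exp (hP : IsWhiteNoise P) (φ : Test) :
    ∫ ξ : Noise κ b, Complex.exp ((ξ.toDistrib φ : ℝ) * Complex.I) ∂P
      = Complex.exp (-(l2inner φ φ : ℝ) / 2) := by
  have h := (hP.hasLaw' φ).integral_comp (f := fun x : ℝ => Complex.exp ((x : ℂ) * Complex.I))
    (by fun_prop)
  have h2 := charFun_gaussianReal (μ := 0) (v := (l2inner φ φ).toNNReal) 1
  rw [charFun_apply_real] at h2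
  simp only [Complex.ofReal_one, one_mul, Function.comp_def] at h2 h
  rw [h, h2]
  congr 1
  rw [Real.coe_toNNReal _ (l2inner_self_nonneg φ)]
  push_cast
  ring

/-- The absolute moment of order `p` of a standard Gaussian variable. -/
def gaussMoment (p : ℝ) : ℝ≥0∞ := ∫⁻ x : ℝ, ‖x‖ₑ ^ p ∂(gaussianReal 0 1)

lemma gaussMoment_lt_top {p : ℝ} (hp : 0 < p) : gaussMoment p < ∞ := by
  have h := (memLp_id_gaussianReal (μ := 0) (v := 1) p.toNNReal).2
  rw [eLpNorm_lt_top_iff_lintegral_rpow_enorm_lt_top (by simpa using hp) (by simp)] at h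
  simpa [gaussMoment, Real.coe_toNNReal p hp.le] using h

/-- A centred Gaussian variable is a multiple of a standard one. All higher moments below ultimately
come from this scaling. -/
lemma lintegral_rpow (hP : IsWhiteNoise P) (φ : Test) {p : ℝ} (hp : 0 < p) :
    ∫⁻ ξ : Noise κ b, ‖ξ.toDistrib φ‖ₑ ^ p ∂P
      = gaussMoment p * ENNReal.ofReal (l2inner φ φ) ^ (p / 2) := by
  have h := (hP.hasLaw' φ).lintegral_comp (f := fun x : ℝ => ‖x‖ₑ ^ p) (by fun_prop)
  rw [h]
  set v := l2inner φ φ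
  have hv : 0 ≤ v := l2inner_self_nonneg φ
  have e : gaussianReal 0 v.toNNReal = (gaussianReal 0 1).map (fun x => √v * x) := by
    rw [gaussianReal_map_const_mul]
    congr 1
    · simp
    · ext
      simp [Real.sq_sqrt hv, Real.coe_toNNReal _ hv]
  rw [e, lintegral_map (by fun_prop) (by fun_prop)]
  simp_rw [enorm_mul, ENNReal.mul_rpow_of_nonneg _ _ hp.le]
  rw [lintegral_const_mul _ (by fun_prop), mul_comm, gaussMoment]
  congr 1
  rw [Real.enorm_eq_ofReal (Real.sqrt_nonneg v), Real.sqrt_eq_rpow,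
    ← ENNReal.ofReal_rpow_of_nonneg hv (by norm_num), ← ENNReal.rpow_mul]
  congr 1
  ring

lemma memLp_eval (hP : IsWhiteNoise P) (φ : Test) {p : ℝ≥0∞} (hp : p ≠ ∞) :
    MemLp (fun ξ : Noise κ b => ξ.toDistrib φ) p P := by
  have h := memLp_id_gaussianReal' (μ := 0) (v := (l2inner φ φ).toNNReal) p hp
  rw [← (hP.hasLaw' φ).map_eq, memLp_map_measure_iff (by fun_prop) (hP.hasLaw' φ).aemeasurable] at h
  exact h

lemma integral_sq (hP : IsWhiteNoise P) (φ : Test) :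
    ∫ ξ : Noise κ b, ξ.toDistrib φ ^ 2 ∂P = l2inner φ φ := by
  have h := (hP.hasLaw' φ).integral_comp (f := fun x : ℝ => x ^ 2) (by fun_prop)
  simp only [Function.comp_def] at h
  rw [h]
  have h2 := variance_fun_id_gaussianReal (μ := 0) (v := (l2inner φ φ).toNNReal)
  rw [variance_of_integral_eq_zero (by fun_prop) (by simp)] at h2
  rw [h2, Real.coe_toNNReal _ (l2inner_self_nonneg φ)]

lemma integrable_mul (hP : IsWhiteNoise P) (φ ψ : Test) :
    Integrable (fun ξ : Noise κ b => ξ.toDistrib φ * ξ.toDistrib ψ) P :=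
  (hP.memLp_eval φ (p := 2) (by simp)).integrable_mul (hP.memLp_eval ψ (p := 2) (by simp))

/-- Polarisation of the variance, which is the only information on second moments in `IsWhiteNoise`.
-/
lemma integral_mul (hP : IsWhiteNoise P) (φ ψ : Test) :
    ∫ ξ : Noise κ b, ξ.toDistrib φ * ξ.toDistrib ψ ∂P = l2inner φ ψ := by
  have h1 := hP.integral_sq (φ + ψ)
  have h2 := hP.integral_sq φ
  have h3 := hP.integral_sq ψ
  have e : ∀ ξ : Noise κ b, ξ.toDistrib (φ + ψ) ^ 2 = ξ.toDistrib φ ^ 2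
      + (2 * (ξ.toDistrib φ * ξ.toDistrib ψ) + ξ.toDistrib ψ ^ 2) := by
    intro ξ
    rw [map_add]
    ring
  simp_rw [e] at h1
  have i2 : ∀ χ : Test, Integrable (fun ξ : Noise κ b => ξ.toDistrib χ ^ 2) P := fun χ => by
    simpa [sq] using hP.integrable_mul χ χ
  have i3 : Integrable (fun ξ : Noise κ b =>
      2 * (ξ.toDistrib φ * ξ.toDistrib ψ) + ξ.toDistrib ψ ^ 2) P :=
    ((hP.integrable_mul φ ψ).const_mul 2).add (i2 ψ)
  rw [integral_add (i2 φ) i3,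
    integral_add ((hP.integrable_mul φ ψ).const_mul 2) (i2 ψ), integral_const_mul, h2, h3,
    l2inner_add_left, l2inner_add_right, l2inner_add_right, l2inner_comm ψ φ] at h1
  linarith

/-- The rotation of angle `π/4` of a pair of noises. -/
def rotate (p : Noise κ b × Noise κ b) : Noise κ b × Noise κ b :=
  (HolderSpace.scale (√2)⁻¹ (p.1 - p.2), HolderSpace.scale (√2)⁻¹ (p.1 + p.2))

lemma rotate_fst_apply (p : Noise κ b × Noise κ b) (φ : Test) :
    (rotate p).1.toDistrib φ = (√2)⁻¹ * (p.1.toDistrib φ - p.2.toDistrib φ) := by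
  simp only [rotate, HolderSpace.toDistrib_scale, HolderSpace.toDistrib_sub]
  rfl

lemma rotate_snd_apply (p : Noise κ b × Noise κ b) (φ : Test) :
    (rotate p).2.toDistrib φ = (√2)⁻¹ * (p.1.toDistrib φ + p.2.toDistrib φ) := rfl

lemma measurable_rotate (hκ : 0 ≤ κ) (hb : 0 ≤ b) :
    Measurable (rotate : Noise κ b × Noise κ b → Noise κ b × Noise κ b) := by
  have hm := HolderSpace.measurable_eval (-1 - κ) hb
  refine Measurable.prodMk ?_ ?_
  · refine HolderSpace.measurable_of_eval (by linarith) hb fun φ => ?_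
    have h := (((hm φ).comp measurable_fst).sub ((hm φ).comp measurable_snd)).const_mul (√2)⁻¹
    have e : (fun p : Noise κ b × Noise κ b =>
        (HolderSpace.scale (√2)⁻¹ (p.1 - p.2)).toDistrib φ)
        = fun p => (√2)⁻¹ * (p.1.toDistrib φ - p.2.toDistrib φ) :=
      funext fun p => rotate_fst_apply p φ
    rw [e]
    exact h
  · refine HolderSpace.measurable_of_eval (by linarith) hb fun φ => ?_
    exact (((hm φ).comp measurable_fst).add ((hm φ).comp measurable_snd)).const_mul (√2)⁻¹

/-- Rotation invariance of a pair of independent white noises. -/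
theorem map_rotate (hP : IsWhiteNoise P) (hκ : 0 ≤ κ) (hb : 0 ≤ b) :
    (P.prod P).map rotate = P.prod P := by
  have := hP.isProbabilityMeasure
  have hrm := measurable_rotate (κ := κ) (b := b) hκ hb
  have hm := HolderSpace.measurable_eval (-1 - κ) hb
  -- By independence the joint characteristic function depends only on `‖φ‖² + ‖ψ‖²`, a quantity
  -- preserved by the transposed rotation acting on the pair `(φ, ψ)`.
  have key : ∀ φ ψ : Test,
      ∫ p : Noise κ b × Noise κ b,
        Complex.exp ((p.1.toDistrib φ + p.2.toDistrib ψ : ℝ) * Complex.I) ∂(P.prod P)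
      = Complex.exp (-(l2inner φ φ + l2inner ψ ψ : ℝ) / 2) := by
    intro φ ψ
    have e : ∀ p : Noise κ b × Noise κ b,
        Complex.exp ((p.1.toDistrib φ + p.2.toDistrib ψ : ℝ) * Complex.I)
        = Complex.exp ((p.1.toDistrib φ : ℝ) * Complex.I)
          * Complex.exp ((p.2.toDistrib ψ : ℝ) * Complex.I) := by
      intro p
      rw [← Complex.exp_add]
      congr 1
      push_cast
      ring
    simp_rw [e]
    rw [integral_prod_mul (fun ξ : Noise κ b => Complex.exp ((ξ.toDistrib φ : ℝ) * Complex.I))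
      (fun ξ : Noise κ b => Complex.exp ((ξ.toDistrib ψ : ℝ) * Complex.I)), hP.integral_exp,
      hP.integral_exp, ← Complex.exp_add]
    congr 1
    push_cast
    ring
  have : IsProbabilityMeasure ((P.prod P).map rotate) :=
    Measure.isProbabilityMeasure_map hrm.aemeasurable
  refine HolderSpace.measure_prod_ext (by linarith) hb fun φ ψ => ?_
  have hmeas : Measurable fun p : Noise κ b × Noise κ b =>
      Complex.exp ((p.1.toDistrib φ + p.2.toDistrib ψ : ℝ) * Complex.I) := by
    have h1 : Measurable fun p : Noise κ b × Noise κ b => p.1.toDistrib φ :=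
      (hm φ).comp measurable_fst
    have h2 : Measurable fun p : Noise κ b × Noise κ b => p.2.toDistrib ψ :=
      (hm ψ).comp measurable_snd
    fun_prop
  rw [integral_map hrm.aemeasurable hmeas.aestronglyMeasurable, key]
  have e : ∀ p : Noise κ b × Noise κ b,
      (rotate p).1.toDistrib φ + (rotate p).2.toDistrib ψ
      = p.1.toDistrib ((√2)⁻¹ • (φ + ψ)) + p.2.toDistrib ((√2)⁻¹ • (ψ - φ)) := by
    intro p
    rw [rotate_fst_apply, rotate_snd_apply, map_smul, map_smul, map_add, map_sub]
    simp only [smul_eq_mul]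
    ring
  simp_rw [e]
  rw [key]
  suffices hs : l2inner ((√2)⁻¹ • (φ + ψ)) ((√2)⁻¹ • (φ + ψ))
      + l2inner ((√2)⁻¹ • (ψ - φ)) ((√2)⁻¹ • (ψ - φ)) = l2inner φ φ + l2inner ψ ψ by
    rw [hs]
  rw [l2inner_smul_left, l2inner_smul_right, l2inner_smul_left, l2inner_smul_right,
    l2inner_add_left, l2inner_add_right, l2inner_add_right, l2inner_sub_left, l2inner_sub_right,
    l2inner_sub_right, l2inner_comm ψ φ]
  have h2 : (√2)⁻¹ * (√2)⁻¹ = (1 : ℝ) / 2 := by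
    rw [← mul_inv, Real.mul_self_sqrt zero_le_two]; norm_num
  linear_combination (2 * l2inner φ φ + 2 * l2inner ψ ψ) * h2

/-- The law of white noise shifted by a test function is absolutely continuous with respect to the
law of white noise. -/
theorem map_add_absolutelyContinuous (hP : IsWhiteNoise P) (hκ : 0 ≤ κ) (hb : 0 ≤ b)
    {f : Test} {h : Noise κ b} (hf : h.toDistrib = ofFun f) :
    P.map (fun ξ => ξ + h) ≪ P := by
  have := hP.isProbabilityMeasure
  have hm := HolderSpace.measurable_eval (-1 - κ) hb
  have hα : -1 - κ ≤ 0 := by linarith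
  have hh : ∀ φ : Test, h.toDistrib φ = l2inner f φ := fun φ => by
    rw [hf, ofFun_apply f.continuous.locallyIntegrable, l2inner]
    simp_rw [mul_comm]
  rcases eq_or_ne f 0 with rfl | hf0
  · have : (fun ξ : Noise κ b => ξ + h) = id := by
      ext1 ξ
      have e : (ξ + h).toDistrib = ξ.toDistrib := by
        ext φ
        have h0 : l2inner 0 φ = 0 := by simp [l2inner]
        have := hh φ
        rw [h0] at this
        rw [HolderSpace.toDistrib_add]
        change ξ.toDistrib φ + h.toDistrib φ = _
        rw [this, add_zero]
      change ξ + h = ξ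
      cases ξ
      cases hx : (_ + h : Noise κ b)
      rw [hx] at e
      simp only at e
      subst e
      rfl
    rw [this, Measure.map_id]
  set v := l2inner f f with hv
  have hvpos : 0 < v := lt_of_le_of_ne (l2inner_self_nonneg f)
    fun h => hf0 (eq_zero_of_l2inner_self h.symm)
  -- `F` replaces the coefficient `ξ(f) / v` of the noise along `f` by an independent variable `x`.
  -- This coefficient has variance `v / v² = v⁻¹`, which is the variance chosen for `x` below.
  let F : ℝ × Noise κ b → Noise κ b := fun p =>
    p.2 + HolderSpace.scale (p.1 - v⁻¹ * p.2.toDistrib f) h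
  have hFe : ∀ p φ, (F p).toDistrib φ
      = p.2.toDistrib φ + (p.1 - v⁻¹ * p.2.toDistrib f) * l2inner f φ := by
    intro p φ
    rw [← hh]
    rfl
  have hFm : Measurable F := by
    refine HolderSpace.measurable_of_eval hα hb fun φ => ?_
    simp_rw [hFe]
    have h1 : ∀ φ, Measurable fun p : ℝ × Noise κ b => p.2.toDistrib φ := fun φ =>
      (hm φ).comp measurable_snd
    exact (h1 φ).add ((measurable_fst.sub ((h1 f).const_mul _)).mul_const _)
  have hvn : v⁻¹.toNNReal ≠ 0 := by simpa using hvpos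
  -- Resampling the coefficient along `f` does not change the law: the Gaussian exponents of the
  -- component along `f` and of the orthogonal remainder add up to `‖φ‖² / 2`.
  have hrep : ((gaussianReal 0 v⁻¹.toNNReal).prod P).map F = P := by
    have : IsProbabilityMeasure (((gaussianReal 0 v⁻¹.toNNReal).prod P).map F) :=
      Measure.isProbabilityMeasure_map hFm.aemeasurable
    refine HolderSpace.measure_ext hα hb fun φ => ?_
    have hmeas : Measurable fun ξ : Noise κ b =>
        Complex.exp ((ξ.toDistrib φ : ℝ) * Complex.I) := by
      have := hm φ
      fun_prop
    rw [integral_map hFm.aemeasurable hmeas.aestronglyMeasurable, hP.integral_exp]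
    have e : ∀ p : ℝ × Noise κ b, Complex.exp (((F p).toDistrib φ : ℝ) * Complex.I)
        = Complex.exp ((l2inner f φ : ℝ) * (p.1 : ℝ) * Complex.I)
          * Complex.exp ((p.2.toDistrib (φ - (v⁻¹ * l2inner f φ) • f) : ℝ) * Complex.I) := by
      intro p
      rw [← Complex.exp_add, hFe, map_sub, map_smul]
      congr 1
      simp only [smul_eq_mul]
      push_cast
      ring
    simp_rw [e]
    rw [integral_prod_mul (fun x : ℝ => Complex.exp ((l2inner f φ : ℝ) * (x : ℝ) * Complex.I))
      (fun ξ : Noise κ b =>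
        Complex.exp ((ξ.toDistrib (φ - (v⁻¹ * l2inner f φ) • f) : ℝ) * Complex.I)),
      hP.integral_exp, ← charFun_apply_real, charFun_gaussianReal, ← Complex.exp_add]
    congr 1
    rw [Real.coe_toNNReal _ (by positivity), l2inner_sub_left, l2inner_sub_right, l2inner_sub_right,
      l2inner_smul_left, l2inner_smul_right, l2inner_smul_right, l2inner_smul_left,
      l2inner_comm φ f, ← hv]
    have hvc : (v : ℂ) ≠ 0 := by exact_mod_cast hvpos.ne'
    push_cast
    field_simp
    ring
  -- In this representation, adding `h` amounts to adding one to `x`. The claim is thus reduced to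
  -- the mutual absolute continuity of nondegenerate Gaussian measures on the line.
  have hshift : P.map (fun ξ => ξ + h) = ((gaussianReal 1 v⁻¹.toNNReal).prod P).map F := by
    have haddm : Measurable (fun ξ : Noise κ b => ξ + h) :=
      (continuous_id.add continuous_const).measurable
    have hg : gaussianReal 1 v⁻¹.toNNReal = (gaussianReal 0 v⁻¹.toNNReal).map (fun x => x + 1) := by
      rw [gaussianReal_map_add_const, zero_add]
    have hprod : ((gaussianReal 0 v⁻¹.toNNReal).map (fun x => x + 1)).prod P
        = ((gaussianReal 0 v⁻¹.toNNReal).prod P).map (Prod.map (fun x => x + 1) id) := by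
      rw [← Measure.map_prod_map _ _ (by fun_prop) measurable_id, Measure.map_id]
    conv_lhs => rw [← hrep]
    rw [hg, hprod, Measure.map_map haddm hFm, Measure.map_map hFm (by fun_prop)]
    congr 1
    ext1 p
    have e : ((fun ξ => ξ + h) ∘ F) p = (F ∘ Prod.map (fun x => x + 1) id) p := by
      have e1 : (F p + h).toDistrib = (F (p.1 + 1, p.2)).toDistrib := by
        ext φ
        rw [hFe, HolderSpace.toDistrib_add]
        change (F p).toDistrib φ + h.toDistrib φ = _
        rw [hFe, hh]
        ring
      change F p + h = F (p.1 + 1, p.2)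
      cases hx : F p + h
      cases hy : F (p.1 + 1, p.2)
      rw [hx, hy] at e1
      simp only at e1
      subst e1
      rfl
    exact e
  rw [hshift]
  conv_rhs => rw [← hrep]
  refine Measure.AbsolutelyContinuous.map ?_ hFm
  exact Measure.AbsolutelyContinuous.prod ((gaussianReal_absolutelyContinuous 1 hvn).trans
    (gaussianReal_absolutelyContinuous' 0 hvn)) Measure.AbsolutelyContinuous.rfl

end IsWhiteNoise

end Anderson
end

noncomputable section
namespace Anderson

/-! ### Moments of the second chaos -/

/-- A Minkowski-type inequality for functions of two variables whose moments are comparable in each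
variable separately. -/
theorem lintegral_lintegral_rpow_le {A B : Type*} [MeasurableSpace A] [MeasurableSpace B]
    {μ : Measure A} {ν : Measure B} [IsProbabilityMeasure μ] [SFinite ν] {F : A → B → ℝ≥0∞}
    (hF : Measurable (Function.uncurry F)) {q : ℝ} (hq : 1 < q) {c : ℝ≥0∞}
    (h1 : ∀ u, ∫⁻ v, F u v ^ q ∂ν ≤ c * (∫⁻ v, F u v ∂ν) ^ q)
    (h2 : ∀ v, ∫⁻ u, F u v ^ q ∂μ ≤ c * (∫⁻ u, F u v ∂μ) ^ q) :
    ∫⁻ u, ∫⁻ v, F u v ^ q ∂ν ∂μ ≤ c * (c * (∫⁻ u, ∫⁻ v, F u v ∂ν ∂μ) ^ q) := by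
  have hq0 : 0 < q := by linarith
  set h : A → ℝ≥0∞ := fun u => ∫⁻ v, F u v ∂ν with hh
  have hhm : Measurable h := hF.lintegral_prod_right'
  refine (lintegral_mono fun u => h1 u).trans ?_
  rw [lintegral_const_mul _ (hhm.pow_const q)]
  gcongr
  set K := c ^ (1 / q) * ∫⁻ u, h u ∂μ with hK
  have hcq : c * (∫⁻ u, h u ∂μ) ^ q = K ^ q := by
    rw [hK, ENNReal.mul_rpow_of_nonneg _ _ hq0.le, ← ENNReal.rpow_mul, one_div,
      inv_mul_cancel₀ hq0.ne', ENNReal.rpow_one]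
  rw [hcq]
  have hconj : q.HolderConjugate (q / (q - 1)) := Real.HolderConjugate.conjExponent hq
  -- Minkowski's integral inequality by duality against `h ^ (q - 1)`. The truncation at `n` makes
  -- `I` finite, which is needed to cancel `I ^ (1 - 1 / q)`; monotone convergence removes it at the
  -- end.
  have htr : ∀ n : ℕ, ∫⁻ u, (min (h u) n) ^ q ∂μ ≤ K ^ q := by
    intro n
    set hn : A → ℝ≥0∞ := fun u => min (h u) n with hhn
    have hnm : Measurable hn := hhm.min measurable_const
    set I := ∫⁻ u, hn u ^ q ∂μ with hI
    have hIfin : I ≠ ∞ := by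
      have : I ≤ ∫⁻ _, (n : ℝ≥0∞) ^ q ∂μ := lintegral_mono fun u => by
        gcongr
        exact min_le_right _ _
      rw [lintegral_const, measure_univ, mul_one] at this
      exact (this.trans_lt (ENNReal.rpow_lt_top_of_nonneg hq0.le (by simp))).ne
    -- One factor `h` is written as an integral over `v`; after exchanging the integrals, Hölder in
    -- `u` separates the weight `hn ^ (q - 1)` from `F`, to which the comparison `h2` applies.
    have step : I ≤ I ^ (1 - 1 / q) * K := by
      calc I ≤ ∫⁻ u, hn u ^ (q - 1) * h u ∂μ := lintegral_mono fun u => by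
            have e : hn u ^ q = hn u ^ (q - 1) * hn u := by
              conv_rhs => rw [← ENNReal.rpow_one (hn u), ← ENNReal.rpow_mul, one_mul]
              rw [← ENNReal.rpow_add_of_nonneg _ _ (by linarith) zero_le_one]
              congr 1; ring
            simp only
            rw [e]
            gcongr
            exact min_le_left _ _
        _ = ∫⁻ u, ∫⁻ v, hn u ^ (q - 1) * F u v ∂ν ∂μ := by
            congr 1 with u
            have hFu : Measurable fun v => F u v := hF.comp (measurable_const.prodMk measurable_id)
            rw [lintegral_const_mul _ hFu]
        _ = ∫⁻ v, ∫⁻ u, hn u ^ (q - 1) * F u v ∂μ ∂ν := by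
            rw [lintegral_lintegral_swap]
            exact (((hnm.pow_const _).comp measurable_fst).mul hF).aemeasurable
        _ ≤ ∫⁻ v, I ^ (1 - 1 / q) * (c ^ (1 / q) * ∫⁻ u, F u v ∂μ) ∂ν := lintegral_mono fun v => by
            have hFv : Measurable fun u => F u v := hF.comp (measurable_id.prodMk measurable_const)
            have hold := ENNReal.lintegral_mul_le_Lp_mul_Lq μ hconj.symm
              (f := fun u => hn u ^ (q - 1)) (g := fun u => F u v)
              (hnm.pow_const _).aemeasurable hFv.aemeasurable
            simp only [Pi.mul_apply] at hold
            refine hold.trans ?_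
            have e1 : ∀ u, (hn u ^ (q - 1)) ^ (q / (q - 1)) = hn u ^ q := by
              intro u
              rw [← ENNReal.rpow_mul]
              congr 1
              have : q - 1 ≠ 0 := by linarith
              field_simp
            simp_rw [e1]
            have e2 : 1 / (q / (q - 1)) = 1 - 1 / q := by
              field_simp
            rw [e2]
            gcongr
            calc (∫⁻ u, F u v ^ q ∂μ) ^ (1 / q) ≤ (c * (∫⁻ u, F u v ∂μ) ^ q) ^ (1 / q) := by
                  gcongr
                  exact h2 v
              _ = _ := by
                  rw [ENNReal.mul_rpow_of_nonneg _ _ (by positivity), ← ENNReal.rpow_mul,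
                    mul_one_div_cancel hq0.ne', ENNReal.rpow_one]
        _ = I ^ (1 - 1 / q) * K := by
            have hm : Measurable fun v => ∫⁻ u, F u v ∂μ := hF.lintegral_prod_left'
            rw [lintegral_const_mul _ (hm.const_mul _), lintegral_const_mul _ hm, hK,
              ← lintegral_lintegral_swap hF.aemeasurable]
    rcases eq_or_ne I 0 with h0 | h0
    · rw [h0]; exact zero_le
    have hsplit : I = I ^ (1 - 1 / q) * I ^ (1 / q) := by
      rw [← ENNReal.rpow_add _ _ h0 hIfin]
      simp
    have hlt : (1 : ℝ) / q < 1 := by rw [div_lt_one hq0]; exact hq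
    have hp0 : I ^ (1 - 1 / q) ≠ 0 := by
      rw [Ne, ENNReal.rpow_eq_zero_iff]
      rintro (⟨h, -⟩ | ⟨h, -⟩)
      · exact h0 h
      · exact hIfin h
    have hpt : I ^ (1 - 1 / q) ≠ ∞ := (ENNReal.rpow_lt_top_of_nonneg (by linarith) hIfin).ne
    have h3 : I ^ (1 / q) ≤ K := by
      have : I ^ (1 - 1 / q) * I ^ (1 / q) ≤ I ^ (1 - 1 / q) * K := by rwa [← hsplit]
      exact (ENNReal.mul_le_mul_iff_right hp0 hpt).1 this
    calc I = (I ^ (1 / q)) ^ q := by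
          rw [← ENNReal.rpow_mul, one_div, inv_mul_cancel₀ hq0.ne', ENNReal.rpow_one]
      _ ≤ K ^ q := by gcongr
  have hmono : Monotone fun (n : ℕ) (u : A) => (min (h u) n) ^ q := by
    intro n m hnm u
    dsimp only
    gcongr
  have hsup : ∀ u, h u ^ q = ⨆ n : ℕ, (min (h u) n) ^ q := by
    intro u
    refine le_antisymm ?_ (iSup_le fun n => by gcongr; exact min_le_left _ _)
    rcases eq_or_ne (h u) ∞ with hu | hu
    · rw [hu, ENNReal.top_rpow_of_pos hq0, top_le_iff]
      refine ENNReal.eq_top_of_forall_nnreal_le fun r => ?_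
      obtain ⟨n, hn⟩ := exists_nat_ge (max (r : ℝ≥0) 1)
      refine le_iSup_of_le n ?_
      rw [min_eq_right le_top]
      have hn1 : (1 : ℝ≥0∞) ≤ n := by exact_mod_cast (le_max_right _ _).trans hn
      have hnr : (r : ℝ≥0∞) ≤ n := by exact_mod_cast (le_max_left _ _).trans hn
      calc (r : ℝ≥0∞) ≤ (n : ℝ≥0∞) ^ (1 : ℝ) := by rwa [ENNReal.rpow_one]
        _ ≤ (n : ℝ≥0∞) ^ q := ENNReal.rpow_le_rpow_of_exponent_le hn1 hq.le
    · obtain ⟨n, hn⟩ := ENNReal.exists_nat_gt hu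
      refine le_iSup_of_le n ?_
      rw [min_eq_left hn.le]
  calc ∫⁻ u, h u ^ q ∂μ = ∫⁻ u, ⨆ n : ℕ, (min (h u) n) ^ q ∂μ := by simp_rw [hsup]
    _ = ⨆ n : ℕ, ∫⁻ u, (min (h u) n) ^ q ∂μ :=
        lintegral_iSup (fun n => (hhm.min measurable_const).pow_const q) hmono
    _ ≤ K ^ q := iSup_le htr

lemma rpow_lintegral_le {A : Type*} [MeasurableSpace A] {μ : Measure A} [IsProbabilityMeasure μ]
    {f : A → ℝ≥0∞} (hf : AEMeasurable f μ) {p : ℝ} (hp : 1 < p) :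
    (∫⁻ x, f x ∂μ) ^ p ≤ ∫⁻ x, f x ^ p ∂μ := by
  have h := ENNReal.lintegral_mul_le_Lp_mul_Lq μ (Real.HolderConjugate.conjExponent hp)
    hf (aemeasurable_const (b := (1 : ℝ≥0∞)))
  simp only [Pi.mul_apply, mul_one, ENNReal.one_rpow, lintegral_const, measure_univ] at h
  have hp0 : 0 < p := by linarith
  calc (∫⁻ x, f x ∂μ) ^ p ≤ ((∫⁻ x, f x ^ p ∂μ) ^ (1 / p)) ^ p := by gcongr
    _ = _ := by rw [← ENNReal.rpow_mul, one_div, inv_mul_cancel₀ hp0.ne', ENNReal.rpow_one]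

/-- The autocorrelation of a test function. -/
def corr (a : Test) (z : Plane) : ℝ := ∫ y, a y * a (y + z)

lemma l2inner_reflect (a : Test) (x x' : Plane) :
    l2inner (reflect a x) (reflect a x') = corr a (x' - x) := by
  rw [l2inner, corr]
  simp_rw [reflect_apply]
  have h := integral_sub_left_eq_self (fun y => a y * a (y + (x' - x))) (volume : Measure Plane) x
  rw [← h]
  congr 1 with y
  congr 2
  abel

lemma l2inner_reflect_same (a b : Test) (x : Plane) :
    l2inner (reflect a x) (reflect b x) = l2inner a b := by
  rw [l2inner, l2inner]
  exact integral_sub_left_eq_self (fun y => a y * b y) (volume : Measure Plane) x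

/-- Joint continuity in the noise and the point gives the joint measurability required by every use
of Fubini over noise and space. The variation in the noise is controlled locally uniformly in space
by `exists_abs_conv_le`. -/
lemma continuous_conv_uncurry (κ : ℝ) {b : ℝ} (hb : 0 ≤ b) (w : Test) :
    Continuous fun p : Noise κ b × Plane => conv p.1.toDistrib w p.2 := by
  obtain ⟨C, hC0, hC⟩ := exists_abs_conv_le (-1 - κ) hb w
  rw [continuous_iff_continuousAt]
  rintro ⟨ξ, x⟩
  have h1 : Tendsto (fun p : Noise κ b × Plane => conv (p.1 - ξ).toDistrib w p.2) (𝓝 (ξ, x))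
      (𝓝 0) := by
    refine squeeze_zero_norm (a := fun p => C * ‖p.1 - ξ‖ * polyWeight b p.2)
      (fun p => hC _ (p.1 - ξ).mem.1 p.2) ?_
    have : Continuous fun p : Noise κ b × Plane => C * ‖p.1 - ξ‖ * polyWeight b p.2 :=
      (continuous_const.mul (continuous_fst.sub continuous_const).norm).mul
        ((continuous_polyWeight b).comp continuous_snd)
    simpa using this.tendsto (ξ, x)
  have h2 : Tendsto (fun p : Noise κ b × Plane => conv ξ.toDistrib w p.2) (𝓝 (ξ, x))
      (𝓝 (conv ξ.toDistrib w x)) :=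
    ((continuous_conv hb ξ.mem w).comp continuous_snd).tendsto (ξ, x)
  have h3 := h1.add h2
  rw [zero_add] at h3
  refine h3.congr fun p => ?_
  rw [HolderSpace.toDistrib_sub, conv_sub_left, sub_add_cancel]

lemma abs_corr_le (a : Test) (z : Plane) : |corr a z| ≤ l2inner a a := by
  have h1 : Integrable fun y => a y ^ 2 := by simpa [sq] using a.integrable_mul a
  have h2 : Integrable fun y => a (y + z) ^ 2 := h1.comp_add_right z
  have h3 : ∫ y, a (y + z) ^ 2 = ∫ y, a y ^ 2 := integral_add_right_eq_self (fun y => a y ^ 2) z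
  have e : l2inner a a = ∫ y, (a y ^ 2 + a (y + z) ^ 2) / 2 := by
    rw [integral_div, integral_add h1 h2, h3, l2inner]
    simp_rw [sq]
    ring
  rw [e, corr, ← Real.norm_eq_abs]
  refine norm_integral_le_of_norm_le ((h1.add h2).div_const 2) (Eventually.of_forall fun y => ?_)
  rw [norm_mul, Real.norm_eq_abs, Real.norm_eq_abs]
  have : 0 ≤ (|a y| - |a (y + z)|) ^ 2 := sq_nonneg _
  nlinarith [sq_abs (a y), sq_abs (a (y + z))]

lemma continuous_corr (a : Test) : Continuous (corr a) := by
  have e : corr a = fun z => testConv (reflect a 0) a (-z) := by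
    ext z
    rw [Test.testConv_apply, corr]
    congr 1 with y
    rw [reflect_apply]
    congr 2
    abel
  rw [e]
  exact (testConv (reflect a 0) a).continuous.comp continuous_neg

/-- The bilinear functional `∫ ψ (u * a) (v * c)`. -/
def chaosForm (ψ a c : Test) (u v : Distrib) : ℝ := ∫ x, ψ x * (conv u a x * conv v c x)

lemma chaosForm_swap (ψ a c : Test) (u v : Distrib) :
    chaosForm ψ a c u v = chaosForm ψ c a v u := by
  simp only [chaosForm, mul_comm (conv u a _)]

section

variable {κ b : ℝ} {P : Measure (Noise κ b)}

/-- Fubini together with the covariance of white noise. The measure `μ` on pairs of points is left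
general in order to cover both the product measure, which yields variances, and the diagonal, which
yields the mean of the quadratic form. -/
lemma integral_mul_conv_conv (hP : IsWhiteNoise P) (hκ : 0 ≤ κ) (hb : 0 ≤ b) (a c : Test)
    {μ : Measure (Plane × Plane)} [SFinite μ] {F : Plane × Plane → ℝ} (hF : Integrable F μ) :
    Integrable (fun ξ : Noise κ b =>
      ∫ z, F z * (conv ξ.toDistrib a z.1 * conv ξ.toDistrib c z.2) ∂μ) P ∧
    ∫ ξ : Noise κ b, (∫ z, F z * (conv ξ.toDistrib a z.1 * conv ξ.toDistrib c z.2) ∂μ) ∂P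
      = ∫ z, F z * l2inner (reflect a z.1) (reflect c z.2) ∂μ := by
  have := hP.isProbabilityMeasure
  have := secondCountable_holderSpace (α := -1 - κ) (by linarith) hb
  have hint : Integrable (fun p : Noise κ b × Plane × Plane =>
      F p.2 * (conv p.1.toDistrib a p.2.1 * conv p.1.toDistrib c p.2.2)) (P.prod μ) := by
    have hcont : Continuous fun p : Noise κ b × Plane × Plane =>
        conv p.1.toDistrib a p.2.1 * conv p.1.toDistrib c p.2.2 :=
      ((continuous_conv_uncurry κ hb a).comp
        (continuous_fst.prodMk (continuous_fst.comp continuous_snd))).mul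
        ((continuous_conv_uncurry κ hb c).comp
        (continuous_fst.prodMk (continuous_snd.comp continuous_snd)))
    rw [integrable_prod_iff']
    · constructor
      · refine Eventually.of_forall fun z => ?_
        exact (hP.integrable_mul (reflect a z.1) (reflect c z.2)).const_mul (F z)
      · refine Integrable.mono' (hF.norm.mul_const ((l2inner a a + l2inner c c) / 2)) ?_
          (Eventually.of_forall fun z => ?_)
        · refine AEStronglyMeasurable.integral_prod_right' (f := fun p : (Plane × Plane) × Noise κ b =>
            ‖F p.1 * (conv p.2.toDistrib a p.1.1 * conv p.2.toDistrib c p.1.2)‖) ?_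
          refine AEStronglyMeasurable.norm ?_
          refine (hF.aestronglyMeasurable.comp_fst).mul ?_
          exact (hcont.comp continuous_swap).aestronglyMeasurable
        · rw [Real.norm_of_nonneg (integral_nonneg fun _ => norm_nonneg _)]
          simp_rw [norm_mul (F z)]
          rw [integral_const_mul]
          gcongr
          have i2 : ∀ χ : Test, Integrable (fun ξ : Noise κ b => ξ.toDistrib χ ^ 2) P := fun χ => by
            simpa [sq] using hP.integrable_mul χ χ
          calc ∫ ξ : Noise κ b, ‖conv ξ.toDistrib a z.1 * conv ξ.toDistrib c z.2‖ ∂P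
              ≤ ∫ ξ : Noise κ b, (ξ.toDistrib (reflect a z.1) ^ 2
                  + ξ.toDistrib (reflect c z.2) ^ 2) / 2 ∂P := by
                refine integral_mono (hP.integrable_mul _ _).norm
                  (((i2 _).add (i2 _)).div_const 2) fun ξ => ?_
                simp only [conv, norm_mul, Real.norm_eq_abs]
                nlinarith [sq_abs (ξ.toDistrib (reflect a z.1)),
                  sq_abs (ξ.toDistrib (reflect c z.2)),
                  sq_nonneg (|ξ.toDistrib (reflect a z.1)| - |ξ.toDistrib (reflect c z.2)|)]
            _ = (l2inner a a + l2inner c c) / 2 := by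
                rw [integral_div, integral_add (i2 _) (i2 _), hP.integral_sq, hP.integral_sq,
                  l2inner_reflect_same, l2inner_reflect_same]
    · exact (hF.aestronglyMeasurable.comp_snd).mul hcont.aestronglyMeasurable
  refine ⟨hint.integral_prod_left, ?_⟩
  rw [integral_integral_swap hint]
  congr 1 with z
  rw [integral_const_mul]
  congr 1
  exact hP.integral_mul (reflect a z.1) (reflect c z.2)

lemma hasCompactSupport_test_mul (ψ : Test) (F : Plane → ℝ) : HasCompactSupport fun x => ψ x * F x :=
  ψ.hasCompactSupport.mul_right

/-- For a fixed first argument, the form `∫ ψ (u * a) (v * c)` is the evaluation of `v` at a test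
function. -/
lemma exists_integral_mul_conv_eq {α : ℝ} (hb : 0 ≤ b) {f : Plane → ℝ} (hf : LocallyIntegrable f)
    (hc : HasCompactSupport f) (c : Test) : ∃ Φ : Test,
    ∀ v ∈ holderSubgroup α (polyWeight b), ∫ x, f x * conv v c x = v Φ := by
  have hf' : LocallyIntegrable fun y => f (-y) := by
    have hfi : Integrable f := by
      rw [← integrableOn_iff_integrable_of_support_subset (subset_tsupport f)]
      exact hf.integrableOn_isCompact hc
    exact hfi.comp_neg.locallyIntegrable
  have hc' : HasCompactSupport fun y => f (-y) := hc.comp_homeomorph (Homeomorph.neg Plane)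
  refine ⟨reflect (testConv c fun y => f (-y)) 0, fun v hv => ?_⟩
  have h := integral_mul_conv hb hv c hf' hc' 0
  rw [conv] at h
  rw [← h, ← integral_neg_eq_self]
  simp

lemma continuous_chaosForm_aux (ψ a : Test) {α : ℝ} (hb : 0 ≤ b) {u : Distrib}
    (hu : u ∈ holderSubgroup α (polyWeight b)) : Continuous fun x => ψ x * conv u a x :=
  ψ.continuous.mul (continuous_conv hb hu a)

/-- With `u` frozen, the form is thus one Gaussian variable in `v`, and its moments are powers of
its conditional variance. -/
lemma exists_chaosForm_eq (hb : 0 ≤ b) (ψ a c : Test) (u : Noise κ b) :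
    ∃ Φ : Test, ∀ v : Noise κ b, chaosForm ψ a c u.toDistrib v.toDistrib = v.toDistrib Φ := by
  have hcont := continuous_chaosForm_aux ψ a hb u.mem
  obtain ⟨Φ, hΦ⟩ := exists_integral_mul_conv_eq (α := -1 - κ) hb hcont.locallyIntegrable
    (hasCompactSupport_test_mul ψ _) c
  refine ⟨Φ, fun v => ?_⟩
  rw [← hΦ _ v.mem, chaosForm]
  simp_rw [mul_assoc]

lemma measurable_chaosForm (hκ : 0 ≤ κ) (hb : 0 ≤ b) (ψ a c : Test) :
    Measurable fun p : Noise κ b × Noise κ b =>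
      chaosForm ψ a c p.1.toDistrib p.2.toDistrib := by
  have := secondCountable_holderSpace (α := -1 - κ) (by linarith) hb
  have hcont : Continuous fun p : (Noise κ b × Noise κ b) × Plane =>
      ψ p.2 * (conv p.1.1.toDistrib a p.2 * conv p.1.2.toDistrib c p.2) :=
    (ψ.continuous.comp continuous_snd).mul
      (((continuous_conv_uncurry κ hb a).comp
        ((continuous_fst.comp continuous_fst).prodMk continuous_snd)).mul
      ((continuous_conv_uncurry κ hb c).comp
        ((continuous_snd.comp continuous_fst).prodMk continuous_snd)))
  exact (StronglyMeasurable.integral_prod_right' (ν := volume) hcont.stronglyMeasurable).measurable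

lemma lintegral_eval_two (hP : IsWhiteNoise P) (Φ : Test) :
    ∫⁻ v : Noise κ b, ‖v.toDistrib Φ‖ₑ ^ (2 : ℝ) ∂P = ENNReal.ofReal (l2inner Φ Φ) := by
  have h := hP.integral_sq Φ
  have i2 : Integrable (fun ξ : Noise κ b => ξ.toDistrib Φ ^ 2) P := by
    simpa [sq] using hP.integrable_mul Φ Φ
  rw [← h, ofReal_integral_eq_lintegral_ofReal i2 (Eventually.of_forall fun _ => sq_nonneg _)]
  congr 1 with v
  rw [Real.enorm_eq_ofReal_abs, ENNReal.rpow_two, ← ENNReal.ofReal_pow (abs_nonneg _), sq_abs]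

end

end Anderson
end

/-! ### Decoupling and moments of Wick products -/

noncomputable section
namespace Anderson

open IsWhiteNoise

section

variable {κ b : ℝ} {P : Measure (Noise κ b)}

/-- The variance of the form `∫ ψ (u * a) (v * c)` for independent white noises `u` and `v`. -/
def chaosVar (ψ : Test) (K : Plane → ℝ) : ℝ :=
  ∫ z : Plane × Plane, ψ z.1 * ψ z.2 * K (z.2 - z.1)

lemma sq_integral_eq {f : Plane → ℝ} :
    (∫ x, f x) ^ 2 = ∫ z : Plane × Plane, f z.1 * f z.2 := by
  rw [sq, Measure.volume_eq_prod, integral_prod_mul]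

lemma integrable_test_mul {f : Plane → ℝ} (ψ : Test) (hf : Continuous f) :
    Integrable fun x => ψ x * f x :=
  (ψ.continuous.mul hf).integrable_of_hasCompactSupport ψ.hasCompactSupport.mul_right

lemma integrable_test_mul_test (ψ : Test) {K : Plane → ℝ} (hK : Continuous K) {B : ℝ}
    (hB : ∀ z, |K z| ≤ B) :
    Integrable fun z : Plane × Plane => ψ z.1 * ψ z.2 * K (z.2 - z.1) := by
  have h1 : Integrable (ψ : Plane → ℝ) :=
    ψ.continuous.integrable_of_hasCompactSupport ψ.hasCompactSupport
  rw [Measure.volume_eq_prod]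
  refine Integrable.mul_bdd (c := B) (h1.mul_prod h1) ?_ ?_
  · exact (hK.comp (continuous_snd.sub continuous_fst)).aestronglyMeasurable
  · exact Eventually.of_forall fun z => hB _

/-- The square of an integral is a double integral, in which averaging over `v` replaces the product
of the two convolutions by the autocorrelation of `c`. -/
lemma integral_sq_chaosForm_right (hP : IsWhiteNoise P) (hκ : 0 ≤ κ) (hb : 0 ≤ b) (ψ a c : Test)
    (u : Noise κ b) :
    ∫⁻ v : Noise κ b, ‖chaosForm ψ a c u.toDistrib v.toDistrib‖ₑ ^ (2 : ℝ) ∂P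
      = ENNReal.ofReal (∫ z : Plane × Plane, ψ z.1 * ψ z.2 * corr c (z.2 - z.1) *
          (conv u.toDistrib a z.1 * conv u.toDistrib a z.2)) := by
  have hF : Integrable (fun z : Plane × Plane => (ψ z.1 * conv u.toDistrib a z.1) *
      (ψ z.2 * conv u.toDistrib a z.2)) := by
    have := integrable_test_mul ψ (continuous_conv hb u.mem a)
    rw [Measure.volume_eq_prod]
    exact this.mul_prod this
  obtain ⟨h1, h2⟩ := integral_mul_conv_conv hP hκ hb c c hF
  have e : ∀ v : Noise κ b, chaosForm ψ a c u.toDistrib v.toDistrib ^ 2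
      = ∫ z : Plane × Plane, (ψ z.1 * conv u.toDistrib a z.1) *
      (ψ z.2 * conv u.toDistrib a z.2) * (conv v.toDistrib c z.1 * conv v.toDistrib c z.2) := by
    intro v
    rw [chaosForm, sq_integral_eq]
    congr 1 with z
    ring
  have e2 : ∀ v : Noise κ b, ‖chaosForm ψ a c u.toDistrib v.toDistrib‖ₑ ^ (2 : ℝ)
      = ENNReal.ofReal (∫ z : Plane × Plane, (ψ z.1 * conv u.toDistrib a z.1) *
      (ψ z.2 * conv u.toDistrib a z.2) * (conv v.toDistrib c z.1 * conv v.toDistrib c z.2)) := by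
    intro v
    rw [← e, Real.enorm_eq_ofReal_abs, ENNReal.rpow_two, ← ENNReal.ofReal_pow (abs_nonneg _),
      sq_abs]
  simp_rw [e2]
  rw [← ofReal_integral_eq_lintegral_ofReal h1
    (Eventually.of_forall fun v => by beta_reduce; rw [← e]; exact sq_nonneg _), h2]
  congr 2 with z
  rw [l2inner_reflect]
  ring

lemma lintegral_sq_chaosForm (hP : IsWhiteNoise P) (hκ : 0 ≤ κ) (hb : 0 ≤ b) (ψ a c : Test) :
    ∫⁻ u : Noise κ b, ∫⁻ v : Noise κ b,
      ‖chaosForm ψ a c u.toDistrib v.toDistrib‖ₑ ^ (2 : ℝ) ∂P ∂P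
      = ENNReal.ofReal (chaosVar ψ fun z => corr a z * corr c z) := by
  simp_rw [integral_sq_chaosForm_right hP hκ hb]
  obtain ⟨h1, h2⟩ := integral_mul_conv_conv hP hκ hb a a
    (integrable_test_mul_test ψ (continuous_corr c) (abs_corr_le c))
  -- Nonnegativity matters because `ENNReal.ofReal` truncates. It is not visible on the integrand
  -- and comes from recognising the mean of a square.
  have hnn : ∀ u : Noise κ b, 0 ≤ ∫ z : Plane × Plane, ψ z.1 * ψ z.2 * corr c (z.2 - z.1) *
          (conv u.toDistrib a z.1 * conv u.toDistrib a z.2) := by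
    intro u
    have hF : Integrable (fun z : Plane × Plane => (ψ z.1 * conv u.toDistrib a z.1) *
        (ψ z.2 * conv u.toDistrib a z.2)) := by
      have := integrable_test_mul ψ (continuous_conv hb u.mem a)
      rw [Measure.volume_eq_prod]
      exact this.mul_prod this
    have h := (integral_mul_conv_conv hP hκ hb c c hF).2
    have e : ∫ z : Plane × Plane, ψ z.1 * ψ z.2 * corr c (z.2 - z.1) *
          (conv u.toDistrib a z.1 * conv u.toDistrib a z.2)
        = ∫ z : Plane × Plane, (ψ z.1 * conv u.toDistrib a z.1) *
        (ψ z.2 * conv u.toDistrib a z.2) * l2inner (reflect c z.1) (reflect c z.2) := by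
      congr 1 with z
      rw [l2inner_reflect]
      ring
    rw [e, ← h]
    refine integral_nonneg fun v => ?_
    have e' : ∫ z : Plane × Plane, (ψ z.1 * conv u.toDistrib a z.1) *
      (ψ z.2 * conv u.toDistrib a z.2) * (conv v.toDistrib c z.1 * conv v.toDistrib c z.2)
        = chaosForm ψ a c u.toDistrib v.toDistrib ^ 2 := by
      rw [chaosForm, sq_integral_eq]
      congr 1 with z
      ring
    beta_reduce
    rw [e']
    exact sq_nonneg _
  rw [← ofReal_integral_eq_lintegral_ofReal h1 (Eventually.of_forall hnn), h2, chaosVar]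
  congr 2 with z
  rw [l2inner_reflect]
  ring

lemma lintegral_rpow_chaosForm_right (hP : IsWhiteNoise P) (hb : 0 ≤ b) (ψ a c : Test)
    {p : ℝ} (hp : 0 < p) (u : Noise κ b) :
    ∫⁻ v : Noise κ b, ‖chaosForm ψ a c u.toDistrib v.toDistrib‖ₑ ^ p ∂P = gaussMoment p *
      (∫⁻ v : Noise κ b, ‖chaosForm ψ a c u.toDistrib v.toDistrib‖ₑ ^ (2 : ℝ) ∂P) ^ (p / 2) := by
  obtain ⟨Φ, hΦ⟩ := exists_chaosForm_eq hb ψ a c u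
  simp_rw [hΦ]
  rw [hP.lintegral_rpow Φ hp, lintegral_eval_two hP]

/-- Moments of the form `∫ ψ (u * a) (v * c)` are controlled by its variance. -/
lemma lintegral_rpow_chaosForm_le (hP : IsWhiteNoise P) (hκ : 0 ≤ κ) (hb : 0 ≤ b) (ψ a c : Test)
    {p : ℝ} (hp : 2 < p) :
    ∫⁻ u : Noise κ b, ∫⁻ v : Noise κ b,
      ‖chaosForm ψ a c u.toDistrib v.toDistrib‖ₑ ^ p ∂P ∂P
      ≤ gaussMoment p * (gaussMoment p *
        ENNReal.ofReal (chaosVar ψ fun z => corr a z * corr c z) ^ (p / 2)) := by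
  have := hP.isProbabilityMeasure
  have hp0 : 0 < p := by linarith
  have e : ∀ r : ℝ≥0∞, (r ^ (2 : ℝ)) ^ (p / 2) = r ^ p := fun r => by
    rw [← ENNReal.rpow_mul]; congr 1; ring
  -- Applied to the squared form with exponent `p / 2`. Gaussianity in `v` given `u`, and in `u`
  -- given `v` after exchanging the roles of `a` and `c`, provides the two comparison hypotheses.
  have h := lintegral_lintegral_rpow_le (μ := P) (ν := P) (c := gaussMoment p) (q := p / 2)
    (F := fun u v : Noise κ b => ‖chaosForm ψ a c u.toDistrib v.toDistrib‖ₑ ^ (2 : ℝ))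
    ((measurable_chaosForm hκ hb ψ a c).enorm.pow_const 2) (by linarith)
    (fun u => by simp_rw [e]; exact (lintegral_rpow_chaosForm_right hP hb ψ a c hp0 u).le)
    (fun v => by
      simp_rw [e, chaosForm_swap ψ a c]
      exact (lintegral_rpow_chaosForm_right hP hb ψ c a hp0 v).le)
  simp_rw [e] at h
  rwa [lintegral_sq_chaosForm hP hκ hb] at h

lemma integral_chaosForm_diag (hP : IsWhiteNoise P) (hκ : 0 ≤ κ) (hb : 0 ≤ b) (ψ a c : Test) :
    Integrable (fun ξ : Noise κ b => chaosForm ψ a c ξ.toDistrib ξ.toDistrib) P ∧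
    ∫ ξ : Noise κ b, chaosForm ψ a c ξ.toDistrib ξ.toDistrib ∂P = (∫ x, ψ x) * l2inner a c := by
  have hd : Measurable fun x : Plane => (x, x) := measurable_id.prodMk measurable_id
  have hψ : Integrable (ψ : Plane → ℝ) :=
    ψ.continuous.integrable_of_hasCompactSupport ψ.hasCompactSupport
  have hψc : Continuous fun z : Plane × Plane => ψ z.1 := ψ.continuous.comp continuous_fst
  -- The image of Lebesgue measure on the diagonal of `Plane × Plane` puts both convolutions at the
  -- same point.
  have hF : Integrable (fun z : Plane × Plane => ψ z.1)
      ((volume : Measure Plane).map fun x => (x, x)) :=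
    (integrable_map_measure hψc.aestronglyMeasurable hd.aemeasurable).2 hψ
  obtain ⟨h1, h2⟩ := integral_mul_conv_conv hP hκ hb a c hF
  have e : ∀ ξ : Noise κ b, ∫ z, ψ z.1 * (conv ξ.toDistrib a z.1 * conv ξ.toDistrib c z.2)
      ∂((volume : Measure Plane).map fun x => (x, x))
      = chaosForm ψ a c ξ.toDistrib ξ.toDistrib := by
    intro ξ
    rw [integral_map hd.aemeasurable, chaosForm]
    exact (hψc.mul (((continuous_conv hb ξ.mem a).comp continuous_fst).mul
      ((continuous_conv hb ξ.mem c).comp continuous_snd))).aestronglyMeasurable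
  simp_rw [e] at h1 h2
  refine ⟨h1, ?_⟩
  rw [h2, ← integral_mul_const, integral_map hd.aemeasurable]
  · simp_rw [l2inner_reflect_same]
  · have e3 : ∀ z : Plane × Plane, l2inner (reflect a z.1) (reflect c z.2)
        = testConv (reflect a 0) c (z.2 - z.1) := by
      intro z
      rw [Test.testConv_apply, l2inner]
      rw [← integral_sub_left_eq_self _ (volume : Measure Plane) z.2]
      congr 1 with y
      simp only [reflect_apply, sub_sub_cancel]
      rw [mul_comm]
      congr 2
      abel
    simp_rw [e3]
    exact (hψc.mul ((testConv (reflect a 0) c).continuous.comp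
      (continuous_snd.sub continuous_fst))).aestronglyMeasurable

/-- Moments of the renormalised square, tested against `ψ`. -/
lemma lintegral_rpow_wick_le (hP : IsWhiteNoise P) (hκ : 0 ≤ κ) (hb : 0 ≤ b) (ψ a c : Test)
    {p : ℝ} (hp : 2 < p) :
    ∫⁻ ξ : Noise κ b, ‖∫ x, ψ x * (conv ξ.toDistrib a x * conv ξ.toDistrib c x - l2inner a c)‖ₑ ^ p ∂P
      ≤ 2 ^ p * (gaussMoment p * (gaussMoment p *
        ENNReal.ofReal (chaosVar ψ fun z => corr a z * corr c z) ^ (p / 2))) := by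
  have := hP.isProbabilityMeasure
  have := secondCountable_holderSpace (α := -1 - κ) (by linarith) hb
  have hp0 : 0 < p := by linarith
  have hψ : Integrable (ψ : Plane → ℝ) :=
    ψ.continuous.integrable_of_hasCompactSupport ψ.hasCompactSupport
  set D : Noise κ b → ℝ := fun ξ => chaosForm ψ a c ξ.toDistrib ξ.toDistrib with hD
  have hmB := measurable_chaosForm hκ hb ψ a c (κ := κ) (b := b)
  have hmD : Measurable D := hmB.comp (measurable_id.prodMk measurable_id)
  have hmDD : Measurable fun z : Noise κ b × Noise κ b => ‖D z.1 - D z.2‖ₑ ^ p :=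
    ((hmD.comp measurable_fst).sub (hmD.comp measurable_snd)).enorm.pow_const p
  obtain ⟨i1, i2⟩ := integral_chaosForm_diag hP hκ hb ψ a c
  -- Centring is the average of the difference with an independent copy, after which Jensen's
  -- inequality applies.
  have e1 : ∀ ξ : Noise κ b,
      ∫ x, ψ x * (conv ξ.toDistrib a x * conv ξ.toDistrib c x - l2inner a c)
        = ∫ ξ', (D ξ - D ξ') ∂P := by
    intro ξ
    rw [integral_sub (integrable_const _) i1, integral_const, i2]
    simp only [probReal_univ, one_smul, mul_sub]
    rw [integral_sub, integral_mul_const]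
    · rfl
    · exact integrable_test_mul ψ ((continuous_conv hb ξ.mem a).mul (continuous_conv hb ξ.mem c))
    · exact hψ.mul_const _
  calc _ ≤ ∫⁻ ξ, ∫⁻ ξ', ‖D ξ - D ξ'‖ₑ ^ p ∂P ∂P := lintegral_mono fun ξ => by
        beta_reduce
        rw [e1]
        calc _ ≤ (∫⁻ ξ', ‖D ξ - D ξ'‖ₑ ∂P) ^ p := by
              gcongr
              exact enorm_integral_le_lintegral_enorm _
          _ ≤ _ := rpow_lintegral_le ((measurable_const.sub hmD).enorm.aemeasurable) (by linarith)
    _ = ∫⁻ z, ‖D z.1 - D z.2‖ₑ ^ p ∂(P.prod P) := by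
        exact (lintegral_prod (fun z : Noise κ b × Noise κ b => ‖D z.1 - D z.2‖ₑ ^ p) hmDD.aemeasurable).symm
    -- Decoupling: for the quadratic form `D` attached to a bilinear form `B`, one has `D((x -
    -- y)/√2) - D((x + y)/√2) = -(B(x, y) + B(y, x))`, where only independent arguments appear.
    _ = ∫⁻ z, ‖D z.1 - D z.2‖ₑ ^ p ∂((P.prod P).map rotate) := by rw [hP.map_rotate hκ hb]
    _ = ∫⁻ z : Noise κ b × Noise κ b, ‖chaosForm ψ a c z.1.toDistrib z.2.toDistrib
          + chaosForm ψ a c z.2.toDistrib z.1.toDistrib‖ₑ ^ p ∂(P.prod P) := by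
        rw [lintegral_map hmDD (measurable_rotate hκ hb)]
        congr 1 with z
        congr 1
        rw [← enorm_neg]
        congr 1
        simp only [hD, chaosForm]
        have hx := fun w : Test => continuous_conv hb z.1.mem w
        have hy := fun w : Test => continuous_conv hb z.2.mem w
        have hX := fun w : Test => continuous_conv hb (rotate z).1.mem w
        have hY := fun w : Test => continuous_conv hb (rotate z).2.mem w
        rw [← integral_sub, ← integral_neg, ← integral_add]
        · congr 1 with x
          simp only [conv, rotate_fst_apply, rotate_snd_apply]
          have hs : (√2)⁻¹ * (√2)⁻¹ = (2 : ℝ)⁻¹ := by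
            rw [← mul_inv, Real.mul_self_sqrt zero_le_two]
          linear_combination (2 * ψ x * (z.1.toDistrib (reflect a x) * z.2.toDistrib (reflect c x)
            + z.2.toDistrib (reflect a x) * z.1.toDistrib (reflect c x))) * hs
        · exact integrable_test_mul ψ ((hx a).mul (hy c))
        · exact integrable_test_mul ψ ((hy a).mul (hx c))
        · exact integrable_test_mul ψ ((hX a).mul (hX c))
        · exact integrable_test_mul ψ ((hY a).mul (hY c))
    _ ≤ ∫⁻ z : Noise κ b × Noise κ b, (2 ^ (p - 1) *
          (‖chaosForm ψ a c z.1.toDistrib z.2.toDistrib‖ₑ ^ p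
          + ‖chaosForm ψ a c z.2.toDistrib z.1.toDistrib‖ₑ ^ p)) ∂(P.prod P) := by
        gcongr with z
        refine le_trans ?_ (ENNReal.rpow_add_le_mul_rpow_add_rpow _ _ (by linarith))
        gcongr
        exact enorm_add_le _ _
    _ = 2 ^ p * ∫⁻ u : Noise κ b, ∫⁻ v : Noise κ b,
          ‖chaosForm ψ a c u.toDistrib v.toDistrib‖ₑ ^ p ∂P ∂P := by
        have m1 : Measurable fun z : Noise κ b × Noise κ b =>
            ‖chaosForm ψ a c z.1.toDistrib z.2.toDistrib‖ₑ ^ p := hmB.enorm.pow_const p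
        have m2 : Measurable fun z : Noise κ b × Noise κ b =>
            ‖chaosForm ψ a c z.2.toDistrib z.1.toDistrib‖ₑ ^ p :=
          (hmB.comp measurable_swap).enorm.pow_const p
        rw [lintegral_const_mul' _ _ (by finiteness), lintegral_add_left m1,
          lintegral_prod _ m1.aemeasurable]
        rw [show ∫⁻ z : Noise κ b × Noise κ b, ‖chaosForm ψ a c z.2.toDistrib z.1.toDistrib‖ₑ ^ p
          ∂(P.prod P) = ∫⁻ u : Noise κ b, ∫⁻ v : Noise κ b,
          ‖chaosForm ψ a c u.toDistrib v.toDistrib‖ₑ ^ p ∂P ∂P from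
          lintegral_prod_symm _ m2.aemeasurable]
        rw [← two_mul, ← mul_assoc]
        congr 1
        have h2 : (2 : ℝ≥0∞) ^ p = 2 ^ (p - 1) * 2 ^ (1 : ℝ) := by
          rw [← ENNReal.rpow_add _ _ two_ne_zero ENNReal.ofNat_ne_top]; simp
        rw [h2, ENNReal.rpow_one]
    _ ≤ _ := by
        gcongr
        exact lintegral_rpow_chaosForm_le hP hκ hb ψ a c hp

/-- Moments of the convolution of the noise with `w`, tested against `ψ`. -/
lemma lintegral_rpow_conv_le (hP : IsWhiteNoise P) (hκ : 0 ≤ κ) (hb : 0 ≤ b) (ψ w : Test)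
    {p : ℝ} (hp : 0 < p) :
    ∫⁻ ξ : Noise κ b, ‖∫ x, ψ x * conv ξ.toDistrib w x‖ₑ ^ p ∂P
      = gaussMoment p * ENNReal.ofReal (chaosVar ψ (corr w)) ^ (p / 2) := by
  have hψ : Integrable (ψ : Plane → ℝ) :=
    ψ.continuous.integrable_of_hasCompactSupport ψ.hasCompactSupport
  obtain ⟨Φ, hΦ⟩ := exists_integral_mul_conv_eq (α := -1 - κ) hb ψ.continuous.locallyIntegrable
    ψ.hasCompactSupport w
  have e : ∀ ξ : Noise κ b, ∫ x, ψ x * conv ξ.toDistrib w x = ξ.toDistrib Φ :=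
    fun ξ => hΦ _ ξ.mem
  simp_rw [e]
  rw [hP.lintegral_rpow Φ hp, ← hP.integral_sq]
  simp_rw [← e]
  have hF : Integrable (fun z : Plane × Plane => ψ z.1 * ψ z.2) := by
    rw [Measure.volume_eq_prod]
    exact hψ.mul_prod hψ
  have h2 := (integral_mul_conv_conv hP hκ hb w w hF).2
  congr 3
  rw [chaosVar]
  simp_rw [l2inner_reflect] at h2
  rw [← h2]
  congr 1 with ξ
  rw [sq_integral_eq]
  congr 1 with z
  ring

end

end Anderson
end

noncomputable section
namespace Anderson

/-! ### Bounds on the variance -/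

/-- A case of Young's convolution inequality. -/
lemma lintegral_rpow_lintegral_mul_le {f : Plane → ℝ≥0∞} (hf : Measurable f) {r : ℝ} (hr : 1 < r) :
    ∫⁻ z, (∫⁻ y, f y * f (y + z)) ^ r ≤ (∫⁻ y, f y ^ (2 * r / (r + 1))) ^ (r + 1) := by
  -- The exponent is determined by Young's relation `2 / s = 1 + 1 / r`.
  set s := 2 * r / (r + 1) with hs
  have hr0 : 0 < r := by linarith
  have hr1 : r - 1 ≠ 0 := by linarith
  have hs0 : 0 < s := by positivity
  set A := ∫⁻ y, f y ^ s with hA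
  have hfz : ∀ z, Measurable fun y => f (y + z) := fun z => hf.comp (measurable_add_const z)
  have htr : ∀ z, ∫⁻ y, f (y + z) ^ s = A := fun z =>
    lintegral_add_right_eq_self (fun y => f y ^ s) z
  have key : ∀ z, (∫⁻ y, f y * f (y + z)) ^ r
      ≤ (∫⁻ y, f y ^ s * f (y + z) ^ s) * A ^ (r - 1) := by
    intro z
    -- Hölder with exponents `r` and `r / (r - 1)` is applied to this splitting; the second factor
    -- becomes the power `s / 2`, which Cauchy-Schwarz bounds by `A` independently of `z`.
    have hsp : ∀ t : ℝ≥0∞, t = (t ^ s) ^ (1 / r) * t ^ ((r - 1) / (r + 1)) := by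
      intro t
      rw [← ENNReal.rpow_mul, ← ENNReal.rpow_add_of_nonneg _ _ (by positivity)
        (div_nonneg (by linarith) (by linarith))]
      have : s * (1 / r) + (r - 1) / (r + 1) = 1 := by
        rw [hs]; field_simp; ring
      rw [this, ENNReal.rpow_one]
    have h1 : ∫⁻ y, f y * f (y + z)
        ≤ (∫⁻ y, f y ^ s * f (y + z) ^ s) ^ (1 / r)
          * (∫⁻ y, (f y * f (y + z)) ^ (s / 2)) ^ ((r - 1) / r) := by
      calc ∫⁻ y, f y * f (y + z)
          = ∫⁻ y, ((f y * f (y + z)) ^ s) ^ (1 / r)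
              * (f y * f (y + z)) ^ ((r - 1) / (r + 1)) := by
            congr 1 with y
            exact hsp _
        _ ≤ (∫⁻ y, (((f y * f (y + z)) ^ s) ^ (1 / r)) ^ r) ^ (1 / r) *
            (∫⁻ y, ((f y * f (y + z)) ^ ((r - 1) / (r + 1))) ^ (r / (r - 1)))
              ^ (1 / (r / (r - 1))) :=
            ENNReal.lintegral_mul_le_Lp_mul_Lq _ (Real.HolderConjugate.conjExponent hr)
              (((hf.mul (hfz z)).pow_const _).pow_const _).aemeasurable
              ((hf.mul (hfz z)).pow_const _).aemeasurable
        _ = _ := by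
            have e1 : ∀ t : ℝ≥0∞, ((t ^ s) ^ (1 / r)) ^ r = t ^ s := fun t => by
              rw [← ENNReal.rpow_mul, one_div, inv_mul_cancel₀ hr0.ne', ENNReal.rpow_one]
            have e2 : ∀ t : ℝ≥0∞, (t ^ ((r - 1) / (r + 1))) ^ (r / (r - 1)) = t ^ (s / 2) :=
              fun t => by
                rw [← ENNReal.rpow_mul]
                congr 1
                rw [hs]
                field_simp
            have e3 : 1 / (r / (r - 1)) = (r - 1) / r := by field_simp
            simp_rw [e1, e2, e3, ENNReal.mul_rpow_of_nonneg _ _ hs0.le]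
    have h2 : ∫⁻ y, (f y * f (y + z)) ^ (s / 2) ≤ A := by
      have hcs := ENNReal.lintegral_mul_le_Lp_mul_Lq volume Real.HolderConjugate.two_two
        (hf.pow_const (s / 2)).aemeasurable ((hfz z).pow_const (s / 2)).aemeasurable
      simp only [Pi.mul_apply, ← ENNReal.rpow_mul, div_mul_cancel₀ s two_ne_zero] at hcs
      rw [htr z, ← hA] at hcs
      calc ∫⁻ y, (f y * f (y + z)) ^ (s / 2) = ∫⁻ y, f y ^ (s / 2) * f (y + z) ^ (s / 2) := by
            congr 1 with y
            rw [ENNReal.mul_rpow_of_nonneg _ _ (by positivity)]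
        _ ≤ _ := hcs
        _ = A := by
            rw [← ENNReal.rpow_add_of_nonneg _ _ (by norm_num) (by norm_num)]
            norm_num
    calc (∫⁻ y, f y * f (y + z)) ^ r
        ≤ ((∫⁻ y, f y ^ s * f (y + z) ^ s) ^ (1 / r) * A ^ ((r - 1) / r)) ^ r := by
          gcongr
          refine h1.trans ?_
          gcongr
      _ = _ := by
          rw [ENNReal.mul_rpow_of_nonneg _ _ hr0.le, ← ENNReal.rpow_mul, ← ENNReal.rpow_mul,
            one_div, inv_mul_cancel₀ hr0.ne', ENNReal.rpow_one, div_mul_cancel₀ _ hr0.ne']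
  have hm2 : Measurable fun p : Plane × Plane => f p.2 ^ s * f (p.2 + p.1) ^ s :=
    ((hf.comp measurable_snd).pow_const _).mul
      ((hf.comp (measurable_snd.add measurable_fst)).pow_const _)
  have hm1 : Measurable fun z => ∫⁻ y, f y ^ s * f (y + z) ^ s := hm2.lintegral_prod_right'
  calc ∫⁻ z, (∫⁻ y, f y * f (y + z)) ^ r
      ≤ ∫⁻ z, (∫⁻ y, f y ^ s * f (y + z) ^ s) * A ^ (r - 1) := lintegral_mono key
    _ = (∫⁻ z, ∫⁻ y, f y ^ s * f (y + z) ^ s) * A ^ (r - 1) := lintegral_mul_const _ hm1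
    _ = (A * A) * A ^ (r - 1) := by
        congr 1
        rw [lintegral_lintegral_swap hm2.aemeasurable]
        have : ∀ y, ∫⁻ z, f y ^ s * f (y + z) ^ s = f y ^ s * A := by
          intro y
          have hmy : Measurable fun z => f (y + z) ^ s :=
            (hf.comp (measurable_const_add y)).pow_const s
          rw [lintegral_const_mul _ hmy]
          congr 1
          exact lintegral_add_left_eq_self (fun z => f z ^ s) y
        simp_rw [this]
        rw [lintegral_mul_const _ (hf.pow_const s)]
    _ = A ^ (r + 1) := by
        have e : r + 1 = 1 + 1 + (r - 1) := by ring
        rw [e, ENNReal.rpow_add_of_nonneg _ _ (by norm_num) (by linarith),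
          ENNReal.rpow_add_of_nonneg _ _ zero_le_one zero_le_one, ENNReal.rpow_one]

/-- The `L^s` norm of a test function. -/
def lsNorm (s : ℝ) (a : Plane → ℝ) : ℝ≥0∞ := (∫⁻ y, ‖a y‖ₑ ^ s) ^ (1 / s)

lemma lintegral_rpow_corr_le (a : Test) {r : ℝ} (hr : 1 < r) :
    (∫⁻ z, ‖corr a z‖ₑ ^ r) ^ (1 / r) ≤ lsNorm (2 * r / (r + 1)) a ^ (2 : ℝ) := by
  have hr0 : 0 < r := by linarith
  have h := lintegral_rpow_lintegral_mul_le (f := fun y => ‖a y‖ₑ)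
    a.continuous.measurable.enorm hr
  have h1 : ∫⁻ z, ‖corr a z‖ₑ ^ r ≤ ∫⁻ z, (∫⁻ y, ‖a y‖ₑ * ‖a (y + z)‖ₑ) ^ r := by
    refine lintegral_mono fun z => ?_
    gcongr
    refine (enorm_integral_le_lintegral_enorm _).trans (le_of_eq ?_)
    simp_rw [enorm_mul]
  calc _ ≤ ((∫⁻ y, ‖a y‖ₑ ^ (2 * r / (r + 1))) ^ (r + 1)) ^ (1 / r) := by
        gcongr
        exact h1.trans h
    _ = _ := by
        rw [lsNorm, ← ENNReal.rpow_mul, ← ENNReal.rpow_mul]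
        congr 1
        field_simp

/-- Hölder in one of the two variables, the dual norm of `ψ` being interpolated between `L¹` and the
uniform norm. For `ψ` normalised in `L¹` at scale `l` the uniform norm is of order `l⁻²`, and only
the power `1 / m` of it is lost. -/
lemma ofReal_chaosVar_le (ψ : Test) {K : Plane → ℝ} (hK : Continuous K) {S : ℝ≥0∞}
    (hS : ∀ x, ‖ψ x‖ₑ ≤ S) {m : ℝ} (hm : 1 < m) :
    ENNReal.ofReal (chaosVar ψ K) ≤ (∫⁻ x, ‖ψ x‖ₑ) * (S ^ (1 / m) * (∫⁻ x, ‖ψ x‖ₑ) ^ (1 - 1 / m) *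
      (∫⁻ z, ‖K z‖ₑ ^ m) ^ (1 / m)) := by
  have hm0 : 0 < m := by linarith
  have hm1 : m - 1 ≠ 0 := by linarith
  set I := ∫⁻ x, ‖ψ x‖ₑ with hI
  have hψm : Measurable fun x => ‖ψ x‖ₑ := ψ.continuous.measurable.enorm
  have hKm : Measurable fun x => ‖K x‖ₑ := hK.measurable.enorm
  have h1 : ENNReal.ofReal (chaosVar ψ K)
      ≤ ∫⁻ z : Plane × Plane, ‖ψ z.1‖ₑ * ‖ψ z.2‖ₑ * ‖K (z.2 - z.1)‖ₑ := by
    calc _ ≤ ‖chaosVar ψ K‖ₑ := by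
          rw [Real.enorm_eq_ofReal_abs]
          exact ENNReal.ofReal_le_ofReal (le_abs_self _)
      _ ≤ _ := by
          refine (enorm_integral_le_lintegral_enorm _).trans (le_of_eq ?_)
          simp_rw [enorm_mul]
  refine h1.trans ?_
  have hmeas : Measurable fun z : Plane × Plane => ‖ψ z.1‖ₑ * ‖ψ z.2‖ₑ * ‖K (z.2 - z.1)‖ₑ :=
    ((hψm.comp measurable_fst).mul (hψm.comp measurable_snd)).mul
      (hKm.comp (measurable_snd.sub measurable_fst))
  rw [Measure.volume_eq_prod, lintegral_prod _ hmeas.aemeasurable]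
  calc _ ≤ ∫⁻ x, ‖ψ x‖ₑ * (S ^ (1 / m) * I ^ (1 - 1 / m) * (∫⁻ z, ‖K z‖ₑ ^ m) ^ (1 / m)) := by
        refine lintegral_mono fun x => ?_
        have hKx : Measurable fun y => ‖K (y - x)‖ₑ := hKm.comp (measurable_sub_const x)
        simp only [mul_assoc]
        rw [lintegral_const_mul' _ _ enorm_ne_top]
        gcongr
        calc _ ≤ (∫⁻ y, ‖ψ y‖ₑ ^ (m / (m - 1))) ^ (1 / (m / (m - 1))) *
              (∫⁻ y, ‖K (y - x)‖ₑ ^ m) ^ (1 / m) :=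
              ENNReal.lintegral_mul_le_Lp_mul_Lq _
                (Real.HolderConjugate.conjExponent hm).symm hψm.aemeasurable hKx.aemeasurable
          _ ≤ (S ^ (1 / m) * I ^ (1 - 1 / m)) * (∫⁻ z, ‖K z‖ₑ ^ m) ^ (1 / m) := by
              rw [lintegral_sub_right_eq_self (fun z => ‖K z‖ₑ ^ m) x]
              gcongr
              have h2 : ∫⁻ y, ‖ψ y‖ₑ ^ (m / (m - 1)) ≤ S ^ (1 / (m - 1)) * I := by
                rw [← lintegral_const_mul _ hψm]
                refine lintegral_mono fun y => ?_
                have e : m / (m - 1) = 1 / (m - 1) + 1 := by field_simp; ring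
                have e0 : 0 ≤ 1 / (m - 1) := div_nonneg zero_le_one (by linarith)
                rw [e, ENNReal.rpow_add_of_nonneg _ _ e0 zero_le_one, ENNReal.rpow_one]
                gcongr
                exact hS y
              have e1 : 1 / (m / (m - 1)) = 1 - 1 / m := by field_simp
              have e2 : 0 ≤ 1 - 1 / m := by
                rw [sub_nonneg, div_le_one hm0]; exact hm.le
              rw [e1]
              calc _ ≤ (S ^ (1 / (m - 1)) * I) ^ (1 - 1 / m) := by gcongr
                _ = _ := by
                    rw [ENNReal.mul_rpow_of_nonneg _ _ e2, ← ENNReal.rpow_mul]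
                    congr 2
                    field_simp
          _ = _ := by ring
    _ = _ := by rw [lintegral_mul_const _ hψm]

/-- Cauchy-Schwarz puts each autocorrelation in `L^{2m}`, and Young's inequality brings this back to
`L^s` norms of the kernels with `s = 4m / (2m + 1) < 2`. Staying strictly below `2` is essential,
since `∇G` just fails to be square integrable. -/
lemma ofReal_chaosVar_corr_mul_le (ψ a c : Test) {S : ℝ≥0∞} (hS : ∀ x, ‖ψ x‖ₑ ≤ S) {m : ℝ}
    (hm : 1 < m) :
    ENNReal.ofReal (chaosVar ψ fun z => corr a z * corr c z)
      ≤ (∫⁻ x, ‖ψ x‖ₑ) * (S ^ (1 / m) * (∫⁻ x, ‖ψ x‖ₑ) ^ (1 - 1 / m) *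
      (lsNorm (4 * m / (2 * m + 1)) a * lsNorm (4 * m / (2 * m + 1)) c) ^ (2 : ℝ)) := by
  refine (ofReal_chaosVar_le ψ ((continuous_corr a).mul (continuous_corr c)) hS hm).trans ?_
  gcongr
  have hm0 : 0 < m := by linarith
  have ha := lintegral_rpow_corr_le a (r := 2 * m) (by linarith)
  have hc := lintegral_rpow_corr_le c (r := 2 * m) (by linarith)
  have e : 2 * (2 * m) / (2 * m + 1) = 4 * m / (2 * m + 1) := by ring
  rw [e] at ha hc
  have ham : ∀ a : Test, Measurable fun z => ‖corr a z‖ₑ ^ m := fun a =>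
    (continuous_corr a).measurable.enorm.pow_const m
  have hcs := ENNReal.lintegral_mul_le_Lp_mul_Lq volume Real.HolderConjugate.two_two
        (ham a).aemeasurable (ham c).aemeasurable
  simp only [Pi.mul_apply, ← ENNReal.rpow_mul, mul_comm m 2] at hcs
  calc (∫⁻ z, ‖corr a z * corr c z‖ₑ ^ m) ^ (1 / m)
      ≤ ((∫⁻ z, ‖corr a z‖ₑ ^ (2 * m)) ^ (1 / 2 : ℝ) *
        (∫⁻ z, ‖corr c z‖ₑ ^ (2 * m)) ^ (1 / 2 : ℝ)) ^ (1 / m) := by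
        gcongr
        refine le_trans (le_of_eq ?_) hcs
        congr 1 with z
        rw [enorm_mul, ENNReal.mul_rpow_of_nonneg _ _ hm0.le]
    _ = (∫⁻ z, ‖corr a z‖ₑ ^ (2 * m)) ^ (1 / (2 * m)) *
        (∫⁻ z, ‖corr c z‖ₑ ^ (2 * m)) ^ (1 / (2 * m)) := by
        rw [ENNReal.mul_rpow_of_nonneg _ _ (by positivity), ← ENNReal.rpow_mul, ← ENNReal.rpow_mul]
        congr 2 <;> field_simp
    _ ≤ _ := by
        rw [ENNReal.mul_rpow_of_nonneg _ _ zero_le_two]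
        gcongr

/-- The exponent `2m` is used here instead of `m`, so that the same `L^s` norm of the kernel appears
as in the second chaos. -/
lemma ofReal_chaosVar_corr_le (ψ w : Test) {S : ℝ≥0∞} (hS : ∀ x, ‖ψ x‖ₑ ≤ S) {m : ℝ}
    (hm : 1 < m) :
    ENNReal.ofReal (chaosVar ψ (corr w))
      ≤ (∫⁻ x, ‖ψ x‖ₑ) * (S ^ (1 / (2 * m)) * (∫⁻ x, ‖ψ x‖ₑ) ^ (1 - 1 / (2 * m)) *
      (lsNorm (4 * m / (2 * m + 1)) w) ^ (2 : ℝ)) := by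
  refine (ofReal_chaosVar_le ψ (continuous_corr w) hS (m := 2 * m) (by linarith)).trans ?_
  gcongr
  have ha := lintegral_rpow_corr_le w (r := 2 * m) (by linarith)
  have e : 2 * (2 * m) / (2 * m + 1) = 4 * m / (2 * m + 1) := by ring
  rwa [e] at ha

end Anderson
end

noncomputable section
namespace Anderson

/-! ### Convolution of test functions and mollification -/

lemma Test.integrable (φ : Test) : Integrable (φ : Plane → ℝ) :=
  φ.continuous.integrable_of_hasCompactSupport φ.hasCompactSupport

lemma testConv_comm (w f : Test) : testConv w f = testConv f w := by
  ext x
  rw [Test.testConv_apply, Test.testConv_apply,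
    ← integral_sub_left_eq_self (fun t => w t * f (x - t)) volume x]
  congr 1 with t
  rw [sub_sub_cancel, mul_comm]

lemma testConv_right_comm (w g f : Test) :
    testConv (testConv w g) f = testConv (testConv w f) g := by
  ext x
  have h := integral_mul_conv_ofFun g w f.continuous.locallyIntegrable f.hasCompactSupport x
  rw [conv_ofFun_test, conv_ofFun_test] at h
  rw [← h, Test.testConv_apply]

lemma testConv_add_left (w v f : Test) : testConv (w + v) f = testConv w f + testConv v f := by
  ext x
  change testConv (w + v) f x = testConv w f x + testConv v f x
  rw [← conv_ofFun_test, ← conv_ofFun_test, ← conv_ofFun_test, conv_add_right]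

lemma testConv_sub_left (w v f : Test) : testConv (w - v) f = testConv w f - testConv v f := by
  ext x
  change testConv (w - v) f x = testConv w f x - testConv v f x
  rw [← conv_ofFun_test, ← conv_ofFun_test, ← conv_ofFun_test, conv_sub_right]

lemma testConv_smul_left (c : ℝ) (w f : Test) : testConv (c • w) f = c • testConv w f := by
  ext x
  change testConv (c • w) f x = c * testConv w f x
  rw [← conv_ofFun_test, ← conv_ofFun_test, conv_smul_right]

lemma testConv_add_right (w f g : Test) :
    testConv w (f + g : Test) = testConv w f + testConv w g := by
  rw [testConv_comm, testConv_add_left, testConv_comm f, testConv_comm g]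

lemma testConv_sub_right (w f g : Test) :
    testConv w (f - g : Test) = testConv w f - testConv w g := by
  rw [testConv_comm, testConv_sub_left, testConv_comm f, testConv_comm g]

lemma testConv_smul_right (c : ℝ) (w f : Test) : testConv w (c • f : Test) = c • testConv w f := by
  rw [testConv_comm, testConv_smul_left, testConv_comm f]

lemma testConv_eq_zero {w : Test} {R : ℝ} (hw : tsupport w ⊆ Metric.closedBall 0 R) {f : Test}
    {c : Plane} {r : ℝ} (hf : ∀ y, r < ‖y - c‖ → f y = 0) {x : Plane} (hx : R + r < ‖x - c‖) :
    testConv w f x = 0 := by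
  rw [Test.testConv_apply]
  refine integral_eq_zero_of_ae (Eventually.of_forall fun t => ?_)
  by_cases ht : r < ‖t - c‖
  · simp [hf t ht]
  · have : w (x - t) = 0 := by
      refine image_eq_zero_of_notMem_tsupport fun h => ?_
      have h1 := hw h
      rw [mem_closedBall_zero_iff] at h1
      have h2 : ‖x - c‖ ≤ ‖x - t‖ + ‖t - c‖ := by
        have := norm_add_le (x - t) (t - c)
        rwa [sub_add_sub_cancel] at this
      linarith
    simp [this]

lemma tsupport_testConv {w : Test} {R : ℝ} (hw : tsupport w ⊆ Metric.closedBall 0 R) {f : Test}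
    {r : ℝ} (hf : tsupport f ⊆ Metric.closedBall 0 r) :
    tsupport (testConv w f) ⊆ Metric.closedBall 0 (R + r) := by
  refine closure_minimal (fun y hy => ?_) Metric.isClosed_closedBall
  by_contra h
  rw [mem_closedBall_zero_iff, not_le] at h
  refine hy (testConv_eq_zero hw (c := 0) (r := r) (fun z hz => ?_) (by simpa using h))
  refine image_eq_zero_of_notMem_tsupport fun h' => ?_
  have := hf h'
  rw [mem_closedBall_zero_iff] at this
  rw [sub_zero] at hz
  linarith

lemma abs_testConv_le {w f : Test} {S : ℝ} (hS : ∀ x, |w x| ≤ S) (x : Plane) :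
    |testConv w f x| ≤ S * ∫ t, |f t| := by
  rw [Test.testConv_apply, ← Real.norm_eq_abs, ← integral_const_mul]
  refine norm_integral_le_of_norm_le (f.integrable.abs.const_mul S) (Eventually.of_forall fun t => ?_)
  rw [norm_mul, mul_comm, Real.norm_eq_abs, Real.norm_eq_abs]
  gcongr
  exact hS _

lemma integral_testConv (w f : Test) : ∫ x, testConv w f x = (∫ x, f x) * ∫ x, w x := by
  have h := integral_convolution (L := ContinuousLinearMap.mul ℝ ℝ) (μ := volume) (ν := volume)
    f.integrable w.integrable
  rw [ContinuousLinearMap.mul_apply'] at h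
  rw [← h]
  congr 1 with x
  rw [Test.testConv_apply]
  rfl

lemma integral_abs_testConv_le (w f : Test) :
    ∫ x, |testConv w f x| ≤ (∫ x, |f x|) * ∫ x, |w x| := by
  have h := integral_convolution (L := ContinuousLinearMap.mul ℝ ℝ) (μ := volume) (ν := volume)
    f.integrable.abs w.integrable.abs
  rw [ContinuousLinearMap.mul_apply'] at h
  rw [← h]
  have hi := (f.integrable.abs.integrable_convolution (ContinuousLinearMap.mul ℝ ℝ)
    w.integrable.abs)
  refine integral_mono (testConv w f).integrable.abs hi fun x => ?_
  beta_reduce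
  rw [Test.testConv_apply, ← Real.norm_eq_abs]
  refine (norm_integral_le_integral_norm _).trans (le_of_eq ?_)
  rw [convolution_def]
  congr 1 with t
  rw [norm_mul]
  rfl

lemma Test.exists_lipschitz (g : Test) : ∃ L : ℝ, 0 ≤ L ∧ ∀ x y, |g x - g y| ≤ L * ‖x - y‖ := by
  obtain ⟨D, hD⟩ := (g.contDiff.continuous_fderiv (by simp)).bounded_above_of_compact_support
    (g.hasCompactSupport.fderiv ℝ)
  refine ⟨D, (norm_nonneg _).trans (hD 0), fun x y => ?_⟩
  exact convex_univ.norm_image_sub_le_of_norm_fderiv_le (𝕜 := ℝ)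
    (fun z _ => g.contDiff.differentiable (by simp) z) (fun z _ => hD z) (mem_univ y) (mem_univ x)

lemma abs_testConv_sub_le {k : Test} {R : ℝ} (hk : tsupport k ⊆ Metric.closedBall 0 R)
    (hk1 : ∫ x, k x = 1) {g : Test} {L : ℝ} (hL : 0 ≤ L) (hg : ∀ x y, |g x - g y| ≤ L * ‖x - y‖)
    (x : Plane) : |testConv k g x - g x| ≤ L * R * ∫ t, |k t| := by
  have e : testConv k g x - g x = ∫ t, k t * (g (x - t) - g x) := by
    rw [testConv_comm, Test.testConv_apply]
    simp_rw [mul_sub]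
    rw [integral_sub, integral_mul_const, hk1, one_mul]
    · exact integrable_mul_comp_sub k.continuous.locallyIntegrable k.hasCompactSupport g.continuous x
    · exact k.integrable.mul_const _
  rw [e, ← Real.norm_eq_abs, ← integral_const_mul]
  refine norm_integral_le_of_norm_le (k.integrable.abs.const_mul _) (Eventually.of_forall fun t => ?_)
  rw [norm_mul, mul_comm, Real.norm_eq_abs, Real.norm_eq_abs]
  by_cases ht : t ∈ tsupport k
  · gcongr
    refine (hg _ _).trans ?_
    gcongr
    rw [sub_sub_cancel_left, norm_neg]
    simpa using hk ht
  · simp [image_eq_zero_of_notMem_tsupport ht]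
section

variable {α b : ℝ} {T : Distrib}

lemma ofFun_conv_apply (hb : 0 ≤ b) (hT : T ∈ holderSubgroup α (polyWeight b)) (k φ : Test) :
    ofFun (conv T k) φ = conv T (testConv k (reflect φ 0)) 0 := by
  rw [ofFun_apply (continuous_conv hb hT k).locallyIntegrable,
    ← integral_mul_conv hb hT k (reflect φ 0).continuous.locallyIntegrable
      (reflect φ 0).hasCompactSupport, ← integral_neg_eq_self]
  simp [reflect_apply]

/-- Convolution only averages over base points and keeps the scale `l`; hence it costs `∫ |k|` and a
weight factor, but no regularity. -/
lemma ofFun_conv_rescale (hb : 0 ≤ b) (hT : T ∈ holderSubgroup α (polyWeight b)) (k φ : Test)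
    (l : ℝ) (x : Plane) :
    ofFun (conv T k) (rescale φ l x) = ∫ y, k y * T (rescale φ l (x - y)) := by
  rw [ofFun_conv_apply hb hT, testConv_comm, ← integral_mul_conv hb hT _
    k.continuous.locallyIntegrable k.hasCompactSupport]
  congr 1 with y
  rw [conv]
  congr 2
  ext z
  simp only [reflect_apply, rescale_apply]
  congr 3
  abel

lemma holderNorm_conv_le (hb : 0 ≤ b) (hT : T ∈ holderSubgroup α (polyWeight b)) {k : Test} {R : ℝ}
    (hR : 0 ≤ R) (hk : tsupport k ⊆ Metric.closedBall 0 R) :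
    holderNorm α (polyWeight b) (ofFun (conv T k))
      ≤ ENNReal.ofReal ((1 + R) ^ b * (∫ y, |k y|) * (holderNorm α (polyWeight b) T).toReal) := by
  refine iSup_le fun x => iSup₂_le fun l hl => iSup₂_le fun φ hφ => ENNReal.ofReal_le_ofReal ?_
  have hw := polyWeight_pos b x
  have hlα : 0 < l ^ α := Real.rpow_pos_of_pos hl.1 α
  rw [div_le_iff₀ (by positivity), ofFun_conv_rescale hb hT]
  set H := (holderNorm α (polyWeight b) T).toReal
  have hH : 0 ≤ H := ENNReal.toReal_nonneg
  have key : ∀ y, ‖k y * T (rescale φ l (x - y))‖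
      ≤ ((1 + R) ^ b * H * (polyWeight b x * l ^ α)) * |k y| := by
    intro y
    rw [norm_mul, mul_comm, Real.norm_eq_abs, Real.norm_eq_abs]
    by_cases hy : y ∈ tsupport k
    · gcongr
      have h1 := abs_apply_le_of_mem_unitTests hT.1 hl (x - y) zero_le_one hφ.1 hφ.2
      have h2 : polyWeight b (x - y) ≤ (1 + R) ^ b * polyWeight b x := by
        refine polyWeight_le hb hR ((norm_sub_le _ _).trans ?_)
        have : ‖y‖ ≤ R := by simpa using hk hy
        linarith
      calc _ ≤ _ := h1
        _ ≤ 1 * H * ((1 + R) ^ b * polyWeight b x * l ^ α) := by gcongr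
        _ = _ := by ring
    · simp [image_eq_zero_of_notMem_tsupport hy]
  have := norm_integral_le_of_norm_le (k.integrable.abs.const_mul _) (Eventually.of_forall key)
  rw [integral_const_mul, Real.norm_eq_abs] at this
  refine this.trans (le_of_eq ?_)
  ring
/-- Convolution with an approximate identity converges in the weighted Hölder norm. -/
theorem exists_holderNorm_conv_sub_le (hα : α ≤ 0) (hb : 0 ≤ b)
    (hT : T ∈ holderSubgroup α (polyWeight b)) {M δ : ℝ} (hM : 0 ≤ M) (hδ : 0 < δ) :
    ∃ R : ℝ, 0 < R ∧ ∀ k : Test, tsupport k ⊆ Metric.closedBall 0 R → ∫ x, k x = 1 →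
      ∫ x, |k x| ≤ M →
        holderNorm α (polyWeight b) (ofFun (conv T k) - T) < ENNReal.ofReal δ := by
  -- The error `T - g` is counted once after convolution, with factor `2 ^ b * M`, and once
  -- directly. The budget is `δ / 4` for these two terms together and `δ / 2` for the smooth part.
  set N := 2 ^ b * M + 1 with hN
  have hN0 : 0 < N := by positivity
  obtain ⟨g, hg, hgδ⟩ := exists_test_toReal_lt hT (show 0 < δ / (4 * N) by positivity)
  obtain ⟨L, hL0, hL⟩ := g.exists_lipschitz
  obtain ⟨K, hK, hKle⟩ := exists_holderNorm_test_sub_le hα hb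
  refine ⟨min 1 (δ / (2 * (L * M * K + 1))), by positivity, fun k hk hk1 hkM => ?_⟩
  set R := min 1 (δ / (2 * (L * M * K + 1)))
  have hR0 : 0 < R := by positivity
  set H := (holderNorm α (polyWeight b) (T - ofFun g)).toReal with hH
  -- The radius is uniform over all admissible `k`: only the Lipschitz constant of the fixed
  -- approximation `g` and the bound `M` on `∫ |k|` enter.
  have e : ofFun (conv T k) - T = ofFun (conv (T - ofFun g) k)
      + ((ofFun (testConv k g) - ofFun g) + -(T - ofFun g)) := by
    have : ofFun (conv (T - ofFun g) k) = ofFun (conv T k) - ofFun (testConv k g) := by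
      rw [← conv_ofFun_test, ← ofFun_sub]
      · rfl
      · exact (continuous_conv hb hT k).locallyIntegrable
      · rw [conv_ofFun_test]; exact (testConv k g).continuous.locallyIntegrable
    rw [this]
    abel
  rw [e]
  have h1 : holderNorm α (polyWeight b) (ofFun (conv (T - ofFun g) k))
      ≤ ENNReal.ofReal (2 ^ b * M * (δ / (4 * N))) := by
    refine (holderNorm_conv_le hb hg hR0.le hk).trans (ENNReal.ofReal_le_ofReal ?_)
    gcongr
    have : R ≤ 1 := min_le_left _ _
    linarith
  have h2 : holderNorm α (polyWeight b) (ofFun (testConv k g) - ofFun g)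
      ≤ ENNReal.ofReal ((L * R * M) * K) := by
    refine hKle _ _ _ (by positivity) fun y => (abs_testConv_sub_le hk hk1 hL0 hL y).trans ?_
    gcongr
  have h3 : holderNorm α (polyWeight b) (-(T - ofFun g)) ≤ ENNReal.ofReal (δ / (4 * N)) := by
    rw [holderNorm_neg, ← ENNReal.ofReal_toReal hg.1.ne]
    exact ENNReal.ofReal_le_ofReal hgδ.le
  calc _ ≤ _ := (holderNorm_add_le _ _ _ _).trans (add_le_add h1
        ((holderNorm_add_le _ _ _ _).trans (add_le_add h2 h3)))
    _ = ENNReal.ofReal (2 ^ b * M * (δ / (4 * N)) + ((L * R * M) * K + δ / (4 * N))) := by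
        rw [ENNReal.ofReal_add (by positivity) (by positivity),
          ENNReal.ofReal_add (by positivity) (by positivity)]
    _ < _ := by
        refine (ENNReal.ofReal_lt_ofReal_iff hδ).2 ?_
        have e1 : 2 ^ b * M * (δ / (4 * N)) + δ / (4 * N) = δ / 4 := by
          rw [hN]; field_simp
        have e2 : L * R * M * K ≤ δ / 2 := by
          have : R * (2 * (L * M * K + 1)) ≤ δ := by
            rw [← le_div_iff₀ (by positivity)]
            exact min_le_right _ _
          nlinarith
        linarith

end

lemma abs_rescale_le {φ : Test} {S : ℝ} (hS : ∀ x, |φ x| ≤ S) (l : ℝ) (x y : Plane) :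
    |rescale φ l x y| ≤ (l ^ 2)⁻¹ * S := by
  rw [rescale_apply, abs_mul, abs_of_nonneg (by positivity : 0 ≤ (l ^ 2)⁻¹)]
  gcongr
  exact hS _

lemma tsupport_rescale {φ : Test} (hφ : tsupport φ ⊆ Metric.closedBall 0 1) {l : ℝ} (hl : 0 < l)
    (x : Plane) : tsupport (rescale φ l x) ⊆ Metric.closedBall x l := by
  refine closure_minimal (fun y hy => ?_) Metric.isClosed_closedBall
  by_contra h
  rw [mem_closedBall_iff_norm, not_le] at h
  refine hy ?_
  rw [rescale_apply, image_eq_zero_of_notMem_tsupport (f := (φ : Plane → ℝ)), mul_zero]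
  intro h'
  have := hφ h'
  rw [mem_closedBall_zero_iff, norm_smul, norm_inv, Real.norm_of_nonneg hl.le,
    inv_mul_le_iff₀ hl, mul_one] at this
  linarith

lemma integral_comp_rescale (F : Plane → ℝ) {l : ℝ} (hl : 0 < l) (x : Plane) :
    ∫ y, (l ^ 2)⁻¹ * F (l⁻¹ • (y - x)) = ∫ y, F y := by
  rw [integral_const_mul, integral_sub_right_eq_self (fun y => F (l⁻¹ • y)) x,
    Measure.integral_comp_inv_smul_of_nonneg volume F hl.le]
  simp only [finrank_euclideanSpace, Fintype.card_fin, smul_eq_mul]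
  field_simp

lemma integral_rescale (φ : Test) {l : ℝ} (hl : 0 < l) (x : Plane) :
    ∫ y, rescale φ l x y = ∫ y, φ y := integral_comp_rescale φ hl x

lemma integral_abs_rescale (φ : Test) {l : ℝ} (hl : 0 < l) (x : Plane) :
    ∫ y, |rescale φ l x y| = ∫ y, |φ y| := by
  rw [← integral_comp_rescale (fun y => |φ y|) hl x]
  congr 1 with y
  rw [rescale_apply, abs_mul, abs_of_nonneg (by positivity : 0 ≤ (l ^ 2)⁻¹)]

lemma integral_abs_reflect (φ : Test) (x : Plane) : ∫ y, |reflect φ x y| = ∫ y, |φ y| :=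
  integral_sub_left_eq_self (fun y => |φ y|) (volume : Measure Plane) x

end Anderson
end

noncomputable section
namespace Anderson

/-! ### A weighted Besov embedding -/

/-- The dyadic rescalings `4ⁿ η(2ⁿ ·)`. -/
def dyad (η : Test) (n : ℕ) : Test := rescale η ((2 : ℝ)⁻¹ ^ n) 0

/-- The weighted `L^p` norm at a dyadic scale. -/
def scaleNorm (η : Test) (p a : ℝ) (T : Distrib) (n : ℕ) : ℝ≥0∞ :=
  ∫⁻ y, (‖conv T (dyad η n) y‖ₑ * ENNReal.ofReal (polyWeight (-a) y)) ^ p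

/-- The `p`-th power of a weighted Besov norm of regularity `-θ`. -/
def besovSum (η : Test) (θ p a : ℝ) (T : Distrib) : ℝ≥0∞ :=
  ∑' n : ℕ, ENNReal.ofReal (((2 : ℝ)⁻¹ ^ n) ^ θ) ^ p * scaleNorm η p a T n

lemma polyWeight_mul_neg (a : ℝ) (x : Plane) : polyWeight a x * polyWeight (-a) x = 1 := by
  rw [polyWeight, polyWeight, ← Real.rpow_add (by positivity)]
  simp

lemma polyWeight_norm_congr (a : ℝ) {x y : Plane} (h : ‖x‖ = ‖y‖) :
    polyWeight a x = polyWeight a y := by rw [polyWeight, h, polyWeight]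

/-- Hölder's inequality with the weight and its inverse inserted. Since `ψ` lives in a ball of
radius at most two, its weight is comparable to the value at the centre; the volume of the ball
supplies the power `1 - 1 / p`. The weight is even, so the reflection is harmless. -/
lemma enorm_integral_mul_le {ψ : Test} {F : Plane → ℝ} (hF : Continuous F) {a p r S : ℝ}
    (ha : 0 ≤ a) (hp : 1 < p) {c : Plane} (hr0 : 0 ≤ r) (hr : r ≤ 2) (hS : ∀ y, |ψ y| ≤ S)
    (hψ : ∀ y, r < ‖y - c‖ → ψ y = 0) :
    ‖∫ y, ψ y * F (0 - y)‖ₑ ≤ ENNReal.ofReal (S * (3 ^ a * polyWeight a c) *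
      (r ^ 2 * volume.real (Metric.closedBall (0 : Plane) 1)) ^ (1 - 1 / p)) *
      (∫⁻ y, (‖F y‖ₑ * ENNReal.ofReal (polyWeight (-a) y)) ^ p) ^ (1 / p) := by
  have hp0 : 0 < p := by linarith
  have hp1 : p - 1 ≠ 0 := by linarith
  have hS0 : 0 ≤ S := (abs_nonneg _).trans (hS 0)
  have hconj := Real.HolderConjugate.conjExponent hp
  have hm1 : Measurable fun y => ‖ψ y‖ₑ * ENNReal.ofReal (polyWeight a y) :=
    ψ.continuous.measurable.enorm.mul (continuous_polyWeight a).measurable.ennreal_ofReal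
  have hm2 : Measurable fun y => ‖F y‖ₑ * ENNReal.ofReal (polyWeight (-a) y) :=
    hF.measurable.enorm.mul (continuous_polyWeight (-a)).measurable.ennreal_ofReal
  have hm2' : Measurable fun y => ‖F (-y)‖ₑ * ENNReal.ofReal (polyWeight (-a) (-y)) :=
    hm2.comp measurable_neg
  have h1 : ‖∫ y, ψ y * F (0 - y)‖ₑ ≤ ∫⁻ y, (‖ψ y‖ₑ * ENNReal.ofReal (polyWeight a y)) *
      (‖F (-y)‖ₑ * ENNReal.ofReal (polyWeight (-a) (-y))) := by
    refine (enorm_integral_le_lintegral_enorm _).trans (le_of_eq ?_)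
    congr 1 with y
    have e : ENNReal.ofReal (polyWeight a y) * ENNReal.ofReal (polyWeight (-a) (-y)) = 1 := by
      rw [polyWeight_norm_congr (-a) (norm_neg y), ← ENNReal.ofReal_mul (polyWeight_pos a y).le,
        polyWeight_mul_neg, ENNReal.ofReal_one]
    rw [enorm_mul, zero_sub]
    calc ‖ψ y‖ₑ * ‖F (-y)‖ₑ = ‖ψ y‖ₑ * ‖F (-y)‖ₑ *
          (ENNReal.ofReal (polyWeight a y) * ENNReal.ofReal (polyWeight (-a) (-y))) := by
          rw [e, mul_one]
      _ = _ := by ring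
  refine h1.trans ?_
  refine (ENNReal.lintegral_mul_le_Lp_mul_Lq volume hconj.symm hm1.aemeasurable
    hm2'.aemeasurable).trans ?_
  have e2 : ∫⁻ y, (‖F (-y)‖ₑ * ENNReal.ofReal (polyWeight (-a) (-y))) ^ p
      = ∫⁻ y, (‖F y‖ₑ * ENNReal.ofReal (polyWeight (-a) y)) ^ p :=
    lintegral_neg_eq_self (μ := volume)
      (fun y => (‖F y‖ₑ * ENNReal.ofReal (polyWeight (-a) y)) ^ p)
  rw [e2]
  gcongr
  set q := p / (p - 1) with hq
  have hq0 : 0 < q := div_pos hp0 (by linarith)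
  have eq1 : 1 / q = 1 - 1 / p := by rw [hq]; field_simp
  set B := S * (3 ^ a * polyWeight a c) with hB
  have hB0 : 0 ≤ B := mul_nonneg hS0 (mul_nonneg (by positivity) (polyWeight_pos a c).le)
  have hbd : ∀ y, (‖ψ y‖ₑ * ENNReal.ofReal (polyWeight a y)) ^ q
      ≤ (Metric.closedBall c r).indicator (fun _ => ENNReal.ofReal B ^ q) y := by
    intro y
    by_cases hy : y ∈ Metric.closedBall c r
    · rw [indicator_of_mem hy, Real.enorm_eq_ofReal_abs, ← ENNReal.ofReal_mul (abs_nonneg _)]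
      refine ENNReal.rpow_le_rpow (ENNReal.ofReal_le_ofReal ?_) hq0.le
      refine mul_le_mul (hS y) ?_ (polyWeight_pos a y).le hS0
      have := polyWeight_le ha zero_le_two (x := c) (y := y) (by
        have h := mem_closedBall_iff_norm.1 hy
        have := norm_le_norm_add_norm_sub c y
        rw [norm_sub_rev] at this
        linarith)
      norm_num at this
      exact this
    · rw [indicator_of_notMem hy, hψ y (by rwa [mem_closedBall_iff_norm, not_le] at hy)]
      simp [hq0]
  calc _ ≤ (∫⁻ y, (Metric.closedBall c r).indicator (fun _ => ENNReal.ofReal B ^ q) y) ^ (1 / q) := by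
        exact ENNReal.rpow_le_rpow (lintegral_mono hbd) (by positivity)
    _ = ENNReal.ofReal B * (volume (Metric.closedBall c r)) ^ (1 / q) := by
        rw [lintegral_indicator_const Metric.isClosed_closedBall.measurableSet,
          ENNReal.mul_rpow_of_nonneg _ _ (by positivity), ← ENNReal.rpow_mul,
          mul_one_div_cancel hq0.ne', ENNReal.rpow_one]
    _ = _ := by
        rw [ENNReal.ofReal_mul hB0, eq1]
        congr 1
        rw [← ENNReal.ofReal_rpow_of_nonneg (by positivity)
          (by rw [← eq1]; positivity)]
        congr 1
        rw [Measure.addHaar_closedBall' _ _ hr0, ENNReal.ofReal_mul (by positivity),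
          ofReal_measureReal measure_closedBall_lt_top.ne]
        simp

lemma scaleNorm_rpow_le (η : Test) (a : ℝ) {p θ : ℝ} (hp : 0 < p) (T : Distrib) (n : ℕ) :
    (scaleNorm η p a T n) ^ (1 / p)
      ≤ ENNReal.ofReal (((2 : ℝ)⁻¹ ^ n) ^ (-θ)) * besovSum η θ p a T ^ (1 / p) := by
  have h := ENNReal.le_tsum (f := fun n : ℕ => ENNReal.ofReal (((2 : ℝ)⁻¹ ^ n) ^ θ) ^ p *
    scaleNorm η p a T n) n
  have hl : (0 : ℝ) < (2 : ℝ)⁻¹ ^ n := by positivity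
  have h2 : ENNReal.ofReal (((2 : ℝ)⁻¹ ^ n) ^ θ) * scaleNorm η p a T n ^ (1 / p)
      ≤ besovSum η θ p a T ^ (1 / p) := by
    have := ENNReal.rpow_le_rpow h (z := 1 / p) (by positivity)
    rwa [ENNReal.mul_rpow_of_nonneg _ _ (by positivity), ← ENNReal.rpow_mul,
      mul_one_div_cancel hp.ne', ENNReal.rpow_one] at this
  calc _ = ENNReal.ofReal (((2 : ℝ)⁻¹ ^ n) ^ (-θ)) * (ENNReal.ofReal (((2 : ℝ)⁻¹ ^ n) ^ θ)
        * scaleNorm η p a T n ^ (1 / p)) := by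
        rw [← mul_assoc, ← ENNReal.ofReal_mul (by positivity), ← Real.rpow_add hl]
        simp
    _ ≤ _ := by gcongr

lemma Test.lipschitz_of_fderiv_le {g : Test} {D : ℝ}
    (hD : ∀ y, ‖iteratedFDeriv ℝ 1 (g : Plane → ℝ) y‖ ≤ D) (x y : Plane) :
    |g x - g y| ≤ D * ‖x - y‖ := by
  refine convex_univ.norm_image_sub_le_of_norm_fderiv_le (𝕜 := ℝ)
    (fun z _ => g.contDiff.differentiable (by simp) z) (fun z _ => ?_) (mem_univ y) (mem_univ x)
  rw [← norm_iteratedFDeriv_one]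
  exact hD z

/-- Two regimes: for `m ≥ l` the size bound `h1` is the better one, for `m ≤ l` the cancellation
bound `h2`. In `κ = θ + 2 / p + γ` the term `2 / p` is the price of passing from `L^p` to pointwise
bounds and `γ` makes the sum over scales converge. One derivative is available, whence `θ + γ ≤ 1`.
-/
lemma scale_exponent_le {l m θ γ p κ : ℝ} (hl : 0 < l) (hm : 0 < m)
    (hκ : κ = θ + 2 / p + γ) (hκ0 : 0 ≤ κ) (hθγ : θ + γ ≤ 1) (hp : 1 < p) {v C₁ S : ℝ} (hv : 0 ≤ v)
    (hC₁ : 0 ≤ C₁) (h1 : S ≤ C₁ * (m ^ 2)⁻¹) (h2 : S ≤ C₁ * (m * (l ^ 3)⁻¹)) :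
    S * ((l + m) ^ 2 * v) ^ (1 - 1 / p) ≤ C₁ * (4 * v + 1) * (m ^ (γ + θ) * l ^ (-κ)) := by
  have hp0 : 0 < p := by linarith
  have he0 : 0 ≤ 1 - 1 / p := by
    rw [sub_nonneg, div_le_one hp0]; exact hp.le
  have he1 : 1 - 1 / p ≤ 1 := by
    have : 0 < 1 / p := by positivity
    linarith
  have hv4 : (4 * v) ^ (1 - 1 / p) ≤ 4 * v + 1 := by
    calc (4 * v) ^ (1 - 1 / p) ≤ (4 * v + 1) ^ (1 - 1 / p) := by gcongr; linarith
      _ ≤ (4 * v + 1) ^ (1 : ℝ) := Real.rpow_le_rpow_of_exponent_le (by linarith) he1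
      _ = _ := Real.rpow_one _
  have hsq : ∀ t : ℝ, 0 < t → l + m ≤ 2 * t →
      ((l + m) ^ 2 * v) ^ (1 - 1 / p) ≤ (4 * v + 1) * t ^ (2 - 2 / p) := by
    intro t ht htl
    calc ((l + m) ^ 2 * v) ^ (1 - 1 / p) ≤ ((4 * v) * t ^ 2) ^ (1 - 1 / p) := by
          have : (l + m) ^ 2 ≤ (2 * t) ^ 2 := by gcongr
          refine Real.rpow_le_rpow (by positivity) ?_ he0
          nlinarith
      _ = (4 * v) ^ (1 - 1 / p) * t ^ (2 - 2 / p) := by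
          rw [Real.mul_rpow (by positivity) (by positivity)]
          congr 1
          rw [← Real.rpow_natCast, ← Real.rpow_mul ht.le]
          congr 1
          push_cast
          ring
      _ ≤ _ := by gcongr
  rcases le_total l m with hlm | hml
  · calc S * ((l + m) ^ 2 * v) ^ (1 - 1 / p)
        ≤ (C₁ * (m ^ 2)⁻¹) * ((4 * v + 1) * m ^ (2 - 2 / p)) := by
          gcongr
          exact hsq m hm (by linarith)
      _ = C₁ * (4 * v + 1) * (m ^ (γ + θ) * m ^ (-κ)) := by
          have : (m ^ 2)⁻¹ * m ^ (2 - 2 / p) = m ^ (γ + θ) * m ^ (-κ) := by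
            rw [← Real.rpow_natCast, ← Real.rpow_neg hm.le, ← Real.rpow_add hm, ← Real.rpow_add hm,
              hκ]
            congr 1
            push_cast
            ring
          linear_combination C₁ * (4 * v + 1) * this
      _ ≤ _ := by
          gcongr C₁ * (4 * v + 1) * (m ^ (γ + θ) * ?_)
          exact Real.rpow_le_rpow_of_nonpos hl hlm (by linarith)
  · calc S * ((l + m) ^ 2 * v) ^ (1 - 1 / p)
        ≤ (C₁ * (m * (l ^ 3)⁻¹)) * ((4 * v + 1) * l ^ (2 - 2 / p)) := by
          gcongr
          exact hsq l hl (by linarith)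
      _ = C₁ * (4 * v + 1) * (m ^ (γ + θ) * (m ^ (1 - (γ + θ)) * l ^ (-1 - 2 / p))) := by
          have e1 : m = m ^ (γ + θ) * m ^ (1 - (γ + θ)) := by
            rw [← Real.rpow_add hm]; simp
          have e2 : (l ^ 3)⁻¹ * l ^ (2 - 2 / p) = l ^ (-1 - 2 / p) := by
            rw [← Real.rpow_natCast, ← Real.rpow_neg hl.le, ← Real.rpow_add hl]
            congr 1
            push_cast
            ring
          rw [← e2]
          nth_rewrite 1 [e1]
          ring
      _ ≤ C₁ * (4 * v + 1) * (m ^ (γ + θ) * (l ^ (1 - (γ + θ)) * l ^ (-1 - 2 / p))) := by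
          gcongr
          linarith
      _ = _ := by
          rw [← Real.rpow_add hl, hκ]
          congr 3
          ring

lemma abs_dyad_le {η : Test} {M : ℝ} (hM : ∀ x, |η x| ≤ M) (n : ℕ) (x : Plane) :
    |dyad η n x| ≤ (((2 : ℝ)⁻¹ ^ n) ^ 2)⁻¹ * M := abs_rescale_le hM _ _ _

lemma tsupport_dyad {η : Test} (hη : tsupport η ⊆ Metric.closedBall 0 1) (n : ℕ) :
    tsupport (dyad η n) ⊆ Metric.closedBall 0 ((2 : ℝ)⁻¹ ^ n) :=
  tsupport_rescale hη (by positivity) 0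

end Anderson
end

/-! ### Proof of the embedding by telescoping over dyadic scales -/

noncomputable section
namespace Anderson

lemma Test.sub_apply (f g : Test) (x : Plane) : (f - g) x = f x - g x := rfl
lemma Test.smul_apply (c : ℝ) (f : Test) (x : Plane) : (c • f) x = c * f x := rfl

lemma tendsto_ofFun_conv_apply {α b : ℝ} (hα : α ≤ 0) (hb : 0 ≤ b) {T : Distrib}
    (hT : T ∈ holderSubgroup α (polyWeight b)) {M : ℝ} (hM : 0 ≤ M) {k : ℕ → Test} {r : ℕ → ℝ}
    (hr : Tendsto r atTop (𝓝 0)) (hk : ∀ n, tsupport (k n) ⊆ Metric.closedBall 0 (r n))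
    (hk1 : ∀ n, ∫ x, k n x = 1) (hkM : ∀ n, ∫ x, |k n x| ≤ M) (φ : Test) :
    Tendsto (fun n => ofFun (conv T (k n)) φ) atTop (𝓝 (T φ)) := by
  obtain ⟨C, hC0, hC⟩ := exists_abs_apply_le_holderNorm α hb φ
  rw [Metric.tendsto_atTop]
  intro δ hδ
  obtain ⟨R, hR0, hR⟩ := exists_holderNorm_conv_sub_le hα hb hT hM
    (show 0 < δ / (C + 1) by positivity)
  obtain ⟨N, hN⟩ := (hr.eventually (gt_mem_nhds hR0)).exists_forall_of_atTop
  refine ⟨N, fun n hn => ?_⟩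
  have h := hR (k n) ((hk n).trans (Metric.closedBall_subset_closedBall (hN n hn).le))
    (hk1 n) (hkM n)
  have h1 := hC _ (h.trans ENNReal.ofReal_lt_top)
  have h2 := (ENNReal.lt_ofReal_iff_toReal_lt (h.trans ENNReal.ofReal_lt_top).ne).1 h
  rw [Real.dist_eq]
  refine lt_of_le_of_lt h1 ?_
  rw [lt_div_iff₀ (by positivity)] at h2
  nlinarith [ENNReal.toReal_nonneg (a := holderNorm α (polyWeight b) (ofFun (conv T (k n)) - T))]

/-- The factorisation `u * u - v * v = (u + v) * (u - v)`. Mollifying twice leaves in each increment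
one factor at a single dyadic scale, to be put on the distribution where `scaleNorm` measures it,
while the difference acts on the test function. -/
lemma testConv_telescope (u v ψ : Test) :
    testConv (testConv u u) ψ - testConv (testConv v v) ψ
      = testConv (u + v) (testConv (u - v) ψ) := by
  have h : ∀ a c : Test, testConv a (testConv c ψ) = testConv (testConv c a) ψ := fun a c => by
    rw [testConv_comm, testConv_right_comm]
  rw [h, testConv_sub_left, testConv_add_right, testConv_add_right, testConv_comm v u,
    testConv_sub_left, testConv_add_left, testConv_add_left]
  abel

lemma reflect_rescale_lipschitz {φ : Test} (hφ : ∀ y, ‖iteratedFDeriv ℝ 1 (φ : Plane → ℝ) y‖ ≤ 1)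
    {l : ℝ} (hl : 0 < l) (x y z : Plane) :
    |reflect (rescale φ l x) 0 y - reflect (rescale φ l x) 0 z| ≤ (l ^ 3)⁻¹ * ‖y - z‖ := by
  simp only [reflect_apply, rescale_apply]
  rw [← mul_sub, abs_mul, abs_of_nonneg (by positivity : 0 ≤ (l ^ 2)⁻¹)]
  calc _ ≤ (l ^ 2)⁻¹ * (1 * ‖l⁻¹ • (0 - y - x) - l⁻¹ • (0 - z - x)‖) := by
        gcongr
        exact Test.lipschitz_of_fderiv_le hφ _ _
    _ = _ := by
        rw [← smul_sub, norm_smul, norm_inv, Real.norm_of_nonneg hl.le,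
          show 0 - y - x - (0 - z - x) = -(y - z) by abel, norm_neg]
        field_simp

lemma integral_abs_le_of_unit {φ : Test} (hs : tsupport φ ⊆ Metric.closedBall 0 1)
    (hφ : ∀ y, |φ y| ≤ 1) : ∫ y, |φ y| ≤ volume.real (Metric.closedBall (0 : Plane) 1) := by
  have h : ∀ y, y ∉ Metric.closedBall (0 : Plane) 1 → |φ y| = 0 := fun y hy => by
    rw [image_eq_zero_of_notMem_tsupport fun h => hy (hs h), abs_zero]
  rw [← setIntegral_eq_integral_of_forall_compl_eq_zero h]
  have := norm_setIntegral_le_of_norm_le_const (f := fun y => |φ y|) (C := 1)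
    (measure_closedBall_lt_top : volume (Metric.closedBall (0 : Plane) 1) < ∞)
    (fun y _ => by simpa using hφ y)
  rw [one_mul] at this
  exact (le_abs_self _).trans this

set_option maxHeartbeats 1000000 in
/-- The weighted Hölder norm is controlled by a weighted Besov norm. -/
theorem exists_holderNorm_le_besovSum {η : Test} (hη : tsupport η ⊆ Metric.closedBall 0 1)
    (hη1 : ∫ x, η x = 1) {κ a θ γ p : ℝ} (ha : 0 ≤ a) (hθ : 0 ≤ θ) (hγ : 0 < γ) (hp : 1 < p)
    (hκ : κ = θ + 2 / p + γ) (hθγ : θ + γ ≤ 1) :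
    ∃ C : ℝ, 0 ≤ C ∧ ∀ (α b : ℝ), α ≤ 0 → 0 ≤ b → ∀ T ∈ holderSubgroup α (polyWeight b),
      holderNorm (-κ) (polyWeight a) T ≤ ENNReal.ofReal C * besovSum η θ p a T ^ (1 / p) := by
  have hp0 : 0 < p := by linarith
  have hκ0 : 0 < κ := by rw [hκ]; positivity
  obtain ⟨M, hM0, hM⟩ := η.exists_bound
  set I := ∫ x, |η x| with hI
  have hI0 : 0 ≤ I := integral_nonneg fun _ => abs_nonneg _
  set v := volume.real (Metric.closedBall (0 : Plane) 1) with hv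
  have hv0 : 0 ≤ v := measureReal_nonneg
  -- `5 = 4 + 1` comes from the uniform norms of the kernels at scales `n + 1` and `n`, and `2 * I`
  -- from the two mollification errors.
  set C₁ := 5 * M * v + 2 * I with hC₁
  have hC₁0 : 0 ≤ C₁ := by positivity
  set ℓ : ℕ → ℝ := fun n => (2 : ℝ)⁻¹ ^ n with hℓ
  have hℓ0 : ∀ n, 0 < ℓ n := fun n => by positivity
  have hℓ1 : ∀ n, ℓ n ≤ 1 := fun n => pow_le_one₀ (by norm_num) (by norm_num)
  set K := C₁ * (4 * v + 1) * 3 ^ a with hK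
  have hK0 : 0 ≤ K := by positivity
  have hgeo : Summable fun n => (ℓ n) ^ γ := by
    have e : (fun n => (ℓ n) ^ γ) = fun n => ((2 : ℝ)⁻¹ ^ γ) ^ n := by
      ext n
      rw [hℓ, ← Real.rpow_natCast, ← Real.rpow_mul (by norm_num), mul_comm, Real.rpow_mul (by norm_num),
        Real.rpow_natCast]
    rw [e]
    exact summable_geometric_of_lt_one (by positivity)
      (Real.rpow_lt_one (by norm_num) (by norm_num) hγ)
  set G := ∑' n, (ℓ n) ^ γ with hG
  have hG0 : 0 ≤ G := tsum_nonneg fun n => by positivity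
  refine ⟨M * v * (3 ^ a * (4 * v + 1)) + 2 * (2 ^ θ * K) * G, by positivity, fun α b hα hb T hT => ?_⟩
  set N := besovSum η θ p a T ^ (1 / p) with hN
  refine iSup_le fun x => iSup₂_le fun l hl => iSup₂_le fun φ hφ => ?_
  obtain ⟨hl0, hl1⟩ := hl
  have hw := polyWeight_pos a x
  have hlκ : 0 < l ^ (-κ) := Real.rpow_pos_of_pos hl0 _
  have hlκ1 : 1 ≤ l ^ (-κ) := Real.one_le_rpow_of_pos_of_le_one_of_nonpos hl0 hl1 (by linarith)
  -- At least one derivative of the test functions is controlled by the norm; this gives the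
  -- Lipschitz bound on `ψ`.
  have hceil : 1 ≤ ⌈-(-κ)⌉₊ := by rw [neg_neg, Nat.one_le_ceil_iff]; exact hκ0
  set ψ := reflect (rescale φ l x) 0 with hψ
  have hψL : ∀ y z, |ψ y - ψ z| ≤ (l ^ 3)⁻¹ * ‖y - z‖ :=
    reflect_rescale_lipschitz (hφ.2 1 hceil) hl0 x
  have hφ1 : ∀ y, |φ y| ≤ 1 := fun y => by simpa using hφ.2 0 (Nat.zero_le _) y
  have hψI : ∫ y, |ψ y| ≤ v := by
    rw [hψ, integral_abs_reflect, integral_abs_rescale φ hl0]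
    exact integral_abs_le_of_unit hφ.1 hφ1
  have hψs : ∀ y, l < ‖y - (-x)‖ → ψ y = 0 := by
    intro y hy
    rw [hψ, reflect_apply]
    refine image_eq_zero_of_notMem_tsupport fun h => ?_
    have := tsupport_rescale hφ.1 hl0 x h
    rw [mem_closedBall_iff_norm, show 0 - y - x = -(y - -x) by abel, norm_neg] at this
    linarith
  have hwx : polyWeight a (-x) = polyWeight a x := polyWeight_norm_congr a (norm_neg x)
  -- the telescoping sequence
  set S : ℕ → ℝ := fun n => conv T (testConv (testConv (dyad η n) (dyad η n)) ψ) 0 with hS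
  have hSlim : Tendsto S atTop (𝓝 (T (rescale φ l x))) := by
    have h := tendsto_ofFun_conv_apply hα hb hT (M := I * I) (by positivity)
      (k := fun n => testConv (dyad η n) (dyad η n)) (r := fun n => ℓ n + ℓ n) (by
        have h0 : Tendsto ℓ atTop (𝓝 0) :=
          tendsto_pow_atTop_nhds_zero_of_lt_one (by norm_num) (by norm_num)
        simpa using h0.add h0)
      (fun n => tsupport_testConv (tsupport_dyad hη n) (tsupport_dyad hη n))
      (fun n => by rw [integral_testConv, dyad, integral_rescale η (hℓ0 n), hη1, mul_one])
      (fun n => (integral_abs_testConv_le _ _).trans (le_of_eq (by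
        rw [dyad, integral_abs_rescale η (hℓ0 n)]))) (rescale φ l x)
    refine h.congr fun n => ?_
    rw [ofFun_conv_apply hb hT]
  have hS0 : ‖S 0‖ₑ ≤ ENNReal.ofReal (M * v * (3 ^ a * (4 * v + 1)) * (polyWeight a x * l ^ (-κ))) * N := by
    have e : S 0 = ∫ y, testConv (dyad η 0) ψ y * conv T (dyad η 0) (0 - y) := by
      rw [integral_mul_conv hb hT _ (testConv (dyad η 0) ψ).continuous.locallyIntegrable
        (testConv (dyad η 0) ψ).hasCompactSupport, testConv_comm (dyad η 0) (testConv (dyad η 0) ψ),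
        testConv_right_comm]
    rw [e]
    refine (enorm_integral_mul_le (continuous_conv hb hT _) ha hp (c := -x) (r := ℓ 0 + l) (S := M * v)
      (by have := hℓ0 0; positivity) (by linarith [hℓ1 0]) (fun y => ?_) (fun y hy => ?_)).trans ?_
    · refine (abs_testConv_le (S := M) (fun z => ?_) y).trans (by gcongr)
      simpa using abs_dyad_le hM 0 z
    · exact testConv_eq_zero (tsupport_dyad hη 0) hψs hy
    · have h1 := scaleNorm_rpow_le η a (θ := θ) hp0 T 0
      rw [pow_zero, Real.one_rpow, ENNReal.ofReal_one, one_mul] at h1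
      refine mul_le_mul' (ENNReal.ofReal_le_ofReal ?_) h1
      rw [hwx]
      have he0 : 0 ≤ 1 - 1 / p := by
        rw [sub_nonneg, div_le_one hp0]; exact hp.le
      have he1 : 1 - 1 / p ≤ 1 := by
        have : 0 < 1 / p := by positivity
        linarith
      have hb1 : ((ℓ 0 + l) ^ 2 * v) ^ (1 - 1 / p) ≤ 4 * v + 1 := by
        calc ((ℓ 0 + l) ^ 2 * v) ^ (1 - 1 / p) ≤ (4 * v + 1) ^ (1 - 1 / p) := by
              refine Real.rpow_le_rpow (by positivity) ?_ he0
              have : (ℓ 0 + l) ^ 2 ≤ 2 ^ 2 := by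
                have := hℓ0 0
                gcongr
                linarith [hℓ1 0]
              nlinarith
          _ ≤ (4 * v + 1) ^ (1 : ℝ) := Real.rpow_le_rpow_of_exponent_le (by linarith) he1
          _ = _ := Real.rpow_one _
      calc _ ≤ M * v * (3 ^ a * polyWeight a x) * (4 * v + 1) * 1 := by rw [mul_one]; gcongr
        _ ≤ M * v * (3 ^ a * polyWeight a x) * (4 * v + 1) * l ^ (-κ) := by gcongr
        _ = _ := by ring
  have hstep : ∀ n, ‖S (n + 1) - S n‖ₑ
      ≤ ENNReal.ofReal (2 * (2 ^ θ * K) * (polyWeight a x * l ^ (-κ)) * ℓ n ^ γ) * N := by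
    intro n
    set w := testConv (dyad η (n + 1) - dyad η n) ψ with hwdef
    have e : S (n + 1) - S n = (∫ y, w y * conv T (dyad η (n + 1)) (0 - y))
        + ∫ y, w y * conv T (dyad η n) (0 - y) := by
      rw [integral_mul_conv hb hT _ w.continuous.locallyIntegrable w.hasCompactSupport,
        integral_mul_conv hb hT _ w.continuous.locallyIntegrable w.hasCompactSupport,
        ← conv_add_right, ← testConv_add_left, hwdef, ← testConv_telescope, conv_sub_right]
    have hsucc : ℓ (n + 1) = ℓ n * 2⁻¹ := pow_succ _ _
    -- The first bound uses only the size of the kernels. The second uses that both mollifications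
    -- are close to the Lipschitz function `ψ`, and gains when `ℓ n` is smaller than `l`.
    obtain ⟨B, hB1, hB2, hB⟩ : ∃ B : ℝ, B ≤ C₁ * (ℓ n ^ 2)⁻¹ ∧ B ≤ C₁ * (ℓ n * (l ^ 3)⁻¹) ∧
        ∀ y, |w y| ≤ B := by
      refine ⟨min (C₁ * (ℓ n ^ 2)⁻¹) (C₁ * (ℓ n * (l ^ 3)⁻¹)), min_le_left _ _, min_le_right _ _,
        fun y => le_min ?_ ?_⟩
      · refine (abs_testConv_le (S := 5 * M * (ℓ n ^ 2)⁻¹) (fun z => ?_) y).trans ?_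
        · change |dyad η (n + 1) z - dyad η n z| ≤ _
          refine (abs_sub _ _).trans ((add_le_add (abs_dyad_le hM (n + 1) z)
            (abs_dyad_le hM n z)).trans (le_of_eq ?_))
          change (ℓ (n + 1) ^ 2)⁻¹ * M + (ℓ n ^ 2)⁻¹ * M = _
          rw [hsucc]
          have := (hℓ0 n).ne'
          field_simp
          norm_num
        · have hn := hℓ0 n
          calc 5 * M * (ℓ n ^ 2)⁻¹ * ∫ t, |ψ t| ≤ 5 * M * (ℓ n ^ 2)⁻¹ * v := by gcongr
            _ = (5 * M * v + 0) * (ℓ n ^ 2)⁻¹ := by ring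
            _ ≤ C₁ * (ℓ n ^ 2)⁻¹ := by rw [hC₁]; gcongr; positivity
      · have hd : ∀ m, |testConv (dyad η m) ψ y - ψ y| ≤ (l ^ 3)⁻¹ * ℓ m * I := fun m => by
          have := abs_testConv_sub_le (tsupport_dyad hη m)
            (by rw [dyad, integral_rescale η (hℓ0 m), hη1]) (by positivity) hψL y
          rwa [dyad, integral_abs_rescale η (hℓ0 m)] at this
        have e2 : w y = (testConv (dyad η (n + 1)) ψ y - ψ y) - (testConv (dyad η n) ψ y - ψ y) := by
          rw [hwdef, testConv_sub_left, Test.sub_apply]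
          ring
        rw [e2]
        have hn := hℓ0 n
        calc _ ≤ (l ^ 3)⁻¹ * ℓ (n + 1) * I + (l ^ 3)⁻¹ * ℓ n * I :=
              (abs_sub _ _).trans (add_le_add (hd _) (hd _))
          _ ≤ (l ^ 3)⁻¹ * ℓ n * I + (l ^ 3)⁻¹ * ℓ n * I := by
              gcongr
              rw [hsucc]; linarith
          _ = (0 + 2 * I) * (ℓ n * (l ^ 3)⁻¹) := by ring
          _ ≤ _ := by rw [hC₁]; gcongr; positivity
    have hws : ∀ y, l + ℓ n < ‖y - (-x)‖ → w y = 0 := by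
      intro y hy
      have h1 : testConv (dyad η (n + 1)) ψ y = 0 :=
        testConv_eq_zero (tsupport_dyad hη (n + 1)) hψs (by
          change ℓ (n + 1) + l < _
          rw [hsucc]; linarith [hℓ0 n])
      have h2 : testConv (dyad η n) ψ y = 0 :=
        testConv_eq_zero (tsupport_dyad hη n) hψs (by
          change ℓ n + l < _
          linarith [hℓ0 n])
      rw [hwdef, testConv_sub_left, Test.sub_apply, h1, h2, sub_zero]
    have hreal := scale_exponent_le hl0 (hℓ0 n) hκ hκ0.le hθγ hp hv0 hC₁0 hB1 hB2
    -- Used for `m = n` and `m = n + 1`; halving the scale once costs the factor `2 ^ θ`.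
    have hterm : ∀ m, ℓ m ^ (-θ) ≤ 2 ^ θ * ℓ n ^ (-θ) →
        ‖∫ y, w y * conv T (dyad η m) (0 - y)‖ₑ
          ≤ ENNReal.ofReal (2 ^ θ * K * (polyWeight a x * l ^ (-κ)) * ℓ n ^ γ) * N := by
      intro m hm
      have hn := hℓ0 n
      refine (enorm_integral_mul_le (continuous_conv hb hT _) ha hp (by positivity)
        (by linarith [hℓ1 n]) hB hws).trans ?_
      have h1 := scaleNorm_rpow_le η a (θ := θ) hp0 T m
      calc _ ≤ ENNReal.ofReal (B * (3 ^ a * polyWeight a (-x)) * ((l + ℓ n) ^ 2 * v) ^ (1 - 1 / p))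
            * (ENNReal.ofReal (ℓ m ^ (-θ)) * N) := by
            gcongr
            exact h1
        _ = ENNReal.ofReal (B * (3 ^ a * polyWeight a (-x)) * ((l + ℓ n) ^ 2 * v) ^ (1 - 1 / p)
            * ℓ m ^ (-θ)) * N := by
            rw [ENNReal.ofReal_mul' (q := ℓ m ^ (-θ)) (Real.rpow_nonneg (hℓ0 m).le _)]
            ring
        _ ≤ _ := by
            refine mul_le_mul' (ENNReal.ofReal_le_ofReal ?_) le_rfl
            rw [hwx]
            calc _ = (B * ((l + ℓ n) ^ 2 * v) ^ (1 - 1 / p)) * (3 ^ a * polyWeight a x)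
                  * ℓ m ^ (-θ) := by ring
              _ ≤ (C₁ * (4 * v + 1) * (ℓ n ^ (γ + θ) * l ^ (-κ))) * (3 ^ a * polyWeight a x)
                  * (2 ^ θ * ℓ n ^ (-θ)) := by
                  have := Real.rpow_nonneg (hℓ0 m).le (-θ)
                  gcongr
              _ = 2 ^ θ * K * (polyWeight a x * l ^ (-κ)) * (ℓ n ^ (γ + θ) * ℓ n ^ (-θ)) := by
                  rw [hK]
                  generalize ℓ n ^ (γ + θ) = A₁
                  generalize ℓ n ^ (-θ) = A₂
                  ring
              _ = _ := by rw [← Real.rpow_add hn]; simp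
    rw [e]
    refine (enorm_add_le _ _).trans ((add_le_add (hterm (n + 1) ?_) (hterm n ?_)).trans (le_of_eq ?_))
    · rw [hsucc, Real.mul_rpow (hℓ0 n).le (by norm_num), Real.inv_rpow (by norm_num),
        Real.rpow_neg (x := 2) (by norm_num), inv_inv, mul_comm]
    · have := Real.rpow_nonneg (hℓ0 n).le (-θ)
      have h2 : 1 ≤ (2 : ℝ) ^ θ := Real.one_le_rpow (by norm_num) hθ
      exact le_mul_of_one_le_left this h2
    · have hn := hℓ0 n
      rw [← add_mul, ← ENNReal.ofReal_add (by positivity) (by positivity)]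
      congr 2
      ring
  have htot : ‖T (rescale φ l x)‖ₑ ≤ ENNReal.ofReal ((M * v * (3 ^ a * (4 * v + 1))
      + 2 * (2 ^ θ * K) * G) * (polyWeight a x * l ^ (-κ))) * N := by
    -- The increments are dominated by the geometric sequence `ℓ n ^ γ`, so their sum bounds the
    -- distance from `S 0` to the limit.
    have h1 := edist_le_tsum_of_edist_le_of_tendsto₀
      (f := S) (fun n => ENNReal.ofReal (2 * (2 ^ θ * K) * (polyWeight a x * l ^ (-κ)) * ℓ n ^ γ) * N)
      (fun n => by rw [edist_comm, edist_eq_enorm_sub]; exact hstep n) hSlim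
    rw [ENNReal.tsum_mul_right] at h1
    have h2 : ∑' n, ENNReal.ofReal (2 * (2 ^ θ * K) * (polyWeight a x * l ^ (-κ)) * ℓ n ^ γ)
        = ENNReal.ofReal (2 * (2 ^ θ * K) * (polyWeight a x * l ^ (-κ)) * G) := by
      rw [← ENNReal.ofReal_tsum_of_nonneg (fun n => by have := hℓ0 n; positivity)
        (hgeo.mul_left _), tsum_mul_left]
    rw [h2] at h1
    calc ‖T (rescale φ l x)‖ₑ ≤ ‖S 0‖ₑ + edist (S 0) (T (rescale φ l x)) := by
          have := edist_triangle (T (rescale φ l x)) (S 0) 0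
          rw [edist_zero_right, edist_zero_right, edist_comm] at this
          rwa [add_comm]
      _ ≤ _ := add_le_add hS0 h1
      _ = _ := by
          rw [← add_mul, ← ENNReal.ofReal_add (by positivity) (by positivity)]
          congr 2
          ring
  rw [ENNReal.ofReal_div_of_pos (by positivity)]
  refine ENNReal.div_le_of_le_mul ?_
  rw [← Real.enorm_eq_ofReal_abs]
  refine htot.trans (le_of_eq ?_)
  rw [ENNReal.ofReal_mul (by positivity)]
  ring

end Anderson
end

noncomputable section
namespace Anderson

open IsWhiteNoise

/-! ### Random fields in weighted Hölder spaces -/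

lemma lintegral_polyWeight_neg_lt_top {a p : ℝ} (h : 2 < a * p) :
    ∫⁻ y, ENNReal.ofReal (polyWeight (-a) y) ^ p < ∞ := by
  have hi := integrable_one_add_norm (E := Plane) (μ := volume) (r := a * p) (by simpa using h)
  have e : ∀ y, ENNReal.ofReal (polyWeight (-a) y) ^ p = ENNReal.ofReal ((1 + ‖y‖) ^ (-(a * p))) := by
    intro y
    rw [ENNReal.ofReal_rpow_of_pos (polyWeight_pos _ y), polyWeight, ← Real.rpow_mul (by positivity)]
    congr 2
    ring
  simp_rw [e]
  exact hi.lintegral_lt_top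

/-- Moment bounds at every scale give a moment bound on the Besov norm. -/
lemma lintegral_besovSum_le {Ω : Type*} [MeasurableSpace Ω] {P : Measure Ω} [SFinite P]
    {η : Test} {T : Ω → Distrib}
    (hm : ∀ n, Measurable fun z : Ω × Plane => conv (T z.1) (dyad η n) z.2) {a p θ τ : ℝ}
    {L : ℝ≥0∞} (hp : 0 < p)
    (hL : ∀ n y, ∫⁻ ω, ‖conv (T ω) (dyad η n) y‖ₑ ^ p ∂P
      ≤ L * ENNReal.ofReal (((2 : ℝ)⁻¹ ^ n) ^ (-τ)) ^ p) :
    Measurable (fun ω => besovSum η θ p a (T ω)) ∧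
    ∫⁻ ω, besovSum η θ p a (T ω) ∂P ≤ L * ((∫⁻ y, ENNReal.ofReal (polyWeight (-a) y) ^ p) *
      ∑' n : ℕ, ENNReal.ofReal ((((2 : ℝ)⁻¹ ^ (θ - τ)) ^ p) ^ n)) := by
  have hm' : ∀ n, Measurable fun z : Ω × Plane =>
      (‖conv (T z.1) (dyad η n) z.2‖ₑ * ENNReal.ofReal (polyWeight (-a) z.2)) ^ p := fun n =>
    ((hm n).enorm.mul ((continuous_polyWeight (-a)).measurable.ennreal_ofReal.comp
      measurable_snd)).pow_const p
  have hms : ∀ n, Measurable fun ω => scaleNorm η p a (T ω) n := fun n =>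
    (hm' n).lintegral_prod_right'
  have hw : Measurable fun y => ENNReal.ofReal (polyWeight (-a) y) ^ p :=
    (continuous_polyWeight (-a)).measurable.ennreal_ofReal.pow_const p
  refine ⟨Measurable.tsum fun n => (hms n).const_mul _, ?_⟩
  set W := ∫⁻ y, ENNReal.ofReal (polyWeight (-a) y) ^ p
  unfold besovSum
  rw [lintegral_tsum fun n => ((hms n).const_mul _).aemeasurable, ← ENNReal.tsum_mul_left,
    ← ENNReal.tsum_mul_left]
  refine ENNReal.tsum_le_tsum fun n => ?_
  rw [lintegral_const_mul _ (hms n)]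
  have h1 : ∫⁻ ω, scaleNorm η p a (T ω) n ∂P
      ≤ (L * ENNReal.ofReal (((2 : ℝ)⁻¹ ^ n) ^ (-τ)) ^ p) * W := by
    unfold scaleNorm
    rw [lintegral_lintegral_swap (hm' n).aemeasurable, ← lintegral_const_mul _ hw]
    refine lintegral_mono fun y => ?_
    simp_rw [ENNReal.mul_rpow_of_nonneg _ _ hp.le]
    rw [lintegral_mul_const]
    · gcongr
      exact hL n y
    · exact ((hm n).comp (measurable_id.prodMk measurable_const)).enorm.pow_const p
  calc _ ≤ ENNReal.ofReal (((2 : ℝ)⁻¹ ^ n) ^ θ) ^ p *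
        ((L * ENNReal.ofReal (((2 : ℝ)⁻¹ ^ n) ^ (-τ)) ^ p) * W) := by gcongr
    _ = L * (W * (ENNReal.ofReal (((2 : ℝ)⁻¹ ^ n) ^ θ) *
        ENNReal.ofReal (((2 : ℝ)⁻¹ ^ n) ^ (-τ))) ^ p) := by
        rw [ENNReal.mul_rpow_of_nonneg _ _ hp.le]; ring
    _ = _ := by
        congr 2
        have h2 : (0 : ℝ) < 2⁻¹ := by norm_num
        rw [← ENNReal.ofReal_mul (by positivity), ← Real.rpow_add (by positivity),
          ENNReal.ofReal_rpow_of_pos (by positivity)]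
        congr 1
        rw [← Real.rpow_natCast, ← Real.rpow_natCast, ← Real.rpow_mul h2.le, ← Real.rpow_mul h2.le,
          ← Real.rpow_mul h2.le, ← Real.rpow_mul h2.le]
        congr 1
        ring

lemma lintegral_enorm_reflect_dyad (η : Test) (n : ℕ) (y : Plane) :
    ∫⁻ x, ‖reflect (dyad η n) y x‖ₑ = ENNReal.ofReal (∫ x, |η x|) := by
  rw [← ofReal_integral_norm_eq_lintegral_enorm (reflect (dyad η n) y).integrable]
  simp_rw [Real.norm_eq_abs]
  rw [integral_abs_reflect, dyad, integral_abs_rescale η (by positivity)]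

lemma measurable_conv_ofFun {Ω : Type*} [TopologicalSpace Ω] [MeasurableSpace Ω] [BorelSpace Ω]
    [SecondCountableTopology Ω] {A : Ω → Plane → ℝ}
    (hA : Continuous fun z : Ω × Plane => A z.1 z.2) (w : Test) :
    Measurable fun z : Ω × Plane => conv (ofFun (A z.1)) w z.2 := by
  have e : ∀ z : Ω × Plane, conv (ofFun (A z.1)) w z.2 = ∫ y, A z.1 y * w (z.2 - y) := fun z =>
    conv_ofFun (hA.comp (continuous_const.prodMk continuous_id) :
      Continuous fun y => A z.1 y).locallyIntegrable w z.2
  simp_rw [e]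
  have hc : Continuous fun q : (Ω × Plane) × Plane => A q.1.1 q.2 * w (q.1.2 - q.2) :=
    (hA.comp ((continuous_fst.comp continuous_fst).prodMk continuous_snd)).mul
      (w.continuous.comp ((continuous_snd.comp continuous_fst).sub continuous_snd))
  exact (StronglyMeasurable.integral_prod_right' (ν := volume) hc.stronglyMeasurable).measurable

/-- A random field whose tested moments are controlled at every scale is small in the weighted
Hölder norm with high probability. -/
theorem exists_measure_holderNorm_le {η : Test} (hη : tsupport η ⊆ Metric.closedBall 0 1)
    (hη1 : ∫ x, η x = 1) {κ a θ γ p τ : ℝ} (ha : 0 ≤ a) (hθ : 0 ≤ θ) (hγ : 0 < γ) (hp : 1 < p)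
    (hκ : κ = θ + 2 / p + γ) (hθγ : θ + γ ≤ 1) (hap : 2 < a * p) (hτ : τ < θ) :
    ∃ C : ℝ≥0∞, C ≠ ∞ ∧ ∀ {Ω : Type} [TopologicalSpace Ω] [MeasurableSpace Ω] [BorelSpace Ω]
      [SecondCountableTopology Ω] (P : Measure Ω) [SFinite P] (A : Ω → Plane → ℝ) (b : ℝ) (L : ℝ≥0∞),
      0 ≤ b → (Continuous fun z : Ω × Plane => A z.1 z.2) → (∀ ω, SupClosure b (A ω)) →
      (∀ (n : ℕ) (y : Plane), ∫⁻ ω, ‖∫ x, reflect (dyad η n) y x * A ω x‖ₑ ^ p ∂P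
        ≤ L * ENNReal.ofReal (((2 : ℝ)⁻¹ ^ n) ^ (-τ)) ^ p) →
      ∀ δ : ℝ, 0 < δ → P {ω | ENNReal.ofReal δ ≤ holderNorm (-κ) (polyWeight a) (ofFun (A ω))}
        ≤ C * (L / ENNReal.ofReal δ ^ p) := by
  have hp0 : 0 < p := by linarith
  obtain ⟨C, hC0, hC⟩ := exists_holderNorm_le_besovSum hη hη1 ha hθ hγ hp hκ hθγ
  set W := (∫⁻ y, ENNReal.ofReal (polyWeight (-a) y) ^ p) *
      ∑' n : ℕ, ENNReal.ofReal ((((2 : ℝ)⁻¹ ^ (θ - τ)) ^ p) ^ n) with hW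
  have hWt : W ≠ ∞ := by
    refine ENNReal.mul_ne_top (lintegral_polyWeight_neg_lt_top hap).ne ?_
    rw [← ENNReal.ofReal_tsum_of_nonneg (fun n => by positivity)]
    · exact ENNReal.ofReal_ne_top
    · refine summable_geometric_of_lt_one (by positivity) (Real.rpow_lt_one (by positivity) ?_ hp0)
      exact Real.rpow_lt_one (by norm_num) (by norm_num) (by linarith)
  refine ⟨ENNReal.ofReal C ^ p * W, ENNReal.mul_ne_top
    (ENNReal.rpow_ne_top_of_nonneg hp0.le ENNReal.ofReal_ne_top) hWt, ?_⟩
  intro Ω _ _ _ _ P _ A b L hb hA hAs hL δ hδ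
  have hAc : ∀ ω, Continuous (A ω) := fun ω => hA.comp (continuous_const.prodMk continuous_id)
  obtain ⟨h1, h2⟩ := lintegral_besovSum_le (P := P) (T := fun ω => ofFun (A ω)) (a := a) (θ := θ)
    (τ := τ) (L := L) (fun n => measurable_conv_ofFun hA (dyad η n)) hp0 (fun n y => by
      simp_rw [conv, ofFun_apply (hAc _).locallyIntegrable]
      exact hL n y)
  have hsub : {ω | ENNReal.ofReal δ ≤ holderNorm (-κ) (polyWeight a) (ofFun (A ω))}
      ⊆ {ω | ENNReal.ofReal δ ^ p ≤ ENNReal.ofReal C ^ p * besovSum η θ p a (ofFun (A ω))} := by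
    intro ω hω
    -- The a priori membership only justifies the convolution identities and does not affect the
    -- constant, so regularity `0` may be used for a continuous function.
    have h3 := hC 0 b le_rfl hb _ ((hAs ω).mem_holderSubgroup le_rfl hb)
    have h4 := ENNReal.rpow_le_rpow (le_trans (show _ ≤ _ from hω) h3) hp0.le
    rwa [ENNReal.mul_rpow_of_nonneg _ _ hp0.le, ← ENNReal.rpow_mul, one_div,
      inv_mul_cancel₀ hp0.ne', ENNReal.rpow_one] at h4
  refine (measure_mono hsub).trans ((meas_ge_le_lintegral_div (h1.const_mul _).aemeasurable
    (by simp [hδ, hp0]) (ENNReal.rpow_ne_top_of_nonneg hp0.le ENNReal.ofReal_ne_top)).trans ?_)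
  rw [lintegral_const_mul _ h1, mul_assoc, mul_div_assoc]
  gcongr
  rw [← mul_div_assoc, mul_comm W]
  gcongr

end Anderson
end

/-! ### Tail bounds for the first and second chaos -/

noncomputable section
namespace Anderson

open IsWhiteNoise

lemma polyWeight_mul (a b : ℝ) (x : Plane) :
    polyWeight a x * polyWeight b x = polyWeight (a + b) x := by
  rw [polyWeight, polyWeight, polyWeight, ← Real.rpow_add (by positivity)]

lemma SupClosure.mul {a b : ℝ} (ha : 0 ≤ a) (hb : 0 ≤ b) {f g : Plane → ℝ} (hf : SupClosure a f)
    (hg : SupClosure b g) : SupClosure (a + b) fun x => f x * g x := by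
  intro δ hδ
  obtain ⟨C, hC0, hC⟩ := hf.exists_bound ha
  obtain ⟨D, hD0, hD⟩ := hg.exists_bound hb
  set e := min 1 (δ / (C + D + 1)) with he
  have he0 : 0 < e := by positivity
  have he1 : e ≤ 1 := min_le_left _ _
  have he2 : e * (C + D + 1) ≤ δ := by
    rw [← le_div_iff₀ (by positivity)]; exact min_le_right _ _
  obtain ⟨u, hu⟩ := hf e he0
  obtain ⟨v, hv⟩ := hg e he0
  refine ⟨mulShift u v 0 0, fun y => ?_⟩
  have ev : mulShift u v 0 0 y = u y * v y := by
    change u (y + 0) * v (y + 0) = _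
    rw [add_zero]
  rw [ev, ← polyWeight_mul]
  have hA := polyWeight_pos a y
  have hB := polyWeight_pos b y
  have e2 : f y * g y - u y * v y = f y * (g y - v y) + (f y - u y) * g y
      - (f y - u y) * (g y - v y) := by ring
  rw [e2]
  refine (abs_sub _ _).trans ((add_le_add_left (abs_add_le _ _) _).trans ?_)
  rw [abs_mul, abs_mul, abs_mul]
  calc |f y| * |g y - v y| + |f y - u y| * |g y| + |f y - u y| * |g y - v y|
      ≤ (C * polyWeight a y) * (e * polyWeight b y) + (e * polyWeight a y) * (D * polyWeight b y)
        + (e * polyWeight a y) * (1 * polyWeight b y) := by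
        have h3 := (hv y).trans (mul_le_mul_of_nonneg_right he1 hB.le)
        gcongr
        · exact hC y
        · exact hv y
        · exact hu y
        · exact hD y
        · exact hu y
    _ = e * (C + D + 1) * (polyWeight a y * polyWeight b y) := by ring
    _ ≤ _ := by gcongr

/-- Quantitative bounds on the first two chaoses in weighted Hölder spaces, in terms of `L^s` norms
with `s < 2` of the kernels. -/
theorem exists_chaos_bounds {η : Test} (hη : tsupport η ⊆ Metric.closedBall 0 1)
    (hη1 : ∫ x, η x = 1) {κ a : ℝ} (hκ : 0 < κ) (hκ1 : κ < 1) (ha : 0 < a) :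
    ∃ (s p : ℝ) (C : ℝ≥0∞), 1 < s ∧ s < 2 ∧ 0 < p ∧ C ≠ ∞ ∧ ∀ {b : ℝ} {P : Measure (Noise κ b)},
      0 ≤ b → IsWhiteNoise P →
      (∀ (u v : Test) (δ : ℝ), 0 < δ → P {ξ | ENNReal.ofReal δ ≤ holderNorm (-κ) (polyWeight a)
        (ofFun fun x => conv ξ.toDistrib u x * conv ξ.toDistrib v x - l2inner u v)}
          ≤ C * (lsNorm s u * lsNorm s v / ENNReal.ofReal δ) ^ p) ∧
      (∀ (w : Test) (δ : ℝ), 0 < δ → P {ξ | ENNReal.ofReal δ ≤ holderNorm (-κ) (polyWeight a)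
        (ofFun (conv ξ.toDistrib w))} ≤ C * (lsNorm s w / ENNReal.ofReal δ) ^ p) := by
  -- The first term makes the embedding loss `2 / p` at most `κ / 4`; the second makes the weight
  -- integrable, `a * p > 2`.
  set p := max (8 / κ) (4 / a) with hp
  have hp8 : 8 / κ ≤ p := le_max_left _ _
  have hp4 : 4 / a ≤ p := le_max_right _ _
  have h8 : 8 < 8 / κ := by rw [lt_div_iff₀ hκ]; linarith
  have hp2 : 2 < p := by linarith
  have hp0 : 0 < p := by linarith
  have hap : 2 < a * p := by
    rw [div_le_iff₀ ha] at hp4; linarith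
  have hpk : 2 / p ≤ κ / 4 := by
    rw [div_le_iff₀ hκ] at hp8
    rw [div_le_iff₀ hp0]
    linarith
  -- With this `m` a moment at scale `l` grows at most like the `p`-th power of `l ^ (-1 / m) = l ^
  -- (-κ / 8)`. This is the exponent `τ`, strictly below `θ = κ / 4`.
  set m := 8 / κ with hm
  have hm1 : 1 < m := by linarith
  have hm0 : 0 < m := by linarith
  have hminv : 1 / m = κ / 8 := by rw [hm]; field_simp
  have hs1 : 1 < 4 * m / (2 * m + 1) := by rw [lt_div_iff₀ (by positivity)]; linarith
  have hs2 : 4 * m / (2 * m + 1) < 2 := by rw [div_lt_iff₀ (by positivity)]; linarith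
  obtain ⟨C, hCt, hC⟩ := exists_measure_holderNorm_le hη hη1 (κ := κ) (a := a) (θ := κ / 4)
    (γ := κ - κ / 4 - 2 / p) (p := p) (τ := κ / 8) ha.le (by positivity) (by linarith) (by linarith)
    (by ring) (by have : 0 < 2 / p := by positivity
                  linarith) hap (by linarith)
  obtain ⟨M, hM0, hM⟩ := η.exists_bound
  set I := ENNReal.ofReal (∫ x, |η x|) with hI
  have hIt : I ≠ ∞ := ENNReal.ofReal_ne_top
  have he0 : ∀ r : ℝ, 1 ≤ r → 0 ≤ 1 - 1 / r := fun r hr => by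
    rw [sub_nonneg, div_le_one (by linarith)]; exact hr
  set B : ℝ → ℝ≥0∞ := fun r => (I * (ENNReal.ofReal M ^ (1 / r) * I ^ (1 - 1 / r))) ^ (p / 2) with hB
  have hBt : ∀ r, 1 ≤ r → B r ≠ ∞ := fun r hr => by
    have hr0 : 0 < r := by linarith
    exact ENNReal.rpow_ne_top_of_nonneg (by positivity) (ENNReal.mul_ne_top hIt (ENNReal.mul_ne_top
      (ENNReal.rpow_ne_top_of_nonneg (by positivity) ENNReal.ofReal_ne_top)
      (ENNReal.rpow_ne_top_of_nonneg (he0 r hr) hIt)))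
  have hgm : gaussMoment p ≠ ∞ := (gaussMoment_lt_top hp0).ne
  set C₂ := 2 ^ p * (gaussMoment p * (gaussMoment p * B m)) with hC₂
  set C₁ := gaussMoment p * B (2 * m) with hC₁
  have hC₂t : C₂ ≠ ∞ := ENNReal.mul_ne_top (by finiteness)
    (ENNReal.mul_ne_top hgm (ENNReal.mul_ne_top hgm (hBt m hm1.le)))
  have hC₁t : C₁ ≠ ∞ := ENNReal.mul_ne_top hgm (hBt _ (by linarith))
  -- the scaling of the variance bound
  have hS : ∀ (n : ℕ) (y x : Plane), ‖reflect (dyad η n) y x‖ₑ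
      ≤ ENNReal.ofReal ((((2 : ℝ)⁻¹ ^ n) ^ 2)⁻¹ * M) := fun n y x => by
    rw [Real.enorm_eq_ofReal_abs]
    exact ENNReal.ofReal_le_ofReal (abs_dyad_le hM n _)
  have hscale : ∀ (n : ℕ) (r : ℝ) (l : ℝ≥0∞), m ≤ r →
      (I * (ENNReal.ofReal ((((2 : ℝ)⁻¹ ^ n) ^ 2)⁻¹ * M) ^ (1 / r) * I ^ (1 - 1 / r) * l ^ (2 : ℝ)))
        ^ (p / 2) ≤ B r * l ^ p * ENNReal.ofReal (((2 : ℝ)⁻¹ ^ n) ^ (-(κ / 8))) ^ p := by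
    intro n r l hr
    have hr0 : 0 < r := by linarith
    have hl0 : (0 : ℝ) < 2⁻¹ ^ n := by positivity
    have hl1 : (2 : ℝ)⁻¹ ^ n ≤ 1 := pow_le_one₀ (by norm_num) (by norm_num)
    have h1 : ENNReal.ofReal ((((2 : ℝ)⁻¹ ^ n) ^ 2)⁻¹ * M) ^ (1 / r)
        ≤ ENNReal.ofReal (((2 : ℝ)⁻¹ ^ n) ^ (-(κ / 8))) ^ (2 : ℝ) * ENNReal.ofReal M ^ (1 / r) := by
      rw [ENNReal.ofReal_mul (by positivity), ENNReal.mul_rpow_of_nonneg _ _ (by positivity)]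
      gcongr
      rw [ENNReal.ofReal_rpow_of_pos (by positivity), ENNReal.ofReal_rpow_of_pos (by positivity),
        ← Real.rpow_natCast, ← Real.rpow_neg hl0.le, ← Real.rpow_mul hl0.le, ← Real.rpow_mul hl0.le]
      refine ENNReal.ofReal_le_ofReal (Real.rpow_le_rpow_of_exponent_ge hl0 hl1 ?_)
      have : 1 / r ≤ κ / 8 := by rw [← hminv]; gcongr
      push_cast
      linarith
    calc _ ≤ (I * ((ENNReal.ofReal (((2 : ℝ)⁻¹ ^ n) ^ (-(κ / 8))) ^ (2 : ℝ) *
          ENNReal.ofReal M ^ (1 / r)) * I ^ (1 - 1 / r) * l ^ (2 : ℝ))) ^ (p / 2) := by gcongr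
      _ = (I * (ENNReal.ofReal M ^ (1 / r) * I ^ (1 - 1 / r)) * (l ^ (2 : ℝ) *
          ENNReal.ofReal (((2 : ℝ)⁻¹ ^ n) ^ (-(κ / 8))) ^ (2 : ℝ))) ^ (p / 2) := by
          congr 1; ring
      _ = _ := by
          have e2 : ∀ t : ℝ≥0∞, (t ^ (2 : ℝ)) ^ (p / 2) = t ^ p := fun t => by
            rw [← ENNReal.rpow_mul]; congr 1; ring
          rw [ENNReal.mul_rpow_of_nonneg _ _ (by positivity),
            ENNReal.mul_rpow_of_nonneg (l ^ (2 : ℝ)) _ (by positivity), e2, e2, hB, mul_assoc]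
  refine ⟨4 * m / (2 * m + 1), p, C * max C₁ C₂, hs1, hs2, hp0,
    ENNReal.mul_ne_top hCt (max_ne_top hC₁t hC₂t), fun {b P} hb hP => ⟨?_, ?_⟩⟩
  · intro u v δ hδ
    have := hP.isProbabilityMeasure
    have := secondCountable_holderSpace (α := -1 - κ) (by linarith) hb
    -- The weight exponent `b + b + 1` serves only the a priori membership: the product needs `b +
    -- b`, and the constant needs a strictly positive exponent. It does not enter the bound.
    have h := hC P (fun ξ x => conv ξ.toDistrib u x * conv ξ.toDistrib v x - l2inner u v)
      (b + b + 1) (C₂ * (lsNorm (4 * m / (2 * m + 1)) u * lsNorm (4 * m / (2 * m + 1)) v) ^ p)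
      (by positivity)
      (((continuous_conv_uncurry κ hb u).mul (continuous_conv_uncurry κ hb v)).sub continuous_const)
      (fun ξ => by
        have h1 := ((supClosure_conv hb ξ.mem u).mul hb hb (supClosure_conv hb ξ.mem v)).mono
          (b := b + b + 1) (by linarith)
        simpa [sub_eq_add_neg] using h1.add (supClosure_const (by positivity) (-l2inner u v)))
      (fun n y => by
        refine (lintegral_rpow_wick_le hP hκ.le hb _ u v hp2).trans ?_
        have h1 := ofReal_chaosVar_corr_mul_le (reflect (dyad η n) y) u v (hS n y) hm1
        rw [lintegral_enorm_reflect_dyad] at h1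
        calc _ ≤ 2 ^ p * (gaussMoment p * (gaussMoment p * (B m *
              (lsNorm (4 * m / (2 * m + 1)) u * lsNorm (4 * m / (2 * m + 1)) v) ^ p *
              ENNReal.ofReal (((2 : ℝ)⁻¹ ^ n) ^ (-(κ / 8))) ^ p))) := by
              gcongr
              exact (ENNReal.rpow_le_rpow h1 (by positivity)).trans (hscale n m _ le_rfl)
          _ = _ := by rw [hC₂]; ring) δ hδ
    refine h.trans ?_
    rw [ENNReal.div_rpow_of_nonneg _ _ hp0.le, mul_assoc C, mul_div_assoc C₂]
    gcongr
    exact le_max_right _ _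
  · intro w δ hδ
    have := hP.isProbabilityMeasure
    have := secondCountable_holderSpace (α := -1 - κ) (by linarith) hb
    have h := hC P (fun ξ x => conv ξ.toDistrib w x)
      b (C₁ * (lsNorm (4 * m / (2 * m + 1)) w) ^ p) hb
      (continuous_conv_uncurry κ hb w) (fun ξ => supClosure_conv hb ξ.mem w)
      (fun n y => by
        rw [lintegral_rpow_conv_le hP hκ.le hb _ w hp0]
        have h1 := ofReal_chaosVar_corr_le (reflect (dyad η n) y) w (hS n y) hm1
        rw [lintegral_enorm_reflect_dyad] at h1
        calc _ ≤ gaussMoment p * (B (2 * m) * (lsNorm (4 * m / (2 * m + 1)) w) ^ p *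
              ENNReal.ofReal (((2 : ℝ)⁻¹ ^ n) ^ (-(κ / 8))) ^ p) := by
              gcongr
              exact (ENNReal.rpow_le_rpow h1 (by positivity)).trans
                (hscale n (2 * m) _ (by linarith))
          _ = _ := by rw [hC₁]; ring) δ hδ
    refine h.trans ?_
    rw [ENNReal.div_rpow_of_nonneg _ _ hp0.le, mul_assoc C, mul_div_assoc C₁]
    gcongr
    exact le_max_left _ _

end Anderson
end

noncomputable section
namespace Anderson

/-! ### Approximate identities in `L^s` -/

lemma lsNorm_eq_eLpNorm {s : ℝ} (hs : 0 < s) (f : Plane → ℝ) :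
    lsNorm s f = eLpNorm f (ENNReal.ofReal s) volume := by
  rw [eLpNorm_eq_lintegral_rpow_enorm_toReal (by simpa using hs) ENNReal.ofReal_ne_top,
    ENNReal.toReal_ofReal hs.le, lsNorm]

lemma lsNorm_add_le {s : ℝ} (hs : 1 ≤ s) {f g : Plane → ℝ} (hf : Measurable f)
    (hg : Measurable g) : lsNorm s (fun x => f x + g x) ≤ lsNorm s f + lsNorm s g := by
  simp_rw [lsNorm_eq_eLpNorm (show 0 < s by linarith)]
  exact eLpNorm_add_le hf.aestronglyMeasurable hg.aestronglyMeasurable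
    (by simpa using ENNReal.ofReal_le_ofReal hs)

lemma lsNorm_neg (s : ℝ) (f : Plane → ℝ) : lsNorm s (fun x => -f x) = lsNorm s f := by
  simp only [lsNorm, enorm_neg]
lemma lsNorm_sub_le {s : ℝ} (hs : 1 ≤ s) {f g : Plane → ℝ} (hf : Measurable f)
    (hg : Measurable g) : lsNorm s (fun x => f x - g x) ≤ lsNorm s f + lsNorm s g := by
  rw [← lsNorm_neg s g]
  simp only [sub_eq_add_neg]
  exact lsNorm_add_le hs hf hg.neg
/-- Young's inequality `‖k * f‖_s ≤ ‖k‖₁ ‖f‖_s`. -/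
lemma lsNorm_convolution_le {s : ℝ} (hs : 1 < s) (k : Test) {f : Plane → ℝ} (hf : Measurable f) :
    lsNorm s (fun x => ∫ t, k t * f (x - t)) ≤ ENNReal.ofReal (∫ t, |k t|) * lsNorm s f := by
  have hs0 : 0 < s := by linarith
  have hs1 : s - 1 ≠ 0 := by linarith
  set I := ∫⁻ t, ‖k t‖ₑ with hI
  have hIe : I = ENNReal.ofReal (∫ t, |k t|) := by
    rw [hI, ← ofReal_integral_norm_eq_lintegral_enorm k.integrable]
    rfl
  have hkm : Measurable fun t => ‖k t‖ₑ := k.continuous.measurable.enorm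
  have hfx : ∀ x, Measurable fun t => ‖f (x - t)‖ₑ := fun x =>
    (hf.comp (measurable_const.sub measurable_id)).enorm
  have he : 0 ≤ 1 - 1 / s := by
    rw [sub_nonneg, div_le_one hs0]; exact hs.le
  have key : ∀ x, ‖∫ t, k t * f (x - t)‖ₑ ^ s ≤ I ^ (s - 1) * ∫⁻ t, ‖k t‖ₑ * ‖f (x - t)‖ₑ ^ s := by
    intro x
    -- Hölder with respect to the measure of density `|k|`; translation invariance then integrates
    -- out `x`.
    have h1 : ‖∫ t, k t * f (x - t)‖ₑ ≤ I ^ (1 - 1 / s) *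
        (∫⁻ t, ‖k t‖ₑ * ‖f (x - t)‖ₑ ^ s) ^ (1 / s) := by
      calc _ ≤ ∫⁻ t, ‖k t‖ₑ * ‖f (x - t)‖ₑ := by
            refine (enorm_integral_le_lintegral_enorm _).trans (le_of_eq ?_)
            simp_rw [enorm_mul]
        _ = ∫⁻ t, ‖k t‖ₑ ^ (1 - 1 / s) * (‖k t‖ₑ ^ (1 / s) * ‖f (x - t)‖ₑ) := by
            congr 1 with t
            rw [← mul_assoc, ← ENNReal.rpow_add_of_nonneg _ _ he (by positivity)]
            simp
        _ ≤ (∫⁻ t, (‖k t‖ₑ ^ (1 - 1 / s)) ^ (s / (s - 1))) ^ (1 / (s / (s - 1))) *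
            (∫⁻ t, (‖k t‖ₑ ^ (1 / s) * ‖f (x - t)‖ₑ) ^ s) ^ (1 / s) :=
            ENNReal.lintegral_mul_le_Lp_mul_Lq _ (Real.HolderConjugate.conjExponent hs).symm
              (hkm.pow_const _).aemeasurable ((hkm.pow_const _).mul (hfx x)).aemeasurable
        _ = _ := by
            have e1 : ∀ u : ℝ≥0∞, (u ^ (1 - 1 / s)) ^ (s / (s - 1)) = u := fun u => by
              rw [← ENNReal.rpow_mul]
              have : (1 - 1 / s) * (s / (s - 1)) = 1 := by field_simp
              rw [this, ENNReal.rpow_one]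
            have e2 : 1 / (s / (s - 1)) = 1 - 1 / s := by field_simp
            have e3 : ∀ u v : ℝ≥0∞, (u ^ (1 / s) * v) ^ s = u * v ^ s := fun u v => by
              rw [ENNReal.mul_rpow_of_nonneg _ _ hs0.le, ← ENNReal.rpow_mul, one_div,
                inv_mul_cancel₀ hs0.ne', ENNReal.rpow_one]
            simp_rw [e1, e2, e3]
            rfl
    calc _ ≤ (I ^ (1 - 1 / s) * (∫⁻ t, ‖k t‖ₑ * ‖f (x - t)‖ₑ ^ s) ^ (1 / s)) ^ s := by gcongr
      _ = _ := by
          rw [ENNReal.mul_rpow_of_nonneg _ _ hs0.le, ← ENNReal.rpow_mul, ← ENNReal.rpow_mul, one_div,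
            inv_mul_cancel₀ hs0.ne', ENNReal.rpow_one]
          congr 2
          field_simp
  have hm2 : Measurable fun z : Plane × Plane => ‖k z.2‖ₑ * ‖f (z.1 - z.2)‖ₑ ^ s :=
    (hkm.comp measurable_snd).mul ((hf.comp (measurable_fst.sub measurable_snd)).enorm.pow_const s)
  have htot : ∫⁻ x, ‖∫ t, k t * f (x - t)‖ₑ ^ s ≤ I ^ s * ∫⁻ x, ‖f x‖ₑ ^ s := by
    calc _ ≤ ∫⁻ x, I ^ (s - 1) * ∫⁻ t, ‖k t‖ₑ * ‖f (x - t)‖ₑ ^ s := lintegral_mono key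
      _ = I ^ (s - 1) * ∫⁻ x, ∫⁻ t, ‖k t‖ₑ * ‖f (x - t)‖ₑ ^ s :=
          lintegral_const_mul _ hm2.lintegral_prod_right'
      _ = I ^ (s - 1) * (I * ∫⁻ x, ‖f x‖ₑ ^ s) := by
          congr 1
          rw [lintegral_lintegral_swap hm2.aemeasurable, hI, ← lintegral_mul_const _ hkm]
          congr 1 with t
          rw [lintegral_const_mul' _ _ enorm_ne_top,
            lintegral_sub_right_eq_self (fun x => ‖f x‖ₑ ^ s) t]
      _ = _ := by
          rw [← mul_assoc]
          congr 1
          conv_lhs => rw [← ENNReal.rpow_one I, ← ENNReal.rpow_mul, one_mul]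
          rw [← ENNReal.rpow_add_of_nonneg _ _ (by linarith) zero_le_one]
          simp
  rw [← hIe]
  calc _ ≤ (I ^ s * ∫⁻ x, ‖f x‖ₑ ^ s) ^ (1 / s) := by
        unfold lsNorm
        gcongr
    _ = _ := by
        rw [ENNReal.mul_rpow_of_nonneg _ _ (by positivity), ← ENNReal.rpow_mul,
          mul_one_div_cancel hs0.ne', ENNReal.rpow_one]
        rfl

lemma testConv_apply' (k : Test) {f : Plane → ℝ} (hf : LocallyIntegrable f)
    (hc : HasCompactSupport f) (x : Plane) : testConv k f x = ∫ t, k t * f (x - t) := by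
  rw [testConv_apply k hf hc, ← integral_sub_left_eq_self (fun t => k t * f (x - t)) volume x]
  congr 1 with t
  rw [sub_sub_cancel, mul_comm]

lemma lsNorm_testConv_le {s : ℝ} (hs : 1 < s) (k : Test) {f : Plane → ℝ} (hf : Measurable f)
    (hfi : LocallyIntegrable f) (hc : HasCompactSupport f) :
    lsNorm s (testConv k f) ≤ ENNReal.ofReal (∫ t, |k t|) * lsNorm s f := by
  have e : (testConv k f : Plane → ℝ) = fun x => ∫ t, k t * f (x - t) := by
    ext x; exact testConv_apply' k hfi hc x
  rw [e]
  exact lsNorm_convolution_le hs k hf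

/-- Convolution with an approximate identity converges in `L^s`. -/
theorem exists_lsNorm_testConv_sub_le {s : ℝ} (hs : 1 < s) {f : Plane → ℝ} (hf : Measurable f)
    (hfi : LocallyIntegrable f) (hc : HasCompactSupport f) (hfs : lsNorm s f ≠ ∞) {M δ : ℝ}
    (hM : 0 ≤ M) (hδ : 0 < δ) :
    ∃ R : ℝ, 0 < R ∧ ∀ k : Test, tsupport k ⊆ Metric.closedBall 0 R → ∫ x, k x = 1 →
      ∫ x, |k x| ≤ M → lsNorm s (fun x => testConv k f x - f x) ≤ ENNReal.ofReal δ := by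
  have hs0 : 0 < s := by linarith
  have hmem : MemLp f (ENNReal.ofReal s) := ⟨hf.aestronglyMeasurable, by
    rw [← lsNorm_eq_eLpNorm hs0]; exact hfs.lt_top⟩
  -- Replacing `f` by a smooth function up to a small `L^s` error, stable under convolution by
  -- Young's inequality, leaves a Lipschitz function with compact support.
  obtain ⟨h, hhc, hhs, hfh⟩ := hmem.exist_eLpNorm_sub_le (ENNReal.ofReal_ne_top)
    (by simpa using ENNReal.ofReal_le_ofReal hs.le) (show 0 < δ / (2 * (M + 1)) by positivity)
  obtain ⟨g, hg⟩ : ∃ g : Test, (g : Plane → ℝ) = h :=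
    ⟨⟨h, hhs, hhc, fun _ _ => trivial⟩, rfl⟩
  subst hg
  have hfh' : lsNorm s (fun x => f x - g x) ≤ ENNReal.ofReal (δ / (2 * (M + 1))) := by
    rw [lsNorm_eq_eLpNorm hs0]; exact hfh
  obtain ⟨L, hL0, hL⟩ := g.exists_lipschitz
  obtain ⟨r, hr0, hr⟩ := g.exists_radius
  set V := volume.real (Metric.closedBall (0 : Plane) (r + 1)) with hV
  set K := L * M * V ^ (1 / s) with hK
  have hK0 : 0 ≤ K := by positivity
  refine ⟨min 1 (δ / (2 * (K + 1))), by positivity, fun k hk hk1 hkM => ?_⟩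
  set R := min 1 (δ / (2 * (K + 1))) with hR
  have hR0 : 0 < R := by positivity
  have hR1 : R ≤ 1 := min_le_left _ _
  have hRK : K * R ≤ δ / 2 := by
    have : R * (2 * (K + 1)) ≤ δ := by
      rw [← le_div_iff₀ (by positivity)]; exact min_le_right _ _
    nlinarith
  have hgm : Measurable (g : Plane → ℝ) := g.continuous.measurable
  -- the smooth part
  have h1 : lsNorm s (fun x => testConv k g x - g x) ≤ ENNReal.ofReal (δ / 2) := by
    have hbd : ∀ x, ‖testConv k g x - g x‖ₑ ^ s ≤
        (Metric.closedBall (0 : Plane) (r + 1)).indicator (fun _ => ENNReal.ofReal (L * R * M) ^ s) x := by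
      intro x
      by_cases hx : x ∈ Metric.closedBall (0 : Plane) (r + 1)
      · rw [indicator_of_mem hx, Real.enorm_eq_ofReal_abs]
        gcongr
        exact (abs_testConv_sub_le hk hk1 hL0 hL x).trans (by gcongr)
      · rw [mem_closedBall_zero_iff, not_le] at hx
        have h2 : testConv k g x = 0 := by
          refine image_eq_zero_of_notMem_tsupport fun h' => ?_
          have := tsupport_testConv hk hr h'
          rw [mem_closedBall_zero_iff] at this
          linarith
        have h3 : g x = 0 := by
          refine image_eq_zero_of_notMem_tsupport fun h' => ?_
          have := hr h'
          rw [mem_closedBall_zero_iff] at this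
          linarith
        rw [h2, h3]
        simp [hs0]
    calc _ ≤ (∫⁻ x, (Metric.closedBall (0 : Plane) (r + 1)).indicator
          (fun _ => ENNReal.ofReal (L * R * M) ^ s) x) ^ (1 / s) :=
          ENNReal.rpow_le_rpow (lintegral_mono hbd) (by positivity)
      _ = ENNReal.ofReal (L * R * M) * ENNReal.ofReal V ^ (1 / s) := by
          rw [lintegral_indicator_const Metric.isClosed_closedBall.measurableSet,
            ENNReal.mul_rpow_of_nonneg _ _ (by positivity), ← ENNReal.rpow_mul,
            mul_one_div_cancel hs0.ne', ENNReal.rpow_one, hV,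
            ofReal_measureReal measure_closedBall_lt_top.ne]
      _ ≤ _ := by
          rw [ENNReal.ofReal_rpow_of_nonneg measureReal_nonneg (by positivity),
            ← ENNReal.ofReal_mul (by positivity)]
          refine ENNReal.ofReal_le_ofReal (le_trans (le_of_eq ?_) hRK)
          rw [hK]; ring
  -- the rough part
  have h2 : lsNorm s (fun x => ∫ t, k t * (f (x - t) - g (x - t)))
      ≤ ENNReal.ofReal (M * (δ / (2 * (M + 1)))) := by
    refine (lsNorm_convolution_le hs k (hf.sub hgm)).trans ?_
    rw [ENNReal.ofReal_mul hM]
    exact mul_le_mul' (ENNReal.ofReal_le_ofReal hkM) hfh'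
  have e : (fun x => testConv k f x - f x) = fun x => (∫ t, k t * (f (x - t) - g (x - t)))
      + ((testConv k g x - g x) - (f x - g x)) := by
    ext x
    simp_rw [mul_sub]
    rw [integral_sub, ← testConv_apply' k hfi hc,
      ← testConv_apply' k g.continuous.locallyIntegrable g.hasCompactSupport]
    · ring
    · have := integrable_mul_comp_sub hfi hc k.continuous x
      have h3 := this.comp_sub_left x
      refine h3.congr (Eventually.of_forall fun t => ?_)
      simp [mul_comm]
    · exact integrable_mul_comp_sub k.continuous.locallyIntegrable k.hasCompactSupport g.continuous x
  have hm1 : Measurable fun x => testConv k g x - g x :=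
    (testConv k g).continuous.measurable.sub hgm
  have hm2 : Measurable fun x => f x - g x := hf.sub hgm
  have hm3 : Measurable fun x => ∫ t, k t * (f (x - t) - g (x - t)) := by
    have : Measurable fun z : Plane × Plane => k z.2 * (f (z.1 - z.2) - g (z.1 - z.2)) :=
      (k.continuous.measurable.comp measurable_snd).mul
        (hm2.comp (measurable_fst.sub measurable_snd))
    exact this.stronglyMeasurable.integral_prod_right'.measurable
  rw [e]
  calc _ ≤ _ := lsNorm_add_le hs.le hm3 (hm1.sub hm2)
    _ ≤ ENNReal.ofReal (M * (δ / (2 * (M + 1)))) + (ENNReal.ofReal (δ / 2)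
        + ENNReal.ofReal (δ / (2 * (M + 1)))) :=
        add_le_add h2 ((lsNorm_sub_le hs.le hm1 hm2).trans (add_le_add h1 hfh'))
    _ = ENNReal.ofReal δ := by
        rw [← ENNReal.ofReal_add (by positivity) (by positivity),
          ← ENNReal.ofReal_add (by positivity) (by positivity)]
        congr 1
        field_simp
        ring

end Anderson
end

noncomputable section
namespace Anderson

/-! ### The kernel `∇G` and the enhanced noise -/

/-- The `i`-th component of `∇G`. -/
def gradComp (χ : Test) (i : Fin 2) (x : Plane) : ℝ := gradient (green χ) x i

section

variable {χ : Test}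

lemma measurable_gradComp (χ : Test) (i : Fin 2) : Measurable (gradComp χ i) :=
  (EuclideanSpace.proj (𝕜 := ℝ) i).continuous.measurable.comp (measurable_gradient_green χ)

lemma abs_gradComp_le (χ : Test) (i : Fin 2) (x : Plane) :
    |gradComp χ i x| ≤ ‖gradient (green χ) x‖ := by
  exact PiLp.norm_apply_le (gradient (green χ) x) i

lemma gradComp_eq_zero (hχ : IsCutoff χ) (i : Fin 2) {x : Plane}
    (hx : x ∉ Metric.closedBall (0 : Plane) 2) : gradComp χ i x = 0 := by
  rw [gradComp, gradient_green_eq_zero hχ hx]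
  rfl

lemma hasCompactSupport_gradComp (hχ : IsCutoff χ) (i : Fin 2) : HasCompactSupport (gradComp χ i) :=
  HasCompactSupport.intro (isCompact_closedBall (0 : Plane) 2) fun _ hx => gradComp_eq_zero hχ i hx

lemma integrable_gradComp (hχ : IsCutoff χ) (i : Fin 2) : Integrable (gradComp χ i) :=
  (integrable_gradient_green hχ).norm.mono' (measurable_gradComp χ i).aestronglyMeasurable
    (Eventually.of_forall fun x => abs_gradComp_le χ i x)

lemma locallyIntegrable_gradComp (hχ : IsCutoff χ) (i : Fin 2) :
    LocallyIntegrable (gradComp χ i) := (integrable_gradComp hχ i).locallyIntegrable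

/-- The kernel is bounded by a multiple of `1 / |x|` and compactly supported, and `|x| ^ (-s)` is
locally integrable in the plane for `s < 2`. Together with the chaos bounds in `L^s`, this is what
makes the renormalised square converge. -/
lemma lsNorm_gradComp_ne_top (hχ : IsCutoff χ) (i : Fin 2) {s : ℝ} (hs : 0 < s) (hs2 : s < 2) :
    lsNorm s (gradComp χ i) ≠ ∞ := by
  obtain ⟨C, hC⟩ := exists_norm_gradient_green_le hχ
  have hC0 : 0 ≤ C := by
    have h := hC (EuclideanSpace.single 0 1) (by simp)
    simp only [PiLp.norm_single, norm_one, Real.one_rpow, mul_one] at h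
    exact (norm_nonneg _).trans h
  have hm : Measurable fun x => |gradComp χ i x| ^ s := (measurable_gradComp χ i).abs.pow_const s
  have h : LocallyIntegrable fun x => |gradComp χ i x| ^ s := by
    refine locallyIntegrable_of_norm_le_rpow (C := C ^ s) (α := s) (by simp) (by simpa using hs2) ?_
      hm.aestronglyMeasurable
    have h0 : ∀ᵐ x : Plane, x ≠ 0 := by simp [ae_iff]
    filter_upwards [h0] with x hx
    rw [Real.norm_of_nonneg (by positivity)]
    calc |gradComp χ i x| ^ s ≤ (C * ‖x‖ ^ (-1 : ℝ)) ^ s := by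
          gcongr
          exact (abs_gradComp_le χ i x).trans (hC x hx)
      _ = _ := by
          rw [Real.mul_rpow hC0 (by positivity), ← Real.rpow_mul (norm_nonneg _)]
          congr 2
          ring
  have h2 : Integrable fun x => |gradComp χ i x| ^ s := by
    rw [← integrableOn_iff_integrable_of_support_subset
      (s := Metric.closedBall (0 : Plane) 2) (fun x hx => by
        by_contra h'
        exact hx (by simp [gradComp_eq_zero hχ i h', hs.ne']))]
    exact h.integrableOn_isCompact (isCompact_closedBall _ _)
  have h3 := h2.lintegral_lt_top
  rw [lsNorm]
  refine ENNReal.rpow_ne_top_of_nonneg (by positivity) (ne_of_lt ?_)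
  refine lt_of_le_of_lt (le_of_eq ?_) h3
  congr 1 with x
  rw [Real.enorm_eq_ofReal_abs, ENNReal.ofReal_rpow_of_nonneg (abs_nonneg _) hs.le]

lemma integrable_mul_gradComp (hχ : IsCutoff χ) (i : Fin 2) {f : Plane → ℝ} (hf : Continuous f)
    (x : Plane) : Integrable fun y => gradComp χ i y * f (x - y) :=
  integrable_mul_comp_sub (locallyIntegrable_gradComp hχ i) (hasCompactSupport_gradComp hχ i) hf x

lemma gradGreenConv_apply {f : Plane → ℝ} {x : Plane}
    (hf : Integrable fun y => f (x - y) • gradient (green χ) y) (i : Fin 2) :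
    gradGreenConv χ f x i = ∫ y, gradComp χ i y * f (x - y) := by
  have h := (EuclideanSpace.proj i : Plane →L[ℝ] ℝ).integral_comp_comm hf
  rw [gradGreenConv]
  refine (h.symm).trans ?_
  congr 1 with y
  simp [gradComp, mul_comm]

lemma sq_norm_gradGreenConv {f : Plane → ℝ} {x : Plane}
    (hf : Integrable fun y => f (x - y) • gradient (green χ) y) :
    ‖gradGreenConv χ f x‖ ^ 2 = ∑ i, (∫ y, gradComp χ i y * f (x - y)) ^ 2 := by
  rw [EuclideanSpace.real_norm_sq_eq]
  simp_rw [gradGreenConv_apply hf]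

/-- The kernel `∂ᵢG * k`. -/
def gradKernel (χ k : Test) (i : Fin 2) : Test := testConv k (gradComp χ i)

/-- Associativity transfers the mollifier to the singular kernel: each component of the gradient
becomes the convolution of the distribution with one test function. -/
lemma sq_norm_gradGreenConv_conv (hχ : IsCutoff χ) {α b : ℝ} (hb : 0 ≤ b) {T : Distrib}
    (hT : T ∈ holderSubgroup α (polyWeight b)) (k : Test) (x : Plane) :
    ‖gradGreenConv χ (conv T k) x‖ ^ 2 = ∑ i, conv T (gradKernel χ k i) x ^ 2 := by
  rw [sq_norm_gradGreenConv (integrable_smul_gradient_green hχ (continuous_conv hb hT k) x)]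
  congr 1 with i
  rw [integral_mul_conv hb hT k (locallyIntegrable_gradComp hχ i) (hasCompactSupport_gradComp hχ i)]
  rfl

lemma testConv_gradKernel (hχ : IsCutoff χ) (k w : Test) (i : Fin 2) :
    testConv w (gradKernel χ k i) = gradKernel χ (testConv w k) i := by
  ext x
  have h := integral_mul_conv_ofFun w k (locallyIntegrable_gradComp hχ i)
    (hasCompactSupport_gradComp hχ i) x
  rw [conv_ofFun_test, conv_ofFun_test] at h
  rw [gradKernel, gradKernel, testConv_apply (testConv w k) (locallyIntegrable_gradComp hχ i)
    (hasCompactSupport_gradComp hχ i), testConv_comm w k, h, testConv_comm]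

end

lemma IsMollifier.reflect_rescale {ρ : Test} (hρ : IsMollifier ρ) (ε : ℝ) (x : Plane) :
    reflect (rescale ρ ε 0) x = rescale ρ ε x := by
  ext y
  rw [reflect_apply, rescale_apply, rescale_apply, ← hρ.even (ε⁻¹ • (y - x)), ← smul_neg, neg_sub,
    sub_zero]

lemma mollify_eq_conv {ρ : Test} (hρ : IsMollifier ρ) (ε : ℝ) (T : Distrib) :
    mollify ρ ε T = conv T (rescale ρ ε 0) := by
  ext x
  rw [mollify, conv, hρ.reflect_rescale]

/-- The renormalised square `∑ᵢ ((ξ * wᵢ)² - ‖wᵢ‖²)`. -/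
def wickSq (T : Distrib) (w : Fin 2 → Test) (x : Plane) : ℝ :=
  ∑ i, (conv T (w i) x ^ 2 - l2inner (w i) (w i))

section

variable {κ b : ℝ} {P : Measure (Noise κ b)} {ρ χ : Test}

/-- The variance of white noise tested on a kernel is its squared `L²` norm, which translations and
reflections preserve. The renormalisation is thus exactly the Wick subtraction, kernel by kernel. -/
lemma renormConst_eq (hP : IsWhiteNoise P) (hb : 0 ≤ b) (hρ : IsMollifier ρ) (hχ : IsCutoff χ)
    (ε : ℝ) : renormConst ρ χ P ε
      = ∑ i, l2inner (gradKernel χ (rescale ρ ε 0) i) (gradKernel χ (rescale ρ ε 0) i) := by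
  rw [renormConst]
  have e : ∀ ξ : Noise κ b, ‖gradGreenConv χ (mollify ρ ε ξ.toDistrib) 0‖ ^ 2
      = ∑ i, ξ.toDistrib (reflect (gradKernel χ (rescale ρ ε 0) i) 0) ^ 2 := fun ξ => by
    rw [mollify_eq_conv hρ, sq_norm_gradGreenConv_conv hχ hb ξ.mem]
    rfl
  simp_rw [e]
  rw [integral_finsetSum _ fun i _ => by simpa [sq] using hP.integrable_mul _ _]
  congr 1 with i
  rw [hP.integral_sq, l2inner_reflect_same]

lemma enhancedNoise_fst (hκ : 0 < κ) (hb : 0 < b) (hbκ : b < κ / 2) (hρ : IsMollifier ρ)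
    (hχ : IsCutoff χ) {ε : ℝ} (hε : ε ∈ Ioc (0 : ℝ) 1) (ξ : Noise κ b) :
    (enhancedNoise ρ χ P ε ξ).1.toDistrib = ofFun (conv ξ.toDistrib (rescale ρ ε 0)) := by
  rw [(toDistrib_enhancedNoise hκ hb hbκ hρ hχ P hε ξ).1, mollify_eq_conv hρ]

lemma enhancedNoise_snd (hP : IsWhiteNoise P) (hκ : 0 < κ) (hb : 0 < b) (hbκ : b < κ / 2)
    (hρ : IsMollifier ρ) (hχ : IsCutoff χ) {ε : ℝ} (hε : ε ∈ Ioc (0 : ℝ) 1) (ξ : Noise κ b) :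
    (enhancedNoise ρ χ P ε ξ).2.toDistrib
      = ofFun (wickSq ξ.toDistrib (gradKernel χ (rescale ρ ε 0))) := by
  rw [(toDistrib_enhancedNoise hκ hb hbκ hρ hχ P hε ξ).2]
  congr 1 with x
  rw [renormConst_eq hP hb.le hρ hχ, mollify_eq_conv hρ, sq_norm_gradGreenConv_conv hχ hb.le ξ.mem,
    wickSq, Finset.sum_sub_distrib]

end

end Anderson
end

noncomputable section
namespace Anderson

/-! ### Convergence in probability -/

section

variable {Ω E : Type*} [MeasurableSpace Ω] {P : Measure Ω} [IsFiniteMeasure P] [PseudoMetricSpace E]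

/-- For a countably generated filter it is enough to test along sequences, where the classical
statement applies. -/
lemma tendstoInMeasure_of_tendsto_ae_filter [SecondCountableTopology E] [MeasurableSpace E]
    [BorelSpace E] {ι : Type*} {l : Filter ι} [l.IsCountablyGenerated] {X : ι → Ω → E} {Y : Ω → E}
    (hX : ∀ i, Measurable (X i)) (h : ∀ᵐ ω ∂P, Tendsto (fun i => X i ω) l (𝓝 (Y ω))) :
    TendstoInMeasure P X l Y := by
  intro δ hδ
  refine tendsto_of_seq_tendsto fun u hu => ?_
  refine tendstoInMeasure_of_tendsto_ae (f := fun n => X (u n))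
    (fun n => (hX (u n)).stronglyMeasurable.aestronglyMeasurable) ?_ δ hδ
  filter_upwards [h] with ω hω using hω.comp hu

/-- A family of random variables which is Cauchy in probability converges in probability. -/
theorem exists_tendstoInMeasure [CompleteSpace E] [SecondCountableTopology E] [MeasurableSpace E]
    [BorelSpace E] {X : ℝ → Ω → E} (hX : ∀ ε, Measurable (X ε))
    (hC : ∀ δ : ℝ, 0 < δ → ∀ r : ℝ≥0∞, 0 < r → ∃ ε₀ : ℝ, 0 < ε₀ ∧ ∀ ε ∈ Ioo 0 ε₀, ∀ ε' ∈ Ioo 0 ε₀,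
      P {ω | δ ≤ dist (X ε ω) (X ε' ω)} ≤ r) :
    ∃ Y : Ω → E, AEMeasurable Y P ∧ TendstoInMeasure P X (𝓝[>] 0) Y := by
  have hpow : ∀ n : ℕ, (0 : ℝ≥0∞) < 2⁻¹ ^ n := fun n => ENNReal.pow_pos (by simp) n
  choose r hr0 hr using fun n : ℕ => hC ((2 : ℝ)⁻¹ ^ n) (by positivity) (2⁻¹ ^ n) (hpow n)
  -- A decreasing sequence is required: both `e n` and `e (n + 1)` must lie below the threshold `r
  -- n`.
  obtain ⟨e, he0, her, hanti, helim⟩ : ∃ e : ℕ → ℝ, (∀ n, 0 < e n) ∧ (∀ n, e n < r n) ∧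
      (∀ n, e (n + 1) ≤ e n) ∧ ∀ n : ℕ, e n ≤ 1 / ((n : ℝ) + 1) := by
    let e : ℕ → ℝ := fun n => Nat.rec (min (r 0 / 2) 1)
      (fun k x => min x (min (r (k + 1) / 2) (1 / (((k + 1 : ℕ) : ℝ) + 1)))) n
    have hs : ∀ k, e (k + 1) = min (e k) (min (r (k + 1) / 2) (1 / (((k + 1 : ℕ) : ℝ) + 1))) :=
      fun k => rfl
    have h0 : e 0 = min (r 0 / 2) 1 := rfl
    refine ⟨e, fun n => ?_, fun n => ?_, fun n => ?_, fun n => ?_⟩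
    · induction n with
      | zero => rw [h0]; exact lt_min (half_pos (hr0 0)) one_pos
      | succ k ih => rw [hs]; exact lt_min ih (lt_min (half_pos (hr0 _)) (by positivity))
    · cases n with
      | zero => rw [h0]; exact (min_le_left _ _).trans_lt (half_lt_self (hr0 0))
      | succ k =>
        rw [hs]
        exact ((min_le_right _ _).trans (min_le_left _ _)).trans_lt (half_lt_self (hr0 _))
    · rw [hs]; exact min_le_left _ _
    · cases n with
      | zero => rw [h0]; simp
      | succ k => rw [hs]; exact (min_le_right _ _).trans (min_le_right _ _)
  have het : Tendsto e atTop (𝓝 0) := squeeze_zero (fun n => (he0 n).le) helim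
    tendsto_one_div_add_atTop_nhds_zero_nat
  -- Borel-Cantelli: the exceptional probabilities are summable, so eventually consecutive distances
  -- are below `2⁻¹ ^ n`.
  have hcauchy : ∀ᵐ ω ∂P, CauchySeq fun n => X (e n) ω := by
    have hsum : ∑' n, P {ω | (2 : ℝ)⁻¹ ^ n ≤ dist (X (e n) ω) (X (e (n + 1)) ω)} ≠ ∞ := by
      refine ne_top_of_le_ne_top ?_ (ENNReal.tsum_le_tsum fun n => hr n (e n) ⟨he0 n, her n⟩
        (e (n + 1)) ⟨he0 _, (hanti n).trans_lt (her n)⟩)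
      rw [ENNReal.tsum_geometric, ENNReal.one_sub_inv_two, inv_inv]
      exact ENNReal.ofNat_ne_top
    filter_upwards [ae_eventually_notMem hsum] with ω hω
    refine cauchySeq_of_summable_dist ?_
    refine Summable.of_norm_bounded_eventually_nat (g := fun n => (2 : ℝ)⁻¹ ^ n)
      (summable_geometric_of_lt_one (by norm_num) (by norm_num)) ?_
    filter_upwards [hω] with n hn
    rw [Real.norm_of_nonneg dist_nonneg]
    exact (not_le.1 hn).le
  classical
  -- The value on the null set of divergence is immaterial; `X 0` merely supplies a point of `E`.
  let Y : Ω → E := fun ω => if h : ∃ y, Tendsto (fun n => X (e n) ω) atTop (𝓝 y) then h.choose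
    else X 0 ω
  have hY : ∀ᵐ ω ∂P, Tendsto (fun n => X (e n) ω) atTop (𝓝 (Y ω)) := by
    filter_upwards [hcauchy] with ω hω
    have h : ∃ y, Tendsto (fun n => X (e n) ω) atTop (𝓝 y) := cauchySeq_tendsto_of_complete hω
    simp only [Y, dif_pos h]
    exact h.choose_spec
  refine ⟨Y, aemeasurable_of_tendsto_metrizable_ae atTop (fun n => (hX (e n)).aemeasurable) hY, ?_⟩
  have hin : TendstoInMeasure P (fun n => X (e n)) atTop Y := tendstoInMeasure_of_tendsto_ae
    (fun n => (hX (e n)).stronglyMeasurable.aestronglyMeasurable) hY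
  rw [tendstoInMeasure_iff_dist] at hin ⊢
  intro δ hδ
  rw [ENNReal.tendsto_nhds_zero]
  intro q hq
  have hq2 : 0 < q / 2 := ENNReal.half_pos hq.ne'
  obtain ⟨ε₀, hε₀, hε⟩ := hC (δ / 2) (half_pos hδ) (q / 2) hq2
  have h1 := (ENNReal.tendsto_nhds_zero.1 (hin (δ / 2) (half_pos hδ))) (q / 2) hq2
  obtain ⟨n, hn1, hn2⟩ := (h1.and (het.eventually (gt_mem_nhds hε₀))).exists
  filter_upwards [Ioo_mem_nhdsGT hε₀] with ε hεm
  -- The Cauchy property transfers convergence from the sequence `e` to the whole family, through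
  -- one comparison index `n`.
  calc P {ω | δ ≤ dist (X ε ω) (Y ω)}
      ≤ P ({ω | δ / 2 ≤ dist (X ε ω) (X (e n) ω)} ∪ {ω | δ / 2 ≤ dist (X (e n) ω) (Y ω)}) := by
        refine measure_mono fun ω hω => ?_
        by_contra hcon
        simp only [mem_union, mem_ofPred_eq, not_or, not_le] at hcon hω
        have := dist_triangle (X ε ω) (X (e n) ω) (Y ω)
        linarith
    _ ≤ q / 2 + q / 2 := (measure_union_le _ _).trans
        (add_le_add (hε ε hεm (e n) ⟨he0 n, hn2⟩) hn1)
    _ = q := ENNReal.add_halves q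

end

/-! ### Existence of the limiting enhanced noise -/

lemma holderNorm_weight_anti {a b : ℝ} (hab : a ≤ b) (α : ℝ) (T : Distrib) :
    holderNorm α (polyWeight b) T ≤ holderNorm α (polyWeight a) T := by
  refine iSup_le fun x => iSup₂_le fun l hl => iSup₂_le fun φ hφ => ?_
  refine le_trans (ENNReal.ofReal_le_ofReal ?_) (le_holderNorm T hφ hl x)
  have h1 := polyWeight_pos a x
  have hl0 : 0 < l ^ α := Real.rpow_pos_of_pos hl.1 α
  gcongr
  exact polyWeight_mono hab x

lemma holderSubgroup_weight_mono {a b : ℝ} (hab : a ≤ b) {α : ℝ} {T : Distrib}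
    (hT : T ∈ holderSubgroup α (polyWeight a)) : T ∈ holderSubgroup α (polyWeight b) :=
  ⟨(holderNorm_weight_anti hab α T).trans_lt hT.1, fun δ hδ =>
    let ⟨g, hg⟩ := hT.2 δ hδ
    ⟨g, (holderNorm_weight_anti hab α _).trans_lt hg⟩⟩

/-- The identity `a² - b² = (a - b)(a + b)` holds for the squares and for their means alike, so the
difference is a Wick product in which one kernel, `w i - w' i`, is small. -/
lemma wickSq_sub (T : Distrib) (w w' : Fin 2 → Test) (x : Plane) :
    wickSq T w x - wickSq T w' x = ∑ i, (conv T (w i - w' i) x * conv T (w i + w' i) x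
      - l2inner (w i - w' i) (w i + w' i)) := by
  rw [wickSq, wickSq, ← Finset.sum_sub_distrib]
  congr 1 with i
  rw [conv_sub_right, conv_add_right, l2inner_sub_left, l2inner_add_right, l2inner_add_right,
    l2inner_comm (w' i) (w i)]
  ring

lemma continuous_wickSq {α b : ℝ} (hb : 0 ≤ b) {T : Distrib}
    (hT : T ∈ holderSubgroup α (polyWeight b)) (w : Fin 2 → Test) : Continuous (wickSq T w) :=
  continuous_finsetSum _ fun i _ => ((continuous_conv hb hT (w i)).pow 2).sub continuous_const

lemma ofFun_finsetSum {ι : Type*} (s : Finset ι) {f : ι → Plane → ℝ}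
    (hf : ∀ i, LocallyIntegrable (f i)) :
    ofFun (fun x => ∑ i ∈ s, f i x) = ∑ i ∈ s, ofFun (f i) := by
  ext φ
  rw [ofFun_apply]
  · simp_rw [Finset.mul_sum]
    rw [integral_finsetSum]
    · have : ∀ i, ∫ x, φ x * f i x = ofFun (f i) φ := fun i => (ofFun_apply (hf i) φ).symm
      simp_rw [this]
      simp
    · intro i _
      simpa using φ.integrable_bilin (ContinuousLinearMap.mul ℝ ℝ)
        ((hf i).locallyIntegrableOn ((⊤ : Opens Plane) : Set Plane))
  · exact locallyIntegrable_finsetSum _ fun i _ => hf i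

lemma holderNorm_finsetSum_le (α : ℝ) (w : Plane → ℝ) {ι : Type*} (s : Finset ι)
    (T : ι → Distrib) : holderNorm α w (∑ i ∈ s, T i) ≤ ∑ i ∈ s, holderNorm α w (T i) := by
  classical
  induction s using Finset.induction_on with
  | empty => simp [holderNorm_zero]
  | insert i s hi ih =>
    rw [Finset.sum_insert hi, Finset.sum_insert hi]
    exact (holderNorm_add_le _ _ _ _).trans (by gcongr)

end Anderson
end

/-! ### Measurability and convergence in probability of the enhanced noise -/

noncomputable section
namespace Anderson

lemma exists_ofReal_mul_rpow_le {C A : ℝ≥0∞} (hC : C ≠ ∞) (hA : A ≠ ∞) {p : ℝ} (hp : 0 < p)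
    {r : ℝ≥0∞} (hr : 0 < r) : ∃ γ : ℝ, 0 < γ ∧ C * (ENNReal.ofReal γ * A) ^ p ≤ r := by
  have h1 : Tendsto (fun t : ℝ≥0∞ => C * (t * A) ^ p) (𝓝 0) (𝓝 (C * (0 * A) ^ p)) := by
    refine ENNReal.Tendsto.const_mul ?_ (Or.inr hC)
    exact (ENNReal.continuous_rpow_const.tendsto _).comp
      (ENNReal.Tendsto.mul_const tendsto_id (Or.inr hA))
  rw [zero_mul, ENNReal.zero_rpow_of_pos hp, mul_zero] at h1
  have h2 : Tendsto (fun γ : ℝ => ENNReal.ofReal γ) (𝓝[>] 0) (𝓝 0) := by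
    have := (ENNReal.continuous_ofReal.tendsto 0).mono_left (nhdsWithin_le_nhds (s := Ioi 0))
    simpa using this
  obtain ⟨γ, hγ1, hγ2⟩ := (((ENNReal.tendsto_nhds_zero.1 (h1.comp h2)) r hr).and
    self_mem_nhdsWithin).exists
  exact ⟨γ, hγ2, hγ1⟩

/-- Wick products and first-order terms built from kernels which are small in `L^s` are small in
probability. -/
theorem exists_chaos_small {η : Test} (hη : tsupport η ⊆ Metric.closedBall 0 1)
    (hη1 : ∫ x, η x = 1) {κ a : ℝ} (hκ : 0 < κ) (hκ1 : κ < 1) (ha : 0 < a) :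
    ∃ s : ℝ, 1 < s ∧ s < 2 ∧ ∀ {b : ℝ} {P : Measure (Noise κ b)}, 0 ≤ b → IsWhiteNoise P →
      ∀ (V : ℝ≥0∞) (δ : ℝ) (r : ℝ≥0∞), V ≠ ∞ → 0 < δ → 0 < r → ∃ γ : ℝ, 0 < γ ∧
      (∀ u v : Test, lsNorm s u ≤ ENNReal.ofReal γ → lsNorm s v ≤ V →
        P {ξ | ENNReal.ofReal δ ≤ holderNorm (-κ) (polyWeight a) (ofFun fun x =>
          conv ξ.toDistrib u x * conv ξ.toDistrib v x - l2inner u v)} ≤ r) ∧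
      (∀ w : Test, lsNorm s w ≤ ENNReal.ofReal γ →
        P {ξ | ENNReal.ofReal δ ≤ holderNorm (-κ) (polyWeight a)
          (ofFun (conv ξ.toDistrib w))} ≤ r) := by
  obtain ⟨s, p, C, hs1, hs2, hp, hC, h⟩ := exists_chaos_bounds hη hη1 hκ hκ1 ha
  refine ⟨s, hs1, hs2, fun {b P} hb hP V δ r hV hδ hr => ?_⟩
  obtain ⟨h1, h2⟩ := h hb hP
  have hδ' : (ENNReal.ofReal δ)⁻¹ ≠ ∞ := by simp [hδ]
  obtain ⟨γ₁, hγ₁, hγ₁'⟩ := exists_ofReal_mul_rpow_le hC (ENNReal.mul_ne_top hV hδ') hp hr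
  obtain ⟨γ₂, hγ₂, hγ₂'⟩ := exists_ofReal_mul_rpow_le hC hδ' hp hr
  refine ⟨min γ₁ γ₂, lt_min hγ₁ hγ₂, fun u v hu hv => ?_, fun w hw => ?_⟩
  · refine (h1 u v δ hδ).trans (le_trans ?_ hγ₁')
    rw [div_eq_mul_inv, mul_assoc]
    have := hu.trans (ENNReal.ofReal_le_ofReal (min_le_left γ₁ γ₂))
    gcongr
  · refine (h2 w δ hδ).trans (le_trans ?_ hγ₂')
    rw [div_eq_mul_inv]
    have := hw.trans (ENNReal.ofReal_le_ofReal (min_le_right γ₁ γ₂))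
    gcongr

section

variable {κ b : ℝ} {P : Measure (Noise κ b)} {ρ χ : Test}

lemma measurable_ofFun_conv_apply (κ : ℝ) (hb : 0 ≤ b) (k φ : Test) :
    Measurable fun ξ : Noise κ b => ofFun (conv ξ.toDistrib k) φ := by
  simp_rw [fun ξ : Noise κ b => ofFun_conv_apply hb ξ.mem k φ]
  exact HolderSpace.measurable_eval _ hb _

lemma continuous_wickSq_uncurry (κ : ℝ) (hb : 0 ≤ b) (w : Fin 2 → Test) :
    Continuous fun p : Noise κ b × Plane => wickSq p.1.toDistrib w p.2 :=
  continuous_finsetSum _ fun i _ => ((continuous_conv_uncurry κ hb (w i)).pow 2).sub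
    continuous_const

lemma measurable_ofFun_wickSq_apply (hκ : 0 ≤ κ) (hb : 0 ≤ b) (w : Fin 2 → Test) (φ : Test) :
    Measurable fun ξ : Noise κ b => ofFun (wickSq ξ.toDistrib w) φ := by
  have := secondCountable_holderSpace (α := -1 - κ) (κ := b) (by linarith) hb
  simp_rw [fun ξ : Noise κ b => ofFun_apply (continuous_wickSq hb ξ.mem w).locallyIntegrable φ]
  have h : Continuous fun p : Noise κ b × Plane => φ p.2 * wickSq p.1.toDistrib w p.2 :=
    (φ.continuous.comp continuous_snd).mul (continuous_wickSq_uncurry κ hb w)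
  exact (h.measurable.stronglyMeasurable.integral_prod_right' (ν := volume)).measurable

lemma measurable_enhancedNoise (hP : IsWhiteNoise P) (hκ : 0 < κ) (hb : 0 < b) (hbκ : b < κ / 2)
    (hρ : IsMollifier ρ) (hχ : IsCutoff χ) {ε : ℝ} (hε : ε ∈ Ioc (0 : ℝ) 1) :
    Measurable (enhancedNoise ρ χ P ε) := by
  refine Measurable.prodMk (HolderSpace.measurable_of_eval (by linarith) hκ.le fun φ => ?_)
    (HolderSpace.measurable_of_eval (by linarith) hκ.le fun φ => ?_)
  · have e : ∀ ξ : Noise κ b, (enhancedNoise ρ χ P ε ξ).1.toDistrib φ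
        = ofFun (conv ξ.toDistrib (rescale ρ ε 0)) φ := fun ξ => by
      rw [enhancedNoise_fst hκ hb hbκ hρ hχ hε]
    change Measurable fun ξ => (enhancedNoise ρ χ P ε ξ).1.toDistrib φ
    rw [funext e]
    exact measurable_ofFun_conv_apply κ hb.le (rescale ρ ε 0) φ
  · have e : ∀ ξ : Noise κ b, (enhancedNoise ρ χ P ε ξ).2.toDistrib φ
        = ofFun (wickSq ξ.toDistrib (gradKernel χ (rescale ρ ε 0))) φ := fun ξ => by
      rw [enhancedNoise_snd hP hκ hb hbκ hρ hχ hε]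
    change Measurable fun ξ => (enhancedNoise ρ χ P ε ξ).2.toDistrib φ
    rw [funext e]
    exact measurable_ofFun_wickSq_apply hκ.le hb.le _ φ

/-- The canonical variable, seen in the space with the larger weight. -/
def Noise.incl (hbκ : b ≤ κ) (ξ : Noise κ b) : HolderSpace (-1 - κ) (polyWeight κ) :=
  ⟨ξ.toDistrib, holderSubgroup_weight_mono hbκ ξ.mem⟩

lemma tsupport_rescale_mollifier (hρ : IsMollifier ρ) {ε R : ℝ} (hε : 0 < ε) (hR : ε ≤ R) :
    tsupport (rescale ρ ε 0) ⊆ Metric.closedBall 0 R :=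
  (tsupport_rescale hρ.tsupport_subset hε 0).trans (Metric.closedBall_subset_closedBall hR)

/-- Convergence for every `ξ`, not only almost surely: elements of `Noise κ b` are norm limits of
test functions, and on those mollification converges. -/
lemma tendsto_enhancedNoise_fst (hκ : 0 < κ) (hb : 0 < b) (hbκ : b < κ / 2) (hρ : IsMollifier ρ)
    (hχ : IsCutoff χ) (P : Measure (Noise κ b)) (ξ : Noise κ b) :
    Tendsto (fun ε => (enhancedNoise ρ χ P ε ξ).1) (𝓝[>] 0)
      (𝓝 (ξ.incl (by linarith : b ≤ κ))) := by
  rw [Metric.tendsto_nhds]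
  intro δ hδ
  obtain ⟨R, hR, h⟩ := exists_holderNorm_conv_sub_le (by linarith : -1 - κ ≤ 0) hb.le ξ.mem
    (integral_nonneg fun x => abs_nonneg (ρ x)) hδ
  filter_upwards [Ioo_mem_nhdsGT (lt_min hR one_pos)] with ε hε
  rw [dist_eq_norm]
  refine norm_mk_lt ?_
  rw [HolderSpace.toDistrib_sub, enhancedNoise_fst hκ hb hbκ hρ hχ
    ⟨hε.1, hε.2.le.trans (min_le_right _ _)⟩]
  refine (holderNorm_weight_anti (by linarith) _ _).trans_lt (h _ ?_ ?_ ?_)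
  · exact tsupport_rescale_mollifier hρ hε.1 (hε.2.le.trans (min_le_left _ _))
  · rw [integral_rescale _ hε.1, hρ.integral_eq_one]
  · rw [integral_abs_rescale _ hε.1]

lemma lsNorm_gradKernel_le (hχ : IsCutoff χ) {s : ℝ} (hs : 1 < s) (k : Test) (i : Fin 2) :
    lsNorm s (gradKernel χ k i) ≤ ENNReal.ofReal (∫ t, |k t|) * lsNorm s (gradComp χ i) :=
  lsNorm_testConv_le hs k (measurable_gradComp χ i) (locallyIntegrable_gradComp hχ i)
    (hasCompactSupport_gradComp hχ i)

/-- Mollifications of the kernel `∇G` by kernels with small support are close to each other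
in `L^s`. -/
lemma exists_lsNorm_gradKernel_sub_le (hχ : IsCutoff χ) {s : ℝ} (hs : 1 < s) (hs2 : s < 2)
    {M γ : ℝ} (hM : 0 ≤ M) (hγ : 0 < γ) : ∃ R : ℝ, 0 < R ∧ ∀ k k' : Test,
      tsupport k ⊆ Metric.closedBall 0 R → ∫ x, k x = 1 → ∫ x, |k x| ≤ M →
      tsupport k' ⊆ Metric.closedBall 0 R → ∫ x, k' x = 1 → ∫ x, |k' x| ≤ M →
      ∀ i, lsNorm s (gradKernel χ k i - gradKernel χ k' i : Test) ≤ ENNReal.ofReal γ := by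
  choose R hR0 hR using fun i => exists_lsNorm_testConv_sub_le hs (measurable_gradComp χ i)
    (locallyIntegrable_gradComp hχ i) (hasCompactSupport_gradComp hχ i)
    (lsNorm_gradComp_ne_top hχ i (by linarith) hs2) hM (half_pos hγ)
  refine ⟨min (R 0) (R 1), lt_min (hR0 0) (hR0 1), fun k k' hk hk1 hkM hk' hk1' hkM' i => ?_⟩
  have hRi : min (R 0) (R 1) ≤ R i := by
    fin_cases i
    · exact min_le_left _ _
    · exact min_le_right _ _
  have hsub := Metric.closedBall_subset_closedBall (x := (0 : Plane)) hRi
  have e : ((gradKernel χ k i - gradKernel χ k' i : Test) : Plane → ℝ)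
      = fun x => (testConv k (gradComp χ i) x - gradComp χ i x)
        - (testConv k' (gradComp χ i) x - gradComp χ i x) := by
    ext x
    rw [Test.sub_apply, gradKernel, gradKernel]
    ring
  rw [e]
  refine (lsNorm_sub_le hs.le ((testConv k _).continuous.measurable.sub (measurable_gradComp χ i))
    ((testConv k' _).continuous.measurable.sub (measurable_gradComp χ i))).trans ?_
  refine (add_le_add (hR i k (hk.trans hsub) hk1 hkM) (hR i k' (hk'.trans hsub) hk1' hkM')).trans ?_
  rw [← ENNReal.ofReal_add (by positivity) (by positivity), add_halves]

lemma ofFun_wickSq_sub (hb : 0 ≤ b) (ξ : Noise κ b) (w w' : Fin 2 → Test) :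
    ofFun (wickSq ξ.toDistrib w) - ofFun (wickSq ξ.toDistrib w')
      = ∑ i, ofFun fun x => conv ξ.toDistrib (w i - w' i) x * conv ξ.toDistrib (w i + w' i) x
        - l2inner (w i - w' i) (w i + w' i) := by
  rw [← ofFun_sub (continuous_wickSq hb ξ.mem w).locallyIntegrable
    (continuous_wickSq hb ξ.mem w').locallyIntegrable, ← ofFun_finsetSum]
  · congr 1 with x
    exact wickSq_sub _ _ _ _
  · intro i
    exact (((continuous_conv hb ξ.mem _).mul (continuous_conv hb ξ.mem _)).sub
      continuous_const).locallyIntegrable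

/-- The difference consists of Wick products of kernels `w - w'`, which are small in `L^s`, and `w +
w'`, which are bounded there uniformly in `ε`. The conclusion records that `ε` stays in `(0, 1]`,
where the second component is given by the Wick square. -/
lemma exists_measure_enhancedNoise_snd_le (hP : IsWhiteNoise P) (hκ : 0 < κ) (hκ1 : κ < 1)
    (hb : 0 < b) (hbκ : b < κ / 2) (hρ : IsMollifier ρ) (hχ : IsCutoff χ) {δ : ℝ} (hδ : 0 < δ)
    {r : ℝ≥0∞} (hr : 0 < r) : ∃ ε₀ : ℝ, 0 < ε₀ ∧ ∀ ε ∈ Ioo 0 ε₀, ∀ ε' ∈ Ioo 0 ε₀,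
      ε ∈ Ioc (0 : ℝ) 1 ∧ P {ξ | δ ≤ dist (enhancedNoise ρ χ P ε ξ).2
        (enhancedNoise ρ χ P ε' ξ).2} ≤ r := by
  obtain ⟨s, hs1, hs2, h⟩ := exists_chaos_small hρ.tsupport_subset hρ.integral_eq_one hκ hκ1 hκ
  set M : ℝ := ∫ x, |ρ x| with hM
  have hM0 : 0 ≤ M := integral_nonneg fun x => abs_nonneg _
  -- A bound for the sums of two mollified kernels, valid for all `ε` since the rescaled mollifiers
  -- share the same `L¹` norm.
  set V : ℝ≥0∞ := ∑ i, (ENNReal.ofReal M * lsNorm s (gradComp χ i)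
    + ENNReal.ofReal M * lsNorm s (gradComp χ i)) with hV
  have hVt : V ≠ ∞ := ENNReal.sum_ne_top.2 fun i _ => by
    have := ENNReal.mul_ne_top (ENNReal.ofReal_ne_top (r := M))
      (lsNorm_gradComp_ne_top hχ i (by linarith : 0 < s) hs2)
    exact ENNReal.add_ne_top.2 ⟨this, this⟩
  obtain ⟨γ, hγ, h1, -⟩ := h hb.le hP V (δ / 2) (r / 2) hVt (half_pos hδ) (ENNReal.half_pos hr.ne')
  obtain ⟨R, hR, hRk⟩ := exists_lsNorm_gradKernel_sub_le hχ hs1 hs2 hM0 hγ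
  refine ⟨min R 1, lt_min hR one_pos, fun ε hε ε' hε' => ?_⟩
  have hε1 : ε ∈ Ioc (0 : ℝ) 1 := ⟨hε.1, hε.2.le.trans (min_le_right _ _)⟩
  have hε1' : ε' ∈ Ioc (0 : ℝ) 1 := ⟨hε'.1, hε'.2.le.trans (min_le_right _ _)⟩
  refine ⟨hε1, ?_⟩
  set w := gradKernel χ (rescale ρ ε 0) with hw
  set w' := gradKernel χ (rescale ρ ε' 0) with hw'
  have hI : ∀ {e : ℝ}, 0 < e → ∫ x, |rescale ρ e 0 x| = M := fun he => integral_abs_rescale _ he _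
  have hu : ∀ i, lsNorm s (w i - w' i : Test) ≤ ENNReal.ofReal γ := hRk _ _
    (tsupport_rescale_mollifier hρ hε.1 (hε.2.le.trans (min_le_left _ _)))
    (by rw [integral_rescale _ hε.1, hρ.integral_eq_one]) (hI hε.1).le
    (tsupport_rescale_mollifier hρ hε'.1 (hε'.2.le.trans (min_le_left _ _)))
    (by rw [integral_rescale _ hε'.1, hρ.integral_eq_one]) (hI hε'.1).le
  have hv : ∀ i, lsNorm s (w i + w' i : Test) ≤ V := fun i => by
    have e : ((w i + w' i : Test) : Plane → ℝ) = fun x => w i x + w' i x := rfl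
    rw [e]
    refine (lsNorm_add_le hs1.le (w i).continuous.measurable (w' i).continuous.measurable).trans ?_
    have a1 := lsNorm_gradKernel_le hχ hs1 (rescale ρ ε 0) i
    have a2 := lsNorm_gradKernel_le hχ hs1 (rescale ρ ε' 0) i
    rw [hI hε.1] at a1
    rw [hI hε'.1] at a2
    refine (add_le_add a1 a2).trans ?_
    exact Finset.single_le_sum (f := fun i => ENNReal.ofReal M * lsNorm s (gradComp χ i)
      + ENNReal.ofReal M * lsNorm s (gradComp χ i)) (fun _ _ => zero_le) (Finset.mem_univ i)
  have hsub : {ξ | δ ≤ dist (enhancedNoise ρ χ P ε ξ).2 (enhancedNoise ρ χ P ε' ξ).2}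
      ⊆ ⋃ i : Fin 2, {ξ : Noise κ b | ENNReal.ofReal (δ / 2) ≤ holderNorm (-κ) (polyWeight κ)
        (ofFun fun x => conv ξ.toDistrib (w i - w' i) x * conv ξ.toDistrib (w i + w' i) x
          - l2inner (w i - w' i) (w i + w' i))} := by
    intro ξ hξ
    by_contra hcon
    simp only [mem_iUnion, mem_ofPred_eq, not_exists, not_le] at hcon hξ
    refine absurd hξ (not_le.2 ?_)
    rw [dist_eq_norm]
    refine norm_mk_lt ?_
    rw [HolderSpace.toDistrib_sub, enhancedNoise_snd hP hκ hb hbκ hρ hχ hε1,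
      enhancedNoise_snd hP hκ hb hbκ hρ hχ hε1', ofFun_wickSq_sub hb.le]
    refine (holderNorm_finsetSum_le _ _ _ _).trans_lt ?_
    rw [Fin.sum_univ_two]
    refine (ENNReal.add_lt_add (hcon 0) (hcon 1)).trans_le ?_
    rw [← ENNReal.ofReal_add (by positivity) (by positivity), add_halves]
  refine (measure_mono hsub).trans ((measure_iUnion_le _).trans ?_)
  rw [tsum_fintype, Fin.sum_univ_two]
  exact (add_le_add (h1 _ _ (hu 0) (hv 0)) (h1 _ _ (hu 1) (hv 1))).trans (ENNReal.add_halves r).le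

lemma tendstoInMeasure_prodMk {Ω ι E F : Type*} [MeasurableSpace Ω] {μ : Measure Ω}
    [PseudoEMetricSpace E] [PseudoEMetricSpace F] {l : Filter ι} {X : ι → Ω → E × F} {Y : Ω → E}
    {Z : Ω → F} (h1 : TendstoInMeasure μ (fun i ω => (X i ω).1) l Y)
    (h2 : TendstoInMeasure μ (fun i ω => (X i ω).2) l Z) :
    TendstoInMeasure μ X l fun ω => (Y ω, Z ω) := by
  intro δ hδ
  have h := (h1 δ hδ).add (h2 δ hδ)
  rw [add_zero] at h
  refine tendsto_of_tendsto_of_tendsto_of_le_of_le tendsto_const_nhds h (fun _ => zero_le)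
    fun i => ?_
  refine (measure_mono fun ω hω => ?_).trans (measure_union_le _ _)
  rw [mem_ofPred_eq, Prod.edist_eq, le_max_iff] at hω
  exact hω

theorem exists_isLimitNoise (hP : IsWhiteNoise P) (hκ : 0 < κ) (hκ1 : κ < 1) (hb : 0 < b)
    (hbκ : b < κ / 2) (hρ : IsMollifier ρ) (hχ : IsCutoff χ) :
    ∃ Q : Noise κ b → EnhancedSpace κ, IsLimitNoise ρ χ P Q := by
  classical
  have := hP.isProbabilityMeasure
  have := secondCountable_holderSpace (α := -1 - κ) (κ := κ) (by linarith) hκ.le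
  have := secondCountable_holderSpace (α := -κ) (κ := κ) (by linarith) hκ.le
  have := completeSpace_holderSpace (-κ) hκ.le
  -- Measurability of `enhancedNoise` is available for `ε` in `(0, 1]` only; changing the family
  -- elsewhere does not affect the limit at `0⁺`.
  let X : ℝ → Noise κ b → EnhancedSpace κ := fun ε =>
    if ε ∈ Ioc (0 : ℝ) 1 then enhancedNoise ρ χ P ε else fun _ => 0
  have hX : ∀ ε, Measurable (X ε) := fun ε => by
    by_cases hε : ε ∈ Ioc (0 : ℝ) 1
    · simp only [X, if_pos hε]
      exact measurable_enhancedNoise hP hκ hb hbκ hρ hχ hε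
    · simp only [X, if_neg hε]
      exact measurable_const
  have hXe : ∀ {ε}, ε ∈ Ioc (0 : ℝ) 1 → X ε = enhancedNoise ρ χ P ε := fun hε => if_pos hε
  have hev : ∀ᶠ ε in 𝓝[>] (0 : ℝ), X ε = enhancedNoise ρ χ P ε := by
    filter_upwards [Ioc_mem_nhdsGT one_pos] with ε hε using hXe hε
  have h1 : TendstoInMeasure P (fun ε ξ => (X ε ξ).1) (𝓝[>] 0)
      fun ξ => Noise.incl (by linarith : b ≤ κ) ξ := by
    refine tendstoInMeasure_of_tendsto_ae_filter (fun ε => (hX ε).fst) (ae_of_all _ fun ξ => ?_)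
    refine (tendsto_enhancedNoise_fst hκ hb hbκ hρ hχ P ξ).congr' ?_
    filter_upwards [hev] with ε hε
    rw [hε]
  obtain ⟨Z, hZm, hZ⟩ := exists_tendstoInMeasure (P := P) (X := fun ε ξ => (X ε ξ).2)
    (fun ε => (hX ε).snd) fun δ hδ r hr => by
      obtain ⟨ε₀, hε₀, h⟩ := exists_measure_enhancedNoise_snd_le hP hκ hκ1 hb hbκ hρ hχ hδ hr
      refine ⟨ε₀, hε₀, fun ε hε ε' hε' => ?_⟩
      rw [hXe (h ε hε ε' hε').1, hXe (h ε' hε' ε hε).1]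
      exact (h ε hε ε' hε').2
  have hincl : Measurable fun ξ : Noise κ b => Noise.incl (by linarith : b ≤ κ) ξ :=
    HolderSpace.measurable_of_eval (by linarith) hκ.le fun φ =>
      HolderSpace.measurable_eval _ hb.le φ
  refine ⟨fun ξ => (Noise.incl (by linarith : b ≤ κ) ξ, Z ξ),
    hincl.aemeasurable.prodMk hZm, ?_⟩
  exact (tendstoInMeasure_prodMk h1 hZ).congr' (hev.mono fun ε hε => by rw [hε]) ae_eq_rfl

end

end Anderson
end

noncomputable section
namespace Anderson

/-! ### Divergence of the variance of `∇G * ξ_ε` -/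

section

variable {χ : Test}

/-- Near the origin `G` is `-log|x| / 2π`, whose differential at `x` applied to `x` itself equals
`-1 / 2π`. -/
lemma le_norm_gradient_green (hχ : IsCutoff χ) {x : Plane} (hx0 : x ≠ 0)
    (hx1 : x ∈ Metric.ball (0 : Plane) 1) :
    (2 * Real.pi)⁻¹ * ‖x‖⁻¹ ≤ ‖gradient (green χ) x‖ := by
  have hx : 0 < ‖x‖ := norm_pos_iff.2 hx0
  have hd : DifferentiableAt ℝ (fun y : Plane => ‖y‖) x :=
    (contDiffAt_norm ℝ hx0 (n := 1)).differentiableAt (by simp)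
  have hlog := ((hd.hasFDerivAt.log hx.ne').mul_const ((2 * Real.pi)⁻¹)).neg
  have hG : HasFDerivAt (green χ) _ x := hlog.congr_of_eventuallyEq (by
    filter_upwards [Metric.isOpen_ball.mem_nhds hx1] with y hy
    simp [green, hχ.eq_one y hy, div_eq_mul_inv])
  have h1 : fderiv ℝ (green χ) x x = -(2 * Real.pi)⁻¹ := by
    rw [hG.fderiv]
    have := hd.fderiv_norm_self
    simp only [neg_apply, smul_apply, smul_eq_mul, this]
    rw [inv_mul_cancel₀ hx.ne', mul_one]
  have h2 := (fderiv ℝ (green χ) x).le_opNorm x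
  rw [h1, norm_neg, Real.norm_of_nonneg (by positivity)] at h2
  rw [gradient, LinearIsometryEquiv.norm_map, ← div_eq_mul_inv, div_le_iff₀ hx]
  exact h2

lemma sum_sq_gradComp (χ : Test) (x : Plane) :
    ∑ i, gradComp χ i x ^ 2 = ‖gradient (green χ) x‖ ^ 2 := by
  rw [EuclideanSpace.norm_sq_eq]
  simp [gradComp]

/-- In polar coordinates `∫ |x|⁻²` over the unit disc becomes `∫₀¹ dr / r`, which diverges. This
logarithmic divergence is why renormalisation is needed, and also why the constant `c` in the
support is free. -/
lemma not_forall_memLp_gradComp (hχ : IsCutoff χ) : ¬ ∀ i, MemLp (gradComp χ i) 2 := by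
  intro h
  have h1 : Integrable fun x => ‖gradient (green χ) x‖ ^ 2 := by
    simp_rw [← sum_sq_gradComp]
    exact integrable_finsetSum _ fun i _ => (h i).integrable_sq
  have h2 : IntegrableOn (fun x : Plane => (fun r : ℝ => r⁻¹ ^ 2) ‖x‖) (Metric.ball 0 1) := by
    refine Integrable.mono' ((h1.integrableOn (s := Metric.ball 0 1)).const_mul
      ((2 * Real.pi) ^ 2)) ?_ ?_
    · exact (measurable_norm.inv.pow_const 2).aestronglyMeasurable
    · have h0 : ∀ᵐ x : Plane ∂volume.restrict (Metric.ball 0 1), x ≠ 0 :=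
        ae_restrict_of_ae (by simp [ae_iff])
      filter_upwards [h0, ae_restrict_mem measurableSet_ball] with x hx0 hx1
      have := le_norm_gradient_green hχ hx0 hx1
      rw [Real.norm_of_nonneg (by positivity), ← mul_pow]
      gcongr
      rwa [inv_mul_le_iff₀ (by positivity)] at this
  have h2' := (integrableOn_fun_norm_addHaar (μ := (volume : Measure Plane))
    (f := fun r : ℝ => r⁻¹ ^ 2) (r := 1)).1 h2
  have h3 : IntegrableOn (fun y : ℝ => y ^ (-1 : ℝ)) (Ioo 0 1) := by
    refine h2'.congr_fun (fun y hy => ?_) measurableSet_Ioo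
    have hy0 : y ≠ 0 := hy.1.ne'
    simp only [finrank_euclideanSpace, Fintype.card_fin, smul_eq_mul, Real.rpow_neg_one]
    norm_num
    field_simp
  rw [intervalIntegral.integrableOn_Ioo_rpow_iff one_pos] at h3
  exact lt_irrefl _ h3

lemma exists_bump {R : ℝ} (hR : 0 < R) : ∃ β : Test, (∀ x, 0 ≤ β x) ∧ (∀ x, β (-x) = β x) ∧
    tsupport β ⊆ Metric.closedBall 0 R ∧ ∫ x, β x = 1 := by
  let B : ContDiffBump (0 : Plane) := ⟨R / 2, R, by linarith, by linarith⟩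
  refine ⟨⟨B.normed volume, B.contDiff_normed, B.hasCompactSupport_normed, fun _ _ => trivial⟩,
    fun x => B.nonneg_normed x, fun x => B.normed_neg x, ?_, B.integral_normed⟩
  exact (B.tsupport_normed_eq (μ := volume)).subset

lemma lsNorm_two_sq (u : Test) : lsNorm 2 u ^ (2 : ℝ) = ENNReal.ofReal (l2inner u u) := by
  rw [lsNorm, ← ENNReal.rpow_mul]
  norm_num
  rw [l2inner, ofReal_integral_eq_lintegral_ofReal (u.integrable_mul u)
    (ae_of_all _ fun x => mul_self_nonneg _)]
  refine lintegral_congr fun x => ?_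
  rw [← sq, ← sq_abs, ENNReal.ofReal_pow (abs_nonneg _), ← Real.enorm_eq_ofReal_abs]

lemma integral_abs_of_nonneg {β : Test} (hβ : ∀ x, 0 ≤ β x) (h1 : ∫ x, β x = 1) :
    ∫ x, |β x| = 1 := by
  simp_rw [abs_of_nonneg (hβ _), h1]

/-- The variance `∑ᵢ ‖∂ᵢG * β‖²`. -/
def gradVar (χ β : Test) : ℝ := ∑ i, l2inner (gradKernel χ β i) (gradKernel χ β i)

lemma gradVar_nonneg (χ β : Test) : 0 ≤ gradVar χ β :=
  Finset.sum_nonneg fun _ _ => l2inner_self_nonneg _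

/-- Otherwise mollified kernels would be bounded in `L²`. They converge to `∂ᵢG` in `L^{3/2}`, hence
in measure, and Fatou's lemma would place `∂ᵢG` in `L²`. The exponent `3/2` is merely a choice
between `1` and `2`. -/
theorem exists_gradVar_gt (hχ : IsCutoff χ) {R : ℝ} (hR : 0 < R) (A : ℝ) :
    ∃ β : Test, (∀ x, 0 ≤ β x) ∧ (∀ x, β (-x) = β x) ∧
      tsupport β ⊆ Metric.closedBall 0 R ∧ ∫ x, β x = 1 ∧ A < gradVar χ β := by
  by_contra! hcon
  choose β hβ0 hβe hβs hβ1 using fun n : ℕ =>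
    exists_bump (R := R / ((n : ℝ) + 1)) (by positivity)
  have hβR : ∀ n, tsupport (β n) ⊆ Metric.closedBall 0 R := fun n =>
    (hβs n).trans (Metric.closedBall_subset_closedBall
      (div_le_self hR.le (by linarith [n.cast_nonneg (α := ℝ)])))
  refine not_forall_memLp_gradComp hχ fun i => ⟨(measurable_gradComp χ i).aestronglyMeasurable, ?_⟩
  have hs : (0 : ℝ) < 3 / 2 := by norm_num
  have ht : TendstoInMeasure volume (fun n => (gradKernel χ (β n) i : Plane → ℝ)) atTop
      (gradComp χ i) := by
    refine tendstoInMeasure_of_tendsto_eLpNorm (p := ENNReal.ofReal (3 / 2)) (by simp)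
      (fun n => (gradKernel χ (β n) i).continuous.aestronglyMeasurable)
      (measurable_gradComp χ i).aestronglyMeasurable ?_
    rw [ENNReal.tendsto_nhds_zero]
    intro δ hδ
    obtain ⟨δ', hδ'0, hδ'⟩ : ∃ δ' : ℝ, 0 < δ' ∧ ENNReal.ofReal δ' ≤ δ := by
      rcases eq_or_ne δ ∞ with rfl | hδt
      · exact ⟨1, one_pos, le_top⟩
      · exact ⟨δ.toReal, ENNReal.toReal_pos hδ.ne' hδt, ENNReal.ofReal_toReal_le⟩
    obtain ⟨r, hr, h⟩ := exists_lsNorm_testConv_sub_le (s := 3 / 2) (by norm_num)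
      (measurable_gradComp χ i) (locallyIntegrable_gradComp hχ i) (hasCompactSupport_gradComp hχ i)
      (lsNorm_gradComp_ne_top hχ i hs (by norm_num)) zero_le_one hδ'0
    have hlim : Tendsto (fun n : ℕ => R / ((n : ℝ) + 1)) atTop (𝓝 0) := by
      have := tendsto_one_div_add_atTop_nhds_zero_nat.const_mul R
      simpa [div_eq_mul_inv] using this
    filter_upwards [hlim.eventually (gt_mem_nhds hr)] with n hn
    rw [← lsNorm_eq_eLpNorm hs]
    exact (h (β n) ((hβs n).trans (Metric.closedBall_subset_closedBall hn.le)) (hβ1 n)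
      (integral_abs_of_nonneg (hβ0 n) (hβ1 n)).le).trans hδ'
  refine (eLpNorm_le_of_tendstoInMeasure (C := ENNReal.ofReal A ^ (1 / 2 : ℝ)) (Eventually.of_forall
    fun n => ?_) ht fun n => (gradKernel χ (β n) i).continuous.aestronglyMeasurable).trans_lt
    (ENNReal.rpow_lt_top_of_nonneg (by norm_num) ENNReal.ofReal_ne_top)
  have e2 := lsNorm_eq_eLpNorm two_pos (gradKernel χ (β n) i)
  rw [ENNReal.ofReal_ofNat] at e2
  rw [← e2, one_div, ENNReal.le_rpow_inv_iff two_pos, lsNorm_two_sq]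
  refine ENNReal.ofReal_le_ofReal (le_trans ?_ (hcon (β n) (hβ0 n) (hβe n) (hβR n) (hβ1 n)))
  exact Finset.single_le_sum (f := fun i => l2inner (gradKernel χ (β n) i) (gradKernel χ (β n) i))
    (fun _ _ => l2inner_self_nonneg _) (Finset.mem_univ i)

/-! ### Kernels with a prescribed renormalisation constant -/

lemma gradKernel_sub (hχ : IsCutoff χ) (k k' : Test) (i : Fin 2) :
    gradKernel χ (k - k') i = gradKernel χ k i - gradKernel χ k' i := by
  ext x
  rw [Test.sub_apply]
  simp only [gradKernel]
  rw [testConv_apply _ (locallyIntegrable_gradComp hχ i) (hasCompactSupport_gradComp hχ i),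
    testConv_apply _ (locallyIntegrable_gradComp hχ i) (hasCompactSupport_gradComp hχ i),
    testConv_apply _ (locallyIntegrable_gradComp hχ i) (hasCompactSupport_gradComp hχ i),
    ← integral_sub (integrable_mul_gradComp hχ i k.continuous x)
      (integrable_mul_gradComp hχ i k'.continuous x)]
  simp_rw [Test.sub_apply, mul_sub]

lemma gradKernel_smul (hχ : IsCutoff χ) (c : ℝ) (k : Test) (i : Fin 2) :
    gradKernel χ (c • k) i = c • gradKernel χ k i := by
  ext x
  rw [Test.smul_apply]
  simp only [gradKernel]
  rw [testConv_apply _ (locallyIntegrable_gradComp hχ i) (hasCompactSupport_gradComp hχ i),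
    testConv_apply _ (locallyIntegrable_gradComp hχ i) (hasCompactSupport_gradComp hχ i),
    ← integral_const_mul]
  congr 1 with t
  rw [Test.smul_apply]
  ring

end

lemma reflect_testConv (u v : Test) : l2inner u v = testConv u (reflect v 0) 0 := by
  rw [Test.testConv_apply, l2inner, ← integral_neg_eq_self]
  congr 1 with t
  rw [reflect_apply]
  simp [mul_comm]

/-- Convolution with an even kernel is self-adjoint in `L²`; this turns cross terms with `β * β`
into squared norms. -/
lemma l2inner_testConv_even {β : Test} (hβ : ∀ x, β (-x) = β x) (u v : Test) :
    l2inner (testConv u β) v = l2inner u (testConv v β) := by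
  have e : reflect (testConv v β) 0 = testConv (reflect v 0) β := by
    ext x
    rw [reflect_apply, Test.testConv_apply, Test.testConv_apply, ← integral_neg_eq_self]
    congr 1 with t
    rw [hβ, reflect_apply]
    congr 2
    abel
  rw [reflect_testConv, reflect_testConv, e, testConv_right_comm, testConv_comm (reflect v 0) β]
  rw [testConv_comm u (reflect v 0), testConv_comm u (testConv β (reflect v 0)),
    testConv_comm β (reflect v 0), testConv_right_comm]

lemma tendsto_testConv_rescale {ρ : Test} (hρ : IsMollifier ρ) (u : Test) (x : Plane) :
    Tendsto (fun ε => testConv (rescale ρ ε 0) u x) (𝓝[>] 0) (𝓝 (u x)) := by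
  obtain ⟨L, hL0, hL⟩ := u.exists_lipschitz
  rw [tendsto_iff_norm_sub_tendsto_zero]
  have h : Tendsto (fun ε : ℝ => L * ε * ∫ t, |ρ t|) (𝓝[>] 0) (𝓝 0) := by
    have : Tendsto (fun ε : ℝ => L * ε * ∫ t, |ρ t|) (𝓝 0) (𝓝 (L * 0 * ∫ t, |ρ t|)) :=
      (continuous_const.mul continuous_id).mul continuous_const |>.tendsto 0
    simpa using this.mono_left nhdsWithin_le_nhds
  refine tendsto_of_tendsto_of_tendsto_of_le_of_le' tendsto_const_nhds h
    (Eventually.of_forall fun _ => norm_nonneg _) ?_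
  filter_upwards [self_mem_nhdsWithin] with ε hε
  have := abs_testConv_sub_le (tsupport_rescale hρ.tsupport_subset hε 0)
    (by rw [integral_rescale _ hε, hρ.integral_eq_one]) hL0 hL x
  rwa [integral_abs_rescale _ hε] at this

lemma tendsto_l2inner_testConv {ρ : Test} (hρ : IsMollifier ρ) (u v : Test) :
    Tendsto (fun ε => l2inner (testConv (rescale ρ ε 0) u) (testConv (rescale ρ ε 0) v))
      (𝓝[>] 0) (𝓝 (l2inner u v)) := by
  obtain ⟨A, hA0, hA⟩ := u.exists_bound
  obtain ⟨B, hB0, hB⟩ := v.exists_bound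
  obtain ⟨R, hR0, hR⟩ := u.exists_radius
  set M := ∫ t, |ρ t|
  have hM0 : 0 ≤ M := integral_nonneg fun _ => abs_nonneg _
  have hbd : ∀ {ε : ℝ}, 0 < ε → ∀ {w : Test} {S : ℝ}, (∀ x, |w x| ≤ S) → ∀ x,
      |testConv (rescale ρ ε 0) w x| ≤ S * M := fun {ε} hε w S hS x => by
    rw [testConv_comm]
    have := abs_testConv_le (f := rescale ρ ε 0) hS x
    rwa [integral_abs_rescale _ hε] at this
  refine tendsto_integral_filter_of_dominated_convergence
    ((Metric.closedBall (0 : Plane) (1 + R)).indicator fun _ => A * M * (B * M)) ?_ ?_ ?_ ?_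
  · exact Eventually.of_forall fun ε => ((testConv _ u).continuous.mul
      (testConv _ v).continuous).aestronglyMeasurable
  · filter_upwards [Ioc_mem_nhdsGT one_pos] with ε hε
    refine ae_of_all _ fun x => ?_
    by_cases hx : x ∈ Metric.closedBall (0 : Plane) (1 + R)
    · rw [indicator_of_mem hx, norm_mul]
      exact mul_le_mul (hbd hε.1 hA x) (hbd hε.1 hB x) (norm_nonneg _) (by positivity)
    · rw [indicator_of_notMem hx]
      have h0 : testConv (rescale ρ ε 0) u x = 0 := image_eq_zero_of_notMem_tsupport fun h =>
        hx (tsupport_testConv (tsupport_rescale_mollifier hρ hε.1 hε.2) hR h)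
      rw [h0, zero_mul, norm_zero]
  · exact (integrable_indicator_iff Metric.isClosed_closedBall.measurableSet).2
      (integrableOn_const measure_closedBall_lt_top.ne)
  · exact ae_of_all _ fun x => (tendsto_testConv_rescale hρ u x).mul (tendsto_testConv_rescale hρ v x)

section

variable {χ : Test}

lemma l2inner_testConv_self_le {β : Test} (hβ : ∀ x, 0 ≤ β x) (h1 : ∫ x, β x = 1) (u : Test) :
    l2inner (testConv β u) (testConv β u) ≤ l2inner u u := by
  have h := lsNorm_testConv_le (s := 2) one_lt_two β u.continuous.measurable
    u.continuous.locallyIntegrable u.hasCompactSupport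
  rw [integral_abs_of_nonneg hβ h1, ENNReal.ofReal_one, one_mul] at h
  have := ENNReal.rpow_le_rpow h zero_le_two
  rwa [lsNorm_two_sq, lsNorm_two_sq, ENNReal.ofReal_le_ofReal_iff (l2inner_self_nonneg u)] at this

/-- There are approximations `k` of the identity such that replacing `ξ` by `ξ - ξ * k` changes the
renormalisation constant by an amount which converges to a prescribed number. -/
theorem exists_kernel {ρ : Test} (hρ : IsMollifier ρ) (hχ : IsCutoff χ) (c : ℝ) {R : ℝ}
    (hR : 0 < R) : ∃ k : Test, tsupport k ⊆ Metric.closedBall 0 R ∧ ∫ x, k x = 1 ∧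
      ∫ x, |k x| ≤ 3 ∧
      Tendsto (fun ε => gradVar χ (rescale ρ ε 0 - testConv (rescale ρ ε 0) k)
        - gradVar χ (rescale ρ ε 0)) (𝓝[>] 0) (𝓝 c) := by
  -- The two thresholds are what is needed for `Φ 0 ≤ c ≤ Φ 1` below. Supports of radius `R / 2` are
  -- taken because `β` and `β'` get convolved with themselves.
  obtain ⟨β, hβ0, hβe, hβs, hβ1, hβc⟩ := exists_gradVar_gt hχ (half_pos hR) (-c)
  obtain ⟨β', hβ0', hβe', hβs', hβ1', hβc'⟩ := exists_gradVar_gt hχ (half_pos hR)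
    ((c + 4 * gradVar χ β) / 2)
  set k : ℝ → Test := fun τ => (1 + τ) • testConv β β - τ • testConv β' β' with hk
  have hker : ∀ τ i, gradKernel χ (k τ) i = (1 + τ) • gradKernel χ (testConv β β) i
      - τ • gradKernel χ (testConv β' β') i := fun τ i => by
    rw [hk, gradKernel_sub hχ, gradKernel_smul hχ, gradKernel_smul hχ]
  -- `Φ τ` is the limit as `ε → 0` of the change in variance: expanding the square leaves `‖∇G *
  -- k‖²` minus twice the pairing of `∇G` with `∇G * k`. This pairing is finite, since for `k = β *
  -- β` it equals `‖∇G * β‖²`.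
  set Φ : ℝ → ℝ := fun τ => gradVar χ (k τ) - 2 * ((1 + τ) * gradVar χ β - τ * gradVar χ β')
    with hΦ
  have hcont : Continuous Φ := by
    simp only [hΦ, gradVar, hker, l2inner_sub_left, l2inner_sub_right, l2inner_smul_left,
      l2inner_smul_right]
    fun_prop
  -- For `τ = 0`, convolution with `β` contracts `L²`, so `Φ 0 ≤ -gradVar χ β < c`.
  have h0 : Φ 0 ≤ c := by
    have e : gradVar χ (k 0) ≤ gradVar χ β := by
      refine Finset.sum_le_sum fun i _ => ?_
      have : gradKernel χ (k 0) i = testConv β (gradKernel χ β i) := by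
        rw [hker, testConv_gradKernel hχ, add_zero, one_smul, zero_smul, sub_zero]
      rw [this]
      exact l2inner_testConv_self_le hβ0 hβ1 _
    simp only [hΦ, add_zero, one_mul, zero_mul, sub_zero]
    linarith
  -- For `τ = 1` the nonnegative term is dropped, and the large energy of `β'` dominates.
  have h1 : c ≤ Φ 1 := by
    have := gradVar_nonneg χ (k 1)
    simp only [hΦ]
    linarith
  obtain ⟨τ, hτ, hτc⟩ := intermediate_value_Icc zero_le_one hcont.continuousOn ⟨h0, h1⟩
  have hI : ∀ x, k τ x = (1 + τ) * testConv β β x - τ * testConv β' β' x := fun x => by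
    rw [hk, Test.sub_apply, Test.smul_apply, Test.smul_apply]
  have hsupp : ∀ {γ : Test}, tsupport γ ⊆ Metric.closedBall 0 (R / 2) →
      tsupport (testConv γ γ) ⊆ Metric.closedBall 0 R := fun hγ => by
    have := tsupport_testConv hγ hγ
    rwa [add_halves] at this
  refine ⟨k τ, ?_, ?_, ?_, ?_⟩
  · refine closure_minimal (fun x hx => ?_) Metric.isClosed_closedBall
    by_contra hxR
    refine hx ?_
    rw [hI, image_eq_zero_of_notMem_tsupport fun h => hxR (hsupp hβs h),
      image_eq_zero_of_notMem_tsupport fun h => hxR (hsupp hβs' h)]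
    ring
  · simp_rw [hI]
    rw [integral_sub ((testConv β β).integrable.const_mul _)
      ((testConv β' β').integrable.const_mul _), integral_const_mul, integral_const_mul,
      integral_testConv, integral_testConv, hβ1, hβ1']
    ring
  · have hb : ∀ x, |k τ x| ≤ (1 + τ) * |testConv β β x| + τ * |testConv β' β' x| := fun x => by
      rw [hI]
      refine (abs_sub _ _).trans (le_of_eq ?_)
      rw [abs_mul, abs_mul, abs_of_nonneg (by linarith [hτ.1]), abs_of_nonneg hτ.1]
    have i1 := (testConv β β).integrable.abs.const_mul (1 + τ)
    have i2 := (testConv β' β').integrable.abs.const_mul τ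
    refine (integral_mono (k τ).integrable.abs (i1.add i2) hb).trans ?_
    have j1 := integral_abs_testConv_le β β
    have j2 := integral_abs_testConv_le β' β'
    rw [integral_abs_of_nonneg hβ0 hβ1] at j1
    rw [integral_abs_of_nonneg hβ0' hβ1'] at j2
    have e : ∫ x, ((1 + τ) * |testConv β β x| + τ * |testConv β' β' x|)
        = (1 + τ) * (∫ x, |testConv β β x|) + τ * ∫ x, |testConv β' β' x| := by
      rw [integral_add i1 i2, integral_const_mul, integral_const_mul]
    refine e.le.trans ?_
    nlinarith [hτ.1, hτ.2]
  · rw [← hτc]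
    have key : ∀ ε, gradVar χ (rescale ρ ε 0 - testConv (rescale ρ ε 0) (k τ))
        - gradVar χ (rescale ρ ε 0)
        = ∑ i, (l2inner (testConv (rescale ρ ε 0) (gradKernel χ (k τ) i))
            (testConv (rescale ρ ε 0) (gradKernel χ (k τ) i))
          - 2 * ((1 + τ) * l2inner (testConv (rescale ρ ε 0) (gradKernel χ β i))
              (testConv (rescale ρ ε 0) (gradKernel χ β i))
            - τ * l2inner (testConv (rescale ρ ε 0) (gradKernel χ β' i))
              (testConv (rescale ρ ε 0) (gradKernel χ β' i)))) := fun ε => by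
      rw [gradVar, gradVar, ← Finset.sum_sub_distrib]
      congr 1 with i
      -- Self-adjointness of the convolution with `γ` distributes one copy of `γ` to each side of
      -- the pairing.
      have hcross : ∀ {γ : Test}, (∀ x, γ (-x) = γ x) →
          l2inner (gradKernel χ (rescale ρ ε 0) i)
            (testConv (rescale ρ ε 0) (gradKernel χ (testConv γ γ) i))
          = l2inner (testConv (rescale ρ ε 0) (gradKernel χ γ i))
            (testConv (rescale ρ ε 0) (gradKernel χ γ i)) := fun {γ} hγ => by
        have e1 : testConv (rescale ρ ε 0) (gradKernel χ γ i)
            = testConv (gradKernel χ (rescale ρ ε 0) i) γ := by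
          rw [testConv_gradKernel hχ, testConv_comm _ γ, testConv_comm _ γ, testConv_gradKernel hχ]
        rw [e1, l2inner_testConv_even hγ, ← e1, ← testConv_gradKernel hχ,
          testConv_comm γ (gradKernel χ γ i), ← testConv_comm (testConv _ _) (rescale ρ ε 0),
          testConv_right_comm, testConv_comm (gradKernel χ γ i) (rescale ρ ε 0)]
      rw [gradKernel_sub hχ, ← testConv_gradKernel hχ, l2inner_sub_left, l2inner_sub_right,
        l2inner_sub_right, l2inner_comm (testConv _ (gradKernel χ (k τ) i))
          (gradKernel χ (rescale ρ ε 0) i), ← hcross hβe, ← hcross hβe']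
      have e2 : l2inner (gradKernel χ (rescale ρ ε 0) i)
          (testConv (rescale ρ ε 0) (gradKernel χ (k τ) i))
          = (1 + τ) * l2inner (gradKernel χ (rescale ρ ε 0) i)
              (testConv (rescale ρ ε 0) (gradKernel χ (testConv β β) i))
            - τ * l2inner (gradKernel χ (rescale ρ ε 0) i)
              (testConv (rescale ρ ε 0) (gradKernel χ (testConv β' β') i)) := by
        rw [hker, testConv_sub_right, testConv_smul_right, testConv_smul_right, l2inner_sub_right,
          l2inner_smul_right, l2inner_smul_right]
      rw [e2]
      ring
    have eΦ : Φ τ = ∑ i, (l2inner (gradKernel χ (k τ) i) (gradKernel χ (k τ) i)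
        - 2 * ((1 + τ) * l2inner (gradKernel χ β i) (gradKernel χ β i)
          - τ * l2inner (gradKernel χ β' i) (gradKernel χ β' i))) := by
      simp only [hΦ, gradVar, Fin.sum_univ_two]
      ring
    rw [eΦ]
    simp_rw [key]
    exact tendsto_finsetSum _ fun i _ => (tendsto_l2inner_testConv hρ _ _).sub
      ((((tendsto_l2inner_testConv hρ _ _).const_mul _).sub
        ((tendsto_l2inner_testConv hρ _ _).const_mul _)).const_mul 2)

end

end Anderson
end

noncomputable section
namespace Anderson

/-! ### Products and regularity of convolutions -/

/-- The test function `y ↦ φ(y) S(x + l y)`. -/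
def mulSmooth (φ : Test) {S : Plane → ℝ} (hS : ContDiff ℝ (⊤ : ℕ∞) S) (l : ℝ) (x : Plane) :
    Test where
  toFun y := φ y * S (x + l • y)
  contDiff' := by
    have := φ.contDiff
    fun_prop
  hasCompactSupport' := φ.hasCompactSupport.mul_right
  tsupport_subset' := fun _ _ => trivial

lemma mulSmooth_apply (φ : Test) {S : Plane → ℝ} (hS : ContDiff ℝ (⊤ : ℕ∞) S) (l : ℝ)
    (x y : Plane) : mulSmooth φ hS l x y = φ y * S (x + l • y) := rfl

/-- Multiplication by a `C¹` function on spaces of regularity between `-1` and `0`. -/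
theorem holderNorm_mul_le {κ a b B : ℝ} (hκ : 0 < κ) (hκ1 : κ ≤ 1) (hb : 0 ≤ b) (hB : 0 ≤ B)
    {A S : Plane → ℝ} (hA : LocallyIntegrable A) (hS : ContDiff ℝ (⊤ : ℕ∞) S)
    (hS0 : ∀ x, |S x| ≤ B * polyWeight b x) (hS1 : ∀ x, ‖fderiv ℝ S x‖ ≤ B * polyWeight b x)
    (hfin : holderNorm (-κ) (polyWeight a) (ofFun A) < ∞) :
    holderNorm (-κ) (polyWeight (a + b)) (ofFun fun x => A x * S x)
      ≤ ENNReal.ofReal (2 * (2 ^ b * B) * (holderNorm (-κ) (polyWeight a) (ofFun A)).toReal) := by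
  -- For `0 < κ ≤ 1` the norm involves exactly one derivative of the test functions, so `C¹` control
  -- of `S` is enough.
  have hceil : ⌈-(-κ)⌉₊ = 1 := by
    rw [neg_neg, Nat.ceil_eq_iff one_ne_zero]
    exact ⟨by simpa using hκ, by simpa using hκ1⟩
  refine iSup_le fun x => iSup₂_le fun l hl => iSup₂_le fun φ hφ => ENNReal.ofReal_le_ofReal ?_
  rw [hceil] at hφ
  have hw := polyWeight_pos (a + b) x
  have hlκ : 0 < l ^ (-κ) := Real.rpow_pos_of_pos hl.1 _
  rw [div_le_iff₀ (by positivity)]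
  -- The factor `S` is absorbed in the test function, read in the coordinates centred at `x` with
  -- scale `l`; since `l ≤ 1`, the chain rule does not enlarge its derivative.
  set ψ := mulSmooth φ hS l x with hψ
  have hts : tsupport ψ ⊆ tsupport φ := tsupport_mul_subset_left
  have hpw : ∀ y ∈ tsupport φ, polyWeight b (x + l • y) ≤ 2 ^ b * polyWeight b x := fun y hy => by
    have hy1 : ‖y‖ ≤ 1 := by simpa using hφ.1 hy
    have := polyWeight_le hb zero_le_one (x := x) (y := x + l • y) (by
      refine (norm_add_le _ _).trans ?_
      rw [norm_smul, Real.norm_of_nonneg hl.1.le]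
      have := mul_le_mul hl.2 hy1 (norm_nonneg _) zero_le_one
      linarith)
    norm_num at this
    exact this
  have hp0 := (polyWeight_pos b x).le
  -- `2 ^ b` compares the weight at distance at most one from `x` with that at `x`; the other `2` is
  -- from the product rule.
  set M : ℝ := 2 * (2 ^ b * B) * polyWeight b x with hM
  have hM0 : 0 ≤ M := by positivity
  have hφ0 : ∀ y, ‖φ y‖ ≤ 1 := fun y => by simpa using hφ.2 0 zero_le_one y
  have hφ1 : ∀ y, ‖fderiv ℝ φ y‖ ≤ 1 := fun y => by
    simpa only [norm_iteratedFDeriv_one] using hφ.2 1 le_rfl y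
  have hder : ∀ k ≤ ⌈-(-κ)⌉₊, ∀ y : Plane, ‖iteratedFDeriv ℝ k (ψ : Plane → ℝ) y‖ ≤ M := by
    rw [hceil]
    intro k hk y
    by_cases hy : y ∈ tsupport φ
    swap
    · have h0 : iteratedFDeriv ℝ k (ψ : Plane → ℝ) y = 0 := by
        by_contra h
        exact hy (hts (support_iteratedFDeriv_subset k h))
      rw [h0, norm_zero]
      exact hM0
    have hSy : |S (x + l • y)| ≤ 2 ^ b * B * polyWeight b x := (hS0 _).trans (by
      have := mul_le_mul_of_nonneg_left (hpw y hy) hB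
      linarith)
    have hSy1 : ‖fderiv ℝ S (x + l • y)‖ ≤ 2 ^ b * B * polyWeight b x := (hS1 _).trans (by
      have := mul_le_mul_of_nonneg_left (hpw y hy) hB
      linarith)
    have hM2 : M = 2 ^ b * B * polyWeight b x + 2 ^ b * B * polyWeight b x := by rw [hM]; ring
    have hpos : 0 ≤ 2 ^ b * B * polyWeight b x := by positivity
    interval_cases k
    · rw [norm_iteratedFDeriv_zero, hψ, mulSmooth_apply, norm_mul]
      have := mul_le_mul (hφ0 y) hSy (abs_nonneg _) zero_le_one
      rw [Real.norm_eq_abs (S _)]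
      linarith
    · rw [norm_iteratedFDeriv_one]
      have d1 : HasFDerivAt (φ : Plane → ℝ) (fderiv ℝ φ y) y :=
        (φ.contDiff.differentiable (by simp) y).hasFDerivAt
      have d2 : HasFDerivAt (fun y : Plane => x + l • y) (l • ContinuousLinearMap.id ℝ Plane) y :=
        ((hasFDerivAt_id y).const_smul l).const_add x
      have d3 : HasFDerivAt S (fderiv ℝ S (x + l • y)) (x + l • y) :=
        (hS.differentiable (by simp) _).hasFDerivAt
      have d4 := d1.mul (d3.comp y d2)
      have d5 : HasFDerivAt (ψ : Plane → ℝ) _ y := d4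
      rw [d5.fderiv]
      refine (norm_add_le _ _).trans ?_
      rw [norm_smul, norm_smul, hM2]
      have h1 : ‖(fderiv ℝ S (x + l • y)).comp (l • ContinuousLinearMap.id ℝ Plane)‖
          ≤ 2 ^ b * B * polyWeight b x := by
        refine (ContinuousLinearMap.opNorm_comp_le _ _).trans ?_
        have h2 : ‖l • ContinuousLinearMap.id ℝ Plane‖ ≤ 1 := by
          rw [norm_smul, Real.norm_of_nonneg hl.1.le]
          exact mul_le_one₀ hl.2 (norm_nonneg _) ContinuousLinearMap.norm_id_le
        calc _ ≤ (2 ^ b * B * polyWeight b x) * 1 :=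
              mul_le_mul hSy1 h2 (norm_nonneg _) hpos
          _ = _ := mul_one _
      refine add_le_add ?_ ?_
      · calc _ ≤ 1 * (2 ^ b * B * polyWeight b x) :=
              mul_le_mul (hφ0 y) h1 (norm_nonneg _) zero_le_one
          _ = _ := one_mul _
      · calc _ ≤ (2 ^ b * B * polyWeight b x) * 1 :=
              mul_le_mul hSy (hφ1 y) (norm_nonneg _) hpos
          _ = _ := mul_one _
  have key := abs_apply_le_of_mem_unitTests hfin hl x hM0 (hts.trans hφ.1) hder
  have hAS : LocallyIntegrable fun x => A x * S x := by
    rw [← locallyIntegrableOn_univ] at hA ⊢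
    exact hA.mul_continuousOn hS.continuous.continuousOn isOpen_univ.isLocallyClosed
  have e : ofFun (fun x => A x * S x) (rescale φ l x) = ofFun A (rescale ψ l x) := by
    rw [ofFun_apply hAS, ofFun_apply hA]
    congr 1 with y
    rw [rescale_apply, rescale_apply, hψ, mulSmooth_apply, smul_smul, mul_inv_cancel₀ hl.1.ne',
      one_smul, add_sub_cancel]
    ring
  rw [e]
  refine key.trans (le_of_eq ?_)
  rw [hM, ← polyWeight_mul]
  ring

/-- The increment is `T` tested on a difference of translates of `k`, whose `C^r` norm is at most
`‖y - x‖` times a `C^{r+1}` bound on `k`. Restricting to `‖y - x‖ ≤ 1` keeps the support in a fixed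
ball. -/
lemma exists_abs_conv_sub_le (α : ℝ) {b : ℝ} (hb : 0 ≤ b) (k : Test) :
    ∃ C : ℝ, 0 ≤ C ∧ ∀ T : Distrib, holderNorm α (polyWeight b) T < ∞ → ∀ x y : Plane,
      ‖y - x‖ ≤ 1 → |conv T k y - conv T k x|
        ≤ C * (holderNorm α (polyWeight b) T).toReal * polyWeight b x * ‖y - x‖ := by
  obtain ⟨R, hR0, hR⟩ := k.exists_radius
  obtain ⟨C, hC0, hC⟩ := exists_abs_apply_le α hb (R + 1)
  obtain ⟨D, hD0, hD⟩ := k.exists_iteratedFDeriv_bound (⌈-α⌉₊ + 1)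
  refine ⟨C * D, by positivity, fun T hT x y hxy => ?_⟩
  set v := y - x with hv
  set kv := reflect (reflect k v) 0 with hkv
  have hkv_apply : ∀ z, kv z = k (z + v) := fun z => by
    rw [hkv, reflect_apply, reflect_apply, zero_sub, sub_neg_eq_add, add_comm]
  have e : conv T k y - conv T k x = T (reflect (kv - k) x) := by
    have e1 : reflect k y = reflect kv x := by
      ext z
      rw [reflect_apply, reflect_apply, hkv_apply, hv]
      congr 1
      abel
    rw [reflect_sub, map_sub, ← e1]
    rfl
  have hfun : ((kv - k : Test) : Plane → ℝ) = (fun z => k (z + v)) - k := by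
    ext z
    rw [Test.sub_apply, hkv_apply, Pi.sub_apply]
  have hder : ∀ j ≤ ⌈-α⌉₊, ∀ z : Plane,
      ‖iteratedFDeriv ℝ j ((kv - k : Test) : Plane → ℝ) z‖ ≤ D * ‖v‖ := fun j hj z => by
    have hk' : ContDiff ℝ j (k : Plane → ℝ) := k.contDiff.of_le (by exact_mod_cast le_top)
    have hk2 : ContDiff ℝ j fun z : Plane => k (z + v) := hk'.comp (contDiff_id.add contDiff_const)
    rw [hfun, iteratedFDeriv_sub_apply hk2.contDiffAt
      hk'.contDiffAt, iteratedFDeriv_comp_add_right]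
    have hdiff : Differentiable ℝ (iteratedFDeriv ℝ j (k : Plane → ℝ)) :=
      k.contDiff.differentiable_iteratedFDeriv (by exact_mod_cast ENat.natCast_lt_top j)
    have := Convex.norm_image_sub_le_of_norm_fderiv_le (s := univ) (C := D)
      (f := iteratedFDeriv ℝ j (k : Plane → ℝ)) (𝕜 := ℝ) (fun w _ => hdiff w)
      (fun w _ => by rw [norm_fderiv_iteratedFDeriv]; exact hD (j + 1) (by omega) w)
      convex_univ (mem_univ z) (mem_univ (z + v))
    simpa using this
  have hsupp : tsupport (reflect (kv - k) x) ⊆ Metric.closedBall x (R + 1) := by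
    refine tsupport_reflect (closure_minimal (fun z hz => ?_) Metric.isClosed_closedBall) x
    by_contra hzR
    rw [mem_closedBall_zero_iff, not_le] at hzR
    refine hz ?_
    have h1 : k z = 0 := image_eq_zero_of_notMem_tsupport fun h => by
      have := mem_closedBall_zero_iff.1 (hR h)
      linarith
    have h2 : k (z + v) = 0 := image_eq_zero_of_notMem_tsupport fun h => by
      have := mem_closedBall_zero_iff.1 (hR h)
      have h3 := norm_sub_norm_le z (-v)
      rw [sub_neg_eq_add, norm_neg] at h3
      linarith
    rw [Test.sub_apply, hkv_apply, h1, h2, sub_zero]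
  rw [e]
  refine (hC T hT _ x (D * ‖v‖) (by positivity) hsupp fun j hj z => ?_).trans (le_of_eq (by ring))
  rw [norm_iteratedFDeriv_reflect]
  exact hder j hj _

section

variable {K : Test} {V : Plane → ℝ} {r b B : ℝ}

lemma contDiff_integral_mul (K : Test) (hV : Continuous V) :
    ContDiff ℝ (⊤ : ℕ∞) fun x => ∫ y, K y * V (x - y) :=
  HasCompactSupport.contDiff_convolution_left (n := ⊤) (ContinuousLinearMap.mul ℝ ℝ)
    K.hasCompactSupport K.contDiff hV.locallyIntegrable

lemma polyWeight_sub_le (hb : 0 ≤ b) (hr : 0 ≤ r) {x y : Plane} (hy : ‖y‖ ≤ r) :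
    polyWeight b (x - y) ≤ (1 + r) ^ b * polyWeight b x :=
  polyWeight_le hb hr ((norm_sub_le x y).trans (by linarith))

lemma abs_integral_mul_le_of_bound (hb : 0 ≤ b) (hr : 0 ≤ r) (hB : 0 ≤ B)
    (hK : tsupport K ⊆ Metric.closedBall 0 r) {x : Plane} {F : Plane → ℝ}
    (hF : ∀ y, ‖y‖ ≤ r → |F y| ≤ B * polyWeight b (x - y)) :
    |∫ y, K y * F y| ≤ (1 + r) ^ b * B * (∫ y, |K y|) * polyWeight b x := by
  have hbd : ∀ y, ‖K y * F y‖ ≤ (1 + r) ^ b * B * polyWeight b x * |K y| := fun y => by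
    by_cases hy : y ∈ tsupport K
    · have hy' : ‖y‖ ≤ r := by simpa using hK hy
      rw [norm_mul, mul_comm]
      refine mul_le_mul_of_nonneg_right ((hF y hy').trans ?_) (abs_nonneg _)
      have := mul_le_mul_of_nonneg_left (polyWeight_sub_le (x := x) hb hr hy') hB
      linarith
    · rw [image_eq_zero_of_notMem_tsupport hy]
      simp
  refine (norm_integral_le_of_norm_le (K.integrable.abs.const_mul _)
    (Eventually.of_forall hbd)).trans (le_of_eq ?_)
  rw [integral_const_mul]
  ring

/-- The derivative is estimated through the Lipschitz bound on `V`, so that only `∫ |K|` enters.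
Derivatives of `K` would not be bounded uniformly when `K` is a mollification of `∇G`. -/
lemma norm_fderiv_integral_mul_le (hb : 0 ≤ b) (hr : 0 ≤ r) (hB : 0 ≤ B)
    (hK : tsupport K ⊆ Metric.closedBall 0 r) (hV : Continuous V)
    (hL : ∀ x y, ‖y - x‖ ≤ 1 → |V y - V x| ≤ B * polyWeight b x * ‖y - x‖) (x : Plane) :
    ‖fderiv ℝ (fun x => ∫ y, K y * V (x - y)) x‖
      ≤ (1 + r) ^ b * B * (∫ y, |K y|) * polyWeight b x := by
  have hI : 0 ≤ ∫ y, |K y| := integral_nonneg fun _ => abs_nonneg _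
  have hp := polyWeight_pos b x
  refine norm_fderiv_le_of_lip' ℝ (by positivity) ?_
  filter_upwards [Metric.closedBall_mem_nhds x one_pos] with z hz
  have hz1 : ‖z - x‖ ≤ 1 := by rwa [mem_closedBall_iff_norm] at hz
  have hi : ∀ u, Integrable fun y => K y * V (u - y) := fun u =>
    integrable_mul_comp_sub K.continuous.locallyIntegrable K.hasCompactSupport hV u
  rw [← integral_sub (hi z) (hi x), Real.norm_eq_abs]
  simp_rw [← mul_sub]
  have := abs_integral_mul_le_of_bound (K := K) (x := x) (B := B * ‖z - x‖) hb hr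
    (by positivity) hK (F := fun y => V (z - y) - V (x - y)) fun y _ => by
      have := hL (x - y) (z - y) (by simpa using hz1)
      simp only [sub_sub_sub_cancel_right] at this
      linarith
  linarith

end

end Anderson
end

noncomputable section
namespace Anderson

/-! ### Pathwise estimates for the shifted enhanced noise -/

section

variable {χ : Test}

lemma integral_abs_gradKernel_le (hχ : IsCutoff χ) (k : Test) (i : Fin 2) :
    ∫ x, |gradKernel χ k i x| ≤ (∫ x, |gradComp χ i x|) * ∫ x, |k x| := by
  have hg := (integrable_gradComp hχ i).abs
  have h := integral_convolution (L := ContinuousLinearMap.mul ℝ ℝ) (μ := volume) (ν := volume)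
    hg k.integrable.abs
  rw [ContinuousLinearMap.mul_apply'] at h
  rw [← h]
  refine integral_mono (gradKernel χ k i).integrable.abs
    (hg.integrable_convolution (ContinuousLinearMap.mul ℝ ℝ) k.integrable.abs) fun x => ?_
  beta_reduce
  rw [gradKernel, testConv_apply _ (locallyIntegrable_gradComp hχ i)
    (hasCompactSupport_gradComp hχ i), ← Real.norm_eq_abs]
  refine (norm_integral_le_integral_norm _).trans (le_of_eq ?_)
  rw [convolution_def]
  congr 1 with t
  rw [norm_mul]
  rfl

lemma tsupport_gradKernel (hχ : IsCutoff χ) {k : Test} {r : ℝ}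
    (hk : tsupport k ⊆ Metric.closedBall 0 r) (i : Fin 2) :
    tsupport (gradKernel χ k i) ⊆ Metric.closedBall 0 (2 + r) := by
  refine closure_minimal (fun x hx => ?_) Metric.isClosed_closedBall
  by_contra hxr
  rw [mem_closedBall_zero_iff, not_le] at hxr
  refine hx ?_
  rw [gradKernel, testConv_apply _ (locallyIntegrable_gradComp hχ i)
    (hasCompactSupport_gradComp hχ i)]
  refine integral_eq_zero_of_ae (ae_of_all _ fun t => ?_)
  by_cases ht : t ∈ Metric.closedBall (0 : Plane) 2
  · have h0 : k (x - t) = 0 := image_eq_zero_of_notMem_tsupport fun h => by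
      have h1 := mem_closedBall_zero_iff.1 (hk h)
      have h2 := mem_closedBall_zero_iff.1 ht
      have h3 := norm_sub_norm_le x t
      linarith
    simp [h0]
  · simp [gradComp_eq_zero hχ i ht]

/-- Decomposition of `∇G * (ξ + h - g * k)_ε` into a rough part, in which `ξ` is replaced by
`ξ - ξ * k`, and a smooth part. -/
lemma conv_shift (hχ : IsCutoff χ) {α b : ℝ} (hb : 0 ≤ b) {ξ : Distrib}
    (hξ : ξ ∈ holderSubgroup α (polyWeight b)) (hα : α ≤ 0) (h k g e : Test) (i : Fin 2)
    (x : Plane) :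
    conv (ξ + ofFun (h - testConv k g : Test)) (gradKernel χ e i) x
      = conv ξ (gradKernel χ (e - testConv e k) i) x
        + ∫ y, gradKernel χ e i y * (h (x - y) + conv (ξ - ofFun g) k (x - y)) := by
  set K := gradKernel χ e i with hK
  have hT : ξ - ofFun g ∈ holderSubgroup α (polyWeight b) :=
    sub_mem hξ (ofFun_test_mem hα hb g)
  have e1 : gradKernel χ (e - testConv e k) i = K - testConv k K := by
    rw [gradKernel_sub hχ, hK, testConv_gradKernel hχ, testConv_comm e k]
  have e2 : ∫ y, K y * (h (x - y) + conv (ξ - ofFun g) k (x - y))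
      = testConv h K x + conv (ξ - ofFun g) (testConv k K) x := by
    rw [← integral_mul_conv hb hT k K.continuous.locallyIntegrable K.hasCompactSupport,
      Test.testConv_apply, ← integral_add
        (integrable_mul_comp_sub K.continuous.locallyIntegrable K.hasCompactSupport h.continuous x)
        (integrable_mul_comp_sub K.continuous.locallyIntegrable K.hasCompactSupport
          (continuous_conv hb hT k) x)]
    simp_rw [mul_add]
  have e3 : testConv K (testConv k g) = testConv (testConv k K) g := by
    rw [testConv_comm K, testConv_right_comm]
  rw [e1, e2, conv_add_left, conv_sub_right, conv_sub_left, ofFun_test_sub, conv_sub_left,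
    conv_ofFun_test, conv_ofFun_test, conv_ofFun_test, e3, testConv_comm h K]
  ring

/-- The smooth part of the shifted enhanced noise is bounded in `C¹`, and its square is close to
that of `∇G * h`. -/
lemma exists_smooth_part_bounds {ρ : Test} (hρ : IsMollifier ρ) (hχ : IsCutoff χ) {κ b : ℝ}
    (hb : 0 ≤ b) (hbκ : b < κ / 2) (h : Test) (i : Fin 2) :
    ∃ B D : ℝ, 0 ≤ B ∧ 0 ≤ D ∧ ∀ δ ∈ Ioc (0 : ℝ) 1, ∀ ε ∈ Ioc 0 δ, ∀ U : Plane → ℝ, Continuous U →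
      (∀ x, |U x| ≤ δ * polyWeight b x) →
      (∀ x y, ‖y - x‖ ≤ 1 → |U y - U x| ≤ polyWeight b x * ‖y - x‖) →
      ∀ S : Plane → ℝ, (S = fun x => ∫ y, gradKernel χ (rescale ρ ε 0) i y
        * (h (x - y) + U (x - y))) →
      ContDiff ℝ (⊤ : ℕ∞) S ∧ (∀ x, |S x| ≤ B * polyWeight b x) ∧
      (∀ x, ‖fderiv ℝ S x‖ ≤ B * polyWeight b x) ∧
      ∀ x, |S x ^ 2 - gradKernel χ h i x ^ 2| ≤ δ * D * polyWeight κ x := by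
  obtain ⟨A, hA0, hA⟩ := h.exists_bound
  obtain ⟨L, hL0, hL⟩ := h.exists_lipschitz
  obtain ⟨A', hA0', hA'⟩ := (gradKernel χ h i).exists_bound
  obtain ⟨L', hL0', hL'⟩ := (gradKernel χ h i).exists_lipschitz
  set M : ℝ := ∫ x, |ρ x| with hM
  have hM0 : 0 ≤ M := integral_nonneg fun _ => abs_nonneg _
  set N : ℝ := (∫ x, |gradComp χ i x|) * M with hN
  have hN0 : 0 ≤ N := mul_nonneg (integral_nonneg fun _ => abs_nonneg _) hM0
  -- `A` and `L` bound `h` and its increments, the `1` those of `U`. The factor `4 ^ b` is the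
  -- weight ratio over the ball of radius `3 = 2 + 1` carrying the mollified kernel.
  set B : ℝ := 4 ^ b * (A + L + 1) * N with hB
  set D : ℝ := 4 ^ b * 1 * N + L' * M with hD
  have hB0 : 0 ≤ B := by positivity
  have hD0 : 0 ≤ D := by positivity
  refine ⟨B, D * (B + A'), hB0, by positivity, ?_⟩
  intro δ hδ ε hε U hU hU0 hU1 S hS
  have hε1 : ε ≤ 1 := hε.2.trans hδ.2
  set K := gradKernel χ (rescale ρ ε 0) i with hK
  have hKs : tsupport K ⊆ Metric.closedBall 0 3 := by
    have := tsupport_gradKernel hχ (tsupport_rescale_mollifier hρ hε.1 hε1) i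
    norm_num at this
    exact this
  have hKI : ∫ x, |K x| ≤ N := by
    have := integral_abs_gradKernel_le hχ (rescale ρ ε 0) i
    rwa [integral_abs_rescale _ hε.1] at this
  have hV : Continuous fun x => h x + U x := h.continuous.add hU
  have hw1 : ∀ x, 1 ≤ polyWeight b x := one_le_polyWeight hb
  have hscale : ∀ {C : ℝ}, 0 ≤ C → ∀ x, (1 + 3) ^ b * C * (∫ y, |K y|) * polyWeight b x
      ≤ 4 ^ b * C * N * polyWeight b x := fun {C} hC x => by
    have := polyWeight_pos b x
    norm_num
    gcongr
  have hS0 : ∀ x, |S x| ≤ B * polyWeight b x := fun x => by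
    rw [hS]
    refine (abs_integral_mul_le_of_bound hb (by norm_num : (0 : ℝ) ≤ 3)
      (by positivity : 0 ≤ A + L + 1) hKs fun y _ => ?_).trans (hscale (by positivity) x)
    refine (abs_add_le _ _).trans ?_
    have h1 := hA (x - y)
    have h2 := hU0 (x - y)
    have h3 := hw1 (x - y)
    have h4 := mul_le_mul_of_nonneg_right hδ.2 (zero_le_one.trans h3)
    nlinarith
  refine ⟨?_, hS0, fun x => ?_, fun x => ?_⟩
  · rw [hS]
    exact contDiff_integral_mul K hV
  · rw [hS]
    refine (norm_fderiv_integral_mul_le (V := fun x => h x + U x) hb (by norm_num : (0 : ℝ) ≤ 3)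
      (by positivity : 0 ≤ A + L + 1) hKs hV (fun x y hxy => ?_) x).trans (hscale (by positivity) x)
    have e : h y + U y - (h x + U x) = (h y - h x) + (U y - U x) := by ring
    rw [e]
    refine (abs_add_le _ _).trans ?_
    have h1 := hL y x
    have h2 := hU1 x y hxy
    have h3 := mul_nonneg (sub_nonneg.2 (hw1 x)) (norm_nonneg (y - x))
    nlinarith [mul_nonneg hA0 (mul_nonneg (zero_le_one.trans (hw1 x)) (norm_nonneg (y - x))),
      mul_nonneg hL0 h3]
  · have e1 : S x = testConv (rescale ρ ε 0) (gradKernel χ h i) x + ∫ y, K y * U (x - y) := by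
      have e2 : testConv (rescale ρ ε 0) (gradKernel χ h i) x = ∫ y, K y * h (x - y) := by
        rw [testConv_gradKernel hχ, testConv_comm, ← testConv_gradKernel hχ, Test.testConv_apply]
      rw [e2, hS, ← integral_add
        (integrable_mul_comp_sub K.continuous.locallyIntegrable K.hasCompactSupport h.continuous x)
        (integrable_mul_comp_sub K.continuous.locallyIntegrable K.hasCompactSupport hU x)]
      simp_rw [mul_add]
    have h1 := abs_testConv_sub_le (tsupport_rescale hρ.tsupport_subset hε.1 0)
      (by rw [integral_rescale _ hε.1, hρ.integral_eq_one]) hL0' hL' x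
    rw [integral_abs_rescale _ hε.1, ← hM] at h1
    have h2 := (abs_integral_mul_le_of_bound hb (by norm_num : (0 : ℝ) ≤ 3) hδ.1.le hKs
      (x := x) fun y _ => hU0 (x - y)).trans (hscale hδ.1.le x)
    have h3 : |S x - gradKernel χ h i x| ≤ δ * D * polyWeight b x := by
      have e2 : S x - gradKernel χ h i x = (testConv (rescale ρ ε 0) (gradKernel χ h i) x
        - gradKernel χ h i x) + ∫ y, K y * U (x - y) := by rw [e1]; ring
      rw [e2]
      refine (abs_add_le _ _).trans ?_
      have h4 : L' * ε * M ≤ L' * δ * M * polyWeight b x := by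
        calc L' * ε * M ≤ L' * δ * M * 1 := by
              rw [mul_one]
              have := hε.2
              gcongr
          _ ≤ _ := by
              have := hδ.1.le
              gcongr
              exact hw1 x
      rw [hD]
      linarith
    have h5 : |S x + gradKernel χ h i x| ≤ (B + A') * polyWeight b x := by
      refine (abs_add_le _ _).trans ?_
      have := hS0 x
      have := hA' x
      nlinarith [hw1 x]
    have e3 : S x ^ 2 - gradKernel χ h i x ^ 2
        = (S x - gradKernel χ h i x) * (S x + gradKernel χ h i x) := by ring
    rw [e3, abs_mul]
    have hp := polyWeight_pos b x
    have hδ0 := hδ.1.le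
    calc _ ≤ (δ * D * polyWeight b x) * ((B + A') * polyWeight b x) :=
          mul_le_mul h3 h5 (abs_nonneg _) (by positivity)
      _ = δ * (D * (B + A')) * (polyWeight b x * polyWeight b x) := by ring
      _ ≤ δ * (D * (B + A')) * polyWeight κ x := by
          rw [polyWeight_mul]
          gcongr
          exact polyWeight_mono (by linarith) x

/-- If the rough part and its Wick square are small and the smooth part is close to `∇G * h`, then
the second component of the shifted enhanced noise is close to `|∇G * h|² + c`. -/
theorem exists_holderNorm_shift_le {ρ : Test} (hρ : IsMollifier ρ) (hχ : IsCutoff χ) {κ b : ℝ}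
    (hκ : 0 < κ) (hκ1 : κ < 1) (hb : 0 ≤ b) (hbκ : b < κ / 2) (h : Test) (c : ℝ) :
    ∃ C : ℝ, 0 ≤ C ∧ ∀ δ ∈ Ioc (0 : ℝ) 1, ∀ ε ∈ Ioc 0 δ, ∀ (k g : Test) (ξ : Noise κ b),
      (∀ x, |conv (ξ.toDistrib - ofFun g) k x| ≤ δ * polyWeight b x) →
      (∀ x y, ‖y - x‖ ≤ 1 → |conv (ξ.toDistrib - ofFun g) k y - conv (ξ.toDistrib - ofFun g) k x|
        ≤ polyWeight b x * ‖y - x‖) →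
      ∀ W : Fin 2 → Test, W = gradKernel χ (rescale ρ ε 0 - testConv (rescale ρ ε 0) k) →
      (∀ i, holderNorm (-κ) (polyWeight (κ / 2)) (ofFun fun x => conv ξ.toDistrib (W i) x
        * conv ξ.toDistrib (W i) x - l2inner (W i) (W i)) < ENNReal.ofReal δ) →
      (∀ i, holderNorm (-κ) (polyWeight (κ / 2)) (ofFun (conv ξ.toDistrib (W i)))
        < ENNReal.ofReal δ) →
      |gradVar χ (rescale ρ ε 0 - testConv (rescale ρ ε 0) k) - gradVar χ (rescale ρ ε 0) - c| ≤ δ →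
      holderNorm (-κ) (polyWeight κ)
        (ofFun (wickSq (ξ.toDistrib + ofFun (h - testConv k g : Test))
          (gradKernel χ (rescale ρ ε 0)))
          - ofFun fun x => ∑ i, gradKernel χ h i x ^ 2 + c) ≤ ENNReal.ofReal (C * δ) := by
  choose B D hB0 hD0 hBD using exists_smooth_part_bounds hρ hχ hb hbκ h
  set v : ℝ := 2 ^ κ * volume.real (Metric.closedBall (0 : Plane) 1) with hv
  have hv0 : 0 ≤ v := by positivity
  refine ⟨∑ i, (1 + 2 * (2 ^ b * (2 * B i))) + (∑ i, D i + 1) * v, ?_, ?_⟩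
  · have h1 : 0 ≤ ∑ i, (1 + 2 * (2 ^ b * (2 * B i))) := Finset.sum_nonneg fun i _ => by
      have := hB0 i
      positivity
    have h2 : 0 ≤ ∑ i, D i := Finset.sum_nonneg fun i _ => hD0 i
    positivity
  intro δ hδ ε hε k g ξ hU0 hU1 W hW hX hZ hc
  have hmem : ξ.toDistrib - ofFun g ∈ holderSubgroup (-1 - κ) (polyWeight b) :=
    sub_mem ξ.mem (ofFun_test_mem (by linarith) hb g)
  have hUc := continuous_conv hb hmem k
  set S : Fin 2 → Plane → ℝ := fun i x => ∫ y, gradKernel χ (rescale ρ ε 0) i y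
    * (h (x - y) + conv (ξ.toDistrib - ofFun g) k (x - y)) with hS
  have hSi := fun i => hBD i δ hδ ε hε _ hUc hU0 hU1 (S i) rfl
  have hsc : ∀ i, Continuous (S i) := fun i => (hSi i).1.continuous
  set c' : ℝ := gradVar χ (rescale ρ ε 0 - testConv (rescale ρ ε 0) k) - gradVar χ (rescale ρ ε 0)
    with hc'
  set X : Fin 2 → Plane → ℝ := fun i x => conv ξ.toDistrib (W i) x * conv ξ.toDistrib (W i) x
    - l2inner (W i) (W i) with hXdef
  set Y : Fin 2 → Plane → ℝ := fun i x => conv ξ.toDistrib (W i) x * (2 * S i x) with hYdef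
  set E : Plane → ℝ := fun x => ∑ i, (S i x ^ 2 - gradKernel χ h i x ^ 2) + (c' - c) with hE
  have hcc : ∀ i, Continuous (conv ξ.toDistrib (W i)) := fun i => continuous_conv hb ξ.mem _
  have hXc : ∀ i, Continuous (X i) := fun i => ((hcc i).mul (hcc i)).sub continuous_const
  have hYc : ∀ i, Continuous (Y i) := fun i => (hcc i).mul (continuous_const.mul (hsc i))
  have hEc : Continuous E := (continuous_finsetSum _ fun i _ => ((hsc i).pow 2).sub
    ((gradKernel χ h i).continuous.pow 2)).add continuous_const
  have hmem' : ξ.toDistrib + ofFun (h - testConv k g : Test)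
      ∈ holderSubgroup (-1 - κ) (polyWeight b) :=
    add_mem ξ.mem (ofFun_test_mem (by linarith) hb _)
  -- Expansion of the square of rough part plus smooth part: `X` is the Wick square of the rough
  -- part, `Y` the cross term, and `E` collects the error on the smooth square and the discrepancy
  -- between `c'` and `c`. The rough part is centred by its own variance, which is how `c'` appears.
  have hdec : ofFun (wickSq (ξ.toDistrib + ofFun (h - testConv k g : Test))
      (gradKernel χ (rescale ρ ε 0))) - ofFun (fun x => ∑ i, gradKernel χ h i x ^ 2 + c)
      = ∑ i, (ofFun (X i) + ofFun (Y i)) + ofFun E := by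
    have hXY : ∀ i, LocallyIntegrable (X i + Y i) := fun i =>
      ((hXc i).add (hYc i)).locallyIntegrable
    have hsum : Continuous fun x => ∑ i, (X i + Y i) x :=
      continuous_finsetSum _ fun i _ => (hXc i).add (hYc i)
    have hHc : Continuous fun x => ∑ i, gradKernel χ h i x ^ 2 + c :=
      (continuous_finsetSum _ fun i _ => (gradKernel χ h i).continuous.pow 2).add continuous_const
    simp_rw [← fun i => ofFun_add (hXc i).locallyIntegrable (hYc i).locallyIntegrable]
    rw [← ofFun_finsetSum _ hXY, ← ofFun_add hsum.locallyIntegrable hEc.locallyIntegrable,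
      ← ofFun_sub (continuous_wickSq hb hmem' _).locallyIntegrable hHc.locallyIntegrable]
    congr 1 with x
    simp only [wickSq, Pi.add_apply, hXdef, hYdef, hE, hc', gradVar]
    simp_rw [fun i => conv_shift hχ hb ξ.mem (by linarith) h k g (rescale ρ ε 0) i x, ← hW]
    simp only [Fin.sum_univ_two, hS]
    ring
  rw [hdec]
  have hXn : ∀ i, holderNorm (-κ) (polyWeight κ) (ofFun (X i)) ≤ ENNReal.ofReal δ := fun i =>
    (holderNorm_weight_anti (by linarith) _ _).trans (hX i).le
  -- The rough factor has weight exponent `κ / 2` and the smooth one `b`, so the product fits in `κ`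
  -- because `b < κ / 2`.
  have hYn : ∀ i, holderNorm (-κ) (polyWeight κ) (ofFun (Y i))
      ≤ ENNReal.ofReal (2 * (2 ^ b * (2 * B i)) * δ) := fun i => by
    refine (holderNorm_weight_anti (by linarith : κ / 2 + b ≤ κ) _ _).trans ?_
    obtain ⟨s1, s2, s3, -⟩ := hSi i
    have hd := s1.differentiable (by simp)
    refine (holderNorm_mul_le hκ hκ1.le hb (mul_nonneg zero_le_two (hB0 i))
      (hcc i).locallyIntegrable (contDiff_const.mul s1) (fun x => ?_) (fun x => ?_)
      ((hZ i).trans ENNReal.ofReal_lt_top)).trans (ENNReal.ofReal_le_ofReal ?_)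
    · rw [abs_mul, abs_two]
      linarith [s2 x]
    · rw [fderiv_const_mul (hd x), norm_smul, Real.norm_two]
      linarith [s3 x]
    · have := hB0 i
      gcongr
      exact ENNReal.toReal_le_of_le_ofReal hδ.1.le (hZ i).le
  have hEn : holderNorm (-κ) (polyWeight κ) (ofFun E)
      ≤ ENNReal.ofReal (δ * (∑ i, D i + 1) * v) := by
    refine holderNorm_ofFun_le (by linarith) hκ.le
      (mul_nonneg hδ.1.le (add_nonneg (Finset.sum_nonneg fun i _ => hD0 i) zero_le_one))
      hEc.locallyIntegrable fun x => ?_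
    refine (abs_add_le _ _).trans ?_
    refine (add_le_add (Finset.abs_sum_le_sum_abs _ _) hc).trans ?_
    have h1 := Finset.sum_le_sum fun i (_ : i ∈ Finset.univ) => (hSi i).2.2.2 x
    refine (add_le_add h1 (le_mul_of_one_le_right hδ.1.le (one_le_polyWeight hκ.le x))).trans
      (le_of_eq ?_)
    simp only [Fin.sum_univ_two]
    ring
  refine (holderNorm_add_le _ _ _ _).trans ?_
  refine (add_le_add ((holderNorm_finsetSum_le _ _ _ _).trans
    (Finset.sum_le_sum fun i _ => (holderNorm_add_le _ _ _ _).trans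
      (add_le_add (hXn i) (hYn i)))) hEn).trans ?_
  have hδ0 := hδ.1.le
  have p0 := hB0 0
  have p1 := hB0 1
  have q0 := hD0 0
  have q1 := hD0 1
  simp only [Fin.sum_univ_two]
  rw [← ENNReal.ofReal_add hδ0 (by positivity), ← ENNReal.ofReal_add hδ0 (by positivity),
    ← ENNReal.ofReal_add (by positivity) (by positivity),
    ← ENNReal.ofReal_add (by positivity) (by positivity)]
  exact ENNReal.ofReal_le_ofReal (le_of_eq (by ring))

end

end Anderson
end

noncomputable section
namespace Anderson

/-! ### Smooth pairs belong to the support -/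

/-- The set of points that eventually leave all the `E n` has measure at most `r`, so it cannot
cover `A` up to a null set. Small failure probabilities at each `n`, without summability, thus yield
one realisation that is good infinitely often. -/
lemma exists_frequently_mem {Ω : Type*} [MeasurableSpace Ω] {P : Measure Ω} {A : Set Ω}
    {E : ℕ → Set Ω} {G : Ω → Prop} {r : ℝ≥0∞} (hA : r < P A) (hE : ∀ᶠ n in atTop, P (E n)ᶜ ≤ r)
    (hG : ∀ᵐ ω ∂P, G ω) : ∃ ω ∈ A, G ω ∧ ∃ᶠ n in atTop, ω ∈ E n := by
  by_contra! hcon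
  obtain ⟨n₀, hn₀⟩ := eventually_atTop.1 hE
  set B : ℕ → Set Ω := fun N => ⋂ n ≥ N, (E n)ᶜ with hB
  have hmono : Monotone B := fun N N' h => biInter_mono (fun n hn => le_trans h hn) fun _ _ => le_rfl
  have hsub : A ⊆ (⋃ N, B N) ∪ {ω | ¬ G ω} := fun ω hω => by
    by_cases hg : G ω
    · obtain ⟨N, hN⟩ := eventually_atTop.1 (hcon ω hω hg)
      exact Or.inl (mem_iUnion.2 ⟨N, mem_iInter₂.2 fun n hn => hN n hn⟩)
    · exact Or.inr hg
  refine absurd hA (not_lt.2 ((measure_mono hsub).trans ((measure_union_le _ _).trans ?_)))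
  rw [show P {ω | ¬ G ω} = 0 from hG, add_zero]
  refine le_of_tendsto (tendsto_measure_iUnion_atTop hmono) ?_
  filter_upwards [eventually_ge_atTop n₀] with N hN
  exact (measure_mono (biInter_subset_of_mem (mem_Ici.2 le_rfl))).trans (hn₀ N hN)

section

variable {κ b : ℝ} {P : Measure (Noise κ b)} {ρ χ : Test}

/-- For each `ξ` some radius works for all admissible `k` simultaneously, so these events increase
to the whole space as the radius decreases, and continuity from below applies. Uniformity in `k`
matters because `k` is selected only after the radius. -/
lemma exists_lt_measure_conv_sub (hP : IsWhiteNoise P) (hκ : 0 < κ) (hb : 0 ≤ b) {δ : ℝ}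
    (hδ : 0 < δ) {r : ℝ≥0∞} (hr : r < 1) : ∃ R : ℝ, 0 < R ∧ r < P {ξ | ∀ k : Test,
      tsupport k ⊆ Metric.closedBall 0 R → ∫ x, k x = 1 → ∫ x, |k x| ≤ 3 →
      holderNorm (-1 - κ) (polyWeight b) (ofFun (conv ξ.toDistrib k) - ξ.toDistrib)
        < ENNReal.ofReal δ} := by
  have := hP.isProbabilityMeasure
  set A : ℕ → Set (Noise κ b) := fun n => {ξ | ∀ k : Test,
      tsupport k ⊆ Metric.closedBall 0 (1 / ((n : ℝ) + 1)) → ∫ x, k x = 1 → ∫ x, |k x| ≤ 3 →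
      holderNorm (-1 - κ) (polyWeight b) (ofFun (conv ξ.toDistrib k) - ξ.toDistrib)
        < ENNReal.ofReal δ} with hA
  have hmono : Monotone A := fun n m hnm ξ hξ k hk => hξ k (hk.trans
    (Metric.closedBall_subset_closedBall (by
      have : (n : ℝ) ≤ m := by exact_mod_cast hnm
      gcongr)))
  have huniv : ⋃ n, A n = univ := eq_univ_of_forall fun ξ => by
    obtain ⟨R, hR, h⟩ := exists_holderNorm_conv_sub_le (by linarith : -1 - κ ≤ 0) hb ξ.mem
      (by norm_num : (0 : ℝ) ≤ 3) hδ
    obtain ⟨n, hn⟩ := exists_nat_one_div_lt hR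
    exact mem_iUnion.2 ⟨n, fun k hk => h k (hk.trans (Metric.closedBall_subset_closedBall hn.le))⟩
  have ht := tendsto_measure_iUnion_atTop (μ := P) hmono
  rw [huniv, measure_univ] at ht
  obtain ⟨n, hn⟩ := (ht.eventually (lt_mem_nhds hr)).exists
  exact ⟨1 / ((n : ℝ) + 1), by positivity, hn⟩

/-- The form in which the Cameron-Martin theorem is used: null sets of white noise are null for its
shifts by test functions. -/
lemma ae_add_test (hP : IsWhiteNoise P) (hκ : 0 ≤ κ) (hb : 0 ≤ b) {f : Test} {h : Noise κ b}
    (hf : h.toDistrib = ofFun f) {p : Noise κ b → Prop} (hp : ∀ᵐ ξ ∂P, p ξ) :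
    ∀ᵐ ξ ∂P, p (ξ + h) := by
  have h1 := (hP.map_add_absolutelyContinuous hκ hb hf).ae_le hp
  exact ae_of_ae_map (continuous_id.add continuous_const).measurable.aemeasurable h1

/-- Smallness in probability of the rough part of the shifted enhanced noise. -/
lemma exists_radius_rough_part (hP : IsWhiteNoise P) (hκ : 0 < κ) (hκ1 : κ < 1) (hb : 0 ≤ b)
    (hρ : IsMollifier ρ) (hχ : IsCutoff χ) {δ : ℝ} (hδ : 0 < δ) {r : ℝ≥0∞} (hr : 0 < r) :
    ∃ R : ℝ, 0 < R ∧ ∀ k : Test, tsupport k ⊆ Metric.closedBall 0 R → ∫ x, k x = 1 →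
      ∫ x, |k x| ≤ 3 → ∀ ε ∈ Ioc 0 R, ∀ W : Fin 2 → Test,
      W = gradKernel χ (rescale ρ ε 0 - testConv (rescale ρ ε 0) k) →
      P {ξ | (∀ i, holderNorm (-κ) (polyWeight (κ / 2)) (ofFun fun x => conv ξ.toDistrib (W i) x
        * conv ξ.toDistrib (W i) x - l2inner (W i) (W i)) < ENNReal.ofReal δ) ∧
        ∀ i, holderNorm (-κ) (polyWeight (κ / 2)) (ofFun (conv ξ.toDistrib (W i)))
          < ENNReal.ofReal δ}ᶜ ≤ r := by
  obtain ⟨s, hs1, hs2, h⟩ := exists_chaos_small hρ.tsupport_subset hρ.integral_eq_one hκ hκ1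
    (half_pos hκ)
  have hr4 : 0 < r / 4 := ENNReal.div_pos hr.ne' (by simp)
  obtain ⟨γ, hγ, h1, h2⟩ := h hb hP 1 δ (r / 4) ENNReal.one_ne_top hδ hr4
  set M : ℝ := ∫ x, |ρ x| with hM
  have hM0 : 0 ≤ M := integral_nonneg fun _ => abs_nonneg _
  obtain ⟨R, hR, hRk⟩ := exists_lsNorm_gradKernel_sub_le hχ hs1 hs2 (M := 3 * M) (by positivity)
    (lt_min hγ one_pos)
  -- With radius `R / 2` for both `k` and `ρ_ε`, their convolution is still supported in the ball of
  -- radius `R`. Then `W` is a difference of two mollified kernels, hence small in `L^s`.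
  refine ⟨R / 2, half_pos hR, fun k hk hk1 hkM ε hε W hW => ?_⟩
  have hW' : ∀ i, lsNorm s (W i) ≤ ENNReal.ofReal (min γ 1) := fun i => by
    rw [hW, gradKernel_sub hχ]
    refine hRk _ _ (tsupport_rescale_mollifier hρ hε.1 (by linarith [hε.2]))
      (by rw [integral_rescale _ hε.1, hρ.integral_eq_one])
      (by rw [integral_abs_rescale _ hε.1]; linarith) ?_ ?_ ?_ i
    · have := tsupport_testConv (tsupport_rescale_mollifier hρ hε.1 hε.2) hk
      rwa [add_halves] at this
    · rw [integral_testConv, integral_rescale _ hε.1, hρ.integral_eq_one, hk1, one_mul]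
    · refine (integral_abs_testConv_le _ _).trans ?_
      rw [integral_abs_rescale _ hε.1]
      exact mul_le_mul_of_nonneg_right hkM hM0
  have hγ' : ∀ i, lsNorm s (W i) ≤ ENNReal.ofReal γ := fun i =>
    (hW' i).trans (ENNReal.ofReal_le_ofReal (min_le_left _ _))
  have h1' : ∀ i, lsNorm s (W i) ≤ 1 := fun i =>
    (hW' i).trans ((ENNReal.ofReal_le_ofReal (min_le_right _ _)).trans ENNReal.ofReal_one.le)
  have hsub : {ξ : Noise κ b | (∀ i, holderNorm (-κ) (polyWeight (κ / 2)) (ofFun fun x =>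
        conv ξ.toDistrib (W i) x * conv ξ.toDistrib (W i) x - l2inner (W i) (W i))
          < ENNReal.ofReal δ) ∧
        ∀ i, holderNorm (-κ) (polyWeight (κ / 2)) (ofFun (conv ξ.toDistrib (W i)))
          < ENNReal.ofReal δ}ᶜ
      ⊆ ⋃ i, ({ξ : Noise κ b | ENNReal.ofReal δ ≤ holderNorm (-κ) (polyWeight (κ / 2))
          (ofFun fun x => conv ξ.toDistrib (W i) x * conv ξ.toDistrib (W i) x
            - l2inner (W i) (W i))}
        ∪ {ξ : Noise κ b | ENNReal.ofReal δ ≤ holderNorm (-κ) (polyWeight (κ / 2))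
          (ofFun (conv ξ.toDistrib (W i)))}) := by
    intro ξ hξ
    rw [mem_compl_iff, mem_ofPred_eq, not_and_or, not_forall, not_forall] at hξ
    rcases hξ with ⟨i, hi⟩ | ⟨i, hi⟩
    · exact mem_iUnion.2 ⟨i, Or.inl (not_lt.1 hi)⟩
    · exact mem_iUnion.2 ⟨i, Or.inr (not_lt.1 hi)⟩
  refine (measure_mono hsub).trans ((measure_iUnion_le _).trans ?_)
  rw [tsum_fintype, Fin.sum_univ_two]
  refine (add_le_add
    ((measure_union_le _ _).trans (add_le_add (h1 _ _ (hγ' 0) (h1' 0)) (h2 _ (hγ' 0))))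
    ((measure_union_le _ _).trans (add_le_add (h1 _ _ (hγ' 1) (h1' 1)) (h2 _ (hγ' 1))))).trans
    (le_of_eq ?_)
  calc r / 4 + r / 4 + (r / 4 + r / 4) = 4 * (r / 4) := by ring
    _ = r := ENNReal.mul_div_cancel (by simp) (by simp)

/-- The pairs `(h, |∇G * h|² + c)` with `h` a test function belong to the support of `Q`. -/
theorem test_mem_support (hP : IsWhiteNoise P) (hκ : 0 < κ) (hκ1 : κ < 1) (hb : 0 < b)
    (hbκ : b < κ / 2) (hρ : IsMollifier ρ) (hχ : IsCutoff χ) {Q : Noise κ b → EnhancedSpace κ}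
    (hQ : IsLimitNoise ρ χ P Q) (h : Test) (c : ℝ) {q : EnhancedSpace κ}
    (hq1 : q.1.toDistrib = ofFun h)
    (hq2 : q.2.toDistrib = ofFun fun x => ∑ i, gradKernel χ h i x ^ 2 + c) :
    q ∈ (P.map Q).support := by
  have := hP.isProbabilityMeasure
  have := secondCountable_holderSpace (α := -1 - κ) (κ := κ) (by linarith) hκ.le
  have := secondCountable_holderSpace (α := -κ) (κ := κ) (by linarith) hκ.le
  by_contra hcon
  obtain ⟨θ, hθ, hθ0⟩ := Metric.nhds_basis_ball.notMem_measureSupport.1 hcon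
  rw [Measure.map_apply_of_aemeasurable hQ.aemeasurable Metric.isOpen_ball.measurableSet] at hθ0
  -- Arguing by contradiction, `Q` almost surely stays at distance at least `θ` from `q`, while
  -- `Q_ε` converges to `Q` almost surely along `e`. A shifted noise at which both facts hold but
  -- `Q_ε` comes close to `q` will be produced.
  obtain ⟨e, he, hae⟩ := hQ.tendsto.exists_seq_tendsto_ae'
  have hfar : ∀ᵐ ξ ∂P, Tendsto (fun n => enhancedNoise ρ χ P (e n) ξ) atTop (𝓝 (Q ξ)) ∧
      θ ≤ dist (Q ξ) q := by
    filter_upwards [hae, measure_eq_zero_iff_ae_notMem.1 hθ0] with ξ h1 h2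
    exact ⟨h1, not_lt.1 h2⟩
  obtain ⟨C, hC0, hC⟩ := exists_holderNorm_shift_le hρ hχ hκ hκ1 hb.le hbκ h c
  obtain ⟨δ, hδ0, hδ1, hδC, hδθ⟩ : ∃ δ : ℝ, 0 < δ ∧ δ ≤ 1 ∧ C * δ < θ / 2 ∧ 3 * δ ≤ θ / 2 := by
    refine ⟨min 1 (θ / (2 * (C + 3) + 1)), by positivity, min_le_left _ _, ?_, ?_⟩
    · have h1 := min_le_right 1 (θ / (2 * (C + 3) + 1))
      have h2 := mul_le_mul_of_nonneg_left h1 hC0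
      refine h2.trans_lt ?_
      rw [mul_div_assoc', div_lt_iff₀ (by positivity)]
      nlinarith
    · have h1 := min_le_right 1 (θ / (2 * (C + 3) + 1))
      have h2 := mul_le_mul_of_nonneg_left h1 (by norm_num : (0 : ℝ) ≤ 3)
      refine h2.trans ?_
      rw [mul_div_assoc', div_le_iff₀ (by positivity)]
      nlinarith
  -- The rough-part event fails with probability at most `1 / 4`, and the next event has probability
  -- above `1 / 4`, as `exists_frequently_mem` requires.
  obtain ⟨R₁, hR₁, hrough⟩ := exists_radius_rough_part hP hκ hκ1 hb.le hρ hχ hδ0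
    (r := 1 / 4) (by simp)
  obtain ⟨R₂, hR₂, hclose⟩ := exists_lt_measure_conv_sub (r := 1 / 4) hP hκ hb.le hδ0
    (by rw [ENNReal.div_lt_iff (by simp) (by simp)]; norm_num)
  set R := min R₁ (min R₂ 1) with hRdef
  have hR0 : 0 < R := lt_min hR₁ (lt_min hR₂ one_pos)
  obtain ⟨k, hks, hk1, hkM, hkc⟩ := exists_kernel hρ hχ c hR0
  have hk₁ : tsupport k ⊆ Metric.closedBall 0 R₁ :=
    hks.trans (Metric.closedBall_subset_closedBall (min_le_left _ _))
  have hk₂ : tsupport k ⊆ Metric.closedBall 0 R₂ :=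
    hks.trans (Metric.closedBall_subset_closedBall ((min_le_right _ _).trans (min_le_left _ _)))
  have hk₃ : tsupport k ⊆ Metric.closedBall 0 1 :=
    hks.trans (Metric.closedBall_subset_closedBall ((min_le_right _ _).trans (min_le_right _ _)))
  obtain ⟨Dn, hDn⟩ := exists_dense_tests_holderNorm (α := -1 - κ) (by linarith) hb.le
  -- The shift adapted to a given noise would use a test function close to it. Running over a
  -- countable dense family instead makes every shift deterministic, so one null set excludes all of
  -- them.
  let F : ℕ → Noise κ b := fun j =>
    ⟨ofFun (h - testConv k (Dn j) : Test), ofFun_test_mem (by linarith) hb.le _⟩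
  have hgood : ∀ᵐ ξ ∂P, ∀ j, Tendsto (fun n => enhancedNoise ρ χ P (e n) (ξ + F j)) atTop
      (𝓝 (Q (ξ + F j))) ∧ θ ≤ dist (Q (ξ + F j)) q :=
    ae_all_iff.2 fun j => ae_add_test hP hκ.le hb.le (f := h - testConv k (Dn j)) rfl hfar
  have hev : ∀ᶠ n in atTop, e n ∈ Ioc 0 (min R₁ δ) := he.eventually
    (Ioc_mem_nhdsGT (lt_min hR₁ hδ0))
  have hevc : ∀ᶠ n in atTop, |gradVar χ (rescale ρ (e n) 0 - testConv (rescale ρ (e n) 0) k)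
      - gradVar χ (rescale ρ (e n) 0) - c| ≤ δ := by
    filter_upwards [(hkc.comp he).eventually (Metric.closedBall_mem_nhds c hδ0)] with n hn
    exact hn
  -- From here on `ξ` is fixed and the argument is deterministic: only now is the index `j` of the
  -- shift chosen, depending on `ξ` and `k`.
  obtain ⟨ξ, hξA, hξG, hξE⟩ := exists_frequently_mem hclose (hev.mono fun n hn =>
    hrough k hk₁ hk1 hkM (e n) ⟨hn.1, hn.2.trans (min_le_left _ _)⟩ _ rfl) hgood
  obtain ⟨C₁, hC₁0, hC₁⟩ := exists_abs_conv_le (-1 - κ) hb.le k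
  obtain ⟨C₂, hC₂0, hC₂⟩ := exists_abs_conv_sub_le (-1 - κ) hb.le k
  set C₃ : ℝ := (1 + 1) ^ b * 3 with hC₃
  have hC₃0 : 0 ≤ C₃ := by positivity
  obtain ⟨j, hj⟩ := hDn ξ.toDistrib ξ.mem (δ / (C₁ + C₂ + C₃ + 1)) (by positivity)
  set T := ξ.toDistrib - ofFun (Dn j) with hT
  have hTm : T ∈ holderSubgroup (-1 - κ) (polyWeight b) :=
    sub_mem ξ.mem (ofFun_test_mem (by linarith) hb.le _)
  set N : ℝ := (holderNorm (-1 - κ) (polyWeight b) T).toReal with hN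
  have hN0 : 0 ≤ N := ENNReal.toReal_nonneg
  have hNδ : (C₁ + C₂ + C₃ + 1) * N ≤ δ := by
    have h1 : N ≤ δ / (C₁ + C₂ + C₃ + 1) :=
      ENNReal.toReal_le_of_le_ofReal (by positivity) hj.le
    rwa [le_div_iff₀ (by positivity), mul_comm] at h1
  have hN1 : C₁ * N ≤ δ := by nlinarith [mul_nonneg hC₂0 hN0, mul_nonneg hC₃0 hN0]
  have hN2 : C₂ * N ≤ 1 := by nlinarith [mul_nonneg hC₁0 hN0, mul_nonneg hC₃0 hN0]
  have hN3 : C₃ * N ≤ δ := by nlinarith [mul_nonneg hC₁0 hN0, mul_nonneg hC₂0 hN0]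
  have hFd : (F j).toDistrib = ofFun (h - testConv k (Dn j) : Test) := rfl
  -- The shifted noise minus `h` is `(ξ - Dⱼ) * k` plus `ξ - ξ * k`; the first is small by the
  -- choice of `j`, the second by the choice of the radius.
  have hlim : dist (Noise.incl (by linarith : b ≤ κ) (ξ + F j)) q.1 < 2 * δ := by
    rw [dist_eq_norm]
    refine norm_mk_lt ?_
    have e1 : (Noise.incl (by linarith : b ≤ κ) (ξ + F j) - q.1).toDistrib
        = ofFun (conv T k) - (ofFun (conv ξ.toDistrib k) - ξ.toDistrib) := by
      have e2 : ofFun (conv T k) = ofFun (conv ξ.toDistrib k) - ofFun (testConv k (Dn j)) := by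
        rw [← ofFun_sub (continuous_conv hb.le ξ.mem k).locallyIntegrable
          (testConv k (Dn j)).continuous.locallyIntegrable]
        congr 1 with x
        rw [hT, conv_sub_left, conv_ofFun_test]
      rw [HolderSpace.toDistrib_sub, hq1, e2]
      change ξ.toDistrib + (F j).toDistrib - ofFun h = _
      rw [hFd, ofFun_test_sub]
      abel
    rw [e1, sub_eq_add_neg (ofFun (conv T k))]
    refine (holderNorm_weight_anti (by linarith : b ≤ κ) _ _).trans_lt
      ((holderNorm_add_le _ _ _ _).trans_lt ?_)
    rw [holderNorm_neg, two_mul, ENNReal.ofReal_add hδ0.le hδ0.le]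
    refine ENNReal.add_lt_add_of_le_of_lt ?_ ?_ (hξA k hk₂ hk1 hkM)
    · exact ((holderNorm_conv_le hb.le hTm zero_le_one hk₃).trans_lt ENNReal.ofReal_lt_top).ne
    · refine (holderNorm_conv_le hb.le hTm zero_le_one hk₃).trans (ENNReal.ofReal_le_ofReal ?_)
      refine le_trans ?_ hN3
      rw [hC₃]
      gcongr
  obtain ⟨hconv, hdist⟩ := hξG j
  have hev1 : ∀ᶠ n in atTop, dist (enhancedNoise ρ χ P (e n) (ξ + F j)) (Q (ξ + F j)) < θ / 2 :=
    hconv.eventually (Metric.ball_mem_nhds _ (half_pos hθ))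
  have hev2 : ∀ᶠ n in atTop, dist (enhancedNoise ρ χ P (e n) (ξ + F j)).1
      (Noise.incl (by linarith : b ≤ κ) (ξ + F j)) < δ :=
    ((tendsto_enhancedNoise_fst hκ hb hbκ hρ hχ P (ξ + F j)).comp he).eventually
      (Metric.ball_mem_nhds _ hδ0)
  -- The rough-part estimate holds only for infinitely many `n`, all the other conditions for all
  -- large `n`; one common index suffices for the contradiction.
  obtain ⟨n, hnE, hn, hnc, hn1, hn2⟩ :=
    (hξE.and_eventually (hev.and (hevc.and (hev1.and hev2)))).exists
  have hεδ : e n ∈ Ioc 0 δ := ⟨hn.1, hn.2.trans (min_le_right _ _)⟩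
  have hfst : dist (enhancedNoise ρ χ P (e n) (ξ + F j)).1 q.1 < θ / 2 := by
    have := dist_triangle (enhancedNoise ρ χ P (e n) (ξ + F j)).1
      (Noise.incl (by linarith : b ≤ κ) (ξ + F j)) q.1
    linarith
  have hsnd : dist (enhancedNoise ρ χ P (e n) (ξ + F j)).2 q.2 < θ / 2 := by
    rw [dist_eq_norm]
    refine norm_mk_lt ?_
    rw [HolderSpace.toDistrib_sub, enhancedNoise_snd hP hκ hb hbκ hρ hχ
      ⟨hεδ.1, hεδ.2.trans hδ1⟩, hq2, HolderSpace.toDistrib_add, hFd]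
    refine (hC δ ⟨hδ0, hδ1⟩ (e n) hεδ k (Dn j) ξ (fun x => ?_) (fun x y hxy => ?_) _ rfl hnE.1 hnE.2
      hnc).trans_lt (ENNReal.ofReal_lt_ofReal_iff (by positivity) |>.2 hδC)
    · exact (hC₁ T hTm.1 x).trans
        (mul_le_mul_of_nonneg_right hN1 (polyWeight_pos b x).le)
    · refine (hC₂ T hTm.1 x y hxy).trans ?_
      rw [mul_assoc]
      exact mul_le_of_le_one_left (mul_nonneg (polyWeight_pos b x).le (norm_nonneg _)) hN2
  have hfin : dist (enhancedNoise ρ χ P (e n) (ξ + F j)) q < θ / 2 := by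
    rw [Prod.dist_eq]
    exact max_lt hfst hsnd
  have := dist_triangle_left (Q (ξ + F j)) q (enhancedNoise ρ χ P (e n) (ξ + F j))
  linarith

end

end Anderson
end

noncomputable section
namespace Anderson

/-! ### Approximation of functions in `L^∞_{p_b}` -/

section

variable {χ : Test} {b C : ℝ} {h : Plane → ℝ}

lemma locallyIntegrable_of_weighted (hm : AEStronglyMeasurable h volume)
    (hh : ∀ᵐ x, |h x| ≤ C * polyWeight b x) : LocallyIntegrable h := by
  refine (((continuous_polyWeight b).const_mul C).locallyIntegrable (μ := volume)).mono hm ?_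
  filter_upwards [hh] with x hx
  exact hx.trans (le_abs_self _)

lemma ae_abs_comp_sub_le (hb : 0 ≤ b) (hC : 0 ≤ C) (hh : ∀ᵐ x, |h x| ≤ C * polyWeight b x)
    {r : ℝ} (hr : 0 ≤ r) (x : Plane) :
    ∀ᵐ y, ‖y‖ ≤ r → |h (x - y)| ≤ C * (1 + r) ^ b * polyWeight b x := by
  filter_upwards [(Measure.measurePreserving_sub_left (volume : Measure Plane)
    x).quasiMeasurePreserving.ae hh] with y hy hyr
  refine hy.trans ?_
  rw [mul_assoc]
  exact mul_le_mul_of_nonneg_left (polyWeight_sub_le hb hr hyr) hC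

lemma aestronglyMeasurable_comp_sub (hm : AEStronglyMeasurable h volume) (x : Plane) :
    AEStronglyMeasurable (fun y => h (x - y)) volume :=
  hm.comp_quasiMeasurePreserving
    (Measure.measurePreserving_sub_left (volume : Measure Plane) x).quasiMeasurePreserving

/-- Since `h` is only measurable, its weighted bound holds almost everywhere. It is transported
along `y ↦ x - y`, which preserves null sets; no continuity of `h` is needed. -/
lemma integrable_smul_comp_sub {E : Type*} [NormedAddCommGroup E] [NormedSpace ℝ E] (hb : 0 ≤ b)
    (hC : 0 ≤ C) (hm : AEStronglyMeasurable h volume) (hh : ∀ᵐ x, |h x| ≤ C * polyWeight b x)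
    {r : ℝ} (hr : 0 ≤ r) {f : Plane → E} (hf : Integrable f) (hf0 : ∀ y, r < ‖y‖ → f y = 0)
    (x : Plane) : Integrable (fun y => h (x - y) • f y) ∧
      ‖∫ y, h (x - y) • f y‖ ≤ C * (1 + r) ^ b * polyWeight b x * ∫ y, ‖f y‖ := by
  have hbd : ∀ᵐ y, ‖h (x - y) • f y‖ ≤ C * (1 + r) ^ b * polyWeight b x * ‖f y‖ := by
    filter_upwards [ae_abs_comp_sub_le hb hC hh hr x] with y hy
    rw [norm_smul]
    rcases le_or_gt ‖y‖ r with h1 | h1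
    · exact mul_le_mul_of_nonneg_right (hy h1) (norm_nonneg _)
    · simp [hf0 y h1]
  have hi := hf.norm.const_mul (C * (1 + r) ^ b * polyWeight b x)
  refine ⟨hi.mono' ((aestronglyMeasurable_comp_sub hm x).smul hf.aestronglyMeasurable) hbd, ?_⟩
  refine (norm_integral_le_of_norm_le hi hbd).trans (le_of_eq ?_)
  rw [integral_const_mul]

/-- Mollifications of the kernel `∇G` converge in `L¹`. -/
lemma exists_integral_abs_gradKernel_sub_le (hχ : IsCutoff χ) {δ : ℝ} (hδ : 0 < δ) :
    ∃ R : ℝ, 0 < R ∧ R ≤ 1 ∧ ∀ k : Test, tsupport k ⊆ Metric.closedBall 0 R → ∫ x, k x = 1 →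
      ∫ x, |k x| ≤ 1 → ∀ i, ∫ x, |gradKernel χ k i x - gradComp χ i x| ≤ δ := by
  -- All the kernels vanish outside this ball of finite volume, where convergence in `L^{3/2}`
  -- implies convergence in `L¹`.
  set B := Metric.closedBall (0 : Plane) 3
  set v : ℝ≥0∞ := (volume.restrict B) univ ^ (1 / (1 : ℝ≥0∞).toReal
    - 1 / (ENNReal.ofReal (3 / 2)).toReal) with hv
  have hvt : v ≠ ∞ := by
    refine ENNReal.rpow_ne_top_of_nonneg ?_ ?_
    · rw [ENNReal.toReal_ofReal (by norm_num)]
      norm_num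
    · rw [Measure.restrict_apply_univ]
      exact measure_closedBall_lt_top.ne
  have hs : (0 : ℝ) < 3 / 2 := by norm_num
  choose R hR0 hR using fun i => exists_lsNorm_testConv_sub_le (s := 3 / 2) (by norm_num)
    (measurable_gradComp χ i) (locallyIntegrable_gradComp hχ i) (hasCompactSupport_gradComp hχ i)
    (lsNorm_gradComp_ne_top hχ i hs (by norm_num)) zero_le_one
    (δ := δ / (v.toReal + 1)) (by positivity)
  refine ⟨min (min (R 0) (R 1)) 1, lt_min (lt_min (hR0 0) (hR0 1)) one_pos, min_le_right _ _,
    fun k hk hk1 hkM i => ?_⟩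
  have hRi : min (min (R 0) (R 1)) 1 ≤ R i := by
    refine (min_le_left _ _).trans ?_
    fin_cases i
    · exact min_le_left _ _
    · exact min_le_right _ _
  have h1 := hR i k (hk.trans (Metric.closedBall_subset_closedBall hRi)) hk1 hkM
  set f : Plane → ℝ := fun x => gradKernel χ k i x - gradComp χ i x with hf
  have hfm : AEStronglyMeasurable f volume :=
    ((gradKernel χ k i).continuous.measurable.sub (measurable_gradComp χ i)).aestronglyMeasurable
  have hf0 : ∀ x ∉ B, |f x| = 0 := fun x hx => by
    have hk3 := tsupport_gradKernel hχ (hk.trans (Metric.closedBall_subset_closedBall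
      (min_le_right _ _))) i
    have a1 : gradKernel χ k i x = 0 := image_eq_zero_of_notMem_tsupport fun hxk => hx (by
      have := hk3 hxk
      norm_num at this ⊢
      simpa [B] using this)
    have a2 : gradComp χ i x = 0 := gradComp_eq_zero hχ i fun hx2 =>
      hx (Metric.closedBall_subset_closedBall (by norm_num) hx2)
    rw [hf]
    simp [a1, a2]
  rw [← setIntegral_eq_integral_of_forall_compl_eq_zero hf0]
  have h2 : eLpNorm f 1 (volume.restrict B) ≤ ENNReal.ofReal δ := by
    refine (eLpNorm_le_eLpNorm_mul_rpow_measure_univ (q := ENNReal.ofReal (3 / 2)) (by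
      rw [ENNReal.one_le_ofReal]; norm_num) hfm.restrict).trans ?_
    rw [← hv]
    have h3 : eLpNorm f (ENNReal.ofReal (3 / 2)) (volume.restrict B)
        ≤ ENNReal.ofReal (δ / (v.toReal + 1)) := by
      refine (eLpNorm_mono_measure f Measure.restrict_le_self).trans ?_
      rw [← lsNorm_eq_eLpNorm hs]
      exact h1
    refine (mul_le_mul' h3 (ENNReal.ofReal_toReal hvt).ge).trans ?_
    rw [← ENNReal.ofReal_mul (by positivity)]
    refine ENNReal.ofReal_le_ofReal ?_
    rw [div_mul_eq_mul_div, div_le_iff₀ (by positivity)]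
    nlinarith [ENNReal.toReal_nonneg (a := v)]
  rw [eLpNorm_one_eq_lintegral_enorm] at h2
  have h4 : ∫ x in B, |f x| = (∫⁻ x in B, ‖f x‖ₑ).toReal :=
    integral_norm_eq_lintegral_enorm hfm.restrict
  rw [h4]
  exact ENNReal.toReal_le_of_le_ofReal hδ.le h2

/-- The test function `V · θ` where `θ` is a smooth cutoff at scale `N`. -/
lemma exists_test_truncation {V : Plane → ℝ} (hV : ContDiff ℝ (⊤ : ℕ∞) V) {a : ℝ} (hab : b < a)
    (hVb : ∀ x, |V x| ≤ C * polyWeight b x) {δ : ℝ} (hδ : 0 < δ) :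
    ∃ u : Test, ∀ x, |u x - V x| ≤ δ * polyWeight a x := by
  obtain ⟨R, hR, hR1⟩ : ∃ R : ℝ, C ≤ δ * R ^ (a - b) ∧ 1 ≤ R := by
    have h := ((tendsto_rpow_atTop (sub_pos.2 hab)).eventually_ge_atTop (C / δ)).and
      (eventually_ge_atTop 1)
    obtain ⟨R, h1, h2⟩ := h.exists
    exact ⟨R, by rw [div_le_iff₀ hδ] at h1; linarith, h2⟩
  let B : ContDiffBump (0 : Plane) := ⟨R, R + 1, by linarith, by linarith⟩
  refine ⟨⟨fun y => V y * B y, hV.mul B.contDiff, B.hasCompactSupport.mul_left,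
    fun _ _ => trivial⟩, fun y => ?_⟩
  change |V y * B y - V y| ≤ _
  by_cases hy : y ∈ Metric.closedBall (0 : Plane) R
  · rw [B.one_of_mem_closedBall hy]
    simpa using mul_nonneg hδ.le (polyWeight_pos a y).le
  · have hy' : R < ‖y‖ := by simpa using hy
    have h1 : |V y * B y - V y| ≤ |V y| := by
      have : V y * B y - V y = V y * (B y - 1) := by ring
      rw [this, abs_mul]
      refine mul_le_of_le_one_right (abs_nonneg _) ?_
      rw [abs_le]
      constructor <;> linarith [B.nonneg (x := y), B.le_one (x := y)]
    have h2 : C ≤ δ * polyWeight (a - b) y := by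
      refine hR.trans ?_
      unfold polyWeight
      have := sub_pos.2 hab
      gcongr
      linarith
    refine h1.trans ((hVb y).trans ((mul_le_mul_of_nonneg_right h2 (polyWeight_pos b y).le).trans
      (le_of_eq ?_)))
    rw [mul_assoc, polyWeight_mul, sub_add_cancel]

/-- Mollify, then truncate. Mollification is harmless for `h` because `ofFun h` lies in the closure
of test functions, and for `∂ᵢG * h` because `∂ᵢG * β` is close to `∂ᵢG` in `L¹`. Truncation at
infinity is paid by the gap between the weights `b` and `κ / 2`; the exponent `κ / 2` is the one
whose square has weight `κ`. -/
theorem exists_test_approx (hχ : IsCutoff χ) {κ : ℝ} (hκ : 0 < κ) (hb : 0 ≤ b) (hbκ : b < κ / 2)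
    (hC : 0 ≤ C) (hm : AEStronglyMeasurable h volume) (hh : ∀ᵐ x, |h x| ≤ C * polyWeight b x)
    (hmem : ofFun h ∈ holderSubgroup (-1 - κ) (polyWeight κ)) {δ : ℝ} (hδ : 0 < δ) :
    ∃ u : Test, holderNorm (-1 - κ) (polyWeight κ) (ofFun u - ofFun h) < ENNReal.ofReal δ ∧
      ∀ i x, |(∫ y, gradComp χ i y * h (x - y)) - gradKernel χ u i x|
        ≤ δ * polyWeight (κ / 2) x := by
  have hli := locallyIntegrable_of_weighted hm hh
  set G : ℝ := ∑ i, ∫ y, |gradComp χ i y| with hG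
  have hG0 : 0 ≤ G := Finset.sum_nonneg fun i _ => integral_nonneg fun _ => abs_nonneg _
  have hGi : ∀ i, ∫ y, |gradComp χ i y| ≤ G := fun i =>
    Finset.single_le_sum (f := fun i => ∫ y, |gradComp χ i y|)
      (fun i _ => integral_nonneg fun _ => abs_nonneg _) (Finset.mem_univ i)
  set v : ℝ := 2 ^ κ * volume.real (Metric.closedBall (0 : Plane) 1) with hv
  have hv0 : 0 ≤ v := by positivity
  obtain ⟨R₁, hR₁, h1⟩ := exists_holderNorm_conv_sub_le (by linarith : -1 - κ ≤ 0) hκ.le hmem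
    zero_le_one (half_pos hδ)
  obtain ⟨R₂, hR₂, hR₂1, h2⟩ := exists_integral_abs_gradKernel_sub_le hχ
    (δ := δ / 2 / (C * (1 + 3) ^ b + 1)) (by positivity)
  obtain ⟨β, hβ0, -, hβs, hβ1⟩ := exists_bump (lt_min hR₁ hR₂)
  have hβ1' := integral_abs_of_nonneg hβ0 hβ1
  have hβR₁ := hβs.trans (Metric.closedBall_subset_closedBall (min_le_left R₁ R₂))
  have hβR₂ := hβs.trans (Metric.closedBall_subset_closedBall (min_le_right R₁ R₂))
  set V : Plane → ℝ := conv (ofFun h) β with hV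
  have hVf : V = fun x => ∫ y, h y * β (x - y) := funext fun x => conv_ofFun hli β x
  have hVs : ContDiff ℝ (⊤ : ℕ∞) V := by
    rw [hVf]
    exact HasCompactSupport.contDiff_convolution_right (n := ⊤) (ContinuousLinearMap.mul ℝ ℝ)
      β.hasCompactSupport hli β.contDiff
  have hflip : ∀ (w : Test) x, ∫ y, h y * w (x - y) = ∫ y, h (x - y) • w y := fun w x => by
    rw [← integral_sub_left_eq_self (fun y => h y * w (x - y)) volume x]
    simp
  have hVb : ∀ x, |V x| ≤ C * (1 + 1) ^ b * polyWeight b x := fun x => by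
    rw [hVf]
    beta_reduce
    rw [hflip]
    have := (integrable_smul_comp_sub hb hC hm hh zero_le_one β.integrable (fun y hy =>
      image_eq_zero_of_notMem_tsupport fun hy' => by
        have := mem_closedBall_zero_iff.1 (hβR₂ hy')
        linarith) x).2
    simpa [hβ1'] using this
  obtain ⟨u, hu⟩ := exists_test_truncation hVs hbκ hVb
    (δ := δ / 2 / (v + (1 + 2) ^ (κ / 2) * G + 1)) (by positivity)
  -- The truncation error is used twice, in the Hölder norm with constant `v` and after convolution
  -- with `∂ᵢG`, whose support has radius two, with constant `3 ^ (κ / 2) * G`.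
  set ν : ℝ := δ / 2 / (v + (1 + 2) ^ (κ / 2) * G + 1) with hν
  have hν0 : 0 ≤ ν := by positivity
  have hνle : ν * (v + (1 + 2) ^ (κ / 2) * G + 1) = δ / 2 := by
    rw [hν]
    exact div_mul_cancel₀ _ (by positivity)
  have hνv : 0 ≤ ν * v := by positivity
  have hνG : 0 ≤ ν * ((1 + 2) ^ (κ / 2) * G) := by positivity
  refine ⟨u, ?_, fun i x => ?_⟩
  · have e : ofFun u - ofFun h = ofFun (fun x => u x - V x) + (ofFun V - ofFun h) := by
      rw [ofFun_sub u.continuous.locallyIntegrable hVs.continuous.locallyIntegrable]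
      abel
    have h3 : holderNorm (-1 - κ) (polyWeight κ) (ofFun fun x => u x - V x)
        ≤ ENNReal.ofReal (δ / 2) := by
      refine (holderNorm_ofFun_le (by linarith) hκ.le hν0
        (u.continuous.sub hVs.continuous).locallyIntegrable fun x => (hu x).trans ?_).trans
        (ENNReal.ofReal_le_ofReal (by linarith))
      exact mul_le_mul_of_nonneg_left (polyWeight_mono (by linarith) x) hν0
    rw [e]
    refine (holderNorm_add_le _ _ _ _).trans_lt ?_
    refine (ENNReal.add_lt_add_of_le_of_lt (h3.trans_lt ENNReal.ofReal_lt_top).ne h3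
      (h1 β hβR₁ hβ1 hβ1'.le)).trans_eq ?_
    rw [← ENNReal.ofReal_add (by positivity) (by positivity), add_halves]
  · have hp := polyWeight_pos (κ / 2) x
    have e1 : gradKernel χ u i x = ∫ y, gradComp χ i y * u (x - y) :=
      testConv_apply _ (locallyIntegrable_gradComp hχ i) (hasCompactSupport_gradComp hχ i) x
    have e2 : ∫ y, gradComp χ i y * V (x - y) = ∫ y, h (x - y) • gradKernel χ β i y := by
      rw [hV, integral_mul_conv hκ.le hmem β (locallyIntegrable_gradComp hχ i)
        (hasCompactSupport_gradComp hχ i), conv_ofFun hli, hflip]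
      rfl
    have hg0 : ∀ y, 2 < ‖y‖ → gradComp χ i y = 0 := fun y hy =>
      gradComp_eq_zero hχ i fun hy' => by
        have := mem_closedBall_zero_iff.1 hy'
        linarith
    have hk0 : ∀ y, 3 < ‖y‖ → gradKernel χ β i y = 0 := fun y hy =>
      image_eq_zero_of_notMem_tsupport fun hy' => by
        have := mem_closedBall_zero_iff.1 (tsupport_gradKernel hχ hβR₂ i hy')
        linarith
    have i1 := (integrable_smul_comp_sub hb hC hm hh (by norm_num : (0 : ℝ) ≤ 3)
      (gradKernel χ β i).integrable hk0 x).1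
    have i2 := (integrable_smul_comp_sub hb hC hm hh zero_le_two (integrable_gradComp hχ i) hg0 x).1
    have e3 : ∫ y, gradComp χ i y * h (x - y) = ∫ y, h (x - y) • gradComp χ i y := by
      simp_rw [smul_eq_mul, mul_comm]
    have d1 : |(∫ y, h (x - y) • gradKernel χ β i y) - ∫ y, h (x - y) • gradComp χ i y|
        ≤ δ / 2 * polyWeight (κ / 2) x := by
      rw [← integral_sub i1 i2]
      simp_rw [← smul_sub]
      have := (integrable_smul_comp_sub hb hC hm hh (by norm_num : (0 : ℝ) ≤ 3)
        ((gradKernel χ β i).integrable.sub (integrable_gradComp hχ i))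
        (fun y hy => by simp [hk0 y hy, hg0 y (by linarith)]) x).2
      refine this.trans ?_
      have h3 := h2 β hβR₂ hβ1 hβ1'.le i
      have hp2 : polyWeight b x ≤ polyWeight (κ / 2) x := polyWeight_mono hbκ.le x
      have hpb := polyWeight_pos b x
      have hJ : 0 ≤ ∫ y, |gradKernel χ β i y - gradComp χ i y| :=
        integral_nonneg fun _ => abs_nonneg _
      calc C * (1 + 3) ^ b * polyWeight b x * ∫ y, |gradKernel χ β i y - gradComp χ i y|
          ≤ (C * (1 + 3) ^ b + 1) * polyWeight (κ / 2) x
            * (δ / 2 / (C * (1 + 3) ^ b + 1)) := by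
            gcongr
            linarith
        _ = δ / 2 * polyWeight (κ / 2) x := by
            field_simp
    have d2 : |(∫ y, gradComp χ i y * V (x - y)) - ∫ y, gradComp χ i y * u (x - y)|
        ≤ δ / 2 * polyWeight (κ / 2) x := by
      rw [← integral_sub (integrable_mul_gradComp hχ i hVs.continuous x)
        (integrable_mul_gradComp hχ i u.continuous x)]
      have hbd : ∀ y, ‖gradComp χ i y * V (x - y) - gradComp χ i y * u (x - y)‖
          ≤ ν * ((1 + 2) ^ (κ / 2) * polyWeight (κ / 2) x) * |gradComp χ i y| := fun y => by
        rw [← mul_sub, norm_mul, mul_comm]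
        rcases le_or_gt ‖y‖ 2 with hy | hy
        · refine mul_le_mul_of_nonneg_right ?_ (abs_nonneg _)
          rw [norm_sub_rev]
          exact (hu (x - y)).trans (mul_le_mul_of_nonneg_left
            (polyWeight_sub_le (by positivity) zero_le_two hy) hν0)
        · simp [hg0 y hy]
      refine (norm_integral_le_of_norm_le ((integrable_gradComp hχ i).abs.const_mul _)
        (Eventually.of_forall hbd)).trans ?_
      rw [integral_const_mul]
      calc ν * ((1 + 2) ^ (κ / 2) * polyWeight (κ / 2) x) * ∫ y, |gradComp χ i y|
          ≤ ν * ((1 + 2) ^ (κ / 2) * polyWeight (κ / 2) x) * G := by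
            gcongr
            exact hGi i
        _ = ν * ((1 + 2) ^ (κ / 2) * G) * polyWeight (κ / 2) x := by ring
        _ ≤ δ / 2 * polyWeight (κ / 2) x := by
            refine mul_le_mul_of_nonneg_right ?_ hp.le
            linarith
    rw [e1, e3]
    rw [e2] at d2
    rw [abs_le] at d1 d2 ⊢
    constructor <;> linarith [d1.1, d1.2, d2.1, d2.2]

end

end Anderson
end

noncomputable section
namespace Anderson

/-! ### The support of the limiting enhanced noise -/

section

variable {κ b : ℝ} {P : Measure (Noise κ b)} {ρ χ : Test}

/-- Take `h = ξ_ε`, which has growth `p_b` because `ξ` does, and `c = -C_ε`. Both upper inclusions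
for supports follow from this membership. -/
lemma enhancedNoise_mem_shiftedPairs (hκ : 0 < κ) (hb : 0 < b) (hbκ : b < κ / 2)
    (hρ : IsMollifier ρ) (hχ : IsCutoff χ) (P : Measure (Noise κ b)) {ε : ℝ}
    (hε : ε ∈ Ioc (0 : ℝ) 1) (ξ : Noise κ b) :
    enhancedNoise ρ χ P ε ξ ∈ shiftedPairs κ b χ := by
  have h := supClosure_mollify hρ.tsupport_subset hε ξ.mem
  obtain ⟨h1, h2⟩ := toDistrib_enhancedNoise hκ hb hbκ hρ hχ P hε ξ
  obtain ⟨C, -, hC⟩ := h.exists_bound hb.le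
  exact ⟨mollify ρ ε ξ.toDistrib, ⟨h.continuous.aestronglyMeasurable, C, ae_of_all _ hC⟩,
    -renormConst ρ χ P ε, h1, h2⟩

lemma support_map_subset {Ω E : Type*} [MeasurableSpace Ω] {P : Measure Ω} [TopologicalSpace E]
    [MeasurableSpace E] [OpensMeasurableSpace E] {X : Ω → E} (hX : AEMeasurable X P) {s : Set E}
    (hs : IsClosed s) (h : ∀ᵐ ω ∂P, X ω ∈ s) : (P.map X).support ⊆ s :=
  Measure.support_subset_of_isClosed hs ((ae_map_iff hX hs.measurableSet).2 h)

lemma sq_norm_gradGreenConv_test (hχ : IsCutoff χ) (u : Test) (x : Plane) :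
    ∑ i, gradKernel χ u i x ^ 2 = ‖gradGreenConv χ u x‖ ^ 2 := by
  rw [sq_norm_gradGreenConv (integrable_smul_gradient_green hχ u.continuous x)]
  congr 1 with i
  rw [gradKernel, testConv_apply _ (locallyIntegrable_gradComp hχ i)
    (hasCompactSupport_gradComp hχ i)]

lemma ofFun_gradKernel_mem (hχ : IsCutoff χ) (hκ : 0 < κ) (u : Test) (c : ℝ) :
    ofFun (fun x => ∑ i, gradKernel χ u i x ^ 2 + c) ∈ holderSubgroup (-κ) (polyWeight κ) := by
  obtain ⟨v, hv⟩ := exists_test_sq_norm_gradGreenConv hχ u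
  simp_rw [sq_norm_gradGreenConv_test hχ, ← hv]
  exact ((v.supClosure κ).add (supClosure_const hκ c)).mem_holderSubgroup (by linarith) hκ.le

/-- The pairs `(h, |∇G * h|² + c)` are limits of such pairs with `h` a test function. -/
theorem exists_test_pair (hκ : 0 < κ) (hb : 0 ≤ b) (hbκ : b < κ / 2) (hχ : IsCutoff χ)
    {q : EnhancedSpace κ} (hq : q ∈ shiftedPairs κ b χ) {θ : ℝ} (hθ : 0 < θ) :
    ∃ (u : Test) (c : ℝ) (q' : EnhancedSpace κ), q'.1.toDistrib = ofFun u ∧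
      (q'.2.toDistrib = ofFun fun x => ∑ i, gradKernel χ u i x ^ 2 + c) ∧ dist q' q < θ := by
  obtain ⟨h, ⟨hm, C, hC⟩, c, hq1, hq2⟩ := hq
  have hC' : ∀ᵐ x, |h x| ≤ |C| * polyWeight b x := hC.mono fun x hx =>
    hx.trans (mul_le_mul_of_nonneg_right (le_abs_self C) (polyWeight_pos b x).le)
  have hmem : ofFun h ∈ holderSubgroup (-1 - κ) (polyWeight κ) := hq1 ▸ q.1.mem
  set A : Fin 2 → Plane → ℝ := fun i x => ∫ y, gradComp χ i y * h (x - y) with hA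
  have hsq : ∀ x, ‖gradGreenConv χ h x‖ ^ 2 = ∑ i, A i x ^ 2 := fun x =>
    sq_norm_gradGreenConv (integrable_smul_comp_sub hb (abs_nonneg C) hm hC' zero_le_two
      (integrable_gradient_green hχ) (fun y hy => gradient_green_eq_zero hχ fun hy' => by
        have := mem_closedBall_zero_iff.1 hy'
        linarith) x).1
  have happrox : ∀ {δ : ℝ}, 0 < δ → ∃ u : Test,
      holderNorm (-1 - κ) (polyWeight κ) (ofFun u - ofFun h) < ENNReal.ofReal δ ∧
      ∀ i x, |A i x - gradKernel χ u i x| ≤ δ * polyWeight (κ / 2) x := fun hδ =>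
    exists_test_approx hχ hκ hb hbκ (abs_nonneg C) hm hC' hmem hδ
  -- The approximants `∂ᵢG * u` are themselves test functions, so the same approximation yields
  -- continuity and growth `p_{κ/2}` for `∂ᵢG * h`.
  have hAs : ∀ i, SupClosure (κ / 2) (A i) := fun i δ hδ => by
    obtain ⟨u, -, hu⟩ := happrox hδ
    exact ⟨gradKernel χ u i, hu i⟩
  choose K hK0 hK using fun i => (hAs i).exists_bound (half_pos hκ).le
  set v : ℝ := 2 ^ κ * volume.real (Metric.closedBall (0 : Plane) 1) with hv
  have hv0 : 0 ≤ v := by positivity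
  set L : ℝ := ∑ i, (2 * K i + 1) with hL
  have hL0 : 0 ≤ L := Finset.sum_nonneg fun i _ => by linarith [hK0 i]
  -- Squaring is locally Lipschitz: with `δ ≤ 1`, the squares differ by at most `δ * (2 * K i + 1)`
  -- times `p_κ`.
  obtain ⟨δ, hδ0, hδ1, hδθ, hδL⟩ : ∃ δ : ℝ, 0 < δ ∧ δ ≤ 1 ∧ δ ≤ θ ∧ δ * L * v < θ := by
    refine ⟨min 1 (θ / (L * v + 1)), by positivity, min_le_left _ _, ?_, ?_⟩
    · exact (min_le_right _ _).trans (div_le_self hθ.le (by nlinarith [mul_nonneg hL0 hv0]))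
    · have h1 := min_le_right 1 (θ / (L * v + 1))
      have h2 := mul_le_mul_of_nonneg_right h1 (mul_nonneg hL0 hv0)
      rw [mul_assoc]
      refine h2.trans_lt ?_
      rw [div_mul_eq_mul_div, div_lt_iff₀ (by positivity)]
      nlinarith
  obtain ⟨u, hu1, hu2⟩ := happrox hδ0
  refine ⟨u, c, (⟨ofFun u, ofFun_test_mem (by linarith) hκ.le u⟩,
    ⟨_, ofFun_gradKernel_mem hχ hκ u c⟩), rfl, rfl, ?_⟩
  rw [Prod.dist_eq]
  refine max_lt ?_ ?_
  · rw [dist_eq_norm]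
    refine norm_mk_lt ?_
    rw [HolderSpace.toDistrib_sub, hq1]
    exact hu1.trans_le (ENNReal.ofReal_le_ofReal hδθ)
  · rw [dist_eq_norm]
    refine norm_mk_lt ?_
    rw [HolderSpace.toDistrib_sub, hq2]
    simp_rw [hsq]
    have c1 : Continuous fun x => ∑ i, gradKernel χ u i x ^ 2 + c :=
      (continuous_finsetSum _ fun i _ => (gradKernel χ u i).continuous.pow 2).add continuous_const
    have c2 : Continuous fun x => ∑ i, A i x ^ 2 + c :=
      (continuous_finsetSum _ fun i _ => (hAs i).continuous.pow 2).add continuous_const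
    rw [← ofFun_sub c1.locallyIntegrable c2.locallyIntegrable]
    refine (holderNorm_ofFun_le (by linarith) hκ.le (mul_nonneg hδ0.le hL0)
      (c1.sub c2).locallyIntegrable fun x => ?_).trans_lt
      ((ENNReal.ofReal_lt_ofReal_iff hθ).2 hδL)
    have hterm : ∀ i, |gradKernel χ u i x ^ 2 - A i x ^ 2|
        ≤ δ * (2 * K i + 1) * polyWeight κ x := fun i => by
      have hp := polyWeight_pos (κ / 2) x
      have e : gradKernel χ u i x ^ 2 - A i x ^ 2 = -((A i x - gradKernel χ u i x)
          * (2 * A i x - (A i x - gradKernel χ u i x))) := by ring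
      have h1 := hu2 i x
      have h2 : |2 * A i x - (A i x - gradKernel χ u i x)|
          ≤ (2 * K i + 1) * polyWeight (κ / 2) x := by
        refine (abs_sub _ _).trans ?_
        rw [abs_mul, abs_two]
        have := hK i x
        have := mul_le_mul_of_nonneg_right hδ1 hp.le
        linarith
      rw [e, abs_neg, abs_mul]
      refine (mul_le_mul h1 h2 (abs_nonneg _) (by positivity)).trans (le_of_eq ?_)
      have e2 : polyWeight κ x = polyWeight (κ / 2) x * polyWeight (κ / 2) x := by
        rw [polyWeight_mul, add_halves]
      rw [e2]
      ring
    have e3 : ∑ i, gradKernel χ u i x ^ 2 + c - (∑ i, A i x ^ 2 + c)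
        = ∑ i, (gradKernel χ u i x ^ 2 - A i x ^ 2) := by
      rw [Finset.sum_sub_distrib]
      ring
    rw [Pi.sub_apply, e3]
    refine (Finset.abs_sum_le_sum_abs _ _).trans
      ((Finset.sum_le_sum fun i _ => hterm i).trans (le_of_eq ?_))
    rw [hL, Finset.mul_sum, Finset.sum_mul]

/-- One inclusion passes to the almost sure limit along a sequence inside a closed set; the other
combines density of test pairs with the closedness of the support. -/
theorem support_limitNoise (hP : IsWhiteNoise P) (hκ : 0 < κ) (hκ1 : κ < 1) (hb : 0 < b)
    (hbκ : b < κ / 2) (hρ : IsMollifier ρ) (hχ : IsCutoff χ) {Q : Noise κ b → EnhancedSpace κ}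
    (hQ : IsLimitNoise ρ χ P Q) : (P.map Q).support = closure (shiftedPairs κ b χ) := by
  have := secondCountable_holderSpace (α := -1 - κ) (κ := κ) (by linarith) hκ.le
  have := secondCountable_holderSpace (α := -κ) (κ := κ) (by linarith) hκ.le
  refine Subset.antisymm (support_map_subset hQ.aemeasurable isClosed_closure ?_)
    (closure_minimal (fun q hq => ?_) Measure.isClosed_support)
  · obtain ⟨e, he, hae⟩ := hQ.tendsto.exists_seq_tendsto_ae'
    filter_upwards [hae] with ξ hξ
    refine mem_closure_of_tendsto hξ ?_
    filter_upwards [he.eventually (Ioc_mem_nhdsGT one_pos)] with n hn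
    exact enhancedNoise_mem_shiftedPairs hκ hb hbκ hρ hχ P hn ξ
  · rw [← Measure.isClosed_support.closure_eq, Metric.mem_closure_iff]
    intro θ hθ
    obtain ⟨u, c, q', h1, h2, h3⟩ := exists_test_pair hκ hb.le hbκ hχ hq hθ
    exact ⟨q', test_mem_support hP hκ hκ1 hb hbκ hρ hχ hQ u c h1 h2, by rwa [dist_comm]⟩

theorem support_enhancedNoise_subset (hP : IsWhiteNoise P) (hκ : 0 < κ) (hb : 0 < b)
    (hbκ : b < κ / 2) (hρ : IsMollifier ρ) (hχ : IsCutoff χ) {ε : ℝ} (hε : ε ∈ Ioc (0 : ℝ) 1) :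
    (P.map (enhancedNoise ρ χ P ε)).support ⊆ closure (shiftedPairs κ b χ) := by
  have := secondCountable_holderSpace (α := -1 - κ) (κ := κ) (by linarith) hκ.le
  have := secondCountable_holderSpace (α := -κ) (κ := κ) (by linarith) hκ.le
  exact support_map_subset (measurable_enhancedNoise hP hκ hb hbκ hρ hχ hε).aemeasurable
    isClosed_closure (ae_of_all _ fun ξ => subset_closure
      (enhancedNoise_mem_shiftedPairs hκ hb hbκ hρ hχ P hε ξ))

end

end Anderson
end


theorem theorem3p9 :
    ∃ κ₀ : ℝ, 0 < κ₀ ∧ ∀ κ b : ℝ, 0 < κ → κ < κ₀ → 0 < b → b < κ / 2 →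
      ∀ ρ χ : Anderson.Test, Anderson.IsMollifier ρ → Anderson.IsCutoff χ →
      ∀ P : MeasureTheory.Measure (Anderson.Noise κ b), Anderson.IsWhiteNoise P →
        (∃ Q : Anderson.Noise κ b → Anderson.EnhancedSpace κ, Anderson.IsLimitNoise ρ χ P Q) ∧
        ∀ Q : Anderson.Noise κ b → Anderson.EnhancedSpace κ, Anderson.IsLimitNoise ρ χ P Q →
          (∀ ε ∈ Set.Ioo (0 : ℝ) 1,
            (P.map (Anderson.enhancedNoise ρ χ P ε)).support ⊆ (P.map Q).support) ∧
          (P.map Q).support = closure (Anderson.shiftedPairs κ b χ) := by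
  -- Any `κ < 1` is small enough: regularity `-κ` then involves a single derivative of the test
  -- functions, as the multiplication and embedding estimates require.
  refine ⟨1, one_pos, fun κ b hκ hκ1 hb hbκ ρ χ hρ hχ P hP => ?_⟩
  refine ⟨Anderson.exists_isLimitNoise hP hκ hκ1 hb hbκ hρ hχ, fun Q hQ => ?_⟩
  have h := Anderson.support_limitNoise hP hκ hκ1 hb hbκ hρ hχ hQ
  refine ⟨fun ε hε => ?_, h⟩
  rw [h]
  exact Anderson.support_enhancedNoise_subset hP hκ hb hbκ hρ hχ ⟨hε.1, hε.2.le⟩
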